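/- **Setting.** $\mathbb H$ is the upper half-plane, $\Gamma=\mathrm{SL}_2(\mathbb Z)$, $T=\begin{pmatrix}1&1\\0&1\end{pmatrix}$, $S=\begin{pmatrix}0&-1\\1&0\end{pmatrix}$, arguments lie in $(-\pi,\pi]$. $\tilde G$ is the universal covering group of $\mathrm{SL}_2(\mathbb R)$, with elements $\tilde p(z)\tilde k(\theta)$ ($z=x+iy\in\mathbb H$, $\theta\in\mathbb R$) lying over $\begin{pmatrix}\sqrt y&x/\sqrt y\\0&1/\sqrt y\end{pmatrix}\begin{pmatrix}\cos\theta&\sin\theta\\-\sin\theta&\cos\theta\end{pmatrix}$; $\tilde a(t)=\tilde p(it)$; $\tilde\Gamma$ is the inverse image of $\Gamma$ in $\tilde G$; $\mathsf t=\tilde p(i+1)$ and $\mathsf s=\tilde k(-\pi/2)$ lie over $T$ and $S$. $\mathcal H=\{h(p,q,r):p,q,r\in\mathbb R\}$ is the Heisenberg group with $h(p,q,r)h(p',q',r')=h(p+p',q+q',r+r'+pq'-p'q)$, and $\tilde G^J=\mathcal H\rtimes\tilde G$ with $\tilde g^{-1}h(p,q,r)\tilde g=h((p,q)g,r)$, where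 $g$ is the image of $\tilde g$ in $\mathrm{SL}_2(\mathbb R)$. $\mathcal H(\mathbb Z)$ is the subgroup with $p,q,r\in\mathbb Z$. Let $m\ge1$ be an integer, $k\in\mathbb R$, $a\in\mathbb Z/12$, $s\in\mathbb C$ with $\operatorname{Re}s\ge0$, and put $s'=(s+1)/2$, $k'=k-\tfrac12$. There are unique characters $\chi_k,\varphi_a:\tilde\Gamma\to\mathbb C^*$ with $\chi_k(\mathsf t)=e^{\pi ik/6}$, $\chi_k(\mathsf s)=e^{-\pi ik/2}$, $\varphi_a(\mathsf t)=e^{\pi ia/6}$, $\varphi_a(\mathsf s)=e^{-\pi ia/2}$. They are extended to $\mathcal H(\mathbb Z)\rtimes\tilde\Gamma$ trivially on $\mathcal H(\mathbb Z)$. **Jacobi Maass forms.** On $C^\infty(\tilde G^J)$, in the coordinates of $h(p,q,r)\tilde p(x+iy)\tilde k(\theta)$, put $X_\pm=e^{\pm2i\theta}\bigl(\pm iy\partial_x+y\partial_y\mp\tfrac i2\partial_\theta\bigr)$; let $Y_\pm=\tfrac12(P\pm iQ)$, where $P,Q$ are right differentiation along $h(t,0,0)$, $h(0,t,0)$ at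 $t=0$; and put $D_\pm=X_\pm\pm\frac1{4\pi m}Y_\pm^2$. The space $A^J_{k,m}(s,\varphi_a\chi_k)$ of Jacobi Maass forms consists of the $f\in C^\infty(\tilde G^J)$ such that (a) $f(h(0,0,r)\,g\,\tilde k(\theta))=e^{2\pi imr+ik\theta}f(g)$; (b) $f(\gamma g)=\varphi_a(\gamma)\chi_k(\gamma)f(g)$ for $\gamma\in\mathcal H(\mathbb Z)\rtimes\tilde\Gamma$; (c) $D_-D_+f=\frac{4s^2-(2k+1)^2}{16}f$, $D_+D_-f=\frac{4s^2-(2k-3)^2}{16}f$ and $Y_-f=0$; (d) for some $\alpha>0$: $f(h\,\tilde a(t)\,g)=O(t^\alpha)$ as $t\to\infty$, uniformly for $h$ in compact subsets of $\mathcal H$ and $g$ in compact subsets of $\tilde G^J$. The subspace $A^{J,0}_{k,m}(s,\varphi_a\chi_k)$ of Jacobi Maass cusp forms is determined by the condition that the estimate in (d) holds with $O(t^{-\alpha})$ for every $\alpha>0$. **Vector-valued Maass forms.** Let $v_k(\gamma)=\eta^{2k}(\gamma z)/\bigl((cz+d)^k\eta^{2k}(z)\bigr)$ for $\gamma=\begin{pmatrix}a&b\\c&d\end{pmatrix}\in\Gamma$,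 with $\eta^{2k}(z)=e^{\pi ikz/6}\prod_{n\ge1}(1-e^{2\pi inz})^{2k}$. For a unitary representation $\rho:\Gamma\to U(n)$ the space $A_k(s,\rho v_k)$ of Maass forms consists of the smooth $u:\mathbb H\to\mathbb C^n$ with $\rho(\gamma)^{-1}v_k(\gamma)^{-1}e^{-ik\arg(cz+d)}u(\gamma z)=u(z)$ for all $\gamma\in\Gamma$, with $\bigl(-y^2\partial_x^2-y^2\partial_y^2+iky\,\partial_x\bigr)u=s(1-s)u$, and with $u(x+iy)=O(y^b)$ as $y\to\infty$ for some $b\in\mathbb R$, uniformly for $x$ in compact sets. The subspace $A^0_k(s,\rho v_k)$ of Maass cusp forms is determined by $u(x+iy)=O(e^{-by})$ for some $b>0$, uniformly for $x$ in compact sets. **Theorem B.** There is a unique unitary representation $\rho_{a,m}:\Gamma\to U(2m)$ such that, for $1\le j,j'\le2m$, $$\rho_{a,m}(T)_{j,j'}=\delta_{j,j'}\,e^{\pi i(a/6+1/12-j^2/2m)},\qquad \rho_{a,m}(S)_{j,j'}=(2m)^{-1/2}\,e^{\pi i(-a/2+jj'/m)}.$$ There is a bijective linear map $$V_{m,k,s}:A^J_{k,m}(s,\varphi_a\chi_k)\to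 A_{k'}(s',\rho_{a,m}v_{k'})$$ that is given by theta decomposition: $u=V_{m,k,s}f$ satisfies $$f\bigl(h\,\tilde p(\tau)\tilde k(\theta)\bigr)=\sum_{j=1}^{2m}\theta_{m,j}\bigl(h\,\tilde p(\tau)\tilde k(\theta)\bigr)\,e^{ik'\theta}u_j(\tau)\qquad(h\in\mathcal H,\ \tau\in\mathbb H,\ \theta\in\mathbb R),$$ where $$\theta_{m,j}\bigl(h(p,q,r)\tilde p(\tau)\tilde k(\theta)\bigr)=(\operatorname{Im}\tau)^{1/4}e^{i\theta/2}\sum_{\alpha\in\frac j{2m}+\mathbb Z}e^{2\pi im(r+q(2\alpha+p))}e^{2\pi im\tau(p+\alpha)^2}.$$ Moreover $V_{m,k,s}\,A^{J,0}_{k,m}(s,\varphi_a\chi_k)=A^0_{k'}(s',\rho_{a,m}v_{k'})$. -/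

import Mathlib

open UpperHalfPlane Matrix Matrix.SpecialLinearGroup Filter Topology
open scoped MatrixGroups ContDiff

noncomputable section

namespace JMF

/-! ### The universal covering group of `SL₂(ℝ)` -/

/-- The element `p(z) = (√y, x/√y; 0, 1/√y)` of `SL₂(ℝ)`, for `z = x + iy`. -/
def pMat (z : ℍ) : SL(2, ℝ) :=
  ⟨!![√z.im, z.re / √z.im; 0, 1 / √z.im], by
    have : √z.im ≠ 0 := (Real.sqrt_pos.2 z.im_pos).ne'
    simp [Matrix.det_fin_two, this]⟩

/-- The rotation `k(θ) = (cos θ, sin θ; -sin θ, cos θ)`. -/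
def kMat (θ : ℝ) : SL(2, ℝ) :=
  ⟨!![Real.cos θ, Real.sin θ; -Real.sin θ, Real.cos θ], by
    simp [Matrix.det_fin_two, ← sq]⟩

/-- The universal covering group of `SL₂(ℝ)`, in Iwasawa coordinates: the pair `(z, θ)` is the
element `p̃(z) k̃(θ)`. -/
@[ext] structure TG where
  z : ℍ
  θ : ℝ

namespace TG

/-- The covering map `p̃(z) k̃(θ) ↦ p(z) k(θ)`. -/
def pr (g : TG) : SL(2, ℝ) := pMat g.z * kMat g.θ

/-- For `p(z') k(θ) = (a, b; c, d)` this is `(c z + d) / (c i + d)`. It depends only on `θ`. -/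
def ratio (g : TG) (z : ℍ) : ℂ :=
  Complex.exp (Complex.I * g.θ) * (Real.cos g.θ - z * Real.sin g.θ)

instance : One TG := ⟨⟨UpperHalfPlane.I, 0⟩⟩

/-- The product covers the product in `SL₂(ℝ)`. The angle is `θ₁ + θ₂` plus the continuous
correction that vanishes for `z₂ = i`. -/
instance : Mul TG := ⟨fun g₁ g₂ => ⟨g₁.pr • g₂.z, g₁.θ + g₂.θ - (g₁.ratio g₂.z).arg⟩⟩

instance : Inv TG :=
  ⟨fun g => ⟨g.pr⁻¹ • UpperHalfPlane.I, -g.θ + (g.ratio (g.pr⁻¹ • UpperHalfPlane.I)).arg⟩⟩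

theorem mul_z (g₁ g₂ : TG) : (g₁ * g₂).z = g₁.pr • g₂.z := rfl

theorem mul_θ (g₁ g₂ : TG) : (g₁ * g₂).θ = g₁.θ + g₂.θ - (g₁.ratio g₂.z).arg := rfl

/-- The factor of automorphy `c z + d`. -/
def jf (A : SL(2, ℝ)) (z : ℍ) : ℂ := (A 1 0 : ℝ) * (z : ℂ) + (A 1 1 : ℝ)

theorem jf_ne_zero (A : SL(2, ℝ)) (z : ℍ) : jf A z ≠ 0 := by
  intro h
  have him := congrArg Complex.im h
  have hre := congrArg Complex.re h
  simp [jf] at him hre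
  have hd := A.det_coe
  rw [Matrix.det_fin_two] at hd
  rcases him with h0 | h0
  · rw [h0] at hre hd
    simp at hre
    rw [hre] at hd
    simp at hd
  · exact z.im_ne_zero h0

theorem coe_smul (A : SL(2, ℝ)) (z : ℍ) :
    ((A • z : ℍ) : ℂ) = ((A 0 0 : ℝ) * (z : ℂ) + (A 0 1 : ℝ)) / jf A z := by
  rw [UpperHalfPlane.coe_specialLinearGroup_apply]
  rfl

theorem jf_mul (A B : SL(2, ℝ)) (z : ℍ) : jf (A * B) z = jf A (B • z) * jf B z := by
  have h := jf_ne_zero B z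
  rw [jf, jf, coe_smul]
  field_simp
  simp only [jf, Matrix.SpecialLinearGroup.coe_mul, Matrix.mul_apply, Fin.sum_univ_two]
  push_cast
  ring

theorem ext_jf {A B : SL(2, ℝ)} (h : A • UpperHalfPlane.I = B • UpperHalfPlane.I)
    (hj : jf A UpperHalfPlane.I = jf B UpperHalfPlane.I) : A = B := by
  have h' := congrArg (fun w : ℍ => (w : ℂ)) h
  simp only [coe_smul, ← hj] at h'
  rw [div_left_inj' (jf_ne_zero A _)] at h'
  have e1 := congrArg Complex.re h'
  have e2 := congrArg Complex.im h'
  have e3 := congrArg Complex.re hj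
  have e4 := congrArg Complex.im hj
  simp [jf] at e1 e2 e3 e4
  ext i j
  fin_cases i <;> fin_cases j <;> simp [e1, e2, e3, e4]

theorem coe_pr (g : TG) : (g.pr : Matrix (Fin 2) (Fin 2) ℝ) =
    !![√g.z.im, g.z.re / √g.z.im; 0, 1 / √g.z.im] *
      !![Real.cos g.θ, Real.sin g.θ; -Real.sin g.θ, Real.cos g.θ] := by
  rw [pr, Matrix.SpecialLinearGroup.coe_mul]
  rfl

theorem jf_pr (g : TG) (z : ℍ) :
    jf g.pr z = ((√g.z.im)⁻¹ : ℝ) * (Real.cos g.θ - z * Real.sin g.θ) := by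
  rw [jf, coe_pr]
  generalize Real.cos g.θ = C
  generalize Real.sin g.θ = S
  simp [Matrix.mul_apply, Fin.sum_univ_two]
  ring

theorem jf_pr_eq (g : TG) (z : ℍ) :
    jf g.pr z = ((√g.z.im)⁻¹ : ℝ) * Complex.exp (-(Complex.I * g.θ)) * g.ratio z := by
  rw [jf_pr, ratio, mul_assoc, ← mul_assoc (Complex.exp _), ← Complex.exp_add]
  simp

theorem ratio_I (g : TG) : g.ratio UpperHalfPlane.I = 1 := by
  have : (Real.cos g.θ - ((UpperHalfPlane.I : ℍ) : ℂ) * Real.sin g.θ : ℂ)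
      = Complex.exp (-(Complex.I * g.θ)) := by
    rw [show -(Complex.I * g.θ) = ((-g.θ : ℝ) : ℂ) * Complex.I by push_cast; ring,
      Complex.exp_mul_I]
    simp
    ring
  rw [ratio, this, ← Complex.exp_add]
  simp

theorem jf_pr_I (g : TG) :
    jf g.pr UpperHalfPlane.I = ((√g.z.im)⁻¹ : ℝ) * Complex.exp (-(Complex.I * g.θ)) := by
  rw [jf_pr_eq, ratio_I, mul_one]

theorem pr_smul_I (g : TG) : g.pr • UpperHalfPlane.I = g.z := by
  apply UpperHalfPlane.ext
  rw [coe_smul, div_eq_iff (jf_ne_zero _ _), jf_pr, coe_pr]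
  generalize Real.cos g.θ = C
  generalize Real.sin g.θ = S
  have hs : √g.z.im ≠ 0 := (Real.sqrt_pos.2 g.z.im_pos).ne'
  have hs2 : (√g.z.im) * √g.z.im = g.z.im := Real.mul_self_sqrt g.z.im_pos.le
  apply Complex.ext
  · simp [Matrix.mul_apply, Fin.sum_univ_two]
    field_simp
    linear_combination S * hs2
  · simp [Matrix.mul_apply, Fin.sum_univ_two]
    field_simp
    linear_combination C * hs2

theorem ratio_eq (g : TG) (z : ℍ) : g.ratio z = jf g.pr z / jf g.pr UpperHalfPlane.I := by
  rw [eq_div_iff (jf_ne_zero _ _), jf_pr_I, jf_pr_eq]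
  ring

theorem ratio_ne_zero (g : TG) (z : ℍ) : g.ratio z ≠ 0 := by
  rw [ratio_eq]
  exact div_ne_zero (jf_ne_zero _ _) (jf_ne_zero _ _)

theorem im_smul (A : SL(2, ℝ)) (z : ℍ) : (A • z).im = z.im / ‖jf A z‖ ^ 2 := by
  have h := coe_smul A z
  have h2 := congrArg Complex.im h
  rw [UpperHalfPlane.coe_im, Complex.div_im, ← Complex.normSq_eq_norm_sq] at *
  have hn : Complex.normSq (jf A z) ≠ 0 := by simpa using jf_ne_zero A z
  have hd := A.det_coe
  rw [Matrix.det_fin_two] at hd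
  rw [h2]
  field_simp
  simp [jf]
  linear_combination (z.im) * hd

theorem pr_mul (g₁ g₂ : TG) : (g₁ * g₂).pr = g₁.pr * g₂.pr := by
  apply ext_jf
  · rw [pr_smul_I, mul_z, mul_smul, pr_smul_I]
  · rw [jf_mul, pr_smul_I, jf_pr_I, jf_pr_I, mul_z, mul_θ, im_smul]
    have hr := ratio_ne_zero g₁ g₂.z
    have h1 : ‖jf g₁.pr g₂.z‖ = (√g₁.z.im)⁻¹ * ‖g₁.ratio g₂.z‖ := by
      rw [jf_pr_eq, norm_mul, norm_mul, Complex.norm_real, Real.norm_eq_abs,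
        abs_of_nonneg (by positivity),
        show -(Complex.I * g₁.θ) = ((-g₁.θ : ℝ) : ℂ) * Complex.I by push_cast; ring,
        Complex.norm_exp_ofReal_mul_I, mul_one]
    have hpos : 0 ≤ ‖jf g₁.pr g₂.z‖ := norm_nonneg _
    rw [Real.sqrt_div g₂.z.im_pos.le, Real.sqrt_sq hpos, h1, jf_pr_eq g₁ g₂.z]
    have e1 : Complex.exp (-(Complex.I * ((g₁.θ + g₂.θ - (g₁.ratio g₂.z).arg : ℝ) : ℂ)))
        = Complex.exp (-(Complex.I * g₁.θ)) * Complex.exp (-(Complex.I * g₂.θ)) *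
          Complex.exp ((g₁.ratio g₂.z).arg * Complex.I) := by
      rw [← Complex.exp_add, ← Complex.exp_add]
      push_cast
      ring_nf
    have e2 := Complex.norm_mul_exp_arg_mul_I (g₁.ratio g₂.z)
    rw [e1]
    conv_rhs => rw [← e2]
    have hn : (‖g₁.ratio g₂.z‖ : ℂ) ≠ 0 := by simpa using hr
    have hs : √g₂.z.im ≠ 0 := (Real.sqrt_pos.2 g₂.z.im_pos).ne'
    have hs1 : √g₁.z.im ≠ 0 := (Real.sqrt_pos.2 g₁.z.im_pos).ne'
    push_cast
    field_simp

theorem pr_one : (1 : TG).pr = 1 := by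
  apply ext_jf
  · rw [pr_smul_I, one_smul]; rfl
  · rw [jf_pr_I]
    simp [jf, show (1 : TG).z = UpperHalfPlane.I from rfl, show (1 : TG).θ = 0 from rfl]

theorem ratio_mem_slitPlane (g : TG) (z : ℍ) : g.ratio z ∈ Complex.slitPlane := by
  by_contra hcon
  have hcon' : (g.ratio z).re ≤ 0 ∧ (g.ratio z).im = 0 := by
    rw [Complex.mem_slitPlane_iff] at hcon
    push Not at hcon
    exact hcon
  obtain ⟨hre, him⟩ := hcon'
  have hr : g.ratio z = (((g.ratio z).re : ℝ) : ℂ) := Complex.ext rfl (by simp [him])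
  have hw : (Real.cos g.θ - z * Real.sin g.θ : ℂ)
      = Complex.exp (((-g.θ : ℝ) : ℂ) * Complex.I) * g.ratio z := by
    rw [ratio, ← mul_assoc, ← Complex.exp_add]
    push_cast
    ring_nf
    simp
  rw [hr, Complex.exp_mul_I] at hw
  have h2 := congrArg Complex.im hw
  rw [← Complex.ofReal_cos, ← Complex.ofReal_sin, Real.cos_neg, Real.sin_neg] at h2
  generalize Real.cos g.θ = C at h2
  generalize hS : Real.sin g.θ = S at h2
  simp at h2
  rw [← hS] at h2
  have h3 : Real.sin g.θ * (z.im - (g.ratio z).re) = 0 := by linarith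
  rcases mul_eq_zero.1 h3 with h4 | h4
  · have h1 : g.ratio z = 1 := by
      rw [← ratio_I g, ratio, ratio, h4]
      simp
    rw [h1] at hre
    norm_num at hre
  · linarith [z.im_pos]

theorem continuous_arg_ratio (g : TG) : Continuous fun z : ℍ => (g.ratio z).arg := by
  rw [continuous_iff_continuousAt]
  intro z
  have h1 : ContinuousAt (fun z : ℍ => g.ratio z) z := by
    unfold ratio
    fun_prop
  exact ContinuousAt.comp (Complex.continuousAt_arg (ratio_mem_slitPlane g z)) h1

theorem continuous_smul (A : SL(2, ℝ)) : Continuous fun z : ℍ => A • z := by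
  rw [UpperHalfPlane.isEmbedding_coe.continuous_iff]
  have : (UpperHalfPlane.coe ∘ fun z : ℍ => A • z) =
      fun z : ℍ => ((A 0 0 : ℝ) * (z : ℂ) + (A 0 1 : ℝ)) / jf A z := by
    funext z
    exact coe_smul A z
  rw [this]
  refine Continuous.div (by fun_prop) ?_ (fun z => jf_ne_zero A z)
  unfold jf
  fun_prop

/-- The cocycle relation behind associativity. -/
theorem arg_ratio_cocycle (g₁ g₂ : TG) (z : ℍ) :
    (g₁.ratio g₂.z).arg + ((g₁ * g₂).ratio z).arg =
      (g₂.ratio z).arg + (g₁.ratio (g₂.pr • z)).arg := by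
  let F : ℍ → ℝ := fun z => (g₁.ratio g₂.z).arg + ((g₁ * g₂).ratio z).arg -
      ((g₂.ratio z).arg + (g₁.ratio (g₂.pr • z)).arg)
  have hF : Continuous F := by
    refine (continuous_const.add (continuous_arg_ratio _)).sub
      ((continuous_arg_ratio _).add ((continuous_arg_ratio g₁).comp (continuous_smul _)))
  have hI : F UpperHalfPlane.I = 0 := by
    simp only [F, ratio_I, pr_smul_I, Complex.arg_one]
    ring
  have hint : ∀ z, ∃ n : ℤ, F z = 2 * Real.pi * n := by
    intro z
    rw [← Real.Angle.angle_eq_iff_two_pi_dvd_sub, Real.Angle.coe_add, Real.Angle.coe_add,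
      ← Complex.arg_mul_coe_angle (ratio_ne_zero _ _) (ratio_ne_zero _ _),
      ← Complex.arg_mul_coe_angle (ratio_ne_zero _ _) (ratio_ne_zero _ _)]
    congr 2
    rw [ratio_eq g₁, ratio_eq (g₁ * g₂), ratio_eq g₂, ratio_eq g₁, pr_mul, jf_mul, jf_mul,
      pr_smul_I]
    have a1 := jf_ne_zero g₁.pr UpperHalfPlane.I
    have a2 := jf_ne_zero g₂.pr UpperHalfPlane.I
    have a3 := jf_ne_zero g₁.pr g₂.z
    field_simp
  have key : ∀ z, F z = 0 := by
    intro z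
    by_contra hne
    have hrange : ∀ c : ℝ, ¬ (∃ n : ℤ, c = 2 * Real.pi * n) →
        (∃ a, F a ≤ c) → (∃ b, c ≤ F b) → False := by
      intro c hc h1 h2
      obtain ⟨w, hw⟩ := mem_range_of_exists_le_of_exists_ge hF h1 h2
      exact hc (hw ▸ hint w)
    have hpi := Real.pi_pos
    obtain ⟨n, hn⟩ := hint z
    have hn0 : n ≠ 0 := by
      rintro rfl
      simp at hn
      exact hne hn
    rcases lt_or_gt_of_ne hn0 with h | h
    · have h' : (n : ℝ) ≤ -1 := by exact_mod_cast (by omega : n ≤ -1)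
      refine hrange (-Real.pi) ?_ ⟨z, by rw [hn]; nlinarith⟩
        ⟨UpperHalfPlane.I, by rw [hI]; linarith⟩
      rintro ⟨k, hk⟩
      have : (2 * k + 1 : ℝ) = 0 := by
        have : Real.pi * (2 * k + 1) = 0 := by linarith
        rcases mul_eq_zero.1 this with h0 | h0
        · exact absurd h0 hpi.ne'
        · exact h0
      have : (2 * k + 1 : ℤ) = 0 := by exact_mod_cast this
      omega
    · have h' : (1 : ℝ) ≤ n := by exact_mod_cast (by omega : 1 ≤ n)
      refine hrange Real.pi ?_ ⟨UpperHalfPlane.I, by rw [hI]; linarith⟩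
        ⟨z, by rw [hn]; nlinarith⟩
      rintro ⟨k, hk⟩
      have : (2 * k - 1 : ℝ) = 0 := by
        have : Real.pi * (2 * k - 1) = 0 := by linarith
        rcases mul_eq_zero.1 this with h0 | h0
        · exact absurd h0 hpi.ne'
        · exact h0
      have : (2 * k - 1 : ℤ) = 0 := by exact_mod_cast this
      omega
  have := key z
  simp only [F] at this
  linarith

instance : Group TG :=
  Group.ofRightAxioms
    (by
      intro g₁ g₂ g₃
      apply TG.ext
      · rw [mul_z, mul_z, mul_z, pr_mul, mul_smul]
      · have h := arg_ratio_cocycle g₁ g₂ g₃.z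
        simp only [mul_θ, mul_z]
        linarith)
    (by
      intro g
      apply TG.ext
      · exact pr_smul_I g
      · change g.θ + 0 - (g.ratio UpperHalfPlane.I).arg = g.θ
        simp [ratio_I])
    (by
      intro g
      apply TG.ext
      · change g.pr • g.pr⁻¹ • UpperHalfPlane.I = UpperHalfPlane.I
        simp
      · change g.θ + (-g.θ + (g.ratio (g.pr⁻¹ • UpperHalfPlane.I)).arg) -
          (g.ratio (g.pr⁻¹ • UpperHalfPlane.I)).arg = 0
        ring)

/-- The covering homomorphism. -/
def prHom : TG →* SL(2, ℝ) where
  toFun := pr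
  map_one' := pr_one
  map_mul' := pr_mul

end TG

/-! ### Smooth functions and differential operators in coordinates

A space `α` is described by a map `ψ : E → α` on an open set `U` of a real normed space `E`, with
inverse `κ : α → E`. -/

section Operators

variable {E F α : Type*} [NormedAddCommGroup E] [NormedSpace ℝ E]
  [NormedAddCommGroup F] [NormedSpace ℂ F]

/-- The function `f` is smooth in the coordinates `ψ` on `U`. -/
def Smooth (ψ : E → α) (U : Set E) (f : α → F) : Prop := ContDiffOn ℝ ∞ (f ∘ ψ) U

/-- The operator `D` preserves smoothness and is `ℂ`-linear on smooth functions. -/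
structure IsOp (ψ : E → α) (U : Set E) (D : (α → F) → (α → F)) : Prop where
  smooth : ∀ f, Smooth ψ U f → Smooth ψ U (D f)
  add : ∀ f g, Smooth ψ U f → Smooth ψ U g → D (f + g) = D f + D g
  smul : ∀ (c : ℂ) f, Smooth ψ U f → D (c • f) = c • D f

/-- The derivative of `f` in the coordinate direction `v`. -/
def pd (ψ : E → α) (κ : α → E) (v : E) (f : α → F) (a : α) : F := lineDeriv ℝ (f ∘ ψ) (κ a) v

variable {ψ : E → α} {κ : α → E} {U : Set E}

theorem Smooth.add {f g : α → F} (hf : Smooth ψ U f) (hg : Smooth ψ U g) :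
    Smooth ψ U (f + g) := ContDiffOn.add hf hg

theorem Smooth.smul {f : α → F} (c : ℂ) (hf : Smooth ψ U f) : Smooth ψ U (c • f) :=
  contDiffOn_const.smul hf

theorem Smooth.zero : Smooth ψ U (0 : α → F) := contDiffOn_const

theorem IsOp.congr {D D' : (α → F) → (α → F)} (h : IsOp ψ U D) (e : ∀ f, D' f = D f) :
    IsOp ψ U D' := by
  rw [show D' = D from funext e]
  exact h

theorem IsOp.id : IsOp (F := F) ψ U (fun f => f) := ⟨fun _ h => h, fun _ _ _ _ => rfl, fun _ _ _ => rfl⟩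

theorem IsOp.comp {D D' : (α → F) → (α → F)} (h : IsOp ψ U D) (h' : IsOp ψ U D') :
    IsOp ψ U (fun f => D (D' f)) where
  smooth f hf := h.smooth _ (h'.smooth _ hf)
  add f g hf hg := by
    rw [h'.add f g hf hg, h.add _ _ (h'.smooth _ hf) (h'.smooth _ hg)]
  smul c f hf := by
    rw [h'.smul c f hf, h.smul _ _ (h'.smooth _ hf)]

theorem IsOp.sum {D D' : (α → F) → (α → F)} (h : IsOp ψ U D) (h' : IsOp ψ U D') :
    IsOp ψ U (fun f => D f + D' f) where
  smooth f hf := (h.smooth _ hf).add (h'.smooth _ hf)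
  add f g hf hg := by
    rw [h.add f g hf hg, h'.add f g hf hg]
    abel
  smul c f hf := by
    rw [h.smul c f hf, h'.smul c f hf, smul_add]

theorem IsOp.coeff {D : (α → F) → (α → F)} (h : IsOp ψ U D) {c : α → ℂ} (hc : Smooth ψ U c) :
    IsOp ψ U (fun f a => c a • D f a) where
  smooth f hf := ContDiffOn.smul hc (h.smooth _ hf)
  add f g hf hg := by
    funext a
    rw [h.add f g hf hg]
    simp
  smul c' f hf := by
    funext a
    rw [h.smul c' f hf]
    exact smul_comm _ _ _

theorem IsOp.pd_field (hU : IsOpen U) (hκ : ∀ a, κ a ∈ U) (hκψ : ∀ v ∈ U, κ (ψ v) = v)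
    {w : α → E} (hw : ContDiffOn ℝ ∞ (w ∘ ψ) U) :
    IsOp (F := F) ψ U (fun f a => pd ψ κ (w a) f a) := by
  have hd : ∀ f : α → F, Smooth ψ U f → ∀ a, DifferentiableAt ℝ (f ∘ ψ) (κ a) := fun f hf a =>
    (hf.contDiffAt (hU.mem_nhds (hκ a))).differentiableAt (by simp)
  have key : ∀ f : α → F, Smooth ψ U f → ∀ a,
      pd ψ κ (w a) f a = fderiv ℝ (f ∘ ψ) (κ a) (w a) := fun f hf a =>
    (hd f hf a).lineDeriv_eq_fderiv
  refine ⟨fun f hf => ?_, fun f g hf hg => ?_, fun c f hf => ?_⟩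
  · have h1 : ContDiffOn ℝ ∞ (fun v => fderiv ℝ (f ∘ ψ) v ((w ∘ ψ) v)) U :=
      (ContDiffOn.fderiv_of_isOpen hf hU (by simp)).clm_apply hw
    refine h1.congr fun v hv => ?_
    simp only [Function.comp_apply]
    rw [key f hf, hκψ v hv]
  · funext a
    rw [Pi.add_apply, key _ (hf.add hg), key f hf, key g hg,
      show (f + g) ∘ ψ = f ∘ ψ + g ∘ ψ from rfl, fderiv_add (hd f hf a) (hd g hg a)]
    rfl
  · funext a
    rw [Pi.smul_apply, key _ (hf.smul c), key f hf, show (c • f) ∘ ψ = c • (f ∘ ψ) from rfl,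
      fderiv_const_smul (hd f hf a)]
    rfl

theorem IsOp.pd_const (hU : IsOpen U) (hκ : ∀ a, κ a ∈ U) (hκψ : ∀ v ∈ U, κ (ψ v) = v) (v : E) :
    IsOp (F := F) ψ U (fun f => pd ψ κ v f) :=
  IsOp.pd_field (w := fun _ => v) hU hκ hκψ contDiffOn_const

end Operators

/-! ### Maass forms on the upper half-plane -/

/-- The upper half-plane as an open set of `ℂ`. -/
def upperSet : Set ℂ := {w | 0 < w.im}

theorem isOpen_upperSet : IsOpen upperSet := isOpen_lt continuous_const Complex.continuous_im

/-- The function `η^{2k}(z) = e^{π i k z / 6} ∏_{n ≥ 1} (1 - e^{2 π i n z})^{2k}`, with principal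
values of the powers. -/
def etaPow (k : ℝ) (z : ℍ) : ℂ :=
  Complex.exp (Real.pi * Complex.I * k * z / 6) *
    ∏' n : ℕ, (1 - Complex.exp (2 * Real.pi * Complex.I * (n + 1) * z)) ^ ((2 * k : ℝ) : ℂ)

/-- The factor `c z + d` for `γ = (a, b; c, d)` in `SL₂(ℤ)`. -/
def jZ (γ : SL(2, ℤ)) (z : ℍ) : ℂ := (γ 1 0 : ℤ) * (z : ℂ) + (γ 1 1 : ℤ)

/-- The multiplier system `v_k(γ) = η^{2k}(γ z) / ((c z + d)^k η^{2k}(z))` with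
`-π < arg (c z + d) ≤ π`. The quotient does not depend on `z`; it is taken at `z = i`. -/
def vMult (k : ℝ) (γ : SL(2, ℤ)) : ℂ :=
  etaPow k (γ • UpperHalfPlane.I) /
    (jZ γ UpperHalfPlane.I ^ (k : ℂ) * etaPow k UpperHalfPlane.I)

/-- The operator `u ↦ u|_{ρ v_k, k} γ`, with
`(u|γ)(z) = ρ(γ)⁻¹ v_k(γ)⁻¹ e^{-i k arg(c z + d)} u(γ z)`. -/
def slash {n : ℕ} (k : ℝ) (ρ : SL(2, ℤ) →* Matrix.unitaryGroup (Fin n) ℂ) (γ : SL(2, ℤ))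
    (u : ℍ → Fin n → ℂ) (z : ℍ) : Fin n → ℂ :=
  ((vMult k γ)⁻¹ * Complex.exp (-(Complex.I * k * (jZ γ z).arg))) •
    ((((ρ γ)⁻¹ : Matrix.unitaryGroup (Fin n) ℂ) : Matrix (Fin n) (Fin n) ℂ) *ᵥ u (γ • z))

/-- The derivative in the direction `v ∈ ℂ` of a function on the upper half-plane. -/
def pdH {F : Type*} [NormedAddCommGroup F] [NormedSpace ℂ F] (v : ℂ) (u : ℍ → F) : ℍ → F :=
  pd (fun w : ℂ => ofComplex w) (fun z : ℍ => (z : ℂ)) v u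

/-- `Δ_k = -y² ∂_x² - y² ∂_y² + i k y ∂_x`. -/
def lapl {n : ℕ} (k : ℝ) (u : ℍ → Fin n → ℂ) (z : ℍ) : Fin n → ℂ :=
  (-(z.im : ℂ) ^ 2) • pdH 1 (pdH 1 u) z
    + (-(z.im : ℂ) ^ 2) • pdH Complex.I (pdH Complex.I u) z
    + (Complex.I * k * z.im) • pdH 1 u z

/-- Smoothness of a function on the upper half-plane. -/
def SmoothH {F : Type*} [NormedAddCommGroup F] [NormedSpace ℂ F] (u : ℍ → F) : Prop :=
  Smooth (fun w : ℂ => ofComplex w) upperSet u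

/-- Maass forms of weight `k`, spectral parameter `s` and multiplier system `ρ v_k`. -/
structure IsMaass {n : ℕ} (k : ℝ) (s : ℂ) (ρ : SL(2, ℤ) →* Matrix.unitaryGroup (Fin n) ℂ)
    (u : ℍ → Fin n → ℂ) : Prop where
  smooth : SmoothH u
  invariant : ∀ γ, slash k ρ γ u = u
  eigen : lapl k u = (s * (1 - s)) • u
  growth : ∃ a : ℝ, ∀ K : Set ℝ, IsCompact K → ∃ C : ℝ, ∀ᶠ y : ℝ in atTop, ∀ x ∈ K,
    ‖u (ofComplex (x + y * Complex.I))‖ ≤ C * y ^ a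

/-- Exponential decay as `y → ∞`, uniformly for `x` in compact sets. -/
def ExpDecay {n : ℕ} (u : ℍ → Fin n → ℂ) : Prop :=
  ∃ a > (0 : ℝ), ∀ K : Set ℝ, IsCompact K → ∃ C : ℝ, ∀ᶠ y : ℝ in atTop, ∀ x ∈ K,
    ‖u (ofComplex (x + y * Complex.I))‖ ≤ C * Real.exp (-(a * y))

theorem isOp_pdH {F : Type*} [NormedAddCommGroup F] [NormedSpace ℂ F] (v : ℂ) :
    IsOp (F := F) (fun w : ℂ => ofComplex w) upperSet (pdH v) :=
  IsOp.pd_const isOpen_upperSet (fun z => z.im_pos)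
    (fun w hw => by rw [ofComplex_apply_of_im_pos hw]) v

theorem smoothH_im : SmoothH (fun z : ℍ => (z.im : ℂ)) := by
  have : ContDiffOn ℝ ∞ (fun w : ℂ => ((Complex.imCLM w : ℝ) : ℂ)) upperSet :=
    (Complex.ofRealCLM.contDiff.comp Complex.imCLM.contDiff).contDiffOn
  refine this.congr fun w hw => ?_
  simp only [Function.comp_apply, ofComplex_apply_of_im_pos hw]
  rfl

theorem isOp_lapl {n : ℕ} (k : ℝ) :
    IsOp (fun w : ℂ => ofComplex w) upperSet (lapl (n := n) k) := by
  have h1 : SmoothH (fun z : ℍ => -(z.im : ℂ) ^ 2) := ContDiffOn.neg (ContDiffOn.pow smoothH_im 2)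
  have h2 : SmoothH (fun z : ℍ => Complex.I * k * (z.im : ℂ)) :=
    ContDiffOn.mul contDiffOn_const smoothH_im
  refine (((((isOp_pdH 1).comp (isOp_pdH 1)).coeff h1).sum
    (((isOp_pdH Complex.I).comp (isOp_pdH Complex.I)).coeff h1)).sum
    ((isOp_pdH 1).coeff h2)).congr fun u => ?_
  funext z
  rfl

theorem slash_add {n : ℕ} (k : ℝ) (ρ : SL(2, ℤ) →* Matrix.unitaryGroup (Fin n) ℂ) (γ : SL(2, ℤ))
    (u v : ℍ → Fin n → ℂ) : slash k ρ γ (u + v) = slash k ρ γ u + slash k ρ γ v := by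
  funext z
  simp [slash, Matrix.mulVec_add]

theorem slash_smul {n : ℕ} (k : ℝ) (ρ : SL(2, ℤ) →* Matrix.unitaryGroup (Fin n) ℂ) (γ : SL(2, ℤ))
    (c : ℂ) (u : ℍ → Fin n → ℂ) : slash k ρ γ (c • u) = c • slash k ρ γ u := by
  funext z
  simp only [slash, Pi.smul_apply, Matrix.mulVec_smul]
  rw [smul_comm]

/-- The space `A_k(s, ρ v_k)` of Maass forms. -/
def Maass {n : ℕ} (k : ℝ) (s : ℂ) (ρ : SL(2, ℤ) →* Matrix.unitaryGroup (Fin n) ℂ) :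
    Submodule ℂ (ℍ → Fin n → ℂ) where
  carrier := {u | IsMaass k s ρ u}
  zero_mem' :=
    { smooth := Smooth.zero
      invariant := fun γ => by
        have := slash_smul k ρ γ 0 0
        simpa using this
      eigen := by
        have := (isOp_lapl (n := n) k).smul 0 0 Smooth.zero
        simpa using this
      growth := ⟨0, fun K _ => ⟨0, Eventually.of_forall fun y x _ => by simp⟩⟩ }
  add_mem' := by
    intro u v hu hv
    refine ⟨hu.smooth.add hv.smooth, fun γ => ?_, ?_, ?_⟩
    · rw [slash_add, hu.invariant, hv.invariant]
    · rw [(isOp_lapl k).add _ _ hu.smooth hv.smooth, hu.eigen, hv.eigen, smul_add]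
    · obtain ⟨a, ha⟩ := hu.growth
      obtain ⟨b, hb⟩ := hv.growth
      refine ⟨max a b, fun K hK => ?_⟩
      obtain ⟨C, hC⟩ := ha K hK
      obtain ⟨D, hD⟩ := hb K hK
      refine ⟨|C| + |D|, ?_⟩
      filter_upwards [hC, hD, eventually_ge_atTop 1] with y h1 h2 hy x hx
      have e1 : y ^ a ≤ y ^ max a b := Real.rpow_le_rpow_of_exponent_le hy (le_max_left _ _)
      have e2 : y ^ b ≤ y ^ max a b := Real.rpow_le_rpow_of_exponent_le hy (le_max_right _ _)
      have p1 : 0 ≤ y ^ a := Real.rpow_nonneg (by linarith) _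
      have p2 : 0 ≤ y ^ b := Real.rpow_nonneg (by linarith) _
      calc ‖(u + v) (ofComplex (x + y * Complex.I))‖ ≤ C * y ^ a + D * y ^ b :=
            (norm_add_le _ _).trans (add_le_add (h1 x hx) (h2 x hx))
        _ ≤ |C| * y ^ max a b + |D| * y ^ max a b :=
            add_le_add (mul_le_mul (le_abs_self _) e1 p1 (abs_nonneg _))
              (mul_le_mul (le_abs_self _) e2 p2 (abs_nonneg _))
        _ = _ := by ring
  smul_mem' := by
    intro c u hu
    refine ⟨hu.smooth.smul c, fun γ => ?_, ?_, ?_⟩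
    · rw [slash_smul, hu.invariant]
    · rw [(isOp_lapl k).smul _ _ hu.smooth, hu.eigen, smul_comm]
    · obtain ⟨a, ha⟩ := hu.growth
      refine ⟨a, fun K hK => ?_⟩
      obtain ⟨C, hC⟩ := ha K hK
      refine ⟨‖c‖ * C, ?_⟩
      filter_upwards [hC] with y h1 x hx
      rw [Pi.smul_apply, norm_smul, mul_assoc]
      exact mul_le_mul_of_nonneg_left (h1 x hx) (norm_nonneg _)

/-- The space `A⁰_k(s, ρ v_k)` of Maass cusp forms. -/
def MaassCusp {n : ℕ} (k : ℝ) (s : ℂ) (ρ : SL(2, ℤ) →* Matrix.unitaryGroup (Fin n) ℂ) :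
    Submodule ℂ (ℍ → Fin n → ℂ) where
  carrier := {u | u ∈ Maass k s ρ ∧ ExpDecay u}
  zero_mem' := ⟨Submodule.zero_mem _, 1, one_pos, fun K _ =>
    ⟨0, Eventually.of_forall fun y x _ => by simp⟩⟩
  add_mem' := by
    rintro u v ⟨hu, a, ha, hua⟩ ⟨hv, b, hb, hvb⟩
    refine ⟨Submodule.add_mem _ hu hv, min a b, lt_min ha hb, fun K hK => ?_⟩
    obtain ⟨C, hC⟩ := hua K hK
    obtain ⟨D, hD⟩ := hvb K hK
    refine ⟨|C| + |D|, ?_⟩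
    filter_upwards [hC, hD, eventually_ge_atTop 0] with y h1 h2 hy x hx
    have e1 : Real.exp (-(a * y)) ≤ Real.exp (-(min a b * y)) := by
      apply Real.exp_le_exp.2
      have := mul_le_mul_of_nonneg_right (min_le_left a b) hy
      linarith
    have e2 : Real.exp (-(b * y)) ≤ Real.exp (-(min a b * y)) := by
      apply Real.exp_le_exp.2
      have := mul_le_mul_of_nonneg_right (min_le_right a b) hy
      linarith
    calc ‖(u + v) (ofComplex (x + y * Complex.I))‖
          ≤ C * Real.exp (-(a * y)) + D * Real.exp (-(b * y)) :=
          (norm_add_le _ _).trans (add_le_add (h1 x hx) (h2 x hx))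
      _ ≤ |C| * Real.exp (-(min a b * y)) + |D| * Real.exp (-(min a b * y)) :=
          add_le_add (mul_le_mul (le_abs_self _) e1 (Real.exp_pos _).le (abs_nonneg _))
            (mul_le_mul (le_abs_self _) e2 (Real.exp_pos _).le (abs_nonneg _))
      _ = _ := by ring
  smul_mem' := by
    rintro c u ⟨hu, a, ha, hua⟩
    refine ⟨Submodule.smul_mem _ c hu, a, ha, fun K hK => ?_⟩
    obtain ⟨C, hC⟩ := hua K hK
    refine ⟨‖c‖ * C, ?_⟩
    filter_upwards [hC] with y h1 x hx
    rw [Pi.smul_apply, norm_smul, mul_assoc]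
    exact mul_le_mul_of_nonneg_left (h1 x hx) (norm_nonneg _)

/-! ### The Jacobi group and its universal covering group -/

/-- The Heisenberg group; `⟨x, y, r⟩` is the element `h(x, y, r)`. -/
@[ext] structure Heis where
  x : ℝ
  y : ℝ
  r : ℝ

namespace Heis

instance : Mul Heis := ⟨fun a b => ⟨a.x + b.x, a.y + b.y, a.r + b.r + a.x * b.y - b.x * a.y⟩⟩
instance : One Heis := ⟨⟨0, 0, 0⟩⟩
instance : Inv Heis := ⟨fun a => ⟨-a.x, -a.y, -a.r⟩⟩

theorem mul_def (a b : Heis) :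
    a * b = ⟨a.x + b.x, a.y + b.y, a.r + b.r + a.x * b.y - b.x * a.y⟩ := rfl
theorem one_def : (1 : Heis) = ⟨0, 0, 0⟩ := rfl
theorem inv_def (a : Heis) : a⁻¹ = ⟨-a.x, -a.y, -a.r⟩ := rfl

instance : Group Heis :=
  Group.ofLeftAxioms
    (by intro a b c; ext <;> simp [mul_def] <;> ring)
    (by intro a; ext <;> simp [mul_def, one_def])
    (by intro a; ext <;> simp [mul_def, one_def, inv_def])

/-- The map `h(x, y, r) ↦ h((x, y) B, r)`. -/
def act (B : SL(2, ℝ)) (h : Heis) : Heis :=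
  ⟨h.x * B 0 0 + h.y * B 1 0, h.x * B 0 1 + h.y * B 1 1, h.r⟩

theorem act_act (A B : SL(2, ℝ)) (h : Heis) : act A (act B h) = act (B * A) h := by
  ext <;> simp [act, Matrix.mul_apply, Fin.sum_univ_two] <;> ring

theorem act_one (h : Heis) : act 1 h = h := by
  ext <;> simp [act]

theorem act_mul (B : SL(2, ℝ)) (h h' : Heis) : act B (h * h') = act B h * act B h' := by
  have hd := B.det_coe
  rw [Matrix.det_fin_two] at hd
  ext
  · simp [act, mul_def]; ring
  · simp [act, mul_def]; ring
  · simp only [act, mul_def]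
    linear_combination (-(h.x * h'.y) + h'.x * h.y) * hd

/-- Conjugation by `A` in `SL₂(ℝ)`: `A h(x, y, r) A⁻¹ = h((x, y) A⁻¹, r)`. -/
def conj : SL(2, ℝ) →* MulAut Heis where
  toFun A :=
    { toFun := act A⁻¹
      invFun := act A
      left_inv := fun h => by rw [act_act, inv_mul_cancel, act_one]
      right_inv := fun h => by rw [act_act, mul_inv_cancel, act_one]
      map_mul' := act_mul _ }
  map_one' := by
    ext1 h
    change act 1⁻¹ h = h
    rw [inv_one, act_one]
  map_mul' A B := by
    ext1 h
    change act (A * B)⁻¹ h = act A⁻¹ (act B⁻¹ h)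
    rw [act_act, _root_.mul_inv_rev]

end Heis

/-- The universal covering group `Heis ⋊ TG` of the Jacobi group. The pair `⟨h, g⟩` is the product
`h g`. -/
abbrev TGJ : Type := SemidirectProduct Heis TG (Heis.conj.comp TG.prHom)

/-- The inclusion of the Heisenberg group. -/
def hJ (p q r : ℝ) : TGJ := SemidirectProduct.inl ⟨p, q, r⟩

/-- The inclusion of the universal covering group of `SL₂(ℝ)`. -/
def gJ (g : TG) : TGJ := SemidirectProduct.inr g

instance : TopologicalSpace TG := .induced (fun g => (g.z, g.θ)) inferInstance

instance : TopologicalSpace Heis := .induced (fun h => (h.x, h.y, h.r)) inferInstance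

instance : TopologicalSpace TGJ := .induced (fun g => (g.left, g.right)) inferInstance

/-- The element `k̃(θ)`. -/
def kT (θ : ℝ) : TG := ⟨UpperHalfPlane.I, θ⟩

/-- The element `ã(t) = p̃(i t)`, for `t > 0`. -/
def aT (t : ℝ) : TG := ⟨ofComplex (t * Complex.I), 0⟩

/-- The inverse image of `SL₂(ℤ)` in the universal covering group of `SL₂(ℝ)`. -/
def tGamma : Subgroup TG :=
  ((Matrix.SpecialLinearGroup.map (Int.castRingHom ℝ) : SL(2, ℤ) →* SL(2, ℝ)).range).comap TG.prHom

/-- The element `p̃(i + 1)`, which lies above `T = (1, 1; 0, 1)`. -/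
def tEl : tGamma :=
  ⟨⟨⟨Complex.I + 1, by simp⟩, 0⟩, ModularGroup.T, by
    apply Subtype.ext
    change (ModularGroup.T : Matrix (Fin 2) (Fin 2) ℤ).map (Int.castRingHom ℝ) =
      ((TG.pr _ : SL(2, ℝ)) : Matrix (Fin 2) (Fin 2) ℝ)
    rw [TG.coe_pr]
    ext i j
    fin_cases i <;> fin_cases j <;>
      simp [ModularGroup.T, Matrix.mul_apply, Fin.sum_univ_two]⟩

/-- The element `k̃(-π/2)`, which lies above `S = (0, -1; 1, 0)`. -/
def sEl : tGamma :=
  ⟨kT (-(Real.pi / 2)), ModularGroup.S, by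
    apply Subtype.ext
    change (ModularGroup.S : Matrix (Fin 2) (Fin 2) ℤ).map (Int.castRingHom ℝ) =
      ((TG.pr _ : SL(2, ℝ)) : Matrix (Fin 2) (Fin 2) ℝ)
    rw [TG.coe_pr]
    ext i j
    fin_cases i <;> fin_cases j <;>
      simp [ModularGroup.S, kT, Matrix.mul_apply, Fin.sum_univ_two]⟩

/-- The character `χ_k`: `χ_k(t) = e^{π i k / 6}` and `χ_k(s) = e^{-π i k / 2}`. -/
def IsChi (k : ℝ) (χ : tGamma →* ℂˣ) : Prop :=
  (χ tEl : ℂ) = Complex.exp (Real.pi * Complex.I * k / 6) ∧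
    (χ sEl : ℂ) = Complex.exp (-(Real.pi * Complex.I * k / 2))

/-- The character `φ_a`: `φ_a(t) = e^{π i a / 6}` and `φ_a(s) = e^{-π i a / 2}`. -/
def IsPhi (a : ZMod 12) (φ : tGamma →* ℂˣ) : Prop :=
  (φ tEl : ℂ) = Complex.exp (Real.pi * Complex.I * a.val / 6) ∧
    (φ sEl : ℂ) = Complex.exp (-(Real.pi * Complex.I * a.val / 2))

/-- The representation `ρ_{a,m}`. The index `j` in `Fin (2 * m)` stands for `j + 1`, so that the
indices run from `1` to `2m`. -/
def IsRho (a : ZMod 12) (m : ℕ) (ρ : SL(2, ℤ) →* Matrix.unitaryGroup (Fin (2 * m)) ℂ) : Prop :=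
  (∀ j j' : Fin (2 * m), (ρ ModularGroup.T : Matrix (Fin (2 * m)) (Fin (2 * m)) ℂ) j j' =
    if j = j' then Complex.exp (Real.pi * Complex.I *
      ((a.val : ℂ) / 6 + 1 / 12 - ((j : ℕ) + 1 : ℂ) ^ 2 / (2 * m))) else 0) ∧
  (∀ j j' : Fin (2 * m), (ρ ModularGroup.S : Matrix (Fin (2 * m)) (Fin (2 * m)) ℂ) j j' =
    ((√(2 * m : ℝ))⁻¹ : ℝ) * Complex.exp (Real.pi * Complex.I *
      (-((a.val : ℂ) / 2) + ((j : ℕ) + 1 : ℂ) * ((j' : ℕ) + 1 : ℂ) / m)))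

/-! ### Differential operators on the covering of the Jacobi group -/

/-- Coordinates `(p, q, r, τ, θ)` of `h(p, q, r) p̃(τ) k̃(θ)`. -/
abbrev Coord : Type := ℝ × ℝ × ℝ × ℂ × ℝ

def ofCoord (v : Coord) : TGJ := ⟨⟨v.1, v.2.1, v.2.2.1⟩, ⟨ofComplex v.2.2.2.1, v.2.2.2.2⟩⟩

def toCoord (g : TGJ) : Coord := (g.left.x, g.left.y, g.left.r, (g.right.z : ℂ), g.right.θ)

def coordSet : Set Coord := {v | 0 < v.2.2.2.1.im}

/-- Smoothness of a function on the covering of the Jacobi group. -/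
def SmoothJ (f : TGJ → ℂ) : Prop := Smooth ofCoord coordSet f

/-- Coordinate derivatives. -/
def pdJ (v : Coord) (f : TGJ → ℂ) : TGJ → ℂ := pd ofCoord toCoord v f

/-- `∂_x`, for `τ = x + iy`. -/
def dx : (TGJ → ℂ) → TGJ → ℂ := pdJ (0, 0, 0, 1, 0)

/-- `∂_y`, for `τ = x + iy`. -/
def dy : (TGJ → ℂ) → TGJ → ℂ := pdJ (0, 0, 0, Complex.I, 0)

/-- `∂_θ`. -/
def dθ : (TGJ → ℂ) → TGJ → ℂ := pdJ (0, 0, 0, 0, 1)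

/-- `X_+ = e^{2iθ} (i y ∂_x + y ∂_y - (i/2) ∂_θ)`: the right derivative by `(1, i; i, -1)/2`. -/
def Xp (f : TGJ → ℂ) (g : TGJ) : ℂ :=
  Complex.exp (2 * Complex.I * g.right.θ) *
    (Complex.I * g.right.z.im * dx f g + g.right.z.im * dy f g - Complex.I / 2 * dθ f g)

/-- `X_- = e^{-2iθ} (-i y ∂_x + y ∂_y + (i/2) ∂_θ)`: the right derivative by `(1, -i; -i, -1)/2`. -/
def Xm (f : TGJ → ℂ) (g : TGJ) : ℂ :=
  Complex.exp (-(2 * Complex.I * g.right.θ)) *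
    (-(Complex.I * g.right.z.im * dx f g) + g.right.z.im * dy f g + Complex.I / 2 * dθ f g)

/-- Right differentiation along `h(t, 0, 0)`. -/
def dP (f : TGJ → ℂ) (g : TGJ) : ℂ := deriv (fun t : ℝ => f (g * hJ t 0 0)) 0

/-- Right differentiation along `h(0, t, 0)`. -/
def dQ (f : TGJ → ℂ) (g : TGJ) : ℂ := deriv (fun t : ℝ => f (g * hJ 0 t 0)) 0

/-- `Y_+ = (P + iQ) / 2`. -/
def Yp (f : TGJ → ℂ) (g : TGJ) : ℂ := 1 / 2 * (dP f g + Complex.I * dQ f g)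

/-- `Y_- = (P - iQ) / 2`. -/
def Ym (f : TGJ → ℂ) (g : TGJ) : ℂ := 1 / 2 * (dP f g - Complex.I * dQ f g)

/-- `D_+ = X_+ + (4πm)⁻¹ Y_+²`. -/
def Dp (m : ℕ) (f : TGJ → ℂ) (g : TGJ) : ℂ := Xp f g + 1 / (4 * Real.pi * m) * Yp (Yp f) g

/-- `D_- = X_- - (4πm)⁻¹ Y_-²`. -/
def Dm (m : ℕ) (f : TGJ → ℂ) (g : TGJ) : ℂ := Xm f g - 1 / (4 * Real.pi * m) * Ym (Ym f) g

/-! ### Jacobi Maass forms -/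

/-- Jacobi Maass forms of weight `k`, index `m` and parameter `s`, for the character `χ` of the
inverse image of `SL₂(ℤ)`, extended trivially to the integral Heisenberg group. In the growth
condition `h` runs through the Heisenberg group and `ã(t)` stands between `h` and `g`. -/
structure IsJacobiMaass (k : ℝ) (m : ℕ) (s : ℂ) (χ : tGamma →* ℂˣ) (f : TGJ → ℂ) : Prop where
  smooth : SmoothJ f
  weight : ∀ (r θ : ℝ) (g : TGJ), f (hJ 0 0 r * g * gJ (kT θ)) =
    Complex.exp (2 * Real.pi * Complex.I * m * r + Complex.I * k * θ) * f g
  equivariant : ∀ (l μ κ : ℤ) (γ : tGamma) (g : TGJ),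
    f (hJ l μ κ * gJ γ * g) = (χ γ : ℂ) * f g
  eigen₁ : Dm m (Dp m f) = ((4 * s ^ 2 - (2 * k + 1) ^ 2) / 16) • f
  eigen₂ : Dp m (Dm m f) = ((4 * s ^ 2 - (2 * k - 3) ^ 2) / 16) • f
  holo : Ym f = 0
  growth : ∃ α > (0 : ℝ), ∀ L : Set Heis, IsCompact L → ∀ K : Set TGJ, IsCompact K →
    ∃ C : ℝ, ∀ᶠ t : ℝ in atTop, ∀ h ∈ L, ∀ g ∈ K,
      ‖f (SemidirectProduct.inl h * gJ (aT t) * g)‖ ≤ C * t ^ α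

/-- Quick decay, the growth condition for cusp forms. -/
def QuickDecay (f : TGJ → ℂ) : Prop :=
  ∀ α > (0 : ℝ), ∀ L : Set Heis, IsCompact L → ∀ K : Set TGJ, IsCompact K →
    ∃ C : ℝ, ∀ᶠ t : ℝ in atTop, ∀ h ∈ L, ∀ g ∈ K,
      ‖f (SemidirectProduct.inl h * gJ (aT t) * g)‖ ≤ C * t ^ (-α)

theorem isOpen_coordSet : IsOpen coordSet :=
  isOpen_lt continuous_const (Complex.continuous_im.comp
    (continuous_fst.comp (continuous_snd.comp (continuous_snd.comp continuous_snd))))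

theorem toCoord_mem (g : TGJ) : toCoord g ∈ coordSet := g.right.z.im_pos

theorem toCoord_ofCoord (v : Coord) (hv : v ∈ coordSet) : toCoord (ofCoord v) = v := by
  have h : 0 < v.2.2.2.1.im := hv
  simp [toCoord, ofCoord, ofComplex_apply_of_im_pos h]

theorem ofCoord_toCoord (g : TGJ) : ofCoord (toCoord g) = g := by
  simp only [toCoord, ofCoord, ofComplex_apply]

theorem isOp_pdJ (v : Coord) : IsOp ofCoord coordSet (pdJ v) :=
  IsOp.pd_const isOpen_coordSet toCoord_mem toCoord_ofCoord v

theorem smoothJ_const (c : ℂ) : SmoothJ fun _ => c := contDiffOn_const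

theorem SmoothJ.mul {c d : TGJ → ℂ} (hc : SmoothJ c) (hd : SmoothJ d) :
    SmoothJ fun g => c g * d g := ContDiffOn.mul hc hd

/-- A smooth function of the coordinates. -/
theorem smoothJ_of {c : TGJ → ℂ} {C : Coord → ℂ} (hC : ContDiffOn ℝ ∞ C coordSet)
    (h : ∀ g, c g = C (toCoord g)) : SmoothJ c := by
  refine hC.congr fun v hv => ?_
  rw [Function.comp_apply, h, toCoord_ofCoord v hv]

theorem smoothJ_im : SmoothJ fun g => (g.right.z.im : ℂ) := by
  refine smoothJ_of (C := fun v => ((v.2.2.2.1.im : ℝ) : ℂ)) ?_ fun g => rfl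
  exact (Complex.ofRealCLM.contDiff.comp (Complex.imCLM.contDiff.comp
    (by fun_prop : ContDiff ℝ ∞ fun v : Coord => v.2.2.2.1))).contDiffOn

theorem smoothJ_exp (c : ℂ) : SmoothJ fun g => Complex.exp (c * g.right.θ) := by
  refine smoothJ_of (C := fun v => Complex.exp (c * (v.2.2.2.2 : ℝ))) ?_ fun g => rfl
  have h1 : ContDiff ℝ ∞ fun v : Coord => ((v.2.2.2.2 : ℝ) : ℂ) :=
    Complex.ofRealCLM.contDiff.comp (by fun_prop : ContDiff ℝ ∞ fun v : Coord => v.2.2.2.2)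
  exact (contDiff_const.mul h1).cexp.contDiffOn

theorem isOp_Xp : IsOp ofCoord coordSet Xp := by
  have hx := (isOp_pdJ (0, 0, 0, 1, 0)).coeff ((smoothJ_const Complex.I).mul smoothJ_im)
  have hy := (isOp_pdJ (0, 0, 0, Complex.I, 0)).coeff smoothJ_im
  have hθ := (isOp_pdJ (0, 0, 0, 0, 1)).coeff (smoothJ_const (-(Complex.I / 2)))
  refine (((hx.sum hy).sum hθ).coeff (smoothJ_exp (2 * Complex.I))).congr fun f => ?_
  funext g
  simp only [Xp, dx, dy, dθ, Pi.add_apply, smul_eq_mul]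
  ring

theorem isOp_Xm : IsOp ofCoord coordSet Xm := by
  have hx := (isOp_pdJ (0, 0, 0, 1, 0)).coeff ((smoothJ_const (-Complex.I)).mul smoothJ_im)
  have hy := (isOp_pdJ (0, 0, 0, Complex.I, 0)).coeff smoothJ_im
  have hθ := (isOp_pdJ (0, 0, 0, 0, 1)).coeff (smoothJ_const (Complex.I / 2))
  refine (((hx.sum hy).sum hθ).coeff (smoothJ_exp (-(2 * Complex.I)))).congr fun f => ?_
  funext g
  simp only [Xm, dx, dy, dθ, Pi.add_apply, smul_eq_mul, neg_mul]

/-- The coordinate vector of right differentiation along `h(t u, t v, 0)`. -/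
def heisDir (u v : ℝ) (g : TGJ) : Coord :=
  (u * g.right.pr 1 1 - v * g.right.pr 1 0, -(u * g.right.pr 0 1) + v * g.right.pr 0 0,
    g.left.x * (-(u * g.right.pr 0 1) + v * g.right.pr 0 0) -
      (u * g.right.pr 1 1 - v * g.right.pr 1 0) * g.left.y, 0, 0)

theorem mul_hJ (u v t : ℝ) (g : TGJ) :
    g * hJ (t * u) (t * v) 0 = ofCoord (toCoord g + t • heisDir u v g) := by
  apply SemidirectProduct.ext
  · change g.left * Heis.act (g.right.pr)⁻¹ ⟨t * u, t * v, 0⟩ = _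
    rw [Heis.mul_def]
    apply Heis.ext
    · simp [Heis.act, ofCoord, toCoord, heisDir, Matrix.SpecialLinearGroup.coe_inv,
        Matrix.adjugate_fin_two]
      ring
    · simp [Heis.act, ofCoord, toCoord, heisDir, Matrix.SpecialLinearGroup.coe_inv,
        Matrix.adjugate_fin_two]
      ring
    · simp [Heis.act, ofCoord, toCoord, heisDir, Matrix.SpecialLinearGroup.coe_inv,
        Matrix.adjugate_fin_two]
      ring
  · change g.right * 1 = _
    rw [mul_one]
    apply TG.ext
    · simp [ofCoord, toCoord, heisDir]
    · simp [ofCoord, toCoord, heisDir]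

theorem heisDir_smooth (u v : ℝ) : ContDiffOn ℝ ∞ (heisDir u v ∘ ofCoord) coordSet := by
  have hτ : ContDiff ℝ ∞ fun w : Coord => w.2.2.2.1 := by fun_prop
  have him : ContDiffOn ℝ ∞ (fun w : Coord => w.2.2.2.1.im) coordSet :=
    (Complex.imCLM.contDiff.comp hτ).contDiffOn
  have hre : ContDiffOn ℝ ∞ (fun w : Coord => w.2.2.2.1.re) coordSet :=
    (Complex.reCLM.contDiff.comp hτ).contDiffOn
  have hsq : ContDiffOn ℝ ∞ (fun w : Coord => √(w.2.2.2.1.im)) coordSet :=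
    him.sqrt fun w hw => (ne_of_gt hw)
  have hne : ∀ w ∈ coordSet, √(w.2.2.2.1.im) ≠ 0 := fun w hw => (Real.sqrt_pos.2 hw).ne'
  have hinv : ContDiffOn ℝ ∞ (fun w : Coord => (√(w.2.2.2.1.im))⁻¹) coordSet := hsq.inv hne
  have hcos : ContDiffOn ℝ ∞ (fun w : Coord => Real.cos w.2.2.2.2) coordSet :=
    (Real.contDiff_cos.comp (by fun_prop : ContDiff ℝ ∞ fun w : Coord => w.2.2.2.2)).contDiffOn
  have hsin : ContDiffOn ℝ ∞ (fun w : Coord => Real.sin w.2.2.2.2) coordSet :=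
    (Real.contDiff_sin.comp (by fun_prop : ContDiff ℝ ∞ fun w : Coord => w.2.2.2.2)).contDiffOn
  have hp : ContDiffOn ℝ ∞ (fun w : Coord => w.1) coordSet := by fun_prop
  have hq : ContDiffOn ℝ ∞ (fun w : Coord => w.2.1) coordSet := by fun_prop
  have c (a : ℝ) : ContDiffOn ℝ ∞ (fun _ : Coord => a) coordSet := contDiffOn_const
  have hX := ((c u).mul (hinv.mul hcos)).add ((c v).mul (hinv.mul hsin))
  have hY := (((c u).mul ((hsq.mul hsin).add ((hre.mul hinv).mul hcos))).neg).add
    ((c v).mul ((hsq.mul hcos).sub ((hre.mul hinv).mul hsin)))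
  have hZ := (hp.mul hY).sub (hX.mul hq)
  have h0 : ContDiffOn ℝ ∞ (fun _ : Coord => ((0, 0) : ℂ × ℝ)) coordSet := contDiffOn_const
  refine (hX.prodMk (hY.prodMk (hZ.prodMk h0))).congr fun w hw => ?_
  have hw' : 0 < w.2.2.2.1.im := hw
  have e : (ofCoord w).right.z.im = w.2.2.2.1.im := by
    simp only [ofCoord, ofComplex_apply_of_im_pos hw']
    rfl
  have e' : (ofCoord w).right.z.re = w.2.2.2.1.re := by
    simp only [ofCoord, ofComplex_apply_of_im_pos hw']
    rfl
  have e1 : (ofCoord w).right.θ = w.2.2.2.2 := rfl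
  have e2 : (ofCoord w).left.x = w.1 := rfl
  have e3 : (ofCoord w).left.y = w.2.1 := rfl
  simp only [Function.comp_apply, heisDir, TG.coe_pr, e, e', e1, e2, e3]
  ext <;> simp [Matrix.mul_apply, Fin.sum_univ_two, -mul_eq_mul_left_iff] <;> ring

theorem isOp_heis (u v : ℝ) :
    IsOp ofCoord coordSet fun (f : TGJ → ℂ) g => pd ofCoord toCoord (heisDir u v g) f g :=
  IsOp.pd_field isOpen_coordSet toCoord_mem toCoord_ofCoord (heisDir_smooth u v)

theorem dP_eq (f : TGJ → ℂ) (g : TGJ) : dP f g = pd ofCoord toCoord (heisDir 1 0 g) f g := by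
  rw [dP, pd, lineDeriv]
  congr 1
  funext t
  rw [Function.comp_apply, ← mul_hJ, mul_one, mul_zero]

theorem dQ_eq (f : TGJ → ℂ) (g : TGJ) : dQ f g = pd ofCoord toCoord (heisDir 0 1 g) f g := by
  rw [dQ, pd, lineDeriv]
  congr 1
  funext t
  rw [Function.comp_apply, ← mul_hJ, mul_one, mul_zero]

theorem isOp_Yp : IsOp ofCoord coordSet Yp := by
  refine (((isOp_heis 1 0).sum ((isOp_heis 0 1).coeff (smoothJ_const Complex.I))).coeff
    (smoothJ_const (1 / 2))).congr fun f => ?_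
  funext g
  simp only [Yp, dP_eq, dQ_eq, Pi.add_apply, smul_eq_mul]

theorem isOp_Ym : IsOp ofCoord coordSet Ym := by
  refine (((isOp_heis 1 0).sum ((isOp_heis 0 1).coeff (smoothJ_const (-Complex.I)))).coeff
    (smoothJ_const (1 / 2))).congr fun f => ?_
  funext g
  simp only [Ym, dP_eq, dQ_eq, Pi.add_apply, smul_eq_mul]
  ring

theorem isOp_Dp (m : ℕ) : IsOp ofCoord coordSet (Dp m) :=
  (isOp_Xp.sum ((isOp_Yp.comp isOp_Yp).coeff (smoothJ_const (1 / (4 * Real.pi * m))))).congr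
    fun _ => rfl

theorem isOp_Dm (m : ℕ) : IsOp ofCoord coordSet (Dm m) := by
  refine (isOp_Xm.sum
    ((isOp_Ym.comp isOp_Ym).coeff (smoothJ_const (-(1 / (4 * Real.pi * m)))))).congr fun f => ?_
  funext g
  simp only [Dm, Pi.add_apply, smul_eq_mul]
  ring

/-- The space `A^J_{k,m}(s, χ)` of Jacobi Maass forms. -/
def JacobiMaass (k : ℝ) (m : ℕ) (s : ℂ) (χ : tGamma →* ℂˣ) : Submodule ℂ (TGJ → ℂ) where
  carrier := {f | IsJacobiMaass k m s χ f}
  zero_mem' :=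
    { smooth := Smooth.zero
      weight := fun r θ g => by simp
      equivariant := fun l μ κ γ g => by simp
      eigen₁ := by simpa using ((isOp_Dm m).comp (isOp_Dp m)).smul 0 0 Smooth.zero
      eigen₂ := by simpa using ((isOp_Dp m).comp (isOp_Dm m)).smul 0 0 Smooth.zero
      holo := by simpa using isOp_Ym.smul 0 0 Smooth.zero
      growth := ⟨1, one_pos, fun L _ K _ =>
        ⟨0, Eventually.of_forall fun t h _ g _ => by simp⟩⟩ }
  add_mem' := by
    intro f f' hf hf'
    refine ⟨hf.smooth.add hf'.smooth, fun r θ g => ?_, fun l μ κ γ g => ?_, ?_, ?_, ?_, ?_⟩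
    · rw [Pi.add_apply, Pi.add_apply, hf.weight, hf'.weight, mul_add]
    · rw [Pi.add_apply, Pi.add_apply, hf.equivariant, hf'.equivariant, mul_add]
    · rw [((isOp_Dm m).comp (isOp_Dp m)).add _ _ hf.smooth hf'.smooth, hf.eigen₁, hf'.eigen₁,
        smul_add]
    · rw [((isOp_Dp m).comp (isOp_Dm m)).add _ _ hf.smooth hf'.smooth, hf.eigen₂, hf'.eigen₂,
        smul_add]
    · rw [isOp_Ym.add _ _ hf.smooth hf'.smooth, hf.holo, hf'.holo, add_zero]
    · obtain ⟨a, ha0, ha⟩ := hf.growth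
      obtain ⟨b, hb0, hb⟩ := hf'.growth
      refine ⟨max a b, lt_max_of_lt_left ha0, fun L hL K hK => ?_⟩
      obtain ⟨C, hC⟩ := ha L hL K hK
      obtain ⟨D, hD⟩ := hb L hL K hK
      refine ⟨|C| + |D|, ?_⟩
      filter_upwards [hC, hD, eventually_ge_atTop 1] with t h1 h2 ht h hh g hg
      have e1 : t ^ a ≤ t ^ max a b := Real.rpow_le_rpow_of_exponent_le ht (le_max_left _ _)
      have e2 : t ^ b ≤ t ^ max a b := Real.rpow_le_rpow_of_exponent_le ht (le_max_right _ _)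
      have p1 : 0 ≤ t ^ a := Real.rpow_nonneg (by linarith) _
      have p2 : 0 ≤ t ^ b := Real.rpow_nonneg (by linarith) _
      calc ‖(f + f') (SemidirectProduct.inl h * gJ (aT t) * g)‖ ≤ C * t ^ a + D * t ^ b :=
            (norm_add_le _ _).trans (add_le_add (h1 h hh g hg) (h2 h hh g hg))
        _ ≤ |C| * t ^ max a b + |D| * t ^ max a b :=
            add_le_add (mul_le_mul (le_abs_self _) e1 p1 (abs_nonneg _))
              (mul_le_mul (le_abs_self _) e2 p2 (abs_nonneg _))
        _ = _ := by ring
  smul_mem' := by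
    intro c f hf
    refine ⟨hf.smooth.smul c, fun r θ g => ?_, fun l μ κ γ g => ?_, ?_, ?_, ?_, ?_⟩
    · rw [Pi.smul_apply, Pi.smul_apply, hf.weight, smul_eq_mul, smul_eq_mul]
      ring
    · rw [Pi.smul_apply, Pi.smul_apply, hf.equivariant, smul_eq_mul, smul_eq_mul]
      ring
    · rw [((isOp_Dm m).comp (isOp_Dp m)).smul _ _ hf.smooth, hf.eigen₁, smul_comm]
    · rw [((isOp_Dp m).comp (isOp_Dm m)).smul _ _ hf.smooth, hf.eigen₂, smul_comm]
    · rw [isOp_Ym.smul _ _ hf.smooth, hf.holo, smul_zero]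
    · obtain ⟨a, ha0, ha⟩ := hf.growth
      refine ⟨a, ha0, fun L hL K hK => ?_⟩
      obtain ⟨C, hC⟩ := ha L hL K hK
      refine ⟨‖c‖ * C, ?_⟩
      filter_upwards [hC] with t h1 h hh g hg
      rw [Pi.smul_apply, smul_eq_mul, norm_mul, mul_assoc ‖c‖]
      exact mul_le_mul_of_nonneg_left (h1 h hh g hg) (norm_nonneg c)

/-- The space `A^{J,0}_{k,m}(s, χ)` of Jacobi Maass cusp forms. -/
def JacobiMaassCusp (k : ℝ) (m : ℕ) (s : ℂ) (χ : tGamma →* ℂˣ) : Submodule ℂ (TGJ → ℂ) where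
  carrier := {f | f ∈ JacobiMaass k m s χ ∧ QuickDecay f}
  zero_mem' := ⟨Submodule.zero_mem _, fun α _ L _ K _ =>
    ⟨0, Eventually.of_forall fun t h _ g _ => by simp⟩⟩
  add_mem' := by
    rintro f f' ⟨hf, ha⟩ ⟨hf', hb⟩
    refine ⟨Submodule.add_mem _ hf hf', fun α hα L hL K hK => ?_⟩
    obtain ⟨C, hC⟩ := ha α hα L hL K hK
    obtain ⟨D, hD⟩ := hb α hα L hL K hK
    refine ⟨C + D, ?_⟩
    filter_upwards [hC, hD] with t h1 h2 h hh g hg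
    rw [add_mul]
    exact (norm_add_le _ _).trans (add_le_add (h1 h hh g hg) (h2 h hh g hg))
  smul_mem' := by
    rintro c f ⟨hf, ha⟩
    refine ⟨Submodule.smul_mem _ c hf, fun α hα L hL K hK => ?_⟩
    obtain ⟨C, hC⟩ := ha α hα L hL K hK
    refine ⟨‖c‖ * C, ?_⟩
    filter_upwards [hC] with t h1 h hh g hg
    rw [Pi.smul_apply, smul_eq_mul, norm_mul, mul_assoc ‖c‖]
    exact mul_le_mul_of_nonneg_left (h1 h hh g hg) (norm_nonneg c)

/-! ### Theta functions -/

/-- The theta function on the Heisenberg group attached to a Schwartz function `φ`: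
`∑ e^{2πi m (r + q (2α + p))} φ(p + α)`, where `α` runs through `j/2m + ℤ`. -/
def thetaHeis (m : ℕ) (j : ℤ) (φ : ℝ → ℂ) (h : Heis) : ℂ :=
  ∑' n : ℤ, Complex.exp (2 * Real.pi * Complex.I * m *
      (h.r + h.y * (2 * ((j : ℝ) / (2 * m) + n) + h.x) : ℝ)) *
    φ (h.x + ((j : ℝ) / (2 * m) + n))

/-- `φ^J(p̃(τ) k̃(θ), ξ) = Im(τ)^{1/4} e^{iθ/2} e^{2πi m τ ξ²}`. -/
def phiJ (m : ℕ) (g : TG) (ξ : ℝ) : ℂ :=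
  (g.z.im ^ (1 / 4 : ℝ) : ℝ) * Complex.exp (Complex.I * g.θ / 2) *
    Complex.exp (2 * Real.pi * Complex.I * m * g.z * ξ ^ 2)

/-- The theta function `θ_{m,j}(h g) = θ^{Heis}_{m,j}(φ^J(g, ·); h)`. -/
def theta (m : ℕ) (j : ℤ) (g : TGJ) : ℂ := thetaHeis m j (phiJ m g.right) g.left

/-- The function `Ψ_k u : p̃(z) k̃(θ) ↦ e^{ikθ} u(z)`. -/
def Psi {n : ℕ} (k : ℝ) (u : ℍ → Fin n → ℂ) (g : TG) : Fin n → ℂ :=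
  Complex.exp (Complex.I * k * g.θ) • u g.z

/-- The theta decomposition `f(h g) = ∑_{j = 1}^{2m} θ_{m,j}(h g) h_j(g)`, with
`(h_j)_j = Ψ_{k - 1/2} u`. -/
def IsThetaDecomposition (m : ℕ) (k : ℝ) (f : TGJ → ℂ) (u : ℍ → Fin (2 * m) → ℂ) : Prop :=
  ∀ g : TGJ, f g = ∑ j : Fin (2 * m), theta m ((j : ℕ) + 1) g * Psi (k - 1 / 2) u g.right j

end JMF

end

open JMF

noncomputable section

namespace JMF

/-! ### The lattice in the universal covering group -/

/-! The correspondence and its inverse are both explicit: `synth` forms the sum of theta functions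
with given coefficients, and `extract` reads the coefficients off as Fourier integrals.

Existence of the decomposition. Invariance under h(0,1,0) makes q ↦ f e^{-2πimpq} periodic with
period 1. The condition `Ym f = 0` is the first order equation ∂_p f = τ ∂_q f + 2πim(pτ + q) f on
the section r = 0. It forces the n-th Fourier coefficient to be the Gaussian e^{2πimτ(p + n/2m)²}
times a quantity `ext m n f` that does not depend on p (`fourier_heis`). Invariance under h(1,0,0)
makes this quantity depend only on n modulo 2m (`ext_add`). Grouping the Fourier series by residue
classes gives 2m theta functions (`eq_sum_theta`). Conversely `ext` recovers the coefficients from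
any combination of theta functions (`ext_sum_theta`), so the two maps are mutually inverse and the
theta functions are linearly independent over each point of `TG`.

Differential equations. Theta functions are annihilated by Y_-, D_- and D_+; for D_+ this is the
heat equation. The operators Y_± do not see functions of the `TG` component, so D_± act on the
coefficient vector as the Maass raising and lowering operators (`Dp_synth`, `Dm_synth`). Their
compositions are the Laplacian up to sign and a constant, and the eigenvalue conditions match
(`synth_eigen₁_iff`, `synth_eigen₂`).

Equivariance. The lattice is generated by t and s (`tGamma_closure`), where the theta functions
transform by explicit unitary matrices; for s this is the functional equation of the Jacobi theta
function together with a splitting by residues modulo 2m (`theta_sEl`). Conjugate theta functions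
multiplied by the lift of η^{2(κ + 1/2)} have integral weight, hence transform under SL₂(ℤ) itself.
Together with linear independence this produces the representation ρ (`existsUnique_isRho`). The
same lifts of eta powers construct all the characters and identify them with the multiplier systems
(`exists_isChi`, `IsChi.secG`). The weight and the character of f are then those of the theta
functions times those of u (`synth_equivariant_iff`).

Growth. Coefficients are averages of f over a compact set, and theta functions are O(y^{1/4}) for
bounded p, so polynomial bounds pass in both directions (`PolyBoundJ.extract`, `PolyBound.synth`).
For cusp forms it remains to see that an eigenfunction that decreases faster than every power of y
decays exponentially (`QuasiPeriodic.exp_decay`). Its Fourier coefficients in x solve a second order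
equation in y: at nonzero frequency a bounded solution decays exponentially, and at frequency zero a
quickly decreasing solution vanishes. -/

/-- The image of an integral matrix in `SL₂(ℝ)`. -/
abbrev toR (γ : SL(2, ℤ)) : SL(2, ℝ) := Matrix.SpecialLinearGroup.map (Int.castRingHom ℝ) γ

theorem toR_mul (γ δ : SL(2, ℤ)) : toR (γ * δ) = toR γ * toR δ := map_mul _ _ _

theorem toR_injective : Function.Injective toR := by
  intro γ δ h
  ext i j
  have := congrArg (fun A : SL(2, ℝ) => A i j) h
  simpa using this

theorem jf_toR (γ : SL(2, ℤ)) (z : ℍ) : TG.jf (toR γ) z = jZ γ z := by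
  simp [TG.jf, jZ]

theorem toR_smul (γ : SL(2, ℤ)) (z : ℍ) : toR γ • z = γ • z := rfl

theorem jZ_ne_zero (γ : SL(2, ℤ)) (z : ℍ) : jZ γ z ≠ 0 := by
  rw [← jf_toR]
  exact TG.jf_ne_zero _ _

namespace TG

theorem mul_kT (g : TG) (θ : ℝ) : g * kT θ = ⟨g.z, g.θ + θ⟩ := by
  apply TG.ext
  · exact pr_smul_I g
  · rw [mul_θ]
    change g.θ + θ - (g.ratio UpperHalfPlane.I).arg = _
    simp [ratio_I]

theorem kT_mul_kT (a b : ℝ) : kT a * kT b = kT (a + b) := mul_kT _ _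

theorem kT_zero : kT 0 = 1 := rfl

theorem kT_zpow (a : ℝ) (n : ℤ) : kT a ^ n = kT (n * a) := by
  have hnat : ∀ n : ℕ, kT a ^ n = kT (n * a) := by
    intro n
    induction n with
    | zero => simp [kT_zero]
    | succ n ih =>
      rw [pow_succ, ih, kT_mul_kT]
      congr 1
      push_cast
      ring
  cases n with
  | ofNat n => simpa using hnat n
  | negSucc n =>
    rw [zpow_negSucc, hnat, inv_eq_iff_mul_eq_one, kT_mul_kT, ← kT_zero]
    congr 1
    push_cast
    ring

/-- The kernel of the covering map. -/
theorem eq_kT_of_pr_eq_one {g : TG} (h : g.pr = 1) : ∃ n : ℤ, g = kT (n * (2 * Real.pi)) := by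
  have hz : g.z = UpperHalfPlane.I := by rw [← pr_smul_I, h, one_smul]
  have hj := jf_pr_I g
  rw [h, hz] at hj
  -- An element over the identity fixes i with factor of automorphy 1, and that factor is e^{-iθ}.
  have h1 : Complex.exp (-(Complex.I * g.θ)) = 1 := by
    have : jf 1 UpperHalfPlane.I = 1 := by simp [jf]
    rw [this] at hj
    simpa using hj.symm
  obtain ⟨n, hn⟩ := Complex.exp_eq_one_iff.1 h1
  refine ⟨-n, TG.ext hz ?_⟩
  have h2 : Complex.I * (g.θ : ℂ) = Complex.I * (((-n : ℤ) : ℝ) * (2 * Real.pi) : ℝ) := by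
    push_cast
    linear_combination -hn
  exact_mod_cast mul_left_cancel₀ Complex.I_ne_zero h2

theorem pr_kT_two_pi (n : ℤ) : (kT (n * (2 * Real.pi))).pr = 1 := by
  apply ext_jf
  · rw [pr_smul_I, one_smul]
    rfl
  · rw [jf_pr_I]
    have : -(Complex.I * ((n * (2 * Real.pi) : ℝ) : ℂ)) = (-n : ℤ) * (2 * Real.pi * Complex.I) := by
      push_cast
      ring
    change ((√(UpperHalfPlane.I).im)⁻¹ : ℝ) *
      Complex.exp (-(Complex.I * ((n * (2 * Real.pi) : ℝ) : ℂ))) = _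
    rw [this, Complex.exp_int_mul_two_pi_mul_I]
    simp [jf]

theorem ratio_kT_two_pi (n : ℤ) (z : ℍ) : (kT (n * (2 * Real.pi))).ratio z = 1 := by
  rw [ratio_eq, pr_kT_two_pi]
  simp [jf]

theorem kT_two_pi_mul (n : ℤ) (g : TG) : kT (n * (2 * Real.pi)) * g =
    ⟨g.z, g.θ + n * (2 * Real.pi)⟩ := by
  apply TG.ext
  · rw [mul_z, pr_kT_two_pi, one_smul]
  · rw [mul_θ, ratio_kT_two_pi]
    change n * (2 * Real.pi) + g.θ - (1 : ℂ).arg = g.θ + n * (2 * Real.pi)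
    simp
    ring

end TG

/-- The lift of `γ` with angle `-arg (c i + d)`. -/
def sec (γ : SL(2, ℤ)) : TG := ⟨γ • UpperHalfPlane.I, -(jZ γ UpperHalfPlane.I).arg⟩

/-- A real matrix is determined by the image of i and by the factor c i + d. The height of γ i
supplies the modulus of this factor and the angle of `sec γ` its argument. -/
theorem pr_sec (γ : SL(2, ℤ)) : (sec γ).pr = toR γ := by
  apply TG.ext_jf
  · rw [TG.pr_smul_I]
    rfl
  · rw [TG.jf_pr_I, jf_toR]
    change ((√(γ • UpperHalfPlane.I).im)⁻¹ : ℝ) *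
      Complex.exp (-(Complex.I * ((-(jZ γ UpperHalfPlane.I).arg : ℝ) : ℂ))) = _
    rw [← toR_smul, TG.im_smul, jf_toR, Real.sqrt_div (by simp), Real.sqrt_sq (norm_nonneg _)]
    conv_rhs => rw [← Complex.norm_mul_exp_arg_mul_I (jZ γ UpperHalfPlane.I)]
    push_cast
    simp [mul_comm]

/-- The lift of `γ` as an element of the lattice. -/
def secG (γ : SL(2, ℤ)) : tGamma := ⟨sec γ, γ, (pr_sec γ).symm⟩

theorem coe_secG (γ : SL(2, ℤ)) : (secG γ : TG) = sec γ := rfl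

/-- As z varies, c z + d keeps its imaginary part of one sign, so its principal argument never jumps
and agrees with the continuous angle used in the group law. -/
theorem arg_jZ (γ : SL(2, ℤ)) (z : ℍ) :
    (jZ γ z).arg = (jZ γ UpperHalfPlane.I).arg + ((sec γ).ratio z).arg := by
  have h1 : jZ γ z = jZ γ UpperHalfPlane.I * (sec γ).ratio z := by
    rw [TG.ratio_eq, pr_sec, jf_toR, jf_toR, mul_div_cancel₀ _ (jZ_ne_zero _ _)]
  have h0 := jZ_ne_zero γ UpperHalfPlane.I
  have hr := TG.ratio_ne_zero (sec γ) z
  have hI : (jZ γ UpperHalfPlane.I).im = γ 1 0 := by simp [jZ]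
  have hz : (jZ γ z).im = γ 1 0 * z.im := by simp [jZ]
  by_cases hc : γ 1 0 = 0
  -- For c = 0 the factor is the constant d, possibly negative with argument π.
  · have e1 : jZ γ z = jZ γ UpperHalfPlane.I := by simp [jZ, hc]
    have e2 : (sec γ).ratio z = 1 := by
      rw [e1] at h1
      exact mul_left_cancel₀ h0 (by rw [← h1, mul_one])
    rw [e1, e2, Complex.arg_one, add_zero]
  · have hang : (((jZ γ z).arg : ℝ) : Real.Angle) =
        (((jZ γ UpperHalfPlane.I).arg + ((sec γ).ratio z).arg : ℝ) : Real.Angle) := by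
      rw [Real.Angle.coe_add, ← Complex.arg_mul_coe_angle h0 hr, ← h1]
    obtain ⟨n, hn⟩ := Real.Angle.angle_eq_iff_two_pi_dvd_sub.1 hang
    have hpi := Real.pi_pos
    have b1 := Complex.neg_pi_lt_arg ((sec γ).ratio z)
    have b2 : ((sec γ).ratio z).arg < Real.pi :=
      lt_of_le_of_ne (Complex.arg_le_pi _) (Complex.mem_slitPlane_iff_arg.1
        (TG.ratio_mem_slitPlane (sec γ) z)).1
    -- Both arguments lie strictly inside the same half circle. As the argument of the ratio is also
    -- less than π in modulus, the two sides differ by less than 2π, so the integer n is zero.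
    have key : |(jZ γ z).arg - (jZ γ UpperHalfPlane.I).arg| < Real.pi := by
      have u1 := Complex.arg_le_pi (jZ γ z)
      have u2 := Complex.neg_pi_lt_arg (jZ γ z)
      have v1 := Complex.arg_le_pi (jZ γ UpperHalfPlane.I)
      have v2 := Complex.neg_pi_lt_arg (jZ γ UpperHalfPlane.I)
      have ne : ∀ w : ℂ, w.im ≠ 0 → w.arg ≠ Real.pi := fun w hw h =>
        hw (Complex.arg_eq_pi_iff.1 h).2
      have ne0 : ∀ w : ℂ, w.im ≠ 0 → w.arg ≠ 0 := fun w hw h =>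
        hw (Complex.arg_eq_zero_iff.1 h).2
      have hcR : (γ 1 0 : ℝ) ≠ 0 := by exact_mod_cast hc
      have i1 : (jZ γ z).im ≠ 0 := by
        rw [hz]
        exact mul_ne_zero hcR z.im_ne_zero
      have i2 : (jZ γ UpperHalfPlane.I).im ≠ 0 := by rwa [hI]
      rcases lt_or_gt_of_ne hcR with h | h
      · have a1 : (jZ γ z).arg < 0 := Complex.arg_neg_iff.2 (by
          rw [hz]; exact mul_neg_of_neg_of_pos h z.im_pos)
        have a2 : (jZ γ UpperHalfPlane.I).arg < 0 := Complex.arg_neg_iff.2 (by rwa [hI])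
        rw [abs_lt]
        constructor <;> linarith
      · have a1 : 0 ≤ (jZ γ z).arg := Complex.arg_nonneg_iff.2 (by
          rw [hz]; exact (mul_pos h z.im_pos).le)
        have a2 : 0 ≤ (jZ γ UpperHalfPlane.I).arg := Complex.arg_nonneg_iff.2 (by
          rw [hI]; exact h.le)
        have a3 := lt_of_le_of_ne u1 (ne _ i1)
        have a4 := lt_of_le_of_ne v1 (ne _ i2)
        rw [abs_lt]
        constructor <;> linarith
    rw [abs_lt] at key
    have n0 : n = 0 := by
      have l1 : (n : ℝ) < 1 := by nlinarith
      have l2 : (-1 : ℝ) < n := by nlinarith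
      have l1' : n < 1 := by exact_mod_cast l1
      have l2' : -1 < n := by exact_mod_cast l2
      omega
    rw [n0] at hn
    simp at hn
    linarith

theorem sec_mul_z (γ : SL(2, ℤ)) (g : TG) : (sec γ * g).z = γ • g.z := by
  rw [TG.mul_z, pr_sec, toR_smul]

/-- The angle drops by exactly the argument in the slash operator. For this reason the section with
principal arguments translates between functions on ℍ and functions on the covering group. -/
theorem sec_mul_θ (γ : SL(2, ℤ)) (g : TG) : (sec γ * g).θ = g.θ - (jZ γ g.z).arg := by
  rw [TG.mul_θ, arg_jZ]
  change -(jZ γ UpperHalfPlane.I).arg + g.θ - _ = _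
  ring

theorem sec_T : sec ModularGroup.T = tEl := by
  apply TG.ext
  · apply UpperHalfPlane.ext
    change ((ModularGroup.T • UpperHalfPlane.I : ℍ) : ℂ) = Complex.I + 1
    rw [UpperHalfPlane.modular_T_smul]
    simp [add_comm]
  · change -(jZ ModularGroup.T UpperHalfPlane.I).arg = 0
    simp [jZ, ModularGroup.T]

theorem sec_S : sec ModularGroup.S = sEl := by
  apply TG.ext
  · apply UpperHalfPlane.ext
    change ((ModularGroup.S • UpperHalfPlane.I : ℍ) : ℂ) = Complex.I
    rw [UpperHalfPlane.modular_S_smul]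
    simp
  · change -(jZ ModularGroup.S UpperHalfPlane.I).arg = -(Real.pi / 2)
    simp [jZ, ModularGroup.S]

theorem exists_toR_eq (γ : tGamma) : ∃ δ : SL(2, ℤ), (γ : TG).pr = toR δ := by
  obtain ⟨δ, hδ⟩ := γ.2
  exact ⟨δ, hδ.symm⟩

/-- The lattice is generated by `t` and `s`. -/
theorem tGamma_closure : Subgroup.closure {tEl, sEl} = (⊤ : Subgroup tGamma) := by
  set H := Subgroup.closure {tEl, sEl} with hH
  have ht : tEl ∈ H := Subgroup.subset_closure (by simp)
  have hs : sEl ∈ H := Subgroup.subset_closure (by simp)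
  -- The matrices covered by the generated subgroup contain S and T, hence are all of SL₂(ℤ). What
  -- remains is the kernel of the covering map.
  let K : Subgroup SL(2, ℤ) :=
    { carrier := {δ | ∃ γ ∈ H, (γ : TG).pr = toR δ}
      one_mem' := ⟨1, H.one_mem, by
        change (1 : TG).pr = _
        rw [TG.pr_one, toR, map_one]⟩
      mul_mem' := by
        rintro δ δ' ⟨γ, hγ, e⟩ ⟨γ', hγ', e'⟩
        refine ⟨γ * γ', H.mul_mem hγ hγ', ?_⟩
        rw [toR_mul, ← e, ← e']
        exact TG.pr_mul _ _
      inv_mem' := by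
        rintro δ ⟨γ, hγ, e⟩
        refine ⟨γ⁻¹, H.inv_mem hγ, ?_⟩
        change TG.prHom (γ : TG)⁻¹ = _
        rw [map_inv, toR, map_inv]
        exact congrArg _ e }
  have hK : K = ⊤ := by
    rw [eq_top_iff, ← _root_.SpecialLinearGroup.SL2Z_generators, Subgroup.closure_le]
    rintro δ (rfl | rfl)
    · exact ⟨sEl, hs, by rw [← sec_S, pr_sec]⟩
    · exact ⟨tEl, ht, by rw [← sec_T, pr_sec]⟩
  rw [eq_top_iff]
  intro γ _
  obtain ⟨δ, hδ⟩ := exists_toR_eq γ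
  obtain ⟨γ', hγ', e⟩ : δ ∈ K := hK ▸ Subgroup.mem_top δ
  have h1 : ((γ'⁻¹ * γ : tGamma) : TG).pr = 1 := by
    change TG.prHom ((γ' : TG)⁻¹ * γ) = 1
    rw [map_mul, map_inv, inv_mul_eq_one]
    exact e.trans hδ.symm
  obtain ⟨n, hn⟩ := TG.eq_kT_of_pr_eq_one h1
  -- The kernel is generated by k̃(2π), which is the power of exponent -4 of s = k̃(-π/2).
  have h2 : γ'⁻¹ * γ = sEl ^ (-4 * n) := by
    apply Subtype.ext
    rw [hn, Subgroup.coe_zpow]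
    change _ = kT (-(Real.pi / 2)) ^ (-4 * n)
    rw [TG.kT_zpow]
    congr 1
    push_cast
    ring
  rw [show γ = γ' * sEl ^ (-4 * n) by rw [← h2]; group]
  exact H.mul_mem hγ' (H.zpow_mem hs _)

theorem tGamma_induction (P : Subgroup tGamma) (ht : tEl ∈ P) (hs : sEl ∈ P) (γ : tGamma) :
    γ ∈ P := by
  have : Subgroup.closure {tEl, sEl} ≤ P := (Subgroup.closure_le P).2 (by
    rintro x (rfl | rfl)
    exacts [ht, hs])
  exact this (tGamma_closure ▸ Subgroup.mem_top γ)

theorem tGamma_hom_ext {χ χ' : tGamma →* ℂˣ} (ht : χ tEl = χ' tEl) (hs : χ sEl = χ' sEl) :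
    χ = χ' := by
  ext γ
  exact congrArg _ (tGamma_induction (χ.eqLocus χ') ht hs γ)

theorem tEl_mul (g : TG) : ((tEl : TG) * g).z = ModularGroup.T • g.z ∧ ((tEl : TG) * g).θ =
    g.θ := by
  rw [← sec_T, sec_mul_z, sec_mul_θ]
  refine ⟨rfl, ?_⟩
  simp [jZ, ModularGroup.T]

theorem sEl_mul (g : TG) :
    ((sEl : TG) * g).z = ModularGroup.S • g.z ∧ ((sEl : TG) * g).θ = g.θ - (g.z : ℂ).arg := by
  rw [← sec_S, sec_mul_z, sec_mul_θ]
  refine ⟨rfl, ?_⟩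
  simp [jZ, ModularGroup.S]

/-! ### The logarithm of the eta function and the character `χ_k` -/

/-- The nome `e^{2πi z}`. -/
def nome (z : ℂ) : ℂ := Complex.exp (2 * Real.pi * Complex.I * z)

theorem norm_nome (z : ℂ) : ‖nome z‖ = Real.exp (-(2 * Real.pi * z.im)) := by
  rw [nome, Complex.norm_exp]
  congr 1
  simp

theorem norm_nome_lt_one {z : ℂ} (hz : 0 < z.im) : ‖nome z‖ < 1 := by
  rw [norm_nome, Real.exp_lt_one_iff]
  have := Real.pi_pos
  nlinarith [mul_pos this hz]

/-- The sum of the logarithms `log (1 - q^{n+1})`. -/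
def logProd (q : ℂ) : ℂ := ∑' n : ℕ, Complex.log (1 - q ^ (n + 1))

/-- A summable majorant, uniform for ‖q‖ ≤ r. It gives both convergence of `logProd` and its
continuity. -/
theorem norm_log_one_sub_pow_le {q : ℂ} {r : ℝ} (hr : r < 1) (hq : ‖q‖ ≤ r) (n : ℕ) :
    ‖Complex.log (1 - q ^ (n + 1))‖ ≤ (1 + (1 - r)⁻¹) * r ^ n := by
  have hr0 : 0 ≤ r := (norm_nonneg q).trans hq
  have h1 : ‖-q ^ (n + 1)‖ ≤ r ^ n := by
    rw [norm_neg, norm_pow]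
    exact (pow_le_pow_left₀ (norm_nonneg _) hq _).trans
      (pow_le_pow_of_le_one hr0 hr.le (Nat.le_succ n))
  have h2 : ‖-q ^ (n + 1)‖ ≤ r := by
    rw [norm_neg, norm_pow]
    exact (pow_le_pow_left₀ (norm_nonneg _) hq _).trans
      (pow_le_of_le_one hr0 hr.le (Nat.succ_ne_zero n))
  have h3 := Complex.norm_log_one_add_le (h2.trans_lt hr)
  rw [← sub_eq_add_neg] at h3
  refine h3.trans ?_
  set x := ‖-q ^ (n + 1)‖ with hx
  have x0 : 0 ≤ x := norm_nonneg _
  have hinv : (1 - x)⁻¹ ≤ (1 - r)⁻¹ := inv_anti₀ (by linarith) (by linarith)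
  have hi0 : 0 ≤ (1 - x)⁻¹ := inv_nonneg.2 (by linarith)
  have e1 : x ^ 2 ≤ r ^ n := by nlinarith
  calc x ^ 2 * (1 - x)⁻¹ / 2 + x ≤ x ^ 2 * (1 - x)⁻¹ + x := by
        have : 0 ≤ x ^ 2 * (1 - x)⁻¹ := by positivity
        linarith
    _ ≤ r ^ n * (1 - r)⁻¹ + r ^ n := add_le_add (mul_le_mul e1 hinv hi0 (by positivity)) h1
    _ = _ := by ring

theorem summable_log_one_sub_pow {q : ℂ} (hq : ‖q‖ < 1) :
    Summable fun n : ℕ => Complex.log (1 - q ^ (n + 1)) :=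
  Summable.of_norm_bounded ((summable_geometric_of_lt_one (norm_nonneg q) hq).mul_left _)
    (norm_log_one_sub_pow_le hq le_rfl)

theorem one_sub_pow_mem_slitPlane {q : ℂ} (hq : ‖q‖ < 1) (n : ℕ) :
    1 - q ^ (n + 1) ∈ Complex.slitPlane := by
  refine Complex.mem_slitPlane_of_norm_lt_one (z := -q ^ (n + 1)) ?_
  rw [norm_neg, norm_pow]
  exact pow_lt_one₀ (norm_nonneg _) hq (Nat.succ_ne_zero n)

theorem continuousOn_logProd : ContinuousOn logProd (Metric.ball 0 1) := by
  intro q hq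
  rw [mem_ball_zero_iff] at hq
  obtain ⟨r, hqr, hr⟩ := exists_between hq
  have h : ContinuousOn logProd (Metric.ball 0 r) := by
    refine continuousOn_tsum (u := fun n => (1 + (1 - r)⁻¹) * r ^ n) (fun n => ?_)
      ((summable_geometric_of_lt_one ((norm_nonneg q).trans hqr.le) hr).mul_left _)
      fun n q hq => norm_log_one_sub_pow_le hr (mem_ball_zero_iff.1 hq).le n
    refine ContinuousOn.clog (by fun_prop) fun q hq => one_sub_pow_mem_slitPlane ?_ n
    exact (mem_ball_zero_iff.1 hq).trans hr
  exact (h.continuousAt (Metric.isOpen_ball.mem_nhds (mem_ball_zero_iff.2 hqr))).continuousWithinAt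

/-- Each factor lies in the slit plane, so its principal power is the exponential of c times its
logarithm. The case c = 1 gives eta, the case c = 2k its powers. -/
theorem exp_mul_logProd (c : ℂ) {q : ℂ} (hq : ‖q‖ < 1) :
    Complex.exp (c * logProd q) = ∏' n : ℕ, (1 - q ^ (n + 1)) ^ c := by
  have hs := (summable_log_one_sub_pow hq).mul_left c
  rw [logProd, ← tsum_mul_left]
  have h := hs.hasSum.cexp
  refine h.tprod_eq.symm.trans (tprod_congr fun n => ?_)
  rw [Function.comp_apply, Complex.cpow_def_of_ne_zero
    (Complex.slitPlane_ne_zero (one_sub_pow_mem_slitPlane hq n)), mul_comm]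

/-- A logarithm of the eta function. -/
def logEta (z : ℂ) : ℂ := Real.pi * Complex.I * z / 12 + logProd (nome z)

theorem continuousOn_logEta : ContinuousOn logEta upperSet := by
  have hn : ContinuousOn nome upperSet := by unfold nome; fun_prop
  exact ContinuousOn.add (by fun_prop)
    (continuousOn_logProd.comp hn fun z hz => mem_ball_zero_iff.2 (norm_nome_lt_one hz))

theorem nome_pow (z : ℂ) (n : ℕ) :
    nome z ^ (n + 1) = Complex.exp (2 * Real.pi * Complex.I * (n + 1) * z) := by
  rw [nome, ← Complex.exp_nat_mul]
  congr 1
  push_cast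
  ring

theorem exp_logEta {z : ℂ} (hz : 0 < z.im) : Complex.exp (logEta z) = ModularForm.eta z := by
  have h := exp_mul_logProd 1 (norm_nome_lt_one hz)
  rw [one_mul] at h
  rw [logEta, Complex.exp_add, h, ModularForm.eta]
  congr 1
  · rw [Function.Periodic.qParam]
    congr 1
    push_cast
    ring
  · refine tprod_congr fun n => ?_
    rw [Complex.cpow_one, ModularForm.eta_q_eq_pow, nome]

/-- All real powers of eta come from one logarithm, so their transformation laws, for all k at once,
follow from those of `logEta`. -/
theorem etaPow_eq (k : ℝ) (z : ℍ) : etaPow k z = Complex.exp (2 * k * logEta z) := by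
  rw [etaPow, logEta, mul_add, Complex.exp_add, exp_mul_logProd _ (norm_nome_lt_one z.im_pos)]
  congr 1
  · congr 1
    ring
  · refine tprod_congr fun n => ?_
    rw [nome_pow]
    push_cast
    rfl

theorem etaPow_ne_zero (k : ℝ) (z : ℍ) : etaPow k z ≠ 0 := by
  rw [etaPow_eq]
  exact Complex.exp_ne_zero _

theorem logEta_add_one (z : ℂ) : logEta (z + 1) = logEta z + Real.pi * Complex.I / 12 := by
  have : nome (z + 1) = nome z := by
    rw [nome, mul_add, mul_one, Complex.exp_add, Complex.exp_two_pi_mul_I, mul_one, nome]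
  rw [logEta, logEta, this]
  ring

theorem neg_one_div_im {z : ℂ} (hz : 0 < z.im) : 0 < (-1 / z).im := by
  have h0 : z ≠ 0 := by
    rintro rfl
    simp at hz
  rw [neg_div, Complex.neg_im, one_div, Complex.inv_im, neg_div, neg_neg]
  exact div_pos hz (Complex.normSq_pos.2 h0)

/-- The transformation law of the logarithm of the eta function. -/
theorem logEta_neg_inv {z : ℂ} (hz : 0 < z.im) :
    logEta (-1 / z) = logEta z + Complex.log z / 2 - Real.pi * Complex.I / 4 := by
  -- The defect D is continuous, takes values in 2πiℤ by the functional equation of eta itself, and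
  -- vanishes at i.
  let D : ℂ → ℂ := fun z =>
    logEta (-1 / z) - (logEta z + Complex.log z / 2 - Real.pi * Complex.I / 4)
  have hslit : ∀ z ∈ upperSet, z ∈ Complex.slitPlane := fun z hz =>
    Complex.mem_slitPlane_iff.2 (Or.inr (ne_of_gt hz))
  have hcont : ContinuousOn D upperSet := by
    refine ContinuousOn.sub ?_ ?_
    · refine continuousOn_logEta.comp ?_ fun z hz => neg_one_div_im hz
      exact continuousOn_const.div continuousOn_id fun z hz =>
        Complex.slitPlane_ne_zero (hslit z hz)
    · exact (continuousOn_logEta.add ((ContinuousOn.clog continuousOn_id hslit).div_const _)).sub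
        continuousOn_const
  have hlogI : Complex.log Complex.I = Real.pi / 2 * Complex.I := by
    rw [Complex.log_I]
  have hexp : ∀ z ∈ upperSet, ∃ n : ℤ, D z = n * (2 * Real.pi * Complex.I) := by
    intro z hz
    rw [← Complex.exp_eq_one_iff]
    have h := ModularForm.eta_comp_eq_csqrt_I_inv hz
    have hz0 := Complex.slitPlane_ne_zero (hslit z hz)
    simp only [Function.comp_apply, Pi.smul_apply, Pi.mul_apply, smul_eq_mul] at h
    rw [← exp_logEta hz, ← exp_logEta (neg_one_div_im hz), _root_.sqrt_eq_exp hz0,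
      _root_.sqrt_eq_exp Complex.I_ne_zero, hlogI] at h
    simp only [D]
    rw [Complex.exp_sub, h, ← Complex.exp_neg, ← Complex.exp_add, ← Complex.exp_add,
      ← Complex.exp_sub, Complex.exp_eq_one_iff]
    exact ⟨0, by push_cast; ring⟩
  have hI : D Complex.I = 0 := by
    simp only [D]
    rw [hlogI, show (-1 / Complex.I : ℂ) = Complex.I by
      rw [div_eq_iff Complex.I_ne_zero, Complex.I_mul_I]]
    ring
  have hpre : IsPreconnected upperSet := (convex_halfSpace_im_gt 0).isPreconnected
  have him : (0 : ℝ) = (D z).im := by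
    by_contra hne
    obtain ⟨n, hn⟩ := hexp z hz
    have hpi := Real.pi_pos
    have hnim : (D z).im = n * (2 * Real.pi) := by rw [hn]; simp
    have hcim : ContinuousOn (fun z => (D z).im) upperSet :=
      Complex.continuous_im.comp_continuousOn hcont
    have hconn : IsPreconnected ((fun z => (D z).im) '' upperSet) := hpre.image _ hcim
    have hIm : (0 : ℝ) ∈ (fun z => (D z).im) '' upperSet :=
      ⟨Complex.I, by simp [upperSet], by simp [hI]⟩
    have hzm : (D z).im ∈ (fun z => (D z).im) '' upperSet := ⟨z, hz, rfl⟩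
    have hn0 : n ≠ 0 := by
      rintro rfl
      rw [hnim] at hne
      simp at hne
    have hno : ∀ c : ℝ, c ∈ (fun z => (D z).im) '' upperSet → ∃ n : ℤ, c = n * (2 * Real.pi) := by
      rintro c ⟨w, hw, rfl⟩
      obtain ⟨n, hn⟩ := hexp w hw
      exact ⟨n, by simp [hn]⟩
    -- If D were nonzero at z, connectedness would make π or -π a value of its imaginary part, and
    -- neither is a multiple of 2π.
    have hodd : ∀ e : ℤ, (e = 1 ∨ e = -1) → ¬ ∃ n : ℤ, (e : ℝ) * Real.pi = n * (2 * Real.pi) := by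
      rintro e he ⟨k, hk⟩
      have : (e : ℝ) = k * 2 := mul_right_cancel₀ hpi.ne' (by linarith)
      have : e = k * 2 := by exact_mod_cast this
      omega
    rcases lt_or_gt_of_ne hn0 with h | h
    · have h' : (n : ℝ) ≤ -1 := by exact_mod_cast (by omega : n ≤ -1)
      refine hodd (-1) (Or.inr rfl) (hno _ (hconn.Icc_subset hzm hIm ⟨?_, ?_⟩))
      · rw [hnim]; push_cast; nlinarith
      · push_cast; linarith
    · have h' : (1 : ℝ) ≤ n := by exact_mod_cast (by omega : 1 ≤ n)
      refine hodd 1 (Or.inl rfl) (hno _ (hconn.Icc_subset hIm hzm ⟨?_, ?_⟩))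
      · push_cast; linarith
      · rw [hnim]; push_cast; nlinarith
  obtain ⟨n, hn⟩ := hexp z hz
  have : D z = 0 := by
    have h : (D z).im = n * (2 * Real.pi) := by rw [hn]; simp
    rw [h] at him
    have : (n : ℝ) = 0 := by
      have := Real.pi_pos
      rcases mul_eq_zero.1 him.symm with h | h
      · exact h
      · linarith
    rw [hn]
    have : n = 0 := by exact_mod_cast this
    simp [this]
  exact sub_eq_zero.1 this

/-- The function `p̃(z) k̃(θ) ↦ y^{k/2} e^{ikθ} η^{2k}(z)`. -/
def etaLift (k : ℝ) (g : TG) : ℂ :=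
  (g.z.im ^ (k / 2) : ℝ) * Complex.exp (Complex.I * k * g.θ) * etaPow k g.z

theorem etaLift_ne_zero (k : ℝ) (g : TG) : etaLift k g ≠ 0 := by
  refine mul_ne_zero (mul_ne_zero ?_ (Complex.exp_ne_zero _)) (etaPow_ne_zero _ _)
  exact_mod_cast (Real.rpow_pos_of_pos g.z.im_pos _).ne'

theorem etaLift_tEl (k : ℝ) (g : TG) :
    etaLift k (tEl * g) = Complex.exp (Real.pi * Complex.I * k / 6) * etaLift k g := by
  obtain ⟨h1, h2⟩ := tEl_mul g
  rw [etaLift, etaLift, h1, h2, etaPow_eq, etaPow_eq]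
  have e1 : ((ModularGroup.T • g.z : ℍ) : ℂ) = g.z + 1 := by
    rw [UpperHalfPlane.modular_T_smul]
    simp [add_comm]
  have e2 : (ModularGroup.T • g.z : ℍ).im = g.z.im := by
    rw [UpperHalfPlane.modular_T_smul]
    simp
  rw [e1, e2, logEta_add_one, mul_add, Complex.exp_add,
    show 2 * (k : ℂ) * (Real.pi * Complex.I / 12) = Real.pi * Complex.I * k / 6 by ring]
  ring

theorem coe_S_smul (z : ℍ) : ((ModularGroup.S • z : ℍ) : ℂ) = -1 / z := by
  rw [UpperHalfPlane.modular_S_smul]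
  simp [neg_div]

theorem im_S_smul (z : ℍ) : (ModularGroup.S • z : ℍ).im = z.im / ‖(z : ℂ)‖ ^ 2 := by
  rw [← toR_smul, TG.im_smul, jf_toR]
  simp [jZ, ModularGroup.S]

/-- The height contributes |z|^{-k} and the angle e^{-ik arg z}. Together they cancel the factor z^k
of η^{2k}(-1/z), and e^{-πik/2} is left. -/
theorem etaLift_sEl (k : ℝ) (g : TG) :
    etaLift k (sEl * g) = Complex.exp (-(Real.pi * Complex.I * k / 2)) * etaLift k g := by
  obtain ⟨h1, h2⟩ := sEl_mul g
  have hz : (g.z : ℂ) ≠ 0 := g.z.ne_zero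
  have hn : 0 < ‖(g.z : ℂ)‖ := norm_pos_iff.2 hz
  rw [etaLift, etaLift, h1, h2, etaPow_eq, etaPow_eq, coe_S_smul, logEta_neg_inv g.z.im_pos,
    im_S_smul, Real.div_rpow g.z.im_pos.le (by positivity), ← Real.rpow_natCast,
    ← Real.rpow_mul hn.le, show ((2 : ℕ) : ℝ) * (k / 2) = k by push_cast; ring]
  have e1 : ((‖(g.z : ℂ)‖ ^ k : ℝ) : ℂ) = Complex.exp (k * Real.log ‖(g.z : ℂ)‖) := by
    rw [Real.rpow_def_of_pos hn]
    push_cast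
    rw [mul_comm]
  rw [Complex.ofReal_div, e1, div_eq_mul_inv, ← Complex.exp_neg]
  have e2 : Complex.log (g.z : ℂ) = Real.log ‖(g.z : ℂ)‖ + (g.z : ℂ).arg * Complex.I := rfl
  rw [e2]
  have e3 : Complex.exp (-(k * Real.log ‖(g.z : ℂ)‖)) *
      Complex.exp (Complex.I * k * ((g.θ - (g.z : ℂ).arg : ℝ) : ℂ)) *
      Complex.exp (2 * k * (logEta g.z + (Real.log ‖(g.z : ℂ)‖ + (g.z : ℂ).arg * Complex.I) / 2
        - Real.pi * Complex.I / 4)) =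
      Complex.exp (-(Real.pi * Complex.I * k / 2)) * Complex.exp (Complex.I * k * g.θ) *
        Complex.exp (2 * k * logEta g.z) := by
    simp only [← Complex.exp_add]
    congr 1
    push_cast
    ring
  linear_combination ((g.z.im ^ (k / 2) : ℝ) : ℂ) * e3

/-- A function on the covering group that is multiplied by constants under `t` and `s` is
multiplied by a character under the lattice. -/
theorem exists_character {F : TG → ℂ} (hF : ∀ g, F g ≠ 0) {ct cs : ℂ}
    (ht : ∀ g, F (tEl * g) = ct * F g) (hs : ∀ g, F (sEl * g) = cs * F g) :
    ∃ χ : tGamma →* ℂˣ, (∀ γ g, F ((γ : tGamma) * g) = (χ γ : ℂ) * F g) ∧ (χ tEl : ℂ) = ct ∧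
      (χ sEl : ℂ) = cs := by
  -- Being multiplied by a constant is stable under products and inverses, so the generators
  -- suffice. The constant is found by evaluation at the identity.
  have key : ∀ γ : tGamma, ∀ g, F (γ * g) = F γ / F 1 * F g := by
    let P : Subgroup tGamma :=
      { carrier := {γ | ∃ c : ℂ, ∀ g, F ((γ : TG) * g) = c * F g}
        one_mem' := ⟨1, fun g => by simp⟩
        mul_mem' := by
          rintro γ γ' ⟨c, hc⟩ ⟨c', hc'⟩
          refine ⟨c * c', fun g => ?_⟩
          rw [Subgroup.coe_mul, mul_assoc, hc, hc', mul_assoc]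
        inv_mem' := by
          rintro γ ⟨c, hc⟩
          have hc0 : c ≠ 0 := by
            rintro rfl
            exact hF _ ((hc 1).trans (zero_mul _))
          refine ⟨c⁻¹, fun g => ?_⟩
          have := hc ((γ⁻¹ : tGamma) * g)
          rw [← mul_assoc, ← Subgroup.coe_mul, mul_inv_cancel, Subgroup.coe_one, one_mul] at this
          rw [this, inv_mul_cancel_left₀ hc0] }
    intro γ g
    obtain ⟨c, hc⟩ := tGamma_induction P ⟨ct, ht⟩ ⟨cs, hs⟩ γ
    have h1 := hc 1
    rw [mul_one] at h1
    rw [hc, h1, mul_div_cancel_right₀ _ (hF 1)]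
  refine ⟨MonoidHom.mk' (fun γ => Units.mk0 (F γ / F 1) (div_ne_zero (hF _) (hF _)))
    fun γ γ' => ?_, fun γ g => key γ g, ?_, ?_⟩
  · apply Units.ext
    simp only [Units.val_mk0, Units.val_mul, Subgroup.coe_mul, key]
    ring
  · have := ht 1
    rw [mul_one] at this
    simp only [MonoidHom.mk'_apply, Units.val_mk0]
    rw [this, mul_div_cancel_right₀ _ (hF 1)]
  · have := hs 1
    rw [mul_one] at this
    simp only [MonoidHom.mk'_apply, Units.val_mk0]
    rw [this, mul_div_cancel_right₀ _ (hF 1)]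

theorem exists_isChi (k : ℝ) :
    ∃ χ : tGamma →* ℂˣ, IsChi k χ ∧ ∀ γ g, etaLift k ((γ : tGamma) * g) = (χ γ : ℂ) * etaLift k
        g := by
  obtain ⟨χ, h1, h2, h3⟩ := exists_character (etaLift_ne_zero k) (etaLift_tEl k) (etaLift_sEl k)
  exact ⟨χ, ⟨h2, h3⟩, h1⟩

theorem IsChi.unique {k : ℝ} {χ χ' : tGamma →* ℂˣ} (h : IsChi k χ) (h' : IsChi k χ') : χ = χ' :=
  tGamma_hom_ext (Units.ext (h.1.trans h'.1.symm)) (Units.ext (h.2.trans h'.2.symm))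

theorem existsUnique_isChi (k : ℝ) : ∃! χ : tGamma →* ℂˣ, IsChi k χ := by
  obtain ⟨χ, h, -⟩ := exists_isChi k
  exact ⟨χ, h, fun χ' h' => h'.unique h⟩

/-- The character φ_a is the member of the family χ_k at the integer representing a, so the eta
construction covers it too. -/
theorem isPhi_iff (a : ZMod 12) (φ : tGamma →* ℂˣ) : IsPhi a φ ↔ IsChi (a.val : ℝ) φ := by
  simp only [IsPhi, IsChi, Complex.ofReal_natCast]

theorem IsChi.etaLift_mul {k : ℝ} {χ : tGamma →* ℂˣ} (h : IsChi k χ) (γ : tGamma) (g : TG) :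
    etaLift k (γ * g) = (χ γ : ℂ) * etaLift k g := by
  obtain ⟨χ', h1, h2⟩ := exists_isChi k
  rw [h.unique h1, h2]

/-- Evaluation of the transformation law of `etaLift` at the identity: the lift at `sec γ` is
η^{2k}(γ i) / (c i + d)^k with the principal power. -/
theorem IsChi.secG {k : ℝ} {χ : tGamma →* ℂˣ} (h : IsChi k χ) (γ : SL(2, ℤ)) :
    (χ (secG γ) : ℂ) = vMult k γ := by
  have h1 := h.etaLift_mul (JMF.secG γ) 1
  rw [mul_one] at h1
  have hj : 0 < ‖jZ γ UpperHalfPlane.I‖ := norm_pos_iff.2 (jZ_ne_zero _ _)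
  have e0 : etaLift k 1 = etaPow k UpperHalfPlane.I := by
    change (((UpperHalfPlane.I : ℍ).im ^ (k / 2) : ℝ) : ℂ) *
      Complex.exp (Complex.I * k * (0 : ℝ)) * etaPow k UpperHalfPlane.I = _
    simp
  have e1 : etaLift k (sec γ) = (jZ γ UpperHalfPlane.I ^ (k : ℂ))⁻¹ *
      etaPow k (γ • UpperHalfPlane.I) := by
    change (((γ • UpperHalfPlane.I : ℍ).im ^ (k / 2) : ℝ) : ℂ) *
      Complex.exp (Complex.I * k * ((-(jZ γ UpperHalfPlane.I).arg : ℝ) : ℂ)) * _ = _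
    rw [← toR_smul, TG.im_smul, jf_toR, UpperHalfPlane.I_im, Real.div_rpow zero_le_one
        (by positivity),
      Real.one_rpow, ← Real.rpow_natCast, ← Real.rpow_mul hj.le,
      show ((2 : ℕ) : ℝ) * (k / 2) = k by push_cast; ring, Real.rpow_def_of_pos hj,
      Complex.cpow_def_of_ne_zero (jZ_ne_zero _ _), ← Complex.exp_neg]
    congr 1
    have e2 : Complex.log (jZ γ UpperHalfPlane.I) = Real.log ‖jZ γ UpperHalfPlane.I‖ +
      (jZ γ UpperHalfPlane.I).arg * Complex.I := rfl
    rw [e2, one_div, ← Real.exp_neg, Complex.ofReal_exp, ← Complex.exp_add]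
    congr 1
    push_cast
    ring
  rw [coe_secG, e0, e1] at h1
  have hne := etaPow_ne_zero k UpperHalfPlane.I
  rw [vMult, eq_div_iff (mul_ne_zero _ hne)]
  · have hne2 : jZ γ UpperHalfPlane.I ^ (k : ℂ) ≠ 0 := by
      rw [Complex.cpow_def_of_ne_zero (jZ_ne_zero _ _)]
      exact Complex.exp_ne_zero _
    rw [mul_left_comm, ← h1, mul_inv_cancel_left₀ hne2]
  · rw [Complex.cpow_def_of_ne_zero (jZ_ne_zero _ _)]
    exact Complex.exp_ne_zero _

/-! ### Slash operators and equivariance on the covering group -/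

/-- Invariance under one slash operator as equivariance of the lift. -/
theorem slash_eq_iff {n : ℕ} {k : ℝ} {χ : tGamma →* ℂˣ} (h : IsChi k χ)
    (ρ : SL(2, ℤ) →* Matrix.unitaryGroup (Fin n) ℂ) (u : ℍ → Fin n → ℂ) (γ : SL(2, ℤ)) :
    slash k ρ γ u = u ↔ ∀ g, Psi k u (sec γ * g) =
      (χ (secG γ) : ℂ) • ((ρ γ : Matrix (Fin n) (Fin n) ℂ) *ᵥ Psi k u g) := by
  have hv : vMult k γ ≠ 0 := by
    rw [← h.secG]
    exact Units.ne_zero _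
  have hρ : ∀ v w : Fin n → ℂ,
      ((((ρ γ)⁻¹ : Matrix.unitaryGroup (Fin n) ℂ) : Matrix (Fin n) (Fin n) ℂ) *ᵥ v = w ↔
        v = (ρ γ : Matrix (Fin n) (Fin n) ℂ) *ᵥ w) := by
    intro v w
    constructor
    · rintro rfl
      rw [Matrix.mulVec_mulVec, ← Matrix.UnitaryGroup.mul_val, mul_inv_cancel,
        Matrix.UnitaryGroup.one_val, Matrix.one_mulVec]
    · rintro rfl
      rw [Matrix.mulVec_mulVec, ← Matrix.UnitaryGroup.mul_val, inv_mul_cancel,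
        Matrix.UnitaryGroup.one_val, Matrix.one_mulVec]
  -- At a given point the angle enters both sides through the common factor e^{ikθ}, and `sec_mul_θ`
  -- supplies the phase of the slash operator.
  have hpt : ∀ g : TG, (slash k ρ γ u g.z = u g.z ↔ Psi k u (sec γ * g) =
      (χ (secG γ) : ℂ) • ((ρ γ : Matrix (Fin n) (Fin n) ℂ) *ᵥ Psi k u g)) := by
    intro g
    have hE := Complex.exp_ne_zero (Complex.I * k * (jZ γ g.z).arg)
    have hE2 := Complex.exp_ne_zero (Complex.I * k * g.θ)
    have e : Complex.exp (Complex.I * k * ((g.θ - (jZ γ g.z).arg : ℝ) : ℂ)) =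
        Complex.exp (Complex.I * k * g.θ) * (Complex.exp (Complex.I * k * (jZ γ g.z).arg))⁻¹ := by
      rw [← Complex.exp_neg, ← Complex.exp_add]
      congr 1
      push_cast
      ring
    rw [slash, ← Matrix.mulVec_smul, hρ, Psi, Psi, sec_mul_z, sec_mul_θ, h.secG, e,
      Matrix.mulVec_smul, Complex.exp_neg]
    generalize (ρ γ : Matrix (Fin n) (Fin n) ℂ) *ᵥ u g.z = w
    generalize Complex.exp (Complex.I * k * (jZ γ g.z).arg) = E at *
    generalize Complex.exp (Complex.I * k * g.θ) = E2 at *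
    generalize u (γ • g.z) = v
    constructor
    · rintro rfl
      simp only [smul_smul]
      congr 1
      field_simp
    · intro h
      rw [mul_smul, smul_comm (vMult k γ) E2] at h
      have h' : E⁻¹ • v = vMult k γ • w := smul_right_injective _ hE2 h
      rw [mul_smul, h', smul_smul, inv_mul_cancel₀ hv, one_smul]
  constructor
  · intro h g
    exact (hpt g).1 (congrFun h _)
  · intro h
    funext z
    exact (hpt ⟨z, 0⟩).2 (h _)

/-- Invariance under the slash operators is equivariance of the lift under the lattice. -/
theorem psi_equivariant {n : ℕ} {k : ℝ} {χ : tGamma →* ℂˣ} (h : IsChi k χ)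
    (ρ : SL(2, ℤ) →* Matrix.unitaryGroup (Fin n) ℂ) (u : ℍ → Fin n → ℂ)
    (ht : ∀ g, Psi k u (tEl * g) =
      (χ tEl : ℂ) • ((ρ ModularGroup.T : Matrix (Fin n) (Fin n) ℂ) *ᵥ Psi k u g))
    (hs : ∀ g, Psi k u (sEl * g) =
      (χ sEl : ℂ) • ((ρ ModularGroup.S : Matrix (Fin n) (Fin n) ℂ) *ᵥ Psi k u g))
    (γ : SL(2, ℤ)) : slash k ρ γ u = u := by
  rw [slash_eq_iff h]
  -- The law is required with some matrix δ below γ. This formulation is stable under the group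
  -- operations, and δ is recovered from γ by injectivity of SL₂(ℤ) → SL₂(ℝ).
  let P : Subgroup tGamma :=
    { carrier := {γ | ∃ δ : SL(2, ℤ), (γ : TG).pr = toR δ ∧ ∀ g, Psi k u ((γ : TG) * g) =
        (χ γ : ℂ) • ((ρ δ : Matrix (Fin n) (Fin n) ℂ) *ᵥ Psi k u g)}
      one_mem' := ⟨1, by simp [TG.pr_one, toR], fun g => by simp⟩
      mul_mem' := by
        rintro γ γ' ⟨δ, e, hc⟩ ⟨δ', e', hc'⟩
        refine ⟨δ * δ', ?_, fun g => ?_⟩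
        · rw [toR_mul, ← e, ← e']
          exact TG.pr_mul _ _
        · rw [Subgroup.coe_mul, mul_assoc, hc, hc', Matrix.mulVec_smul, smul_smul,
            Matrix.mulVec_mulVec, map_mul, map_mul, Units.val_mul, Matrix.UnitaryGroup.mul_val]
      inv_mem' := by
        rintro γ ⟨δ, e, hc⟩
        refine ⟨δ⁻¹, ?_, fun g => ?_⟩
        · change TG.prHom (γ : TG)⁻¹ = _
          rw [map_inv, toR, map_inv]
          exact congrArg _ e
        · have := hc ((γ⁻¹ : tGamma) * g)
          rw [← mul_assoc, ← Subgroup.coe_mul, mul_inv_cancel, Subgroup.coe_one, one_mul] at this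
          rw [this, Matrix.mulVec_smul, smul_smul, Matrix.mulVec_mulVec,
            ← Matrix.UnitaryGroup.mul_val, ← map_mul, inv_mul_cancel, map_one,
            Matrix.UnitaryGroup.one_val, Matrix.one_mulVec, ← Units.val_mul, ← map_mul,
            inv_mul_cancel, map_one, Units.val_one, one_smul] }
  obtain ⟨δ, e, hδ⟩ := tGamma_induction P ⟨ModularGroup.T, by rw [← sec_T, pr_sec], ht⟩
    ⟨ModularGroup.S, by rw [← sec_S, pr_sec], hs⟩ (secG γ)
  have : δ = γ := toR_injective (by rw [← e, coe_secG, pr_sec])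
  subst this
  exact hδ

/-! ### Differentiation of theta series -/

/-- The series `∑ n^k e^{2πi n z + πi n² τ}`. -/
def thS (k : ℕ) (z τ : ℂ) : ℂ := ∑' n : ℤ, (n : ℂ) ^ k * jacobiTheta₂_term n z τ

theorem summable_pow_mul_term (k : ℕ) (z : ℂ) {τ : ℂ} (hτ : 0 < τ.im) :
    Summable fun n : ℤ => (n : ℂ) ^ k * jacobiTheta₂_term n z τ := by
  refine (summable_pow_mul_jacobiTheta₂_term_bound |z.im| hτ k).of_norm_bounded fun n => ?_
  rw [norm_mul, norm_pow, Complex.norm_intCast]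
  refine (mul_le_mul_of_nonneg_left (norm_jacobiTheta₂_term_le hτ le_rfl le_rfl n)
    (by positivity)).trans ?_
  simp

/-- Differentiation in z brings down 2πi n, and in τ it brings down πi n². Both stay inside the
family `thS`, with k raised by 1 or 2. -/
theorem hasFDerivAt_thS (k : ℕ) (z : ℂ) {τ : ℂ} (hτ : 0 < τ.im) :
    HasFDerivAt (fun p : ℂ × ℂ => thS k p.1 p.2)
      ((2 * Real.pi * Complex.I * thS (k + 1) z τ) • ContinuousLinearMap.fst ℂ ℂ ℂ +
        (Real.pi * Complex.I * thS (k + 2) z τ) • ContinuousLinearMap.snd ℂ ℂ ℂ) (z, τ) := by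
  -- On the domain where |Im z| < S and Im τ > T the derivatives of the terms have a summable bound
  -- independent of the point.
  obtain ⟨T, hT, hτ'⟩ := exists_between hτ
  obtain ⟨S, hz⟩ := exists_gt |z.im|
  let V := {u : ℂ | |u.im| < S} ×ˢ {v : ℂ | T < v.im}
  have hVo : IsOpen V :=
    ((_root_.continuous_abs.comp Complex.continuous_im).isOpen_preimage _ isOpen_Iio).prod
      (Complex.continuous_im.isOpen_preimage _ isOpen_Ioi)
  have hVmem : (z, τ) ∈ V := ⟨hz, hτ'⟩
  have hVp : IsPreconnected V := by
    refine (Convex.isPreconnected ?_).prod (convex_halfSpace_im_gt T).isPreconnected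
    simpa only [abs_lt] using! (convex_halfSpace_im_gt _).inter (convex_halfSpace_im_lt _)
  let f : ℤ → ℂ × ℂ → ℂ := fun n p => (n : ℂ) ^ k * jacobiTheta₂_term n p.1 p.2
  let f' : ℤ → ℂ × ℂ → ℂ × ℂ →L[ℂ] ℂ := fun n p =>
    (n : ℂ) ^ k • jacobiTheta₂_term_fderiv n p.1 p.2
  have hf (n : ℤ) : ∀ p ∈ V, HasFDerivAt (f n) (f' n p) p :=
    fun p _ => (hasFDerivAt_jacobiTheta₂_term n p.1 p.2).const_mul _
  let u : ℤ → ℝ := fun n =>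
    3 * Real.pi * (|n| ^ (k + 2) * Real.exp (-Real.pi * (T * n ^ 2 - 2 * S * |n|)))
  have hu : ∀ (n : ℤ), ∀ x ∈ V, ‖f' n x‖ ≤ u n := by
    intro n p hp
    rw [norm_smul, norm_pow, Complex.norm_intCast]
    have h1 := (norm_jacobiTheta₂_term_fderiv_le n p.1 p.2).trans
      (mul_le_mul_of_nonneg_left (norm_jacobiTheta₂_term_le hT (le_of_lt hp.1) (le_of_lt hp.2) n)
        (by positivity))
    refine (mul_le_mul_of_nonneg_left h1 (by positivity)).trans (le_of_eq ?_)
    simp only [u, Int.cast_abs]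
    ring
  have hu_sum : Summable u :=
    (summable_pow_mul_jacobiTheta₂_term_bound S hT (k + 2)).mul_left _
  have h := hasFDerivAt_tsum_of_isPreconnected hu_sum hVo hVp hf hu hVmem
    (summable_pow_mul_term k z hτ) hVmem
  have e : ∀ n : ℤ, f' n (z, τ) =
      (2 * Real.pi * Complex.I * ((n : ℂ) ^ (k + 1) * jacobiTheta₂_term n z τ)) •
        ContinuousLinearMap.fst ℂ ℂ ℂ +
      (Real.pi * Complex.I * ((n : ℂ) ^ (k + 2) * jacobiTheta₂_term n z τ)) •
        ContinuousLinearMap.snd ℂ ℂ ℂ := by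
    intro n
    simp only [f', jacobiTheta₂_term_fderiv, jacobiTheta₂_term, smul_add, smul_smul]
    congr 2 <;> ring
  have hs : HasSum (fun n => f' n (z, τ))
      ((2 * Real.pi * Complex.I * thS (k + 1) z τ) • ContinuousLinearMap.fst ℂ ℂ ℂ +
        (Real.pi * Complex.I * thS (k + 2) z τ) • ContinuousLinearMap.snd ℂ ℂ ℂ) := by
    rw [funext e]
    exact (((summable_pow_mul_term (k + 1) z hτ).hasSum.mul_left _).smul_const _).add
      (((summable_pow_mul_term (k + 2) z hτ).hasSum.mul_left _).smul_const _)
  rw [hs.tsum_eq] at h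
  exact h

theorem isOpen_thDom : IsOpen {p : ℂ × ℂ | 0 < p.2.im} :=
  isOpen_lt continuous_const (Complex.continuous_im.comp continuous_snd)

/-- The derivative consists of members of the same family, so induction on N for all k
simultaneously gives smoothness. -/
theorem contDiffOn_thS_nat (N : ℕ) : ∀ k : ℕ, ContDiffOn ℂ N (fun p : ℂ × ℂ => thS k p.1 p.2)
    {p : ℂ × ℂ | 0 < p.2.im} := by
  have hd : ∀ k : ℕ, DifferentiableOn ℂ (fun p : ℂ × ℂ => thS k p.1 p.2)
      {p : ℂ × ℂ | 0 < p.2.im} := fun k p hp =>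
    (hasFDerivAt_thS k p.1 hp).differentiableAt.differentiableWithinAt
  induction N with
  | zero =>
    intro k
    rw [Nat.cast_zero, contDiffOn_zero]
    exact (hd k).continuousOn
  | succ N ih =>
    intro k
    rw [Nat.cast_succ, contDiffOn_succ_iff_fderiv_of_isOpen isOpen_thDom]
    refine ⟨hd k, fun h => by simp at h, ?_⟩
    refine ContDiffOn.congr (f := fun p : ℂ × ℂ =>
      (2 * Real.pi * Complex.I * thS (k + 1) p.1 p.2) • ContinuousLinearMap.fst ℂ ℂ ℂ +
        (Real.pi * Complex.I * thS (k + 2) p.1 p.2) • ContinuousLinearMap.snd ℂ ℂ ℂ) ?_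
      fun p hp => (hasFDerivAt_thS k p.1 hp).fderiv
    exact ((contDiffOn_const.mul (ih _)).smul contDiffOn_const).add
      ((contDiffOn_const.mul (ih _)).smul contDiffOn_const)

theorem contDiffOn_thS (k : ℕ) : ContDiffOn ℝ ∞ (fun p : ℂ × ℂ => thS k p.1 p.2)
    {p : ℂ × ℂ | 0 < p.2.im} :=
  (contDiffOn_infty.2 fun N => contDiffOn_thS_nat N k).restrict_scalars ℝ

/-! ### Theta functions in coordinates and their partial derivatives -/

/-- The exponent in the term `α = β` of the theta function. -/
def thX (m : ℕ) (β : ℝ) (v : Coord) : ℂ :=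
  Complex.I * v.2.2.2.2 / 2 + 2 * Real.pi * Complex.I * m *
    (v.2.2.1 + v.2.1 * (2 * β + v.1) + v.2.2.2.1 * (v.1 + β) ^ 2)

/-- The elliptic variable of the theta function. -/
def thZ (m : ℕ) (β : ℝ) (v : Coord) : ℂ := 2 * m * (v.2.1 + v.2.2.2.1 * (v.1 + β))

/-- The theta function with `n^k` inserted, in coordinates. -/
def thC (m : ℕ) (β : ℝ) (k : ℕ) (v : Coord) : ℂ :=
  (v.2.2.2.1.im ^ (1 / 4 : ℝ) : ℝ) * Complex.exp (thX m β v) *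
    thS k (thZ m β v) (2 * m * v.2.2.2.1)

/-- The theta function with `n^k` inserted. -/
def thG (m : ℕ) (β : ℝ) (k : ℕ) (g : TGJ) : ℂ := thC m β k (toCoord g)

/-- Expansion of the exponent for α = β + n: the part free of n is `thX`, the linear part has
elliptic variable `thZ`, and the quadratic part has modulus 2mτ. -/
theorem theta_eq (m : ℕ) (hm : 1 ≤ m) (j : ℤ) : theta m j = thG m ((j : ℝ) / (2 * m)) 0 := by
  funext g
  have hm0 : (m : ℂ) ≠ 0 := by exact_mod_cast (by omega : m ≠ 0)
  rw [theta, thetaHeis, thG, thC, thS, ← tsum_mul_left]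
  refine tsum_congr fun n => ?_
  rw [phiJ, pow_zero, one_mul, jacobiTheta₂_term, thX, thZ]
  simp only [toCoord, UpperHalfPlane.coe_im]
  have e : Complex.exp (2 * Real.pi * Complex.I * m *
        ((g.left.r + g.left.y * (2 * ((j : ℝ) / (2 * m) + n) + g.left.x) : ℝ) : ℂ)) *
        (Complex.exp (Complex.I * g.right.θ / 2) * Complex.exp (2 * Real.pi * Complex.I * m *
          g.right.z * ((g.left.x + ((j : ℝ) / (2 * m) + n) : ℝ) : ℂ) ^ 2)) =
      Complex.exp (Complex.I * g.right.θ / 2 + 2 * Real.pi * Complex.I * m *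
        (g.left.r + g.left.y * (2 * ((j : ℝ) / (2 * m) : ℝ) + g.left.x) +
          g.right.z * (g.left.x + ((j : ℝ) / (2 * m) : ℝ)) ^ 2)) *
      Complex.exp (2 * Real.pi * Complex.I * n * (2 * m * (g.left.y + g.right.z *
        (g.left.x + ((j : ℝ) / (2 * m) : ℝ)))) +
          Real.pi * Complex.I * n ^ 2 * (2 * m * g.right.z)) := by
    simp only [← Complex.exp_add]
    congr 1
    push_cast
    ring
  linear_combination ((g.right.z.im ^ (1 / 4 : ℝ) : ℝ) : ℂ) * e

theorem contDiff_coordτ : ContDiff ℝ ∞ fun v : Coord => v.2.2.2.1 := by fun_prop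

theorem contDiffOn_coord_im_rpow (r : ℝ) :
    ContDiffOn ℝ ∞ (fun v : Coord => ((v.2.2.2.1.im ^ r : ℝ) : ℂ)) coordSet := by
  have h : ContDiffOn ℝ ∞ (fun v : Coord => v.2.2.2.1.im) coordSet :=
    (Complex.imCLM.contDiff.comp contDiff_coordτ).contDiffOn
  exact Complex.ofRealCLM.contDiff.comp_contDiffOn
    (h.rpow_const_of_ne fun v hv => ne_of_gt hv)

theorem contDiff_ofReal_comp {f : Coord → ℝ} (hf : ContDiff ℝ ∞ f) :
    ContDiff ℝ ∞ fun v => (f v : ℂ) := Complex.ofRealCLM.contDiff.comp hf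

theorem contDiff_thX (m : ℕ) (β : ℝ) : ContDiff ℝ ∞ (thX m β) := by
  have hp := contDiff_ofReal_comp (f := fun v => v.1) (by fun_prop)
  have hq := contDiff_ofReal_comp (f := fun v => v.2.1) (by fun_prop)
  have hr := contDiff_ofReal_comp (f := fun v => v.2.2.1) (by fun_prop)
  have hθ := contDiff_ofReal_comp (f := fun v => v.2.2.2.2) (by fun_prop)
  unfold thX
  fun_prop

theorem contDiff_thZ (m : ℕ) (β : ℝ) : ContDiff ℝ ∞ (thZ m β) := by
  have hp := contDiff_ofReal_comp (f := fun v => v.1) (by fun_prop)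
  have hq := contDiff_ofReal_comp (f := fun v => v.2.1) (by fun_prop)
  unfold thZ
  fun_prop

theorem two_m_mul_im_pos {m : ℕ} (hm : 1 ≤ m) {z : ℂ} (hz : 0 < z.im) : 0 < (2 * m * z).im := by
  have : (2 * m * z).im = 2 * m * z.im := by simp
  rw [this]
  have : (0 : ℝ) < m := by exact_mod_cast hm
  positivity

theorem contDiffOn_thC {m : ℕ} (hm : 1 ≤ m) (β : ℝ) (k : ℕ) :
    ContDiffOn ℝ ∞ (thC m β k) coordSet := by
  have h : ContDiff ℝ ∞ fun v : Coord => (thZ m β v, 2 * m * v.2.2.2.1) :=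
    (contDiff_thZ m β).prodMk (contDiff_const.mul contDiff_coordτ)
  have h1 : ContDiffOn ℝ ∞ (fun v : Coord => Complex.exp (thX m β v)) coordSet :=
    (contDiff_thX m β).cexp.contDiffOn
  have h2 := ContDiffOn.comp (s := coordSet) (contDiffOn_thS k) h.contDiffOn
    fun v hv => two_m_mul_im_pos hm hv
  refine (((contDiffOn_coord_im_rpow (1 / 4)).mul h1).mul h2).congr fun v _ => ?_
  simp only [thC, Function.comp_apply]

theorem smoothJ_thG {m : ℕ} (hm : 1 ≤ m) (β : ℝ) (k : ℕ) : SmoothJ (thG m β k) :=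
  smoothJ_of (contDiffOn_thC hm β k) fun _ => rfl

theorem smoothJ_theta {m : ℕ} (hm : 1 ≤ m) (j : ℤ) : SmoothJ (theta m j) := by
  rw [theta_eq m hm]
  exact smoothJ_thG hm _ _

/-- The derivative in a coordinate direction from the derivative along a line. -/
theorem pd_of_line {f : TGJ → ℂ} {C : Coord → ℂ} (h : ∀ g, f g = C (toCoord g)) {w : Coord}
    {D : ℂ} {g : TGJ} (hd : HasDerivAt (fun t : ℝ => C (toCoord g + t • w)) D 0) :
    pd ofCoord toCoord w f g = D := by
  rw [pd, lineDeriv]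
  refine HasDerivAt.deriv (hd.congr_of_eventuallyEq ?_)
  have hc : ContinuousAt (fun t : ℝ => toCoord g + t • w) 0 := by fun_prop
  have hmem : ∀ᶠ t : ℝ in 𝓝 0, toCoord g + t • w ∈ coordSet := by
    refine hc.eventually_mem (isOpen_coordSet.mem_nhds ?_)
    simpa using toCoord_mem g
  filter_upwards [hmem] with t ht
  rw [Function.comp_apply, h, toCoord_ofCoord _ ht]

/-- The coefficients of the derivative of `thC` in the direction `w`. -/
theorem hasDerivAt_thC {m : ℕ} (hm : 1 ≤ m) (β : ℝ) (k : ℕ) {v : Coord} (hv : v ∈ coordSet)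
    (w : Coord) : HasDerivAt (fun t : ℝ => thC m β k (v + t • w))
      ((w.2.2.2.1.im / (4 * v.2.2.2.1.im) + Complex.I * w.2.2.2.2 / 2 +
          2 * Real.pi * Complex.I * m * (w.2.2.1 + w.2.1 * (2 * β + v.1) + v.2.1 * w.1 +
            w.2.2.2.1 * (v.1 + β) ^ 2 + 2 * v.2.2.2.1 * (v.1 + β) * w.1)) * thC m β k v +
        (4 * Real.pi * Complex.I * m * (w.2.1 + w.2.2.2.1 * (v.1 + β) + v.2.2.2.1 * w.1)) *
          thC m β (k + 1) v +
        (2 * Real.pi * Complex.I * m * w.2.2.2.1) * thC m β (k + 2) v) 0 := by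
  have hv' : 0 < v.2.2.2.1.im := hv
  have hreal : ∀ a b : ℝ, HasDerivAt (fun t : ℝ => ((a + t * b : ℝ) : ℂ)) b 0 := by
    intro a b
    have : HasDerivAt (fun t : ℝ => a + t * b) b 0 := by
      simpa using ((hasDerivAt_id (0 : ℝ)).mul_const b).const_add a
    exact this.ofReal_comp
  have hp := hreal v.1 w.1
  have hq := hreal v.2.1 w.2.1
  have hr := hreal v.2.2.1 w.2.2.1
  have hθ := hreal v.2.2.2.2 w.2.2.2.2
  have hτ : HasDerivAt (fun t : ℝ => v.2.2.2.1 + (t : ℂ) * w.2.2.2.1) w.2.2.2.1 0 := by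
    have h1 : HasDerivAt (fun t : ℝ => (t : ℂ)) 1 0 := by
      simpa using (hasDerivAt_id (0 : ℝ)).ofReal_comp
    simpa using (h1.mul_const w.2.2.2.1).const_add v.2.2.2.1
  have him : HasDerivAt (fun t : ℝ =>
      (((v.2.2.2.1 + (t : ℂ) * w.2.2.2.1).im ^ (1 / 4 : ℝ) : ℝ) : ℂ))
      ((w.2.2.2.1.im / (4 * v.2.2.2.1.im) * v.2.2.2.1.im ^ (1 / 4 : ℝ) : ℝ) : ℂ) 0 := by
    have h1 : HasDerivAt (fun t : ℝ => v.2.2.2.1.im + t * w.2.2.2.1.im) w.2.2.2.1.im 0 := by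
      simpa using ((hasDerivAt_id (0 : ℝ)).mul_const w.2.2.2.1.im).const_add v.2.2.2.1.im
    have h2 := (h1.rpow_const (p := 1 / 4) (Or.inl (by simpa using hv'.ne'))).ofReal_comp
    refine (h2.congr_deriv ?_).congr_of_eventuallyEq (Eventually.of_forall fun t => ?_)
    · rw [zero_mul, add_zero, Real.rpow_sub_one hv'.ne']
      congr 1
      field_simp
    · simp
  have hX : HasDerivAt (fun t : ℝ => thX m β (v + t • w)) (Complex.I * w.2.2.2.2 / 2 +
      2 * Real.pi * Complex.I * m * (w.2.2.1 + w.2.1 * (2 * β + v.1) + v.2.1 * w.1 +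
        w.2.2.2.1 * (v.1 + β) ^ 2 + 2 * v.2.2.2.1 * (v.1 + β) * w.1)) 0 := by
    have := ((hθ.const_mul Complex.I).div_const 2).add
        (((hr.add (hq.mul (hp.const_add (2 * (β : ℂ))))).add
      (hτ.mul ((hp.add_const (β : ℂ)).pow 2))).const_mul (2 * Real.pi * Complex.I * m))
    refine (this.congr_deriv ?_).congr_of_eventuallyEq (Eventually.of_forall fun t => ?_)
    · simp only [Pi.pow_apply, Complex.ofReal_zero, zero_mul, add_zero, Nat.cast_ofNat,
        Nat.reduceSub, pow_one]
      ring
    · simp [thX]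
  have hZ : HasDerivAt (fun t : ℝ => thZ m β (v + t • w))
      (2 * m * (w.2.1 + w.2.2.2.1 * (v.1 + β) + v.2.2.2.1 * w.1)) 0 := by
    have := (hq.add (hτ.mul (hp.add_const (β : ℂ)))).const_mul (2 * m : ℂ)
    refine (this.congr_deriv ?_).congr_of_eventuallyEq (Eventually.of_forall fun t => ?_)
    · simp only [Complex.ofReal_zero, zero_mul, add_zero]
      ring
    · simp [thZ]
  have hS := ((hasFDerivAt_thS k (thZ m β v) (two_m_mul_im_pos hm hv')).restrictScalars ℝ)
  have hZτ : HasDerivAt (fun t : ℝ =>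
      (thZ m β (v + t • w), 2 * m * (v.2.2.2.1 + (t : ℂ) * w.2.2.2.1)))
      (2 * m * (w.2.1 + w.2.2.2.1 * (v.1 + β) + v.2.2.2.1 * w.1), 2 * m * w.2.2.2.1) 0 :=
    hZ.prodMk (hτ.const_mul (2 * m : ℂ))
  have hS' := HasFDerivAt.comp_hasDerivAt_of_eq (0 : ℝ) hS hZτ (by simp)
  have := (him.mul hX.cexp).mul hS'
  refine (this.congr_deriv ?_).congr_of_eventuallyEq (Eventually.of_forall fun t => ?_)
  · simp [thC]
    ring
  · simp [thC, Function.comp_def]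

theorem pd_thG {m : ℕ} (hm : 1 ≤ m) (β : ℝ) (k : ℕ) (w : Coord) (g : TGJ) :
    pd ofCoord toCoord w (thG m β k) g =
      (w.2.2.2.1.im / (4 * g.right.z.im) + Complex.I * w.2.2.2.2 / 2 +
          2 * Real.pi * Complex.I * m * (w.2.2.1 + w.2.1 * (2 * β + g.left.x) + g.left.y * w.1 +
            w.2.2.2.1 * (g.left.x + β) ^ 2 + 2 * g.right.z * (g.left.x + β) * w.1)) * thG m β k g +
        (4 * Real.pi * Complex.I * m * (w.2.1 + w.2.2.2.1 * (g.left.x + β) + g.right.z * w.1)) *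
          thG m β (k + 1) g +
        (2 * Real.pi * Complex.I * m * w.2.2.2.1) * thG m β (k + 2) g :=
  pd_of_line (fun _ => rfl) (hasDerivAt_thC hm β k (toCoord_mem g) w)

/-! ### The operators X_± and Y_± on theta functions -/

/-- The factor `(√y)⁻¹ e^{iθ}`. -/
def wbar (g : TG) : ℂ := ((√g.z.im)⁻¹ : ℝ) * Complex.exp (Complex.I * g.θ)

/-- This lets the factor e^{2iθ} of X_+ cancel against the square of `wbar` that Y_+² produces. -/
theorem wbar_sq (g : TG) : wbar g ^ 2 * g.z.im = Complex.exp (2 * Complex.I * g.θ) := by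
  have h : ((√g.z.im)⁻¹ ^ 2 * g.z.im : ℝ) = 1 := by
    rw [inv_pow, Real.sq_sqrt g.z.im_pos.le, inv_mul_cancel₀ g.z.im_pos.ne']
  have h' : (((√g.z.im)⁻¹ : ℝ) : ℂ) ^ 2 * g.z.im = 1 := by exact_mod_cast h
  rw [wbar, mul_pow, ← Complex.exp_nat_mul, mul_right_comm, h', one_mul]
  congr 1
  push_cast
  ring

/-- The last two expressions are the denominator c i + d and the numerator a i + b of g i, and the
first two are their conjugates. -/
theorem pr_relations (g : TG) :
    ((g.pr 1 1 : ℝ) : ℂ) - Complex.I * (g.pr 1 0 : ℝ) = wbar g ∧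
    ((g.pr 0 1 : ℝ) : ℂ) - Complex.I * (g.pr 0 0 : ℝ) = (starRingEnd ℂ g.z) * wbar g ∧
    ((g.pr 1 1 : ℝ) : ℂ) + Complex.I * (g.pr 1 0 : ℝ) = starRingEnd ℂ (wbar g) ∧
    ((g.pr 0 1 : ℝ) : ℂ) + Complex.I * (g.pr 0 0 : ℝ) = g.z * starRingEnd ℂ (wbar g) := by
  have h1 : ((g.pr 1 1 : ℝ) : ℂ) + Complex.I * (g.pr 1 0 : ℝ) = starRingEnd ℂ (wbar g) := by
    have := TG.jf_pr_I g
    rw [TG.jf, UpperHalfPlane.coe_I] at this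
    rw [wbar, map_mul, Complex.conj_ofReal, ← Complex.exp_conj, map_mul, Complex.conj_I,
      Complex.conj_ofReal, neg_mul, ← this]
    ring
  have h2 : ((g.pr 0 1 : ℝ) : ℂ) + Complex.I * (g.pr 0 0 : ℝ) = g.z * starRingEnd ℂ (wbar g) := by
    have := TG.coe_smul g.pr UpperHalfPlane.I
    rw [TG.pr_smul_I, eq_div_iff (TG.jf_ne_zero _ _), TG.jf, UpperHalfPlane.coe_I] at this
    rw [← h1]
    linear_combination -this
  refine ⟨?_, ?_, h1, h2⟩
  · have := congrArg (starRingEnd ℂ) h1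
    simpa [← sub_eq_add_neg] using this
  · have := congrArg (starRingEnd ℂ) h2
    simpa [← sub_eq_add_neg] using this

/-- Up to a nonvanishing factor, Y_- is ∂_p - τ ∂_q - (pτ + q) ∂_r. For Y_+ the conjugate of τ takes
the place of τ. -/
theorem Ym_of_partials {f : TGJ → ℂ} {g : TGJ} {cp cq cr : ℂ}
    (h : ∀ u v : ℝ, pd ofCoord toCoord (heisDir u v g) f g =
      cp * (heisDir u v g).1 + cq * (heisDir u v g).2.1 + cr * (heisDir u v g).2.2.1) :
    Ym f g = 1 / 2 * starRingEnd ℂ (wbar g.right) *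
      (cp - g.right.z * cq - (g.left.x * g.right.z + g.left.y) * cr) := by
  obtain ⟨-, -, h1, h2⟩ := pr_relations g.right
  rw [Ym, dP_eq, dQ_eq, h, h]
  simp only [heisDir]
  push_cast
  linear_combination (1 / 2 : ℂ) * (cp - g.left.y * cr) * h1 +
    (1 / 2 : ℂ) * (-cq - g.left.x * cr) * h2

theorem Yp_of_partials {f : TGJ → ℂ} {g : TGJ} {cp cq cr : ℂ}
    (h : ∀ u v : ℝ, pd ofCoord toCoord (heisDir u v g) f g =
      cp * (heisDir u v g).1 + cq * (heisDir u v g).2.1 + cr * (heisDir u v g).2.2.1) :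
    Yp f g = 1 / 2 * wbar g.right *
      (cp - starRingEnd ℂ g.right.z * cq -
        (g.left.x * starRingEnd ℂ g.right.z + g.left.y) * cr) := by
  obtain ⟨h1, h2, -, -⟩ := pr_relations g.right
  rw [Yp, dP_eq, dQ_eq, h, h]
  simp only [heisDir]
  push_cast
  linear_combination (1 / 2 : ℂ) * (cp - g.left.y * cr) * h1 +
    (1 / 2 : ℂ) * (-cq - g.left.x * cr) * h2

theorem right_mul_hJ (g : TGJ) (p q r : ℝ) : (g * hJ p q r).right = g.right := by
  change g.right * 1 = _
  rw [mul_one]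

/-- Right translation by the Heisenberg group does not move the `TG` component, so functions of it
are constants for Y_±. -/
theorem Yp_mul_right (f : TGJ → ℂ) (U : TG → ℂ) :
    Yp (fun g => f g * U g.right) = fun g => Yp f g * U g.right := by
  funext g
  simp only [Yp, dP, dQ, right_mul_hJ, deriv_mul_const_field]
  ring

theorem Ym_mul_right (f : TGJ → ℂ) (U : TG → ℂ) :
    Ym (fun g => f g * U g.right) = fun g => Ym f g * U g.right := by
  funext g
  simp only [Ym, dP, dQ, right_mul_hJ, deriv_mul_const_field]
  ring

theorem pd_thG_heis {m : ℕ} (hm : 1 ≤ m) (β : ℝ) (k : ℕ) (g : TGJ) (u v : ℝ) :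
    pd ofCoord toCoord (heisDir u v g) (thG m β k) g =
      (2 * Real.pi * Complex.I * m * ((g.left.y + 2 * g.right.z * (g.left.x + β)) * thG m β k g +
        2 * g.right.z * thG m β (k + 1) g)) * (heisDir u v g).1 +
      (2 * Real.pi * Complex.I * m * ((2 * β + g.left.x) * thG m β k g +
        2 * thG m β (k + 1) g)) * (heisDir u v g).2.1 +
      (2 * Real.pi * Complex.I * m * thG m β k g) * (heisDir u v g).2.2.1 := by
  rw [pd_thG hm]
  have e1 : (heisDir u v g).2.2.2.1 = 0 := rfl
  have e2 : (heisDir u v g).2.2.2.2 = 0 := rfl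
  rw [e1, e2]
  simp only [Complex.zero_im, Complex.ofReal_zero]
  ring

/-- The exponent r + q(2α + p) + τ(p + α)² is annihilated by ∂_p - τ ∂_q - (pτ + q) ∂_r for every α.
-/
theorem Ym_thG {m : ℕ} (hm : 1 ≤ m) (β : ℝ) (k : ℕ) : Ym (thG m β k) = 0 := by
  funext g
  rw [Ym_of_partials (pd_thG_heis hm β k g), Pi.zero_apply]
  ring

theorem sub_conj_H (z : ℍ) : starRingEnd ℂ (z : ℂ) = z - 2 * Complex.I * z.im := by
  apply Complex.ext
  · simp
  · simp
    ring

/-- On the term of index α, Y_+ is multiplication by -4πmy · `wbar` · (p + α). Splitting p + α as (p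
+ β) + n gives the two summands. -/
theorem Yp_thG {m : ℕ} (hm : 1 ≤ m) (β : ℝ) (k : ℕ) (g : TGJ) :
    Yp (thG m β k) g = (g.left.x + β) * thG m β k g *
        (-(4 * Real.pi * m * g.right.z.im * wbar g.right))
      + thG m β (k + 1) g * (-(4 * Real.pi * m * g.right.z.im * wbar g.right)) := by
  rw [Yp_of_partials (pd_thG_heis hm β k g), sub_conj_H]
  linear_combination (4 * Real.pi * m * g.right.z.im * wbar g.right *
    ((g.left.x + β) * thG m β k g + thG m β (k + 1) g)) * Complex.I_mul_I

/-- The lift of a smooth function of `τ` with one power of `p + α` inserted. -/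
def thP (m : ℕ) (β : ℝ) (g : TGJ) : ℂ := (g.left.x + β) * thG m β 0 g + thG m β 1 g

/-- A second application of Y_+ also differentiates the factor p + α, and this is the source of the
term with 1/2. -/
theorem Yp_thP {m : ℕ} (hm : 1 ≤ m) (β : ℝ) (g : TGJ) :
    Yp (thP m β) g = 1 / 2 * wbar g.right * thG m β 0 g - 4 * Real.pi * m * g.right.z.im * wbar
        g.right *
      ((g.left.x + β) ^ 2 * thG m β 0 g + 2 * (g.left.x + β) * thG m β 1 g + thG m β 2 g) := by
  have key : ∀ u v : ℝ, pd ofCoord toCoord (heisDir u v g) (thP m β) g =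
      (heisDir u v g).1 * thG m β 0 g + (g.left.x + β) *
        pd ofCoord toCoord (heisDir u v g) (thG m β 0) g +
        pd ofCoord toCoord (heisDir u v g) (thG m β 1) g := by
    intro u v
    have h0 := hasDerivAt_thC hm β 0 (toCoord_mem g) (heisDir u v g)
    have h1 := hasDerivAt_thC hm β 1 (toCoord_mem g) (heisDir u v g)
    have e0 : pd ofCoord toCoord (heisDir u v g) (thG m β 0) g = _ := pd_of_line (fun _ => rfl) h0
    have e1 : pd ofCoord toCoord (heisDir u v g) (thG m β 1) g = _ := pd_of_line (fun _ => rfl) h1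
    rw [← e0] at h0
    rw [← e1] at h1
    have hx : HasDerivAt (fun t : ℝ => (((toCoord g + t • heisDir u v g).1 : ℝ) : ℂ) + β)
        ((heisDir u v g).1 : ℂ) 0 := by
      have : HasDerivAt (fun t : ℝ => g.left.x + t * (heisDir u v g).1) (heisDir u v g).1 0 := by
        simpa using ((hasDerivAt_id (0 : ℝ)).mul_const (heisDir u v g).1).const_add g.left.x
      exact this.ofReal_comp.add_const _
    have h := (hx.mul h0).add h1
    refine pd_of_line (C := fun w : Coord => ((w.1 : ℂ) + β) * thC m β 0 w + thC m β 1 w)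
      (fun _ => rfl) (h.congr_deriv ?_)
    simp only [zero_smul, add_zero]
    rfl
  have key' : ∀ u v : ℝ, pd ofCoord toCoord (heisDir u v g) (thP m β) g =
      (thG m β 0 g + 2 * Real.pi * Complex.I * m *
        ((g.left.y + 2 * g.right.z * (g.left.x + β)) * thP m β g +
        2 * g.right.z * ((g.left.x + β) * thG m β 1 g + thG m β 2 g))) * (heisDir u v g).1 +
      (2 * Real.pi * Complex.I * m * ((2 * β + g.left.x) * thP m β g +
        2 * ((g.left.x + β) * thG m β 1 g + thG m β 2 g))) * (heisDir u v g).2.1 +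
      (2 * Real.pi * Complex.I * m * thP m β g) * (heisDir u v g).2.2.1 := by
    intro u v
    rw [key, pd_thG_heis hm, pd_thG_heis hm, thP]
    ring
  rw [Yp_of_partials key', sub_conj_H, thP]
  linear_combination (4 * Real.pi * m * g.right.z.im * wbar g.right *
    ((g.left.x + β) ^ 2 * thG m β 0 g + 2 * (g.left.x + β) * thG m β 1 g + thG m β 2 g)) *
      Complex.I_mul_I

theorem Xp_thG {m : ℕ} (hm : 1 ≤ m) (β : ℝ) (g : TGJ) :
    Xp (thG m β 0) g = Complex.exp (2 * Complex.I * g.right.θ) * (1 / 2 * thG m β 0 g -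
      4 * Real.pi * m * g.right.z.im * ((g.left.x + β) ^ 2 * thG m β 0 g +
        2 * (g.left.x + β) * thG m β 1 g + thG m β 2 g)) := by
  have hy : (g.right.z.im : ℂ) ≠ 0 := by exact_mod_cast g.right.z.im_pos.ne'
  rw [Xp, dx, dy, dθ, pdJ, pdJ, pdJ, pd_thG hm, pd_thG hm, pd_thG hm]
  simp only [Complex.zero_im, Complex.one_im, Complex.I_im, Complex.ofReal_zero, Complex.ofReal_one]
  field_simp
  ring_nf
  rw [Complex.I_sq]
  ring

/-- The series is holomorphic in τ, and the contribution 1/4 of y^{1/4} cancels that of the weight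
1/2 in θ. -/
theorem Xm_thG {m : ℕ} (hm : 1 ≤ m) (β : ℝ) (g : TGJ) : Xm (thG m β 0) g = 0 := by
  have hy : (g.right.z.im : ℂ) ≠ 0 := by exact_mod_cast g.right.z.im_pos.ne'
  rw [Xm, dx, dy, dθ, pdJ, pdJ, pdJ, pd_thG hm, pd_thG hm, pd_thG hm]
  simp only [Complex.zero_im, Complex.one_im, Complex.I_im, Complex.ofReal_zero, Complex.ofReal_one]
  field_simp
  ring_nf
  rw [Complex.I_sq]
  ring

theorem Ym_zero : Ym 0 = 0 := by simpa using isOp_Ym.smul 0 0 Smooth.zero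

/-- The heat equation: on each term X_+ gives the factor e^{2iθ}(1/2 - 4πmy(p + α)²), and Y_+² / 4πm
gives its negative. -/
theorem Dp_thG {m : ℕ} (hm : 1 ≤ m) (β : ℝ) : Dp m (thG m β 0) = 0 := by
  funext g
  have hm0 : (m : ℂ) ≠ 0 := by exact_mod_cast (by omega : m ≠ 0)
  have hpi : (Real.pi : ℂ) ≠ 0 := by exact_mod_cast Real.pi_ne_zero
  have e : Yp (thG m β 0) = fun g => thP m β g *
      (fun g' : TG => -(4 * Real.pi * m * g'.z.im * wbar g')) g.right := by
    funext g
    rw [Yp_thG hm, thP]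
    ring
  rw [Dp, e, Yp_mul_right (thP m β) fun g' : TG => -(4 * Real.pi * m * g'.z.im * wbar g')]
  beta_reduce
  rw [Yp_thP hm, Xp_thG hm, Pi.zero_apply, ← wbar_sq]
  field_simp
  ring

theorem Dm_thG {m : ℕ} (hm : 1 ≤ m) (β : ℝ) : Dm m (thG m β 0) = 0 := by
  funext g
  rw [Dm, Ym_thG hm, Ym_zero, Xm_thG hm]
  simp

/-! ### The operators on theta decompositions -/

theorem Dp_theta {m : ℕ} (hm : 1 ≤ m) (j : ℤ) : Dp m (theta m j) = 0 := by
  rw [theta_eq m hm]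
  exact Dp_thG hm _

theorem Dm_theta {m : ℕ} (hm : 1 ≤ m) (j : ℤ) : Dm m (theta m j) = 0 := by
  rw [theta_eq m hm]
  exact Dm_thG hm _

theorem Ym_theta {m : ℕ} (hm : 1 ≤ m) (j : ℤ) : Ym (theta m j) = 0 := by
  rw [theta_eq m hm]
  exact Ym_thG hm _ _

/-! ### The Leibniz rule, and functions of the TG component -/

theorem SmoothJ.differentiableAt {f : TGJ → ℂ} (hf : SmoothJ f) (g : TGJ) :
    DifferentiableAt ℝ (f ∘ ofCoord) (toCoord g) :=
  (hf.contDiffAt (isOpen_coordSet.mem_nhds (toCoord_mem g))).differentiableAt (by simp)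

theorem pdJ_mul {f f' : TGJ → ℂ} (hf : SmoothJ f) (hf' : SmoothJ f') (v : Coord) (g : TGJ) :
    pdJ v (fun g => f g * f' g) g = pdJ v f g * f' g + f g * pdJ v f' g := by
  have h1 := hf.differentiableAt g
  have h2 := hf'.differentiableAt g
  rw [pdJ, pdJ, pdJ, pd, pd, pd, h1.lineDeriv_eq_fderiv, h2.lineDeriv_eq_fderiv,
    show (fun g => f g * f' g) ∘ ofCoord = fun w => (f ∘ ofCoord) w * (f' ∘ ofCoord) w from rfl,
    (h1.fun_mul h2).lineDeriv_eq_fderiv, fderiv_fun_mul h1 h2]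
  simp only [_root_.add_apply, _root_.smul_apply, Function.comp_apply,
    ofCoord_toCoord, smul_eq_mul]
  ring

theorem Xp_mul {f f' : TGJ → ℂ} (hf : SmoothJ f) (hf' : SmoothJ f') (g : TGJ) :
    Xp (fun g => f g * f' g) g = Xp f g * f' g + f g * Xp f' g := by
  simp only [Xp, dx, dy, dθ, pdJ_mul hf hf']
  ring

theorem Xm_mul {f f' : TGJ → ℂ} (hf : SmoothJ f) (hf' : SmoothJ f') (g : TGJ) :
    Xm (fun g => f g * f' g) g = Xm f g * f' g + f g * Xm f' g := by
  simp only [Xm, dx, dy, dθ, pdJ_mul hf hf']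
  ring

/-- The second order part of D_+ passes over U, so only the derivation X_+ contributes a second
term. -/
theorem Dp_mul_right (m : ℕ) {f : TGJ → ℂ} {U : TG → ℂ} (hf : SmoothJ f)
    (hU : SmoothJ fun g => U g.right) :
    Dp m (fun g => f g * U g.right) =
      fun g => Dp m f g * U g.right + f g * Xp (fun g => U g.right) g := by
  funext g
  rw [Dp, Xp_mul hf hU, Yp_mul_right, Yp_mul_right, Dp]
  ring

theorem Dm_mul_right (m : ℕ) {f : TGJ → ℂ} {U : TG → ℂ} (hf : SmoothJ f)
    (hU : SmoothJ fun g => U g.right) :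
    Dm m (fun g => f g * U g.right) =
      fun g => Dm m f g * U g.right + f g * Xm (fun g => U g.right) g := by
  funext g
  rw [Dm, Xm_mul hf hU, Ym_mul_right, Ym_mul_right, Dm]
  ring

/-- The function `p̃(z) k̃(θ) ↦ e^{ikθ} u(z)` for scalar `u`. -/
def psi (k : ℝ) (u : ℍ → ℂ) (g : TG) : ℂ := Complex.exp (Complex.I * k * g.θ) * u g.z

theorem smoothJ_psi (k : ℝ) {u : ℍ → ℂ} (hu : SmoothH u) : SmoothJ fun g => psi k u g.right := by
  refine (smoothJ_exp (Complex.I * k)).mul (d := fun g => u g.right.z) ?_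
  have h : ContDiffOn ℝ ∞ (fun v : Coord => u (ofComplex v.2.2.2.1)) coordSet :=
    ContDiffOn.comp (s := coordSet) (g := u ∘ fun w : ℂ => ofComplex w) hu
      contDiff_coordτ.contDiffOn fun v hv => hv
  exact h

theorem pdJ_psi_τ (k : ℝ) (u : ℍ → ℂ) (v : ℂ) (g : TGJ) :
    pdJ (0, 0, 0, v, 0) (fun g => psi k u g.right) g =
      Complex.exp (Complex.I * k * g.right.θ) * pdH v u g.right.z := by
  rw [pdJ, pd, pdH, pd, lineDeriv, lineDeriv, ← deriv_const_mul_field]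
  congr 1
  funext t
  simp [psi, ofCoord, toCoord]

theorem pdJ_psi_θ (k : ℝ) (u : ℍ → ℂ) (g : TGJ) :
    pdJ (0, 0, 0, 0, 1) (fun g => psi k u g.right) g =
      Complex.I * k * psi k u g.right := by
  have h1 : HasDerivAt (fun t : ℝ => Complex.I * k * ((g.right.θ + t : ℝ) : ℂ)) (Complex.I * k)
      0 := by
    have : HasDerivAt (fun t : ℝ => g.right.θ + t) 1 0 := (hasDerivAt_id (0 : ℝ)).const_add _
    simpa using this.ofReal_comp.const_mul (Complex.I * k)
  have h2 := h1.cexp.mul_const (u g.right.z)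
  rw [pdJ, pd, lineDeriv]
  refine HasDerivAt.deriv ((h2.congr_deriv ?_).congr_of_eventuallyEq
    (Eventually.of_forall fun t => ?_))
  · rw [psi, add_zero]
    ring
  · simp [psi, ofCoord, toCoord]

/-! ### Raising and lowering operators on the upper half-plane -/

/-- The raising operator in weight `k`. -/
def Kp (k : ℝ) (u : ℍ → ℂ) (z : ℍ) : ℂ :=
  Complex.I * z.im * pdH 1 u z + z.im * pdH Complex.I u z + k / 2 * u z

/-- The lowering operator in weight `k`. -/
def Km (k : ℝ) (u : ℍ → ℂ) (z : ℍ) : ℂ :=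
  -(Complex.I * z.im * pdH 1 u z) + z.im * pdH Complex.I u z - k / 2 * u z

/-- The factor e^{2iθ} raises the weight by 2, and -(i/2)∂_θ contributes k/2. -/
theorem Xp_psi (k : ℝ) (u : ℍ → ℂ) :
    Xp (fun g => psi k u g.right) = fun g => psi (k + 2) (Kp k u) g.right := by
  funext g
  have e : Complex.exp (Complex.I * ((k + 2 : ℝ) : ℂ) * g.right.θ) =
      Complex.exp (2 * Complex.I * g.right.θ) * Complex.exp (Complex.I * k * g.right.θ) := by
    rw [← Complex.exp_add]
    congr 1
    push_cast
    ring
  rw [Xp, dx, dy, dθ, pdJ_psi_τ, pdJ_psi_τ, pdJ_psi_θ, psi, psi, e, Kp]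
  linear_combination (-(1 / 2 : ℂ) * k * u g.right.z * Complex.exp (2 * Complex.I * g.right.θ) *
    Complex.exp (Complex.I * k * g.right.θ)) * Complex.I_mul_I

theorem Xm_psi (k : ℝ) (u : ℍ → ℂ) :
    Xm (fun g => psi k u g.right) = fun g => psi (k - 2) (Km k u) g.right := by
  funext g
  have e : Complex.exp (Complex.I * ((k - 2 : ℝ) : ℂ) * g.right.θ) =
      Complex.exp (-(2 * Complex.I * g.right.θ)) * Complex.exp (Complex.I * k * g.right.θ) := by
    rw [← Complex.exp_add]
    congr 1
    push_cast
    ring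
  rw [Xm, dx, dy, dθ, pdJ_psi_τ, pdJ_psi_τ, pdJ_psi_θ, psi, psi, e, Km]
  linear_combination ((1 / 2 : ℂ) * k * u g.right.z * Complex.exp (-(2 * Complex.I * g.right.θ)) *
    Complex.exp (Complex.I * k * g.right.θ)) * Complex.I_mul_I

theorem SmoothH.pdH {u : ℍ → ℂ} (hu : SmoothH u) (v : ℂ) : SmoothH (JMF.pdH v u) :=
  (isOp_pdH v).smooth _ hu

theorem SmoothH.mul {u v : ℍ → ℂ} (hu : SmoothH u) (hv : SmoothH v) :
    SmoothH fun z => u z * v z := ContDiffOn.mul hu hv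

theorem SmoothH.const (c : ℂ) : SmoothH fun _ => c := contDiffOn_const

theorem SmoothH.Kp {u : ℍ → ℂ} (hu : SmoothH u) (k : ℝ) : SmoothH (JMF.Kp k u) :=
  ((((SmoothH.const Complex.I).mul smoothH_im).mul (hu.pdH 1)).add
    (smoothH_im.mul (hu.pdH Complex.I))).add ((SmoothH.const (k / 2)).mul hu)

theorem SmoothH.Km {u : ℍ → ℂ} (hu : SmoothH u) (k : ℝ) : SmoothH (JMF.Km k u) :=
  ContDiffOn.sub (((ContDiffOn.mul (ContDiffOn.mul (SmoothH.const Complex.I) smoothH_im)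
    (hu.pdH 1)).neg).add (smoothH_im.mul (hu.pdH Complex.I))) ((SmoothH.const (k / 2)).mul hu)

theorem SmoothH.differentiableAt {F : Type*} [NormedAddCommGroup F] [NormedSpace ℂ F] {u : ℍ → F}
    (hu : SmoothH u) (z : ℍ) :
    DifferentiableAt ℝ (u ∘ fun w : ℂ => ofComplex w) (z : ℂ) :=
  (hu.contDiffAt (isOpen_upperSet.mem_nhds z.im_pos)).differentiableAt (by simp)

theorem pdH_mul {u v : ℍ → ℂ} (hu : SmoothH u) (hv : SmoothH v) (d : ℂ) (z : ℍ) :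
    pdH d (fun z => u z * v z) z = pdH d u z * v z + u z * pdH d v z := by
  have h1 := hu.differentiableAt z
  have h2 := hv.differentiableAt z
  have e : ∀ z : ℍ, ofComplex (z : ℂ) = z := fun z => ofComplex_apply z
  rw [pdH, pd, pdH, pd, pdH, pd, h1.lineDeriv_eq_fderiv, h2.lineDeriv_eq_fderiv,
    show (fun z => u z * v z) ∘ (fun w : ℂ => ofComplex w) = fun w =>
      (u ∘ fun w : ℂ => ofComplex w) w * (v ∘ fun w : ℂ => ofComplex w) w from rfl,
    (h1.fun_mul h2).lineDeriv_eq_fderiv, fderiv_fun_mul h1 h2]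
  simp only [_root_.add_apply, _root_.smul_apply, Function.comp_apply, e, smul_eq_mul]
  ring

theorem pdH_add {u v : ℍ → ℂ} (hu : SmoothH u) (hv : SmoothH v) (d : ℂ) (z : ℍ) :
    pdH d (fun z => u z + v z) z = pdH d u z + pdH d v z :=
  congrFun ((isOp_pdH d).add u v hu hv) z

theorem pdH_const_mul {u : ℍ → ℂ} (hu : SmoothH u) (c d : ℂ) (z : ℍ) :
    pdH d (fun z => c * u z) z = c * pdH d u z :=
  congrFun ((isOp_pdH d).smul c u hu) z

theorem pdH_im (d : ℂ) (z : ℍ) : pdH d (fun z : ℍ => (z.im : ℂ)) z = d.im := by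
  rw [pdH, pd, lineDeriv]
  have h : HasDerivAt (fun t : ℝ => ((z.im + t * d.im : ℝ) : ℂ)) d.im 0 := by
    have : HasDerivAt (fun t : ℝ => z.im + t * d.im) d.im 0 := by
      simpa using ((hasDerivAt_id (0 : ℝ)).mul_const d.im).const_add z.im
    exact this.ofReal_comp
  refine HasDerivAt.deriv (h.congr_of_eventuallyEq ?_)
  have hc : ContinuousAt (fun t : ℝ => (z : ℂ) + t • d) 0 := by fun_prop
  have hmem : ∀ᶠ t : ℝ in 𝓝 0, (z : ℂ) + t • d ∈ upperSet := by
    refine hc.eventually_mem (isOpen_upperSet.mem_nhds ?_)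
    rw [zero_smul, add_zero]
    exact z.im_pos
  filter_upwards [hmem] with t ht
  simp only [Function.comp_apply]
  rw [ofComplex_apply_of_im_pos ht]
  simp

theorem pdH_comm {u : ℍ → ℂ} (hu : SmoothH u) (d e : ℂ) (z : ℍ) :
    pdH d (pdH e u) z = pdH e (pdH d u) z := by
  set F := u ∘ fun w : ℂ => ofComplex w with hF
  have hC : ContDiffAt ℝ ∞ F z := hu.contDiffAt (isOpen_upperSet.mem_nhds z.im_pos)
  have key : ∀ d e : ℂ, pdH d (pdH e u) z = fderiv ℝ (fderiv ℝ F) z d e := by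
    intro d e
    have h1 : (pdH e u) ∘ (fun w : ℂ => ofComplex w) =ᶠ[𝓝 (z : ℂ)] fun w => fderiv ℝ F w e := by
      filter_upwards [isOpen_upperSet.mem_nhds z.im_pos] with w hw
      have hd := hu.differentiableAt ⟨w, hw⟩
      rw [Function.comp_apply, pdH, pd, ofComplex_apply_of_im_pos hw]
      exact hd.lineDeriv_eq_fderiv
    have h2 : DifferentiableAt ℝ (fderiv ℝ F) z :=
      (hC.fderiv_right (m := 1) (by norm_cast)).differentiableAt (by simp)
    have h3 : HasFDerivAt (fun w => fderiv ℝ F w e)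
        ((ContinuousLinearMap.apply ℝ ℂ e).comp (fderiv ℝ (fderiv ℝ F) z)) z :=
      (ContinuousLinearMap.apply ℝ ℂ e).hasFDerivAt.comp (z : ℂ) h2.hasFDerivAt
    rw [pdH, pd, h1.lineDeriv_eq, h3.hasLineDerivAt d |>.lineDeriv]
    rfl
  rw [key, key]
  refine (hC.isSymmSndFDerivAt ?_) d e
  rw [minSmoothness_of_isRCLikeNormedField]
  exact WithTop.coe_le_coe.2 (le_top : (2 : ℕ∞) ≤ ⊤)

/-- The scalar Laplacian of weight `k`. -/
def lap1 (k : ℝ) (u : ℍ → ℂ) (z : ℍ) : ℂ :=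
  -(z.im : ℂ) ^ 2 * pdH 1 (pdH 1 u) z + -(z.im : ℂ) ^ 2 * pdH Complex.I (pdH Complex.I u) z +
    Complex.I * k * z.im * pdH 1 u z

theorem pdH_Kp {u : ℍ → ℂ} (hu : SmoothH u) (k : ℝ) (d : ℂ) (z : ℍ) :
    pdH d (Kp k u) z = Complex.I * (d.im * pdH 1 u z + z.im * pdH d (pdH 1 u) z) +
      (d.im * pdH Complex.I u z + z.im * pdH d (pdH Complex.I u) z) + k / 2 * pdH d u z := by
  have h1 := smoothH_im.mul (hu.pdH 1)
  have h2 := smoothH_im.mul (hu.pdH Complex.I)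
  have e : Kp k u = fun z => (Complex.I * (z.im * pdH 1 u z) + z.im * pdH Complex.I u z) +
      k / 2 * u z := by
    funext z
    rw [Kp]
    ring
  rw [e, pdH_add (u := fun z => Complex.I * (z.im * pdH 1 u z) + z.im * pdH Complex.I u z)
      (((SmoothH.const Complex.I).mul h1).add h2) ((SmoothH.const (k / 2)).mul hu),
    pdH_add ((SmoothH.const Complex.I).mul h1) h2, pdH_const_mul h1, pdH_const_mul hu,
    pdH_mul smoothH_im (hu.pdH 1), pdH_mul smoothH_im (hu.pdH Complex.I), pdH_im]

theorem pdH_Km {u : ℍ → ℂ} (hu : SmoothH u) (k : ℝ) (d : ℂ) (z : ℍ) :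
    pdH d (Km k u) z = -Complex.I * (d.im * pdH 1 u z + z.im * pdH d (pdH 1 u) z) +
      (d.im * pdH Complex.I u z + z.im * pdH d (pdH Complex.I u) z) + -(k / 2) * pdH d u z := by
  have h1 := smoothH_im.mul (hu.pdH 1)
  have h2 := smoothH_im.mul (hu.pdH Complex.I)
  have e : Km k u = fun z => (-Complex.I * (z.im * pdH 1 u z) + z.im * pdH Complex.I u z) +
      -(k / 2) * u z := by
    funext z
    rw [Km]
    ring
  rw [e, pdH_add (u := fun z => -Complex.I * (z.im * pdH 1 u z) + z.im * pdH Complex.I u z)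
      (((SmoothH.const (-Complex.I)).mul h1).add h2)
      ((SmoothH.const (-(k / 2))).mul hu),
    pdH_add ((SmoothH.const (-Complex.I)).mul h1) h2, pdH_const_mul h1, pdH_const_mul hu,
    pdH_mul smoothH_im (hu.pdH 1), pdH_mul smoothH_im (hu.pdH Complex.I), pdH_im]

/-- The mixed second derivatives cancel by symmetry. The first order terms left over form the drift
i k y ∂_x of the Laplacian. -/
theorem Km_Kp {u : ℍ → ℂ} (hu : SmoothH u) (k : ℝ) (z : ℍ) :
    Km (k + 2) (Kp k u) z = -lap1 k u z - k / 2 * (k / 2 + 1) * u z := by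
  rw [Km, pdH_Kp hu, pdH_Kp hu, pdH_comm hu Complex.I 1, lap1, Kp]
  simp only [Complex.one_im, Complex.I_im, Complex.ofReal_zero, Complex.ofReal_one]
  push_cast
  linear_combination (-(z.im : ℂ) ^ 2 * pdH 1 (pdH 1 u) z) * Complex.I_mul_I

theorem Kp_Km {u : ℍ → ℂ} (hu : SmoothH u) (k : ℝ) (z : ℍ) :
    Kp (k - 2) (Km k u) z = -lap1 k u z - k / 2 * (k / 2 - 1) * u z := by
  rw [Kp, pdH_Km hu, pdH_Km hu, pdH_comm hu Complex.I 1, lap1, Km]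
  simp only [Complex.one_im, Complex.I_im, Complex.ofReal_zero, Complex.ofReal_one]
  push_cast
  linear_combination (-(z.im : ℂ) ^ 2 * pdH 1 (pdH 1 u) z) * Complex.I_mul_I

theorem Dp_theta_psi {m : ℕ} (hm : 1 ≤ m) (j : ℤ) (k : ℝ) {u : ℍ → ℂ} (hu : SmoothH u) :
    Dp m (fun g => theta m j g * psi k u g.right) =
      fun g => theta m j g * psi (k + 2) (Kp k u) g.right := by
  rw [Dp_mul_right m (smoothJ_theta hm j) (smoothJ_psi k hu), Dp_theta hm, Xp_psi]
  simp

theorem Dm_theta_psi {m : ℕ} (hm : 1 ≤ m) (j : ℤ) (k : ℝ) {u : ℍ → ℂ} (hu : SmoothH u) :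
    Dm m (fun g => theta m j g * psi k u g.right) =
      fun g => theta m j g * psi (k - 2) (Km k u) g.right := by
  rw [Dm_mul_right m (smoothJ_theta hm j) (smoothJ_psi k hu), Dm_theta hm, Xm_psi]
  simp

/-! ### Operators on sums of theta functions -/

/-- The operators are additive on smooth functions only, so the induction has to carry smoothness of
the partial sums. -/
theorem IsOp.sum_apply {E F α : Type*} [NormedAddCommGroup E] [NormedSpace ℝ E]
    [NormedAddCommGroup F] [NormedSpace ℂ F] {ψ : E → α} {U : Set E} {D : (α → F) → α → F}
    (h : IsOp ψ U D) {ι : Type*} (s : Finset ι) {f : ι → α → F} (hf : ∀ i ∈ s, Smooth ψ U (f i)) :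
    D (∑ i ∈ s, f i) = ∑ i ∈ s, D (f i) ∧ Smooth ψ U (∑ i ∈ s, f i) := by
  classical
  induction s using Finset.induction_on with
  | empty => exact ⟨by simpa using h.smul 0 0 Smooth.zero, Smooth.zero⟩
  | insert a s ha ih =>
    obtain ⟨h1, h2⟩ := ih fun i hi => hf i (Finset.mem_insert_of_mem hi)
    have h3 := hf a (Finset.mem_insert_self a s)
    rw [Finset.sum_insert ha, Finset.sum_insert ha, h.add _ _ h3 h2, h1]
    exact ⟨rfl, h3.add h2⟩

/-- The function with theta components `u`. -/
def synth (m : ℕ) (k : ℝ) (u : ℍ → Fin (2 * m) → ℂ) (g : TGJ) : ℂ :=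
  ∑ j : Fin (2 * m), theta m ((j : ℕ) + 1) g * Psi k u g.right j

theorem synth_eq_sum (m : ℕ) (k : ℝ) (u : ℍ → Fin (2 * m) → ℂ) :
    synth m k u = ∑ j : Fin (2 * m), fun g : TGJ =>
      theta m ((j : ℕ) + 1) g * psi k (fun z => u z j) g.right := by
  funext g
  rw [Finset.sum_apply]
  rfl

theorem SmoothH.apply {n : ℕ} {u : ℍ → Fin n → ℂ} (hu : SmoothH u) (j : Fin n) :
    SmoothH fun z => u z j := (contDiffOn_pi.1 hu) j

theorem smoothJ_theta_psi {m : ℕ} (hm : 1 ≤ m) (j : ℤ) (k : ℝ) {u : ℍ → ℂ} (hu : SmoothH u) :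
    SmoothJ fun g => theta m j g * psi k u g.right := (smoothJ_theta hm j).mul (smoothJ_psi k hu)

theorem smoothJ_synth {m : ℕ} (hm : 1 ≤ m) (k : ℝ) {u : ℍ → Fin (2 * m) → ℂ} (hu : SmoothH u) :
    SmoothJ (synth m k u) := by
  rw [synth_eq_sum]
  exact (IsOp.id.sum_apply _ fun j _ => smoothJ_theta_psi hm _ k (hu.apply j)).2

/-- Since D_+ annihilates theta functions, they act as constants here: D_+ becomes the raising
operator on each coefficient. -/
theorem Dp_synth {m : ℕ} (hm : 1 ≤ m) (k : ℝ) {u : ℍ → Fin (2 * m) → ℂ} (hu : SmoothH u) :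
    Dp m (synth m k u) = synth m (k + 2) fun z j => Kp k (fun z => u z j) z := by
  rw [synth_eq_sum, synth_eq_sum, ((isOp_Dp m).sum_apply _ fun j _ =>
    smoothJ_theta_psi hm _ k (hu.apply j)).1]
  exact Finset.sum_congr rfl fun j _ => Dp_theta_psi hm _ k (hu.apply j)

theorem Dm_synth {m : ℕ} (hm : 1 ≤ m) (k : ℝ) {u : ℍ → Fin (2 * m) → ℂ} (hu : SmoothH u) :
    Dm m (synth m k u) = synth m (k - 2) fun z j => Km k (fun z => u z j) z := by
  rw [synth_eq_sum, synth_eq_sum, ((isOp_Dm m).sum_apply _ fun j _ =>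
    smoothJ_theta_psi hm _ k (hu.apply j)).1]
  exact Finset.sum_congr rfl fun j _ => Dm_theta_psi hm _ k (hu.apply j)

theorem Ym_synth {m : ℕ} (hm : 1 ≤ m) (k : ℝ) {u : ℍ → Fin (2 * m) → ℂ} (hu : SmoothH u) :
    Ym (synth m k u) = 0 := by
  rw [synth_eq_sum, (isOp_Ym.sum_apply _ fun j _ => smoothJ_theta_psi hm _ k (hu.apply j)).1]
  refine Finset.sum_eq_zero fun j _ => ?_
  rw [Ym_mul_right, Ym_theta hm]
  funext g
  simp

theorem pdH_apply {n : ℕ} {u : ℍ → Fin n → ℂ} (hu : SmoothH u) (d : ℂ) (z : ℍ) (j : Fin n) :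
    pdH d u z j = pdH d (fun z => u z j) z := by
  have h := hu.differentiableAt z
  have h' := (hu.apply j).differentiableAt z
  rw [pdH, pdH, pd, pd, h.lineDeriv_eq_fderiv, h'.lineDeriv_eq_fderiv]
  have := (hasFDerivAt_pi'.1 h.hasFDerivAt j).fderiv
  exact congrArg (fun L : ℂ →L[ℝ] ℂ => L d) this.symm

theorem lapl_apply {n : ℕ} (k : ℝ) {u : ℍ → Fin n → ℂ} (hu : SmoothH u) (z : ℍ) (j : Fin n) :
    lapl k u z j = lap1 k (fun z => u z j) z := by
  have h1 : ∀ d : ℂ, SmoothH (pdH d u) := fun d => (isOp_pdH d).smooth _ hu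
  simp only [lapl, Pi.add_apply, Pi.smul_apply, smul_eq_mul, pdH_apply (h1 _), pdH_apply hu, lap1]

theorem Dm_Dp_synth {m : ℕ} (hm : 1 ≤ m) (k : ℝ) {u : ℍ → Fin (2 * m) → ℂ} (hu : SmoothH u) :
    Dm m (Dp m (synth m k u)) =
      synth m k (-lapl k u - ((k / 2 * (k / 2 + 1) : ℝ) : ℂ) • u) := by
  have hu' : SmoothH fun z j => Kp k (fun z => u z j) z :=
    contDiffOn_pi.2 fun j => (hu.apply j).Kp k
  rw [Dp_synth hm k hu, Dm_synth hm _ hu', add_sub_cancel_right]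
  congr 1
  funext z j
  rw [Km_Kp (hu.apply j)]
  simp [lapl_apply k hu]

theorem Dp_Dm_synth {m : ℕ} (hm : 1 ≤ m) (k : ℝ) {u : ℍ → Fin (2 * m) → ℂ} (hu : SmoothH u) :
    Dp m (Dm m (synth m k u)) =
      synth m k (-lapl k u - ((k / 2 * (k / 2 - 1) : ℝ) : ℂ) • u) := by
  have hu' : SmoothH fun z j => Km k (fun z => u z j) z :=
    contDiffOn_pi.2 fun j => (hu.apply j).Km k
  rw [Dm_synth hm k hu, Dp_synth hm _ hu', sub_add_cancel]
  congr 1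
  funext z j
  rw [Kp_Km (hu.apply j)]
  simp [lapl_apply k hu]

theorem synth_smul (m : ℕ) (k : ℝ) (c : ℂ) (u : ℍ → Fin (2 * m) → ℂ) :
    synth m k (c • u) = c • synth m k u := by
  funext g
  simp only [synth, Psi, Pi.smul_apply, smul_eq_mul, Finset.mul_sum]
  exact Finset.sum_congr rfl fun j _ => by ring

theorem synth_add (m : ℕ) (k : ℝ) (u v : ℍ → Fin (2 * m) → ℂ) :
    synth m k (u + v) = synth m k u + synth m k v := by
  funext g
  simp only [synth, Psi, Pi.smul_apply, Pi.add_apply, smul_eq_mul, mul_add, Finset.sum_add_distrib]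

/-! ### Transformation of theta functions -/

theorem hJ_mul (p q r : ℝ) (g : TGJ) : hJ p q r * g =
    ⟨⟨p + g.left.x, q + g.left.y, r + g.left.r + p * g.left.y - g.left.x * q⟩, g.right⟩ := by
  apply SemidirectProduct.ext
  · change (⟨p, q, r⟩ : Heis) * Heis.act (TG.pr 1)⁻¹ g.left = _
    rw [TG.pr_one, inv_one, Heis.act_one, Heis.mul_def]
  · change 1 * g.right = _
    rw [one_mul]

theorem hJ_mul_gJ (p q r : ℝ) (g : TG) : hJ p q r * gJ g = ⟨⟨p, q, r⟩, g⟩ := by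
  rw [hJ_mul]
  change (⟨⟨p + 0, q + 0, r + 0 + p * 0 - 0 * q⟩, g⟩ : TGJ) = _
  simp

theorem gJ_mul (x : TG) (g : TGJ) : gJ x * g = ⟨Heis.act (x.pr)⁻¹ g.left, x * g.right⟩ := by
  apply SemidirectProduct.ext
  · change 1 * Heis.act (x.pr)⁻¹ g.left = _
    rw [one_mul]
  · rfl

theorem gJ_mul_gJ (x y : TG) : gJ x * gJ y = gJ (x * y) := (map_mul SemidirectProduct.inr x y).symm

theorem gJ_tEl_mul (g : TGJ) : gJ tEl * g =
    ⟨⟨g.left.x, g.left.y - g.left.x, g.left.r⟩, tEl * g.right⟩ := by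
  rw [gJ_mul, ← sec_T, pr_sec]
  congr 1
  ext <;> simp [Heis.act, Matrix.SpecialLinearGroup.coe_inv, Matrix.adjugate_fin_two,
    ModularGroup.coe_T]
  ring

theorem gJ_sEl_mul (g : TGJ) : gJ sEl * g =
    ⟨⟨-g.left.y, g.left.x, g.left.r⟩, sEl * g.right⟩ := by
  rw [gJ_mul, ← sec_S, pr_sec]
  congr 1
  ext <;> simp [Heis.act, Matrix.SpecialLinearGroup.coe_inv, Matrix.adjugate_fin_two,
    ModularGroup.coe_S]

theorem gJ_kT_mul (n : ℤ) (g : TGJ) : gJ (kT (n * (2 * Real.pi))) * g =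
    ⟨g.left, ⟨g.right.z, g.right.θ + n * (2 * Real.pi)⟩⟩ := by
  rw [gJ_mul, TG.pr_kT_two_pi, inv_one, Heis.act_one, TG.kT_two_pi_mul]

/-- The term of the theta function that belongs to `α`. -/
def thT (m : ℕ) (α : ℝ) (g : TGJ) : ℂ :=
  (g.right.z.im ^ (1 / 4 : ℝ) : ℝ) * Complex.exp (Complex.I * g.right.θ / 2 +
    2 * Real.pi * Complex.I * m * (g.left.r + g.left.y * (2 * α + g.left.x) +
      g.right.z * (g.left.x + α) ^ 2))

theorem theta_eq_tsum (m : ℕ) (j : ℤ) (g : TGJ) :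
    theta m j g = ∑' n : ℤ, thT m ((j : ℝ) / (2 * m) + n) g := by
  rw [theta, thetaHeis]
  refine tsum_congr fun n => ?_
  rw [phiJ, thT]
  have e : ∀ A B C D Y : ℂ, A + B + C = D →
      Complex.exp B * (Y * Complex.exp A * Complex.exp C) = Y * Complex.exp D := by
    rintro A B C D Y rfl
    rw [Complex.exp_add, Complex.exp_add]
    ring
  apply e
  push_cast
  ring

theorem thT_eq_term (m : ℕ) (β : ℝ) (n : ℤ) (g : TGJ) :
    thT m (β + n) g = ((g.right.z.im ^ (1 / 4 : ℝ) : ℝ) * Complex.exp (thX m β (toCoord g))) *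
      jacobiTheta₂_term n (thZ m β (toCoord g)) (2 * m * g.right.z) := by
  rw [thT, jacobiTheta₂_term, thX, thZ, mul_assoc _ (Complex.exp _), ← Complex.exp_add]
  simp only [toCoord]
  congr 2
  push_cast
  ring

theorem summable_thT {m : ℕ} (hm : 1 ≤ m) (β : ℝ) (g : TGJ) :
    Summable fun n : ℤ => thT m (β + n) g := by
  simp only [thT_eq_term]
  refine Summable.mul_left _ ?_
  rw [summable_jacobiTheta₂_term_iff]
  exact two_m_mul_im_pos hm g.right.z.im_pos

theorem norm_thT (m : ℕ) (α : ℝ) (g : TGJ) : ‖thT m α g‖ =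
    g.right.z.im ^ (1 / 4 : ℝ) * Real.exp
        (-(2 * Real.pi * m * g.right.z.im * (g.left.x + α) ^ 2)) := by
  rw [thT, norm_mul, Complex.norm_real, Real.norm_eq_abs,
    abs_of_nonneg (Real.rpow_nonneg g.right.z.im_pos.le _), Complex.norm_exp]
  congr 2
  have e : Complex.I * g.right.θ / 2 + 2 * Real.pi * Complex.I * m *
      (g.left.r + g.left.y * (2 * α + g.left.x) + g.right.z * (g.left.x + α) ^ 2) =
      ((g.right.θ / 2 + 2 * Real.pi * m * (g.left.r + g.left.y * (2 * α + g.left.x)) : ℝ) : ℂ) *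
        Complex.I + ((2 * Real.pi * m * (g.left.x + α) ^ 2 : ℝ) : ℂ) * (g.right.z * Complex.I) := by
    push_cast
    ring
  rw [e, Complex.add_re, Complex.re_ofReal_mul, Complex.re_ofReal_mul, Complex.mul_I_re]
  simp
  ring

/-- Congruences of phases below take this form: a polynomial identity with an explicit integer N. -/
theorem exp_eq_of_int {x y : ℂ} (N : ℤ) (h : x = y + N * (2 * Real.pi * Complex.I)) :
    Complex.exp x = Complex.exp y := by
  rw [h, Complex.exp_add, Complex.exp_int_mul_two_pi_mul_I, mul_one]

theorem theta_heis {m : ℕ} (hm : 1 ≤ m) (j l μ κ : ℤ) (g : TGJ) :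
    theta m j (hJ l μ κ * g) = theta m j g := by
  have hm0 : (m : ℂ) ≠ 0 := by exact_mod_cast (by omega : m ≠ 0)
  rw [theta_eq_tsum, theta_eq_tsum, 
    -- Translation of p by l is absorbed by the shift n ↦ n + l of the summation index.
    ← (Equiv.addRight l).tsum_eq (fun n : ℤ => thT m ((j : ℝ) / (2 * m) + n) g)]
  refine tsum_congr fun n => ?_
  rw [hJ_mul, thT, thT]
  congr 1
  refine exp_eq_of_int (m * κ + (j + 2 * m * n) * μ + m * μ * l) ?_
  simp only [Equiv.coe_addRight]
  push_cast
  field_simp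
  ring

/-- Replacing (q, τ) by (q - p, τ + 1) adds mα² to the exponent over 2πi, and mα² is congruent to
j²/4m modulo 1. -/
theorem theta_tEl {m : ℕ} (hm : 1 ≤ m) (j : ℤ) (g : TGJ) :
    theta m j (gJ tEl * g) = Complex.exp (Real.pi * Complex.I * j ^ 2 / (2 * m)) * theta m j g := by
  have hm0 : (m : ℂ) ≠ 0 := by exact_mod_cast (by omega : m ≠ 0)
  rw [theta_eq_tsum, theta_eq_tsum, ← tsum_mul_left]
  refine tsum_congr fun n => ?_
  rw [gJ_tEl_mul, thT, thT]
  simp only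
  obtain ⟨h1, h2⟩ := tEl_mul g.right
  rw [h1, h2]
  have e1 : ((ModularGroup.T • g.right.z : ℍ) : ℂ) = g.right.z + 1 := by
    rw [UpperHalfPlane.modular_T_smul]
    simp [add_comm]
  have e2 : (ModularGroup.T • g.right.z : ℍ).im = g.right.z.im := by
    rw [UpperHalfPlane.modular_T_smul]
    simp
  rw [e1, e2, mul_left_comm]
  congr 1
  rw [← Complex.exp_add]
  refine exp_eq_of_int (j * n + m * n ^ 2) ?_
  push_cast
  field_simp
  ring

theorem theta_kT (m : ℕ) (j : ℤ) (h : Heis) (z : ℍ) (θ t : ℝ) :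
    theta m j ⟨h, ⟨z, θ + t⟩⟩ = Complex.exp (Complex.I * t / 2) * theta m j ⟨h, ⟨z, θ⟩⟩ := by
  rw [theta_eq_tsum, theta_eq_tsum, ← tsum_mul_left]
  refine tsum_congr fun n => ?_
  rw [thT, thT, mul_left_comm, ← Complex.exp_add]
  congr 2
  push_cast
  ring

/-- Summation over the residue classes `1, …, 2m`. -/
theorem tsum_int_eq_sum {m : ℕ} (hm : 1 ≤ m) {F : ℤ → ℂ} (hF : Summable F) :
    ∑' N : ℤ, F N = ∑ j : Fin (2 * m), ∑' l : ℤ, F ((j : ℕ) + 1 + 2 * m * l) := by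
  have : NeZero (2 * m) := ⟨by omega⟩
  let e : Fin (2 * m) × ℤ ≃ ℤ :=
    ((Equiv.prodComm _ _).trans (Int.divModEquiv (2 * m)).symm).trans (Equiv.addRight 1)
  have he : ∀ x : Fin (2 * m) × ℤ, e x = (x.1 : ℕ) + 1 + 2 * m * x.2 := by
    intro x
    simp only [e, Equiv.trans_apply, Equiv.prodComm_apply, Int.divModEquiv_symm_apply,
      Equiv.coe_addRight, Prod.fst_swap, Prod.snd_swap]
    push_cast
    ring
  have hs : Summable fun x => F (e x) := (e.summable_iff (f := F)).2 hF
  rw [← e.tsum_eq, hs.tsum_prod, tsum_fintype]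
  simp only [he]

/-- The functional equation of the Jacobi theta function turns the sum over α in j/2m + ℤ into a sum
over all N/2m. Splitting N modulo 2m yields every theta function, with the phase of j j'. -/
theorem theta_sEl {m : ℕ} (hm : 1 ≤ m) (j : ℤ) (g : TGJ) :
    theta m j (gJ sEl * g) = ∑ j' : Fin (2 * m), (((√(2 * m : ℝ))⁻¹ : ℝ) *
      Complex.exp (Real.pi * Complex.I * (-(1 / 4) - j * ((j' : ℕ) + 1) / m))) *
        theta m ((j' : ℕ) + 1) g := by
  have hm0 : (m : ℂ) ≠ 0 := by exact_mod_cast (by omega : m ≠ 0)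
  have hmR : (0 : ℝ) < 2 * m := by have : 0 < m := hm; positivity
  obtain ⟨⟨x, y, r⟩, ⟨τ, θ⟩⟩ := g
  have hτ0 : (τ : ℂ) ≠ 0 := τ.ne_zero
  have hn : 0 < ‖(τ : ℂ)‖ := norm_pos_iff.2 hτ0
  set β : ℝ := (j : ℝ) / (2 * m) with hβ
  have hβ' : (β : ℂ) = j / (2 * m) := by rw [hβ]; push_cast; rfl
  -- Chosen so that -1/τ₁ = 2m(-1/τ) is the modulus, and z₁/τ₁ the elliptic variable, of the theta
  -- function at s g.
  set τ₁ : ℂ := τ / (2 * m) with hτ₁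
  set z₁ : ℂ := τ * x + y - β with hz₁
  obtain ⟨h1, h2⟩ := sEl_mul (⟨τ, θ⟩ : TG)
  simp only at h1 h2
  have hτ₁im : 0 < τ₁.im := by
    rw [hτ₁, show (2 * m : ℂ) = ((2 * m : ℝ) : ℂ) by push_cast; rfl, Complex.div_ofReal_im]
    exact div_pos τ.im_pos hmR
  have hfun := jacobiTheta₂_functional_equation z₁ τ₁
  have hτ₁0 : τ₁ ≠ 0 := div_ne_zero hτ0 (by simpa using hm0)
  have hsq : (-Complex.I * τ₁) ^ (1 / 2 : ℂ) ≠ 0 := by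
    rw [Complex.cpow_def_of_ne_zero (mul_ne_zero (neg_ne_zero.2 Complex.I_ne_zero) hτ₁0)]
    exact Complex.exp_ne_zero _
  have hfun' : jacobiTheta₂ (z₁ / τ₁) (-1 / τ₁) = (-Complex.I * τ₁) ^ (1 / 2 : ℂ) *
      Complex.exp (Real.pi * Complex.I * z₁ ^ 2 / τ₁) * jacobiTheta₂ z₁ τ₁ := by
    rw [hfun]
    have e : Complex.exp (Real.pi * Complex.I * z₁ ^ 2 / τ₁) *
        Complex.exp (-Real.pi * Complex.I * z₁ ^ 2 / τ₁) = 1 := by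
      rw [← Complex.exp_add, ← Complex.exp_zero]
      congr 1
      ring
    have e2 : (-Complex.I * τ₁) ^ (1 / 2 : ℂ) * (1 / (-Complex.I * τ₁) ^ (1 / 2 : ℂ)) = 1 :=
      mul_one_div_cancel hsq
    linear_combination (-jacobiTheta₂ (z₁ / τ₁) (-1 / τ₁)) * e2 * 1 +
      (-((-Complex.I * τ₁) ^ (1 / 2 : ℂ) * (1 / (-Complex.I * τ₁) ^ (1 / 2 : ℂ)) *
        jacobiTheta₂ (z₁ / τ₁) (-1 / τ₁))) * e
  have hleft : theta m j (gJ sEl * ⟨⟨x, y, r⟩, ⟨τ, θ⟩⟩) =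
      (((τ.im / ‖(τ : ℂ)‖ ^ 2) ^ (1 / 4 : ℝ) : ℝ) * Complex.exp
          (Complex.I * (θ - (τ : ℂ).arg : ℝ) / 2 +
        2 * Real.pi * Complex.I * m * (r + x * (2 * β - y) + (-1 / τ) * (-y + β) ^ 2))) *
      jacobiTheta₂ (z₁ / τ₁) (-1 / τ₁) := by
    rw [theta_eq_tsum, ← hβ, jacobiTheta₂, ← tsum_mul_left]
    refine tsum_congr fun n => ?_
    rw [gJ_sEl_mul, thT_eq_term, thX, thZ]
    simp only [toCoord]
    rw [h1, h2, coe_S_smul, im_S_smul]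
    congr 2
    · congr 1
      push_cast
      ring
    · simp only [hz₁, hτ₁]
      push_cast
      field_simp
      ring
    · simp only [hτ₁]
      field_simp
  -- The square root in the functional equation compensates the change of y^{1/4} and of the angle.
  -- What is left is (2m)^{-1/2} e^{-πi/4}.
  have hscal : (((τ.im / ‖(τ : ℂ)‖ ^ 2) ^ (1 / 4 : ℝ) : ℝ) : ℂ) * (-Complex.I * τ₁) ^ (1 / 2 : ℂ) *
      Complex.exp (-(Complex.I * (τ : ℂ).arg / 2)) =
      ((τ.im ^ (1 / 4 : ℝ) : ℝ) : ℂ) * ((√(2 * m : ℝ))⁻¹ : ℝ) *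
        Complex.exp (-(Real.pi * Complex.I / 4)) := by
    have e1 : -Complex.I * τ₁ = ((‖(τ : ℂ)‖ / (2 * m) : ℝ) : ℂ) *
        (Complex.cos (((τ : ℂ).arg - Real.pi / 2 : ℝ)) +
          Complex.sin (((τ : ℂ).arg - Real.pi / 2 : ℝ)) * Complex.I) := by
      rw [← Complex.exp_mul_I]
      have : Complex.exp ((((τ : ℂ).arg - Real.pi / 2 : ℝ) : ℂ) * Complex.I) =
          Complex.exp ((τ : ℂ).arg * Complex.I) * -Complex.I := by
        rw [← Complex.exp_neg_pi_div_two_mul_I, ← Complex.exp_add]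
        congr 1
        push_cast
        ring
      rw [this]
      have h3 := Complex.norm_mul_exp_arg_mul_I (τ : ℂ)
      rw [hτ₁]
      conv_lhs => rw [← h3]
      push_cast
      ring
    have harg0 : 0 < (τ : ℂ).arg := by
      have h4 : 0 ≤ (τ : ℂ).arg := Complex.arg_nonneg_iff.2 τ.im_pos.le
      refine lt_of_le_of_ne h4 fun h5 => ?_
      exact τ.im_pos.ne' (Complex.arg_eq_zero_iff.1 h5.symm).2
    have e2 : (-Complex.I * τ₁) ^ (1 / 2 : ℂ) = ((√‖(τ : ℂ)‖ * (√(2 * m : ℝ))⁻¹ : ℝ) : ℂ) *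
        Complex.exp (Complex.I * (τ : ℂ).arg / 2 - Real.pi * Complex.I / 4) := by
      have hpos : 0 < ‖(τ : ℂ)‖ / (2 * m) := div_pos hn hmR
      rw [Complex.cpow_def_of_ne_zero (mul_ne_zero (neg_ne_zero.2 Complex.I_ne_zero) hτ₁0),
        Complex.log, e1, Complex.arg_mul_cos_add_sin_mul_I hpos
          ⟨by linarith [Real.pi_pos], by linarith [Complex.arg_le_pi (τ : ℂ), Real.pi_pos]⟩,
        ← Complex.exp_mul_I, norm_mul, Complex.norm_exp_ofReal_mul_I, mul_one, Complex.norm_real,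
        Real.norm_eq_abs, abs_of_pos hpos]
      have e3 : √‖(τ : ℂ)‖ * (√(2 * m : ℝ))⁻¹ = Real.exp
          (Real.log (‖(τ : ℂ)‖ / (2 * m)) * (1 / 2)) := by
        rw [← Real.rpow_def_of_pos hpos, ← Real.sqrt_eq_rpow, Real.sqrt_div hn.le, div_eq_mul_inv]
      rw [e3, Complex.ofReal_exp, ← Complex.exp_add]
      congr 1
      push_cast
      ring
    have e4 : (τ.im / ‖(τ : ℂ)‖ ^ 2) ^ (1 / 4 : ℝ) * √‖(τ : ℂ)‖ = τ.im ^ (1 / 4 : ℝ) := by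
      rw [Real.div_rpow τ.im_pos.le (by positivity), ← Real.rpow_natCast, ← Real.rpow_mul hn.le,
        Real.sqrt_eq_rpow, show ((2 : ℕ) : ℝ) * (1 / 4) = 1 / 2 by norm_num,
        div_mul_cancel₀ _ (Real.rpow_pos_of_pos hn _).ne']
    rw [e2, ← e4, Complex.exp_sub, Complex.exp_neg, Complex.exp_neg]
    have := Complex.exp_ne_zero (Complex.I * (τ : ℂ).arg / 2)
    push_cast
    field_simp
  rw [hleft, hfun', jacobiTheta₂, tsum_int_eq_sum hm
      ((summable_jacobiTheta₂_term_iff z₁ τ₁).2 hτ₁im),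
    Finset.mul_sum, Finset.mul_sum]
  refine Finset.sum_congr rfl fun j' _ => ?_
  rw [theta_eq_tsum, ← tsum_mul_left, ← tsum_mul_left, ← tsum_mul_left]
  refine tsum_congr fun l => ?_
  rw [jacobiTheta₂_term, thT]
  simp only
  -- Completed squares on both sides; they differ by e^{-2πi j l}, which is 1.
  have hexp : Complex.exp (Complex.I * (θ - (τ : ℂ).arg : ℝ) / 2 +
        2 * Real.pi * Complex.I * m * (r + x * (2 * β - y) + (-1 / τ) * (-y + β) ^ 2)) *
      Complex.exp (Real.pi * Complex.I * z₁ ^ 2 / τ₁) *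
      Complex.exp (2 * Real.pi * Complex.I * (((j' : ℕ) + 1 + 2 * m * l : ℤ) : ℂ) * z₁ +
        Real.pi * Complex.I * (((j' : ℕ) + 1 + 2 * m * l : ℤ) : ℂ) ^ 2 * τ₁) =
      Complex.exp (-(Complex.I * (τ : ℂ).arg / 2)) *
      (Complex.exp (Real.pi * Complex.I * (-(j * ((j' : ℕ) + 1) / m))) *
      Complex.exp (Complex.I * θ / 2 + 2 * Real.pi * Complex.I * m *
        (r + y * (2 * (((((j' : ℕ) + 1 : ℤ) : ℝ) / (2 * m) + l : ℝ) : ℂ) + x) +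
          τ * (x + (((((j' : ℕ) + 1 : ℤ) : ℝ) / (2 * m) + l : ℝ) : ℂ)) ^ 2))) := by
    simp only [← Complex.exp_add]
    refine exp_eq_of_int (-(j * l)) ?_
    simp only [hz₁, hτ₁, hβ']
    push_cast
    field_simp
    ring
  have hfin : Complex.exp (Real.pi * Complex.I * (-(1 / 4) - j * ((j' : ℕ) + 1) / m)) =
      Complex.exp (-(Real.pi * Complex.I / 4)) *
        Complex.exp (Real.pi * Complex.I * (-(j * ((j' : ℕ) + 1) / m))) := by
    rw [← Complex.exp_add]
    congr 1
    ring
  rw [hfin]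
  linear_combination ((((τ.im / ‖(τ : ℂ)‖ ^ 2) ^ (1 / 4 : ℝ) : ℝ) : ℂ) *
    (-Complex.I * τ₁) ^ (1 / 2 : ℂ)) * hexp + (Complex.exp (Real.pi * Complex.I *
      (-(j * ((j' : ℕ) + 1) / m))) * Complex.exp (Complex.I * θ / 2 + 2 * Real.pi * Complex.I * m *
        (r + y * (2 * (((((j' : ℕ) + 1 : ℤ) : ℝ) / (2 * m) + l : ℝ) : ℂ) + x) +
          τ * (x + (((((j' : ℕ) + 1 : ℤ) : ℝ) / (2 * m) + l : ℝ) : ℂ)) ^ 2))) * hscal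

/-! ### Fourier coefficients in the Heisenberg variable -/

theorem continuous_toCoord : Continuous toCoord := by
  have h1 : Continuous fun g : TGJ => (g.left, g.right) := continuous_induced_dom
  have h2 : Continuous fun h : Heis => (h.x, h.y, h.r) := continuous_induced_dom
  have h3 : Continuous fun g : TG => (g.z, g.θ) := continuous_induced_dom
  have hl := h2.comp h1.fst
  have hr := h3.comp h1.snd
  exact hl.fst.prodMk (hl.snd.fst.prodMk (hl.snd.snd.prodMk
    ((UpperHalfPlane.continuous_coe.comp hr.fst).prodMk hr.snd)))

theorem SmoothJ.continuous {f : TGJ → ℂ} (hf : SmoothJ f) : Continuous f := by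
  have h : f = (f ∘ ofCoord) ∘ toCoord := by
    funext g
    simp only [Function.comp_apply, ofCoord_toCoord]
  rw [h]
  exact (ContDiffOn.continuousOn hf).comp_continuous continuous_toCoord toCoord_mem

theorem continuous_mk_heis : Continuous fun v : (ℝ × ℝ × ℝ) × TG =>
    (⟨⟨v.1.1, v.1.2.1, v.1.2.2⟩, v.2⟩ : TGJ) := by
  refine continuous_induced_rng.2 ?_
  refine Continuous.prodMk ?_ continuous_snd
  refine continuous_induced_rng.2 ?_
  exact continuous_fst

theorem SmoothJ.continuous_heis {f : TGJ → ℂ} (hf : SmoothJ f) (p r : ℝ) (g : TG) :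
    Continuous fun q : ℝ => f ⟨⟨p, q, r⟩, g⟩ :=
  hf.continuous.comp (continuous_mk_heis.comp (f := fun q : ℝ => ((p, q, r), g)) (by fun_prop))

/-- The coefficient of index `i` in the theta decomposition of `f`, up to a scalar function. -/
def ext (m : ℕ) (i : ℤ) (f : TGJ → ℂ) (g : TG) : ℂ :=
  ∫ q in (0 : ℝ)..1, f ⟨⟨-(i / (2 * m)), q, 0⟩, g⟩ * Complex.exp (-(Real.pi * Complex.I * i * q))

theorem integral_exp_two_pi (N : ℤ) :
    ∫ q in (0 : ℝ)..1, Complex.exp (2 * Real.pi * Complex.I * N * q) = if N = 0 then 1 else 0 := by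
  split_ifs with h
  · simp [h]
  · have hc : (2 * Real.pi * Complex.I * N : ℂ) ≠ 0 :=
      mul_ne_zero Complex.two_pi_I_ne_zero (by exact_mod_cast h)
    rw [integral_exp_mul_complex hc]
    have : Complex.exp (2 * Real.pi * Complex.I * N * (1 : ℝ)) = Complex.exp 0 :=
      exp_eq_of_int N (by push_cast; ring)
    rw [this]
    simp

/-- The scalar function `y^{1/4} e^{iθ/2}`. -/
def wt (g : TG) : ℂ := (g.z.im ^ (1 / 4 : ℝ) : ℝ) * Complex.exp (Complex.I * g.θ / 2)

theorem wt_ne_zero (g : TG) : wt g ≠ 0 :=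
  mul_ne_zero (by exact_mod_cast (Real.rpow_pos_of_pos g.z.im_pos _).ne') (Complex.exp_ne_zero _)

/-- At p = -i/2m the term of index α = i/2m has Gaussian factor 1 and phase e^{πi·i·q} (the
subscript i stands for the shifted index). Multiplied by the kernel of `ext`, the term of index j/2m
+ n has frequency j - i + 2mn, so the integral keeps one term at most. -/
theorem ext_theta {m : ℕ} (hm : 1 ≤ m) (i j : Fin (2 * m)) (g : TG) :
    ext m ((i : ℕ) + 1) (theta m ((j : ℕ) + 1)) g = if i = j then wt g else 0 := by
  have hm0 : (m : ℂ) ≠ 0 := by exact_mod_cast (by omega : m ≠ 0)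
  set p : ℝ := -((((i : ℕ) + 1 : ℤ) : ℝ) / (2 * m)) with hp
  set β : ℝ := (((j : ℕ) + 1 : ℤ) : ℝ) / (2 * m) with hβ
  have hterm : ∀ (n : ℤ) (q : ℝ), thT m (β + n) ⟨⟨p, q, 0⟩, g⟩ *
      Complex.exp (-(Real.pi * Complex.I * ((i : ℕ) + 1 : ℤ) * q)) =
      thT m (β + n) ⟨⟨p, 0, 0⟩, g⟩ *
        Complex.exp (2 * Real.pi * Complex.I * (((j : ℕ) : ℤ) - (i : ℕ) + 2 * m * n : ℤ) * q) := by
    intro n q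
    rw [thT, thT, mul_assoc _ (Complex.exp _), mul_assoc _ (Complex.exp _), ← Complex.exp_add,
      ← Complex.exp_add]
    congr 2
    simp only [hp, hβ]
    push_cast
    field_simp
    ring
  -- Sum and integral are exchanged by domination: the modulus of each term does not depend on q.
  have hsum : HasSum (fun n : ℤ => ∫ q in (0 : ℝ)..1, thT m (β + n) ⟨⟨p, q, 0⟩, g⟩ *
      Complex.exp (-(Real.pi * Complex.I * ((i : ℕ) + 1 : ℤ) * q)))
      (ext m ((i : ℕ) + 1) (theta m ((j : ℕ) + 1)) g) := by
    refine intervalIntegral.hasSum_integral_of_dominated_convergence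
      (fun n _ => ‖thT m (β + n) ⟨⟨p, 0, 0⟩, g⟩‖) (fun n => ?_) (fun n => ?_) ?_ ?_ ?_
    · simp only [hterm]
      exact Continuous.aestronglyMeasurable (by fun_prop)
    · refine Eventually.of_forall fun q _ => ?_
      rw [hterm, norm_mul, show (2 * Real.pi * Complex.I * (((j : ℕ) : ℤ) - (i : ℕ) + 2 * m * n : ℤ)
          * q : ℂ)
        = ((2 * Real.pi * (((j : ℕ) : ℤ) - (i : ℕ) + 2 * m * n : ℤ) * q : ℝ) : ℂ) * Complex.I by
          push_cast; ring, Complex.norm_exp_ofReal_mul_I, mul_one]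
    · exact Eventually.of_forall fun q _ => (summable_thT hm β _).norm
    · exact intervalIntegrable_const
    · refine Eventually.of_forall fun q _ => ?_
      rw [theta_eq_tsum]
      exact (summable_thT hm β _).hasSum.mul_right _
  refine hsum.unique ?_
  simp only [hterm, intervalIntegral.integral_const_mul, integral_exp_two_pi]
  -- Both indices lie in a range of length 2m, so their difference is a multiple of 2m only if it is
  -- zero.
  have hn : ∀ n : ℤ, ((j : ℕ) : ℤ) - (i : ℕ) + 2 * m * n = 0 ↔ i = j ∧ n = 0 := by
    intro n
    have h1 : ((i : ℕ) : ℤ) < 2 * m := by exact_mod_cast i.2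
    have h2 : ((j : ℕ) : ℤ) < 2 * m := by exact_mod_cast j.2
    have hm' : (0 : ℤ) < 2 * m := by omega
    constructor
    · intro h
      have : n = 0 := by
        by_contra hne
        rcases lt_or_gt_of_ne hne with h0 | h0
        · nlinarith
        · nlinarith
      subst this
      exact ⟨Fin.ext (by omega), rfl⟩
    · rintro ⟨rfl, rfl⟩
      ring
  simp only [hn]
  by_cases h : i = j
  · subst h
    simp only [true_and, if_true]
    have : wt g = thT m (β + (0 : ℤ)) ⟨⟨p, 0, 0⟩, g⟩ * (if (0 : ℤ) = 0 then 1 else 0) := by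
      rw [thT, wt, if_pos rfl, mul_one]
      congr 2
      simp [hp, hβ]
    rw [this]
    exact hasSum_single 0 fun n hne => by rw [if_neg hne, mul_zero]
  · simp only [h, false_and, if_false, mul_zero]
    exact hasSum_zero

theorem ext_sum_theta {m : ℕ} (hm : 1 ≤ m) (c : Fin (2 * m) → ℂ) (i : Fin (2 * m)) (g : TG) :
    ext m ((i : ℕ) + 1) (fun x => ∑ j : Fin (2 * m), theta m ((j : ℕ) + 1) x * c j) g =
      wt g * c i := by
  have hi : ∀ j : Fin (2 * m), IntervalIntegrable (fun q : ℝ =>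
      theta m ((j : ℕ) + 1) ⟨⟨-((((i : ℕ) + 1 : ℤ) : ℝ) / (2 * m)), q, 0⟩, g⟩ *
        Complex.exp (-(Real.pi * Complex.I * ((i : ℕ) + 1 : ℤ) * q)) * c j)
      MeasureTheory.volume 0 1 := fun j => by
    refine Continuous.intervalIntegrable ?_ _ _
    have := (smoothJ_theta hm ((j : ℕ) + 1)).continuous_heis (-((((i : ℕ) + 1 : ℤ) : ℝ) / (2 * m)))
        0 g
    fun_prop
  have h : ext m ((i : ℕ) + 1) (fun x => ∑ j : Fin (2 * m), theta m ((j : ℕ) + 1) x * c j) g =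
      ∑ j : Fin (2 * m), ext m ((i : ℕ) + 1) (theta m ((j : ℕ) + 1)) g * c j := by
    simp only [ext, ← intervalIntegral.integral_mul_const]
    rw [← intervalIntegral.integral_finsetSum fun j _ => hi j]
    refine intervalIntegral.integral_congr fun q _ => ?_
    simp only [Finset.sum_mul]
    exact Finset.sum_congr rfl fun j _ => by ring
  rw [h, Finset.sum_eq_single i]
  · rw [ext_theta hm, if_pos rfl]
  · intro j _ hj
    rw [ext_theta hm, if_neg (Ne.symm hj), zero_mul]
  · simp

theorem ext_synth {m : ℕ} (hm : 1 ≤ m) (k : ℝ) (u : ℍ → Fin (2 * m) → ℂ) (i : Fin (2 * m))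
    (g : TG) :
    ext m ((i : ℕ) + 1) (synth m k u) g = wt g * Psi k u g i := by
  rw [← ext_sum_theta hm (Psi k u g) i g]
  rfl

theorem synth_injective {m : ℕ} (hm : 1 ≤ m) (k : ℝ) : Function.Injective (synth m k) := by
  intro u v h
  funext z i
  have h1 := ext_synth hm k u i ⟨z, 0⟩
  rw [h, ext_synth hm k v i ⟨z, 0⟩] at h1
  have h2 := mul_left_cancel₀ (wt_ne_zero _) h1
  simpa [Psi] using h2.symm

/-- The theta functions are linearly independent over each point of `TG`. -/
theorem eq_of_sum_theta_eq {m : ℕ} (hm : 1 ≤ m) (g : TG) {c d : Fin (2 * m) → ℂ}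
    (h : ∀ x : Heis, ∑ j : Fin (2 * m), theta m ((j : ℕ) + 1) ⟨x, g⟩ * c j =
      ∑ j : Fin (2 * m), theta m ((j : ℕ) + 1) ⟨x, g⟩ * d j) : c = d := by
  funext i
  have h1 := ext_sum_theta hm c i g
  have h2 := ext_sum_theta hm d i g
  simp only [ext, h] at h1 h2
  exact mul_left_cancel₀ (wt_ne_zero g) (h1.symm.trans h2)

/-! ### The representation -/

/-- The matrix of the theta multiplier at `T`. -/
def rhoT (κ m : ℕ) : Matrix (Fin (2 * m)) (Fin (2 * m)) ℂ := fun j j' =>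
  if j = j' then Complex.exp (Real.pi * Complex.I *
    ((κ : ℂ) / 6 + 1 / 12 - ((j : ℕ) + 1 : ℂ) ^ 2 / (2 * m))) else 0

/-- The matrix of the theta multiplier at `S`. -/
def rhoS (κ m : ℕ) : Matrix (Fin (2 * m)) (Fin (2 * m)) ℂ := fun j j' =>
  ((√(2 * m : ℝ))⁻¹ : ℝ) * Complex.exp (Real.pi * Complex.I *
    (-((κ : ℂ) / 2) + ((j : ℕ) + 1 : ℂ) * ((j' : ℕ) + 1 : ℂ) / m))

theorem conj_exp_pi (x : ℝ) : (starRingEnd ℂ) (Complex.exp (Real.pi * Complex.I * x)) =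
    Complex.exp (-(Real.pi * Complex.I * x)) := by
  rw [← Complex.exp_conj]
  simp

theorem rhoT_mem (κ m : ℕ) : rhoT κ m ∈ Matrix.unitaryGroup (Fin (2 * m)) ℂ := by
  rw [Matrix.mem_unitaryGroup_iff]
  have h : rhoT κ m = Matrix.diagonal fun j : Fin (2 * m) => Complex.exp (Real.pi * Complex.I *
      (((κ : ℝ) / 6 + 1 / 12 - (((j : ℕ) + 1 : ℝ)) ^ 2 / (2 * m) : ℝ) : ℂ)) := by
    ext i j
    rw [Matrix.diagonal_apply, rhoT]
    push_cast
    rfl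
  rw [h, Matrix.star_eq_conjTranspose, Matrix.diagonal_conjTranspose, Matrix.diagonal_mul_diagonal,
    ← Matrix.diagonal_one]
  congr 1
  funext j
  rw [Pi.star_apply, Complex.star_def, conj_exp_pi, ← Complex.exp_add, add_neg_cancel,
    Complex.exp_zero]

theorem sum_root_of_unity {n : ℕ} {ζ : ℂ} (h : ζ ^ n = 1) (h1 : ζ ≠ 1) :
    ∑ j : Fin n, ζ ^ ((j : ℕ) + 1) = 0 := by
  have h2 : (∑ j : Fin n, ζ ^ ((j : ℕ) + 1)) = ζ * ∑ j ∈ Finset.range n, ζ ^ j := by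
    rw [Finset.mul_sum, ← Fin.sum_univ_eq_sum_range (fun j => ζ * ζ ^ j)]
    exact Finset.sum_congr rfl fun j _ => pow_succ' _ _
  have h3 := mul_geom_sum ζ n
  rw [h, sub_self] at h3
  rw [h2, (mul_eq_zero.1 h3).resolve_left (sub_ne_zero.2 h1), mul_zero]

/-- Up to a phase and a cyclic relabelling this is the finite Fourier transform on ℤ/2m.
Orthogonality of rows is the vanishing of a sum of powers of a nontrivial root of unity. -/
theorem rhoS_mem {m : ℕ} (hm : 1 ≤ m) (κ : ℕ) :
    rhoS κ m ∈ Matrix.unitaryGroup (Fin (2 * m)) ℂ := by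
  have hm0 : (m : ℂ) ≠ 0 := by exact_mod_cast (by omega : m ≠ 0)
  have hmR : (0 : ℝ) < 2 * m := by have : 0 < m := hm; positivity
  rw [Matrix.mem_unitaryGroup_iff]
  ext i k
  rw [Matrix.mul_apply]
  set ζ : ℂ := Complex.exp (Real.pi * Complex.I * (((i : ℕ) : ℂ) - (k : ℕ)) / m) with hζ
  have hterm : ∀ j : Fin (2 * m), rhoS κ m i j * (star (rhoS κ m)) j k =
      (2 * m : ℂ)⁻¹ * ζ ^ ((j : ℕ) + 1) := by
    intro j
    have e1 : rhoS κ m k j = ((√(2 * m : ℝ))⁻¹ : ℝ) * Complex.exp (Real.pi * Complex.I *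
        ((-((κ : ℝ) / 2) + ((k : ℕ) + 1 : ℝ) * ((j : ℕ) + 1 : ℝ) / m : ℝ) : ℂ)) := by
      rw [rhoS]
      push_cast
      rfl
    have e2 : (2 * m : ℂ)⁻¹ = ((√(2 * m : ℝ))⁻¹ : ℝ) * ((√(2 * m : ℝ))⁻¹ : ℝ) := by
      rw [← Complex.ofReal_mul, ← mul_inv, Real.mul_self_sqrt hmR.le]
      push_cast
      rfl
    rw [Matrix.star_apply, e1, star_mul', Complex.star_def, conj_exp_pi,
      Complex.conj_ofReal, rhoS, e2, hζ, ← Complex.exp_nat_mul]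
    have e3 : Complex.exp ((((j : ℕ) + 1 : ℕ) : ℂ) *
        (Real.pi * Complex.I * (((i : ℕ) : ℂ) - (k : ℕ)) / m)) =
        Complex.exp (Real.pi * Complex.I *
          (-((κ : ℂ) / 2) + ((i : ℕ) + 1 : ℂ) * ((j : ℕ) + 1 : ℂ) / m)) *
        Complex.exp (-(Real.pi * Complex.I *
          ((-((κ : ℝ) / 2) + ((k : ℕ) + 1 : ℝ) * ((j : ℕ) + 1 : ℝ) / m : ℝ) : ℂ))) := by
      rw [← Complex.exp_add]
      congr 1
      push_cast
      field_simp
      ring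
    rw [e3]
    ring
  simp only [hterm]
  rw [← Finset.mul_sum, Matrix.one_apply]
  split_ifs with h
  · subst h
    have : ζ = 1 := by rw [hζ]; simp
    rw [this]
    simp only [one_pow, Finset.sum_const, Finset.card_univ, Fintype.card_fin]
    rw [nsmul_eq_mul, mul_one]
    push_cast
    exact inv_mul_cancel₀ (mul_ne_zero two_ne_zero hm0)
  · rw [sum_root_of_unity, mul_zero]
    · rw [hζ, ← Complex.exp_nat_mul, ← Complex.exp_zero]
      refine exp_eq_of_int (((i : ℕ) : ℤ) - (k : ℕ)) ?_
      push_cast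
      field_simp
      ring
    · intro h1
      obtain ⟨n, hn⟩ := Complex.exp_eq_one_iff.1 h1
      have h2 : (((i : ℕ) : ℂ) - (k : ℕ)) = 2 * m * n := by
        have := Complex.two_pi_I_ne_zero
        field_simp at hn
        have h3 : (Real.pi * Complex.I : ℂ) ≠ 0 :=
          mul_ne_zero (by exact_mod_cast Real.pi_ne_zero) Complex.I_ne_zero
        refine mul_left_cancel₀ h3 ?_
        linear_combination (Real.pi * Complex.I) * hn
      have h4 : ((i : ℕ) : ℤ) - (k : ℕ) = 2 * m * n := by exact_mod_cast h2
      have h5 : ((i : ℕ) : ℤ) < 2 * m := by exact_mod_cast i.2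
      have h6 : ((k : ℕ) : ℤ) < 2 * m := by exact_mod_cast k.2
      have : n = 0 := by
        by_contra hne
        rcases lt_or_gt_of_ne hne with h0 | h0
        · nlinarith
        · nlinarith
      subst this
      exact h (Fin.ext (by omega))

/-- The vector of conjugate theta functions, with the weight shifted to be integral. -/
def thVec (κ m : ℕ) (g : TGJ) : Fin (2 * m) → ℂ := fun j =>
  etaLift ((κ : ℝ) + 1 / 2) g.right * (starRingEnd ℂ) (theta m ((j : ℕ) + 1) g)

/-- The eta factor of weight κ + 1/2 contributes κ/6 + 1/12 to the exponent over πi, and the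
conjugate theta function contributes -j²/2m. -/
theorem thVec_tEl (κ : ℕ) {m : ℕ} (hm : 1 ≤ m) (g : TGJ) :
    thVec κ m (gJ tEl * g) = rhoT κ m *ᵥ thVec κ m g := by
  have hm0 : (m : ℂ) ≠ 0 := by exact_mod_cast (by omega : m ≠ 0)
  funext j
  have hd : rhoT κ m = Matrix.diagonal fun j : Fin (2 * m) => Complex.exp (Real.pi * Complex.I *
    ((κ : ℂ) / 6 + 1 / 12 - ((j : ℕ) + 1 : ℂ) ^ 2 / (2 * m))) := by
    ext i j
    rw [Matrix.diagonal_apply, rhoT]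
  rw [hd, Matrix.mulVec_diagonal, thVec, thVec, theta_tEl hm, map_mul]
  have e1 : (gJ tEl * g).right = tEl * g.right := rfl
  rw [e1, etaLift_tEl, show (Real.pi * Complex.I * (((j : ℕ) + 1 : ℤ) : ℂ) ^ 2 / (2 * m) : ℂ) =
    Real.pi * Complex.I * ((((j : ℕ) + 1) ^ 2 / (2 * m) : ℝ) : ℂ) by push_cast; ring, conj_exp_pi]
  have e2 : Complex.exp (Real.pi * Complex.I *
      ((κ : ℂ) / 6 + 1 / 12 - ((j : ℕ) + 1 : ℂ) ^ 2 / (2 * m))) =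
      Complex.exp (Real.pi * Complex.I * ((κ : ℝ) + 1 / 2 : ℝ) / 6) *
        Complex.exp (-(Real.pi * Complex.I * ((((j : ℕ) + 1) ^ 2 / (2 * m) : ℝ) : ℂ))) := by
    rw [← Complex.exp_add]
    congr 1
    push_cast
    ring
  rw [e2]
  ring

/-- The constant 1/4 from conjugating the theta multiplier turns -(κ + 1/2)/2 into -κ/2. -/
theorem thVec_sEl (κ : ℕ) {m : ℕ} (hm : 1 ≤ m) (g : TGJ) :
    thVec κ m (gJ sEl * g) = rhoS κ m *ᵥ thVec κ m g := by
  have hm0 : (m : ℂ) ≠ 0 := by exact_mod_cast (by omega : m ≠ 0)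
  funext j
  rw [Matrix.mulVec, dotProduct, thVec, theta_sEl hm, map_sum, Finset.mul_sum]
  refine Finset.sum_congr rfl fun j' _ => ?_
  have e1 : (gJ sEl * g).right = sEl * g.right := rfl
  rw [e1, etaLift_sEl, map_mul, map_mul, Complex.conj_ofReal, thVec, rhoS,
    show (Real.pi * Complex.I * (-(1 / 4) - (((j : ℕ) + 1 : ℤ) : ℂ) * ((j' : ℕ) + 1) / m) : ℂ) =
    Real.pi * Complex.I * ((-(1 / 4) - ((j : ℕ) + 1) * ((j' : ℕ) + 1) / m : ℝ) : ℂ) by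
      push_cast; ring, conj_exp_pi]
  have e2 : Complex.exp (Real.pi * Complex.I *
      (-((κ : ℂ) / 2) + ((j : ℕ) + 1 : ℂ) * ((j' : ℕ) + 1 : ℂ) / m)) =
      Complex.exp (-(Real.pi * Complex.I * ((κ : ℝ) + 1 / 2 : ℝ) / 2)) *
        Complex.exp (-(Real.pi * Complex.I *
          ((-(1 / 4) - ((j : ℕ) + 1) * ((j' : ℕ) + 1) / m : ℝ) : ℂ))) := by
    rw [← Complex.exp_add]
    congr 1
    push_cast
    ring
  rw [e2]
  ring

/-- The weights κ + 1/2 and -1/2 add up to the integer κ, so the kernel of the covering map acts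
trivially and the action descends to SL₂(ℤ). -/
theorem thVec_kT (κ m : ℕ) (n : ℤ) (g : TGJ) :
    thVec κ m (gJ (kT (n * (2 * Real.pi))) * g) = thVec κ m g := by
  funext j
  obtain ⟨h, ⟨z, θ⟩⟩ := g
  rw [gJ_kT_mul, thVec, thVec, theta_kT, map_mul, etaLift, etaLift]
  have e : Complex.exp (Complex.I * ((κ : ℝ) + 1 / 2 : ℝ) * (θ + n * (2 * Real.pi) : ℝ)) *
      (starRingEnd ℂ) (Complex.exp (Complex.I * (n * (2 * Real.pi) : ℝ) / 2)) =
      Complex.exp (Complex.I * ((κ : ℝ) + 1 / 2 : ℝ) * θ) := by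
    rw [show (Complex.I * (n * (2 * Real.pi) : ℝ) / 2 : ℂ) = Real.pi * Complex.I * (n : ℝ) by
      push_cast; ring, conj_exp_pi, ← Complex.exp_add]
    refine exp_eq_of_int (κ * n) ?_
    push_cast
    ring
  rw [← e]
  ring

/-- Linear independence of the theta functions over the identity of `TG`, applied to the conjugated
rows of the matrices. -/
theorem eq_of_mulVec_thVec {κ m : ℕ} (hm : 1 ≤ m) {M N : Matrix (Fin (2 * m)) (Fin (2 * m)) ℂ}
    (h : ∀ g, M *ᵥ thVec κ m g = N *ᵥ thVec κ m g) : M = N := by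
  ext i j
  have h1 : (fun j => (starRingEnd ℂ) (M i j)) = fun j => (starRingEnd ℂ) (N i j) := by
    refine eq_of_sum_theta_eq hm 1 fun x => ?_
    have h2 := congrFun (h ⟨x, 1⟩) i
    simp only [Matrix.mulVec, dotProduct, thVec] at h2
    have h3 : ∀ A : Matrix (Fin (2 * m)) (Fin (2 * m)) ℂ,
        (∑ j : Fin (2 * m), theta m ((j : ℕ) + 1) ⟨x, 1⟩ * (starRingEnd ℂ) (A i j)) =
        (starRingEnd ℂ) ((etaLift ((κ : ℝ) + 1 / 2) 1)⁻¹ * ∑ j : Fin (2 * m), A i j *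
          (etaLift ((κ : ℝ) + 1 / 2) 1 * (starRingEnd ℂ) (theta m ((j : ℕ) + 1) ⟨x, 1⟩))) := by
      intro A
      have h0 := etaLift_ne_zero ((κ : ℝ) + 1 / 2) 1
      generalize etaLift ((κ : ℝ) + 1 / 2) 1 = E at h0 ⊢
      rw [Finset.mul_sum, map_sum]
      refine Finset.sum_congr rfl fun j _ => ?_
      rw [show E⁻¹ * (A i j * (E * (starRingEnd ℂ) (theta m ((j : ℕ) + 1) ⟨x, 1⟩))) =
        A i j * (starRingEnd ℂ) (theta m ((j : ℕ) + 1) ⟨x, 1⟩) by field_simp, map_mul,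
        Complex.conj_conj, mul_comm]
    rw [h3, h3, h2]
  exact (starRingEnd ℂ).injective (congrFun h1 j)

/-- `M` describes the action of the lifts of `γ` on the theta functions. -/
def IsThetaMatrix (κ m : ℕ) (γ : SL(2, ℤ)) (M : Matrix.unitaryGroup (Fin (2 * m)) ℂ) : Prop :=
  ∀ x : TG, x.pr = toR γ → ∀ g, thVec κ m (gJ x * g) = (M : Matrix _ _ ℂ) *ᵥ thVec κ m g

theorem IsThetaMatrix.mul {κ m : ℕ} {γ γ' : SL(2, ℤ)} {M M' : Matrix.unitaryGroup (Fin (2 * m)) ℂ}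
    (h : IsThetaMatrix κ m γ M) (h' : IsThetaMatrix κ m γ' M') :
    IsThetaMatrix κ m (γ * γ') (M * M') := by
  intro x hx g
  have e : x = (x * (sec γ')⁻¹) * sec γ' := by group
  have h1 : (x * (sec γ')⁻¹).pr = toR γ := by
    have h2 := TG.pr_mul (x * (sec γ')⁻¹) (sec γ')
    rw [← e, hx, pr_sec, toR_mul] at h2
    exact (mul_right_cancel h2).symm
  rw [e, ← gJ_mul_gJ, mul_assoc, h _ h1, h' _ (pr_sec γ'), Matrix.mulVec_mulVec]
  rfl

theorem IsThetaMatrix.inv {κ m : ℕ} {γ : SL(2, ℤ)} {M : Matrix.unitaryGroup (Fin (2 * m)) ℂ}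
    (h : IsThetaMatrix κ m γ M) : IsThetaMatrix κ m γ⁻¹ M⁻¹ := by
  intro x hx g
  have h1 : (x⁻¹).pr = toR γ := by
    have h2 : (x⁻¹).pr = (x.pr)⁻¹ := map_inv TG.prHom x
    rw [h2, hx, inv_eq_iff_mul_eq_one, ← toR_mul, inv_mul_cancel]
    exact map_one _
  have h3 := h _ h1 (gJ x * g)
  rw [← mul_assoc, gJ_mul_gJ, inv_mul_cancel, show gJ 1 = 1 from map_one _, one_mul] at h3
  rw [h3, Matrix.mulVec_mulVec, ← Matrix.UnitaryGroup.mul_val, inv_mul_cancel]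
  simp

/-- Two lifts of γ differ by an element of the kernel, which fixes `thVec`, so one lift decides for
all. -/
theorem isThetaMatrix_of_lift {κ m : ℕ} {γ : SL(2, ℤ)} {M : Matrix.unitaryGroup (Fin (2 * m)) ℂ}
    {y : TG} (hy : y.pr = toR γ)
    (h : ∀ g, thVec κ m (gJ y * g) = (M : Matrix _ _ ℂ) *ᵥ thVec κ m g) : IsThetaMatrix κ m γ
        M := by
  intro x hx g
  have h1 : (y⁻¹ * x).pr = 1 := by
    rw [TG.pr_mul, show (y⁻¹).pr = (y.pr)⁻¹ from map_inv TG.prHom y, hy, hx, inv_mul_cancel]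
  obtain ⟨n, hn⟩ := TG.eq_kT_of_pr_eq_one h1
  have h2 : x = y * kT (n * (2 * Real.pi)) := by rw [← hn]; group
  rw [h2, ← gJ_mul_gJ, mul_assoc, h, thVec_kT]

theorem exists_isThetaMatrix (κ : ℕ) {m : ℕ} (hm : 1 ≤ m) (γ : SL(2, ℤ)) :
    ∃ M, IsThetaMatrix κ m γ M := by
  let P : Subgroup SL(2, ℤ) :=
    { carrier := {γ | ∃ M, IsThetaMatrix κ m γ M}
      mul_mem' := fun ⟨M, h⟩ ⟨M', h'⟩ => ⟨M * M', h.mul h'⟩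
      one_mem' := ⟨1, isThetaMatrix_of_lift (y := 1) (TG.pr_one.trans (map_one _).symm) fun g => by
        rw [show gJ 1 = 1 from map_one _, one_mul]
        simp⟩
      inv_mem' := fun ⟨M, h⟩ => ⟨M⁻¹, h.inv⟩ }
  have hT : ModularGroup.T ∈ P := ⟨⟨rhoT κ m, rhoT_mem κ m⟩,
    isThetaMatrix_of_lift (y := tEl) (by rw [← sec_T, pr_sec]) (thVec_tEl κ hm)⟩
  have hS : ModularGroup.S ∈ P := ⟨⟨rhoS κ m, rhoS_mem hm κ⟩,
    isThetaMatrix_of_lift (y := sEl) (by rw [← sec_S, pr_sec]) (thVec_sEl κ hm)⟩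
  have hP : Subgroup.closure {ModularGroup.S, ModularGroup.T} ≤ P := (Subgroup.closure_le P).2 (by
    rintro x (rfl | rfl)
    exacts [hS, hT])
  rw [_root_.SpecialLinearGroup.SL2Z_generators] at hP
  exact hP (Subgroup.mem_top γ)

theorem IsThetaMatrix.unique {κ m : ℕ} (hm : 1 ≤ m) {γ : SL(2, ℤ)}
    {M N : Matrix.unitaryGroup (Fin (2 * m)) ℂ} (h : IsThetaMatrix κ m γ M)
    (h' : IsThetaMatrix κ m γ N) : M = N :=
  Subtype.ext (eq_of_mulVec_thVec (κ := κ) hm fun g =>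
    (h _ (pr_sec γ) g).symm.trans (h' _ (pr_sec γ) g))

/-- There is a unique unitary representation with the prescribed values at `T` and `S`. -/
theorem existsUnique_isRho (a : ZMod 12) {m : ℕ} (hm : 1 ≤ m) :
    ∃! ρ : SL(2, ℤ) →* Matrix.unitaryGroup (Fin (2 * m)) ℂ, IsRho a m ρ := by
  choose M hM using exists_isThetaMatrix a.val hm
  -- Multiplicativity needs no relations between S and T: the matrix of each γ is unique, and the
  -- product of the matrices qualifies for the product.
  let ρ : SL(2, ℤ) →* Matrix.unitaryGroup (Fin (2 * m)) ℂ := MonoidHom.mk' M fun γ γ' =>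
    (hM (γ * γ')).unique hm ((hM γ).mul (hM γ'))
  have hT : (M ModularGroup.T : Matrix (Fin (2 * m)) (Fin (2 * m)) ℂ) = rhoT a.val m :=
    eq_of_mulVec_thVec hm fun g => by
      rw [← hM _ tEl (by rw [← sec_T, pr_sec]), thVec_tEl _ hm]
  have hS : (M ModularGroup.S : Matrix (Fin (2 * m)) (Fin (2 * m)) ℂ) = rhoS a.val m :=
    eq_of_mulVec_thVec hm fun g => by
      rw [← hM _ sEl (by rw [← sec_S, pr_sec]), thVec_sEl _ hm]
  refine ⟨ρ, ⟨fun j j' => congrFun (congrFun hT j) j', fun j j' => congrFun (congrFun hS j) j'⟩, ?_⟩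
  intro ρ' h'
  refine MonoidHom.eq_of_eqOn_dense _root_.SpecialLinearGroup.SL2Z_generators ?_
  rintro x (rfl | rfl)
  · refine Subtype.ext (Matrix.ext fun i j => ?_)
    rw [h'.2]
    exact (congrFun (congrFun hS i) j).symm
  · refine Subtype.ext (Matrix.ext fun i j => ?_)
    rw [h'.1]
    exact (congrFun (congrFun hT i) j).symm

/-! ### Integrals with a parameter -/

theorem continuous_of_continuousOn_prod {E F : Type*} [TopologicalSpace E] [TopologicalSpace F]
    {U : Set E} {f : E × ℝ → F}
    (hf : ContinuousOn f (U ×ˢ Set.univ)) {x : E} (hx : x ∈ U) : Continuous fun q : ℝ => f (x, q) :=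
  hf.comp_continuous (by fun_prop) fun _ => ⟨hx, Set.mem_univ _⟩

section ParametricIntegral

variable {E F : Type} [NormedAddCommGroup E] [NormedSpace ℝ E] [NormedAddCommGroup F]
  [NormedSpace ℝ F]

/-- The derivative in x is continuous, hence bounded on a compact ball times the interval; this
constant dominates the differentiated integrand. -/
theorem hasFDerivAt_parametric_integral [ProperSpace E] {U : Set E} (hU : IsOpen U) {f : E × ℝ → F}
    (hf : ContDiffOn ℝ 1 f (U ×ˢ Set.univ)) {x : E} (hx : x ∈ U) (a b : ℝ) :
    HasFDerivAt (fun x => ∫ q in a..b, f (x, q))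
      (∫ q in a..b, (fderiv ℝ f (x, q)).comp (ContinuousLinearMap.inl ℝ E ℝ)) x := by
  have hUo : IsOpen (U ×ˢ (Set.univ : Set ℝ)) := hU.prod isOpen_univ
  have hD : ContinuousOn (fun v => (fderiv ℝ f v).comp (ContinuousLinearMap.inl ℝ E ℝ))
      (U ×ˢ Set.univ) := by
    have h := hf.continuousOn_fderiv_of_isOpen hUo le_rfl
    exact ((ContinuousLinearMap.compL ℝ E (E × ℝ) F).flip
      (ContinuousLinearMap.inl ℝ E ℝ)).continuous.comp_continuousOn h
  obtain ⟨r, hr, hrU⟩ := Metric.isOpen_iff.1 hU x hx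
  have hrU' : Metric.closedBall x (r / 2) ⊆ U :=
    (Metric.closedBall_subset_ball (half_lt_self hr)).trans hrU
  obtain ⟨C, hC⟩ := ((isCompact_closedBall x (r / 2)).prod
    (isCompact_uIcc (a := a) (b := b))).exists_bound_of_continuousOn
      (hD.mono (Set.prod_mono hrU' (Set.subset_univ _)))
  have hmem : ∀ {x'}, x' ∈ Metric.ball x (r / 2) → x' ∈ U := fun h =>
    hrU' (Metric.ball_subset_closedBall h)
  refine intervalIntegral.hasFDerivAt_integral_of_dominated_of_fderiv_le (bound := fun _ => C)
    (F' := fun x q => (fderiv ℝ f (x, q)).comp (ContinuousLinearMap.inl ℝ E ℝ))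
    (Metric.ball_mem_nhds x (half_pos hr)) ?_ ?_ ?_ ?_ intervalIntegrable_const ?_
  · filter_upwards [Metric.ball_mem_nhds x (half_pos hr)] with x' hx'
    exact (continuous_of_continuousOn_prod hf.continuousOn (hmem hx')).aestronglyMeasurable
  · exact (continuous_of_continuousOn_prod hf.continuousOn hx).intervalIntegrable _ _
  · exact (continuous_of_continuousOn_prod hD hx).aestronglyMeasurable
  · refine Eventually.of_forall fun q hq x' hx' => ?_
    exact hC (x', q) ⟨Metric.ball_subset_closedBall hx', Set.uIoc_subset_uIcc hq⟩
  · refine Eventually.of_forall fun q _ x' hx' => ?_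
    have h1 : HasFDerivAt f (fderiv ℝ f (x', q)) (x', q) :=
      ((hf.contDiffAt (hUo.mem_nhds ⟨hmem hx', Set.mem_univ _⟩)).differentiableAt
        one_ne_zero).hasFDerivAt
    exact HasFDerivAt.comp x' h1 (hasFDerivAt_prodMk_left x' q)

/-- The derivative is again such an integral, but with values in linear maps. The induction
therefore runs over all target spaces F. -/
theorem contDiffOn_parametric_integral [ProperSpace E] {U : Set E} (hU : IsOpen U) (a b : ℝ)
    (n : ℕ) : ∀ {F : Type} [NormedAddCommGroup F] [NormedSpace ℝ F] {f : E × ℝ → F},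
    ContDiffOn ℝ ∞ f (U ×ˢ Set.univ) → ContDiffOn ℝ n (fun x => ∫ q in a..b, f (x, q)) U := by
  induction n with
  | zero =>
    intro F _ _ f hf
    have hf1 : ContDiffOn ℝ 1 f (U ×ˢ Set.univ) := hf.of_le (by exact_mod_cast le_top)
    refine contDiffOn_zero.2 fun x hx => ?_
    exact (hasFDerivAt_parametric_integral hU hf1 hx a b).continuousAt.continuousWithinAt
  | succ n ih =>
    intro F _ _ f hf
    have hf1 : ContDiffOn ℝ 1 f (U ×ˢ Set.univ) := hf.of_le (by exact_mod_cast le_top)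
    have hd := fun x (hx : x ∈ U) => hasFDerivAt_parametric_integral hU hf1 hx a b
    rw [show ((n + 1 : ℕ) : WithTop ℕ∞) = (n : WithTop ℕ∞) + 1 by push_cast; rfl,
      contDiffOn_succ_iff_fderiv_of_isOpen hU]
    refine ⟨fun x hx => (hd x hx).differentiableAt.differentiableWithinAt, fun h => by simp at h,
        ?_⟩
    refine (ih (f := fun v => (fderiv ℝ f v).comp (ContinuousLinearMap.inl ℝ E ℝ)) ?_).congr
      fun x hx => (hd x hx).fderiv
    have h := hf.fderiv_of_isOpen (m := ∞) (hU.prod isOpen_univ) (by simp)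
    exact ((ContinuousLinearMap.compL ℝ E (E × ℝ) F).flip
      (ContinuousLinearMap.inl ℝ E ℝ)).contDiff.comp_contDiffOn h

theorem contDiffOn_top_parametric_integral [ProperSpace E] {U : Set E} (hU : IsOpen U) (a b : ℝ)
    {f : E × ℝ → F} (hf : ContDiffOn ℝ ∞ f (U ×ˢ Set.univ)) :
    ContDiffOn ℝ ∞ (fun x => ∫ q in a..b, f (x, q)) U :=
  contDiffOn_infty.2 fun n => contDiffOn_parametric_integral hU a b n hf

end ParametricIntegral

/-- The integral over a period of a solution of `∂_p H = τ ∂_q H` does not depend on `p`. -/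
theorem integral_period_const {H D : ℝ → ℝ → ℂ} {τ : ℂ}
    (hH : ContDiff ℝ 1 fun v : ℝ × ℝ => H v.1 v.2)
    (hp : ∀ p q, HasDerivAt (fun p => H p q) (τ * D p q) p)
    (hq : ∀ p q, HasDerivAt (fun q => H p q) (D p q) q) (hper : ∀ p, H p 1 = H p 0) (p p' : ℝ) :
    ∫ q in (0 : ℝ)..1, H p q = ∫ q in (0 : ℝ)..1, H p' q := by
  set f : ℝ × ℝ → ℂ := fun v => H v.1 v.2 with hf
  have hdf : ∀ v, HasFDerivAt f (fderiv ℝ f v) v := fun v =>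
    (hH.differentiable one_ne_zero v).hasFDerivAt
  have hcont : Continuous (fderiv ℝ f) := hH.continuous_fderiv one_ne_zero
  have hDq : ∀ p q, fderiv ℝ f (p, q) (0, 1) = D p q := fun p q => by
    have h0 : HasDerivAt (fun q : ℝ => (p, q)) ((0 : ℝ), (1 : ℝ)) q :=
      (hasDerivAt_const q p).prodMk (hasDerivAt_id q)
    have h1 : HasDerivAt (fun q : ℝ => f (p, q)) (fderiv ℝ f (p, q) (0, 1)) q :=
      (hdf (p, q)).comp_hasDerivAt q h0
    exact h1.unique (hq p q)
  have hDp : ∀ p q, fderiv ℝ f (p, q) (1, 0) = τ * D p q := fun p q => by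
    have h0 : HasDerivAt (fun p : ℝ => (p, q)) ((1 : ℝ), (0 : ℝ)) p :=
      (hasDerivAt_id p).prodMk (hasDerivAt_const p q)
    have h1 : HasDerivAt (fun p : ℝ => f (p, q)) (fderiv ℝ f (p, q) (1, 0)) p :=
      HasFDerivAt.comp_hasDerivAt (l := f) p (hdf (p, q)) h0
    exact h1.unique (hp p q)
  have hDc : ∀ p, Continuous (D p) := fun p => by
    have : D p = fun q => fderiv ℝ f (p, q) (0, 1) := funext fun q => (hDq p q).symm
    rw [this]
    exact (hcont.comp (by fun_prop : Continuous fun q : ℝ => (p, q))).clm_apply continuous_const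
  have hzero : ∀ p, HasDerivAt (fun p => ∫ q in (0 : ℝ)..1, H p q) 0 p := by
    intro p
    have h1 := (hasFDerivAt_parametric_integral isOpen_univ (f := f) (by simpa using hH.contDiffOn)
      (Set.mem_univ p) 0 1).hasDerivAt
    have hint : IntervalIntegrable (fun q : ℝ => (fderiv ℝ f (p, q)).comp
        (ContinuousLinearMap.inl ℝ ℝ ℝ)) MeasureTheory.volume 0 1 := by
      refine Continuous.intervalIntegrable ?_ _ _
      exact (hcont.comp (by fun_prop : Continuous fun q : ℝ => (p, q))).clm_comp continuous_const
    rw [ContinuousLinearMap.intervalIntegral_apply hint] at h1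
    -- The derivative in p is τ times the integral of ∂_q H over a period, which is zero.
    have h2 : (∫ q in (0 : ℝ)..1, ((fderiv ℝ f (p, q)).comp (ContinuousLinearMap.inl ℝ ℝ ℝ)) 1) =
        0 := by
      have : ∀ q : ℝ, ((fderiv ℝ f (p, q)).comp (ContinuousLinearMap.inl ℝ ℝ ℝ)) 1 = τ * D p q :=
        fun q => hDp p q
      simp only [this]
      rw [intervalIntegral.integral_const_mul, intervalIntegral.integral_eq_sub_of_hasDerivAt
        (fun q _ => hq p q) ((hDc p).intervalIntegrable _ _), hper, sub_self, mul_zero]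
    rwa [h2] at h1
  exact is_const_of_deriv_eq_zero (fun p => (hzero p).differentiableAt)
    (fun p => (hzero p).deriv) p p'

/-- A continuous function of period `1` with summable Fourier coefficients is the sum of its
Fourier series. -/
theorem hasSum_fourier_of_periodic {G : ℝ → ℂ} (hc : Continuous G) (hp : Function.Periodic G 1)
    (hs : Summable fun n : ℤ => ∫ q in (0 : ℝ)..1, G q * Complex.exp
        (-(2 * Real.pi * Complex.I * n * q)))
    (x : ℝ) : HasSum (fun n : ℤ => (∫ q in (0 : ℝ)..1, G q *
      Complex.exp (-(2 * Real.pi * Complex.I * n * q))) * Complex.exp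
          (2 * Real.pi * Complex.I * n * x))
      (G x) := by
  have hlift : Continuous hp.lift := continuous_coinduced_dom.2 hc
  let f : C(AddCircle (1 : ℝ), ℂ) := ⟨hp.lift, hlift⟩
  have hcoeff : ∀ n : ℤ, fourierCoeff f n =
      ∫ q in (0 : ℝ)..1, G q * Complex.exp (-(2 * Real.pi * Complex.I * n * q)) := by
    intro n
    rw [fourierCoeff_eq_intervalIntegral f n 0]
    simp only [div_one, one_smul, zero_add]
    refine intervalIntegral.integral_congr fun q _ => ?_
    simp only [fourier_coe_apply, smul_eq_mul]
    rw [mul_comm]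
    congr 2
    push_cast
    ring
  have hs' : Summable (fourierCoeff f) := by
    rw [show fourierCoeff f = _ from funext hcoeff]
    exact hs
  have h := has_pointwise_sum_fourier_series_of_summable hs' (x : AddCircle (1 : ℝ))
  have hx : f (x : AddCircle (1 : ℝ)) = G x := rfl
  rw [hx] at h
  have hterm : ∀ n : ℤ, fourierCoeff f n • fourier n (x : AddCircle (1 : ℝ)) =
      (∫ q in (0 : ℝ)..1, G q * Complex.exp (-(2 * Real.pi * Complex.I * n * q))) *
        Complex.exp (2 * Real.pi * Complex.I * n * x) := by
    intro n
    rw [hcoeff, fourier_coe_apply, smul_eq_mul, Complex.ofReal_one, div_one]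
  simpa only [hterm] using h

theorem wbar_ne_zero (g : TG) : wbar g ≠ 0 := by
  intro h
  have := wbar_sq g
  rw [h] at this
  exact Complex.exp_ne_zero _ (by rw [← this]; ring)

/-! ### Theta decomposition of Jacobi Maass forms -/

namespace IsJacobiMaass

variable {k : ℝ} {m : ℕ} {s : ℂ} {χ : tGamma →* ℂˣ} {f : TGJ → ℂ}

theorem apply_r (hf : IsJacobiMaass k m s χ f) (p q r : ℝ) (g : TG) :
    f ⟨⟨p, q, r⟩, g⟩ = Complex.exp (2 * Real.pi * Complex.I * m * r) * f ⟨⟨p, q, 0⟩, g⟩ := by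
  have h := hf.weight r 0 ⟨⟨p, q, 0⟩, g⟩
  rw [show kT 0 = 1 from rfl, show gJ 1 = 1 from map_one _, mul_one, hJ_mul] at h
  simpa using h

theorem apply_θ (hf : IsJacobiMaass k m s χ f) (x : Heis) (z : ℍ) (θ t : ℝ) :
    f ⟨x, ⟨z, θ + t⟩⟩ = Complex.exp (Complex.I * k * t) * f ⟨x, ⟨z, θ⟩⟩ := by
  have h := hf.weight 0 t ⟨x, ⟨z, θ⟩⟩
  have e : hJ 0 0 0 * (⟨x, ⟨z, θ⟩⟩ : TGJ) * gJ (kT t) = ⟨x, ⟨z, θ + t⟩⟩ := by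
    rw [show hJ 0 0 0 = 1 from map_one _, one_mul]
    apply SemidirectProduct.ext
    · change x * Heis.conj (TG.prHom _) 1 = x
      rw [map_one, mul_one]
    · exact TG.mul_kT _ _
  rw [e] at h
  simpa using h

theorem apply_heis (hf : IsJacobiMaass k m s χ f) (l μ κ : ℤ) (g : TGJ) :
    f (hJ l μ κ * g) = f g := by
  have h := hf.equivariant l μ κ 1 g
  simpa [show gJ 1 = 1 from map_one _] using h

/-- The product h(0,1,0) h(p,q,0) has third coordinate -p, which the index m converts into the
phase. -/
theorem apply_q_add_one (hf : IsJacobiMaass k m s χ f) (p q : ℝ) (g : TG) :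
    f ⟨⟨p, q + 1, 0⟩, g⟩ = Complex.exp (2 * Real.pi * Complex.I * m * p) * f ⟨⟨p, q, 0⟩, g⟩ := by
  have h := hf.apply_heis 0 1 0 ⟨⟨p, q, 0⟩, g⟩
  rw [hJ_mul, hf.apply_r] at h
  simp only [Int.cast_zero, Int.cast_one, zero_add, zero_mul, mul_one, zero_sub] at h
  rw [← h, ← mul_assoc, ← Complex.exp_add, add_comm 1 q]
  simp

theorem apply_p_add_one (hf : IsJacobiMaass k m s χ f) (p q : ℝ) (g : TG) :
    f ⟨⟨p, q, 0⟩, g⟩ = Complex.exp (2 * Real.pi * Complex.I * m * q) * f ⟨⟨p + 1, q, 0⟩, g⟩ := by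
  have h := hf.apply_heis 1 0 0 ⟨⟨p, q, 0⟩, g⟩
  rw [hJ_mul, hf.apply_r] at h
  simp only [Int.cast_zero, Int.cast_one, zero_add, mul_zero, one_mul, sub_zero] at h
  rw [← h, add_comm 1 p]

/-- The differential equation in the Heisenberg variables. -/
theorem exists_partials (hf : IsJacobiMaass k m s χ f) (g : TG) :
    ∃ A : ℝ → ℝ → ℂ, ∀ p q : ℝ, HasDerivAt (fun q => f ⟨⟨p, q, 0⟩, g⟩) (A p q) q ∧
      HasDerivAt (fun p => f ⟨⟨p, q, 0⟩, g⟩)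
        (g.z * A p q + 2 * Real.pi * Complex.I * m * (p * g.z + q) * f ⟨⟨p, q, 0⟩, g⟩) p := by
  let L : ℝ → ℝ → Coord →L[ℝ] ℂ := fun p q => fderiv ℝ (f ∘ ofCoord) (toCoord ⟨⟨p, q, 0⟩, g⟩)
  have hL : ∀ p q, HasFDerivAt (f ∘ ofCoord) (L p q) (toCoord ⟨⟨p, q, 0⟩, g⟩) := fun p q =>
    (hf.smooth.differentiableAt _).hasFDerivAt
  have hof : ∀ p q r : ℝ, (f ∘ ofCoord) (p, q, r, (g.z : ℂ), g.θ) = f ⟨⟨p, q, r⟩, g⟩ :=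
    fun p q r => congrArg f (ofCoord_toCoord ⟨⟨p, q, r⟩, g⟩)
  have hp : ∀ p q, HasDerivAt (fun p => f ⟨⟨p, q, 0⟩, g⟩) (L p q (1, 0, 0, 0, 0)) p := by
    intro p q
    have h1 : HasDerivAt (fun p : ℝ => ((p, q, 0, (g.z : ℂ), g.θ) : Coord)) (1, 0, 0, 0, 0) p :=
      (hasDerivAt_id p).prodMk (hasDerivAt_const p (q, (0 : ℝ), (g.z : ℂ), g.θ))
    have h2 := (hL p q).comp_hasDerivAt p h1
    refine h2.congr_of_eventuallyEq (Eventually.of_forall fun p => ?_)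
    exact (hof p q 0).symm
  have hq : ∀ p q, HasDerivAt (fun q => f ⟨⟨p, q, 0⟩, g⟩) (L p q (0, 1, 0, 0, 0)) q := by
    intro p q
    have h1 : HasDerivAt (fun q : ℝ => ((p, q, 0, (g.z : ℂ), g.θ) : Coord)) (0, 1, 0, 0, 0) q :=
      (hasDerivAt_const q p).prodMk ((hasDerivAt_id q).prodMk
        (hasDerivAt_const q ((0 : ℝ), (g.z : ℂ), g.θ)))
    have h2 := (hL p q).comp_hasDerivAt q h1
    refine h2.congr_of_eventuallyEq (Eventually.of_forall fun q => ?_)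
    exact (hof p q 0).symm
  have hr : ∀ p q, L p q (0, 0, 1, 0, 0) = 2 * Real.pi * Complex.I * m * f ⟨⟨p, q, 0⟩, g⟩ := by
    intro p q
    have h1 : HasDerivAt (fun r : ℝ => ((p, q, r, (g.z : ℂ), g.θ) : Coord)) (0, 0, 1, 0, 0) 0 :=
      (hasDerivAt_const _ p).prodMk ((hasDerivAt_const _ q).prodMk ((hasDerivAt_id (0 : ℝ)).prodMk
        (hasDerivAt_const _ ((g.z : ℂ), g.θ))))
    have h2 := (hL p q).comp_hasDerivAt (0 : ℝ) h1
    have h3 : HasDerivAt (fun r : ℝ => Complex.exp (2 * Real.pi * Complex.I * m * r) * f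
        ⟨⟨p, q, 0⟩, g⟩)
        (Complex.exp (2 * Real.pi * Complex.I * m * (0 : ℝ)) * (2 * Real.pi * Complex.I * m * 1) *
          f ⟨⟨p, q, 0⟩, g⟩) 0 :=
      (((Complex.ofRealCLM.hasDerivAt (x := 0)).const_mul _).cexp).mul_const _
    have h4 := h2.congr_of_eventuallyEq (f₁ := fun r : ℝ =>
      Complex.exp (2 * Real.pi * Complex.I * m * r) * f ⟨⟨p, q, 0⟩, g⟩)
      (Eventually.of_forall fun r => by
        exact (hf.apply_r p q r g).symm.trans (hof p q r).symm)
    rw [h4.unique h3]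
    simp
  refine ⟨fun p q => L p q (0, 1, 0, 0, 0), fun p q => ⟨hq p q, ?_⟩⟩
  -- Since `wbar` does not vanish, Y_- f = 0 expresses ∂_p f through ∂_q f and ∂_r f, and ∂_r f is
  -- 2πim f.
  have h1 : Ym f ⟨⟨p, q, 0⟩, g⟩ = 0 := congrFun hf.holo _
  rw [Ym_of_partials (cp := L p q (1, 0, 0, 0, 0)) (cq := L p q (0, 1, 0, 0, 0))
    (cr := L p q (0, 0, 1, 0, 0))] at h1
  · have h2 : (1 / 2 * starRingEnd ℂ (wbar g) : ℂ) ≠ 0 := by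
      refine mul_ne_zero (by norm_num) ((map_ne_zero _).2 (wbar_ne_zero g))
    have h3 := (mul_eq_zero.1 h1).resolve_left h2
    rw [hr] at h3
    simp only at h3
    have h4 : g.z * L p q (0, 1, 0, 0, 0) + 2 * Real.pi * Complex.I * m * (p * g.z + q) *
        f ⟨⟨p, q, 0⟩, g⟩ = L p q (1, 0, 0, 0, 0) := by linear_combination -h3
    rw [h4]
    exact hp p q
  · intro u v
    rw [pd, (hf.smooth.differentiableAt _).lineDeriv_eq_fderiv]
    have h5 : heisDir u v ⟨⟨p, q, 0⟩, g⟩ =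
        (heisDir u v ⟨⟨p, q, 0⟩, g⟩).1 • ((1, 0, 0, 0, 0) : Coord) +
        (heisDir u v ⟨⟨p, q, 0⟩, g⟩).2.1 • ((0, 1, 0, 0, 0) : Coord) +
        (heisDir u v ⟨⟨p, q, 0⟩, g⟩).2.2.1 • ((0, 0, 1, 0, 0) : Coord) := by
      ext <;> simp [heisDir]
    conv_lhs => rw [h5]
    rw [map_add, map_add, map_smul, map_smul, map_smul]
    simp only [Complex.real_smul]
    ring

theorem contDiff_heis (hf : IsJacobiMaass k m s χ f) (g : TG) :
    ContDiff ℝ ∞ fun v : ℝ × ℝ => f ⟨⟨v.1, v.2, 0⟩, g⟩ := by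
  have h1 : ContDiff ℝ ∞ fun v : ℝ × ℝ => ((v.1, v.2, 0, (g.z : ℂ), g.θ) : Coord) := by fun_prop
  have h2 := ContDiffOn.comp_contDiff hf.smooth h1 fun v => g.z.im_pos
  have h3 : (fun v : ℝ × ℝ => f ⟨⟨v.1, v.2, 0⟩, g⟩) = (f ∘ ofCoord) ∘
      fun v : ℝ × ℝ => ((v.1, v.2, 0, (g.z : ℂ), g.θ) : Coord) :=
    funext fun v => (congrArg f (ofCoord_toCoord ⟨⟨v.1, v.2, 0⟩, g⟩)).symm
  rw [h3]
  exact h2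

/-- Moving the base point p by 1 is the same as changing the index by 2m; invariance under h(1,0,0)
supplies exactly the phase between the two kernels. -/
theorem ext_add (hf : IsJacobiMaass k m s χ f) (hm : 1 ≤ m) (n : ℤ) (g : TG) :
    ext m (n + 2 * m) f g = ext m n f g := by
  have hm0 : (m : ℝ) ≠ 0 := by exact_mod_cast (by omega : m ≠ 0)
  refine intervalIntegral.integral_congr fun q _ => ?_
  have e : -(((n + 2 * m : ℤ) : ℝ) / (2 * m)) + 1 = -((n : ℝ) / (2 * m)) := by
    push_cast
    field_simp
    ring
  rw [hf.apply_p_add_one, e, mul_right_comm, ← Complex.exp_add, mul_comm]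
  congr 2
  push_cast
  ring

/-- The Fourier coefficients in the Heisenberg variable. -/
theorem fourier_heis (hf : IsJacobiMaass k m s χ f) (hm : 1 ≤ m) (n : ℤ) (p : ℝ) (g : TG) :
    ∫ q in (0 : ℝ)..1, f ⟨⟨p, q, 0⟩, g⟩ * Complex.exp (-(2 * Real.pi * Complex.I * m * p * q)) *
      Complex.exp (-(2 * Real.pi * Complex.I * n * q)) =
    Complex.exp (2 * Real.pi * Complex.I * m * g.z * (p + n / (2 * m)) ^ 2) * ext m n f g := by
  have hm0 : (m : ℂ) ≠ 0 := by exact_mod_cast (by omega : m ≠ 0)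
  obtain ⟨A, hA⟩ := hf.exists_partials g
  -- The exponent is chosen so that H has period 1 in q and satisfies ∂_p H = τ ∂_q H. The integral
  -- of H over a period is then independent of p.
  let Q : ℝ → ℝ → ℂ := fun p q => -(2 * Real.pi * Complex.I * m * p * q +
    2 * Real.pi * Complex.I * m * g.z * (p + n / (2 * m)) ^ 2 + 2 * Real.pi * Complex.I * n * q)
  let H : ℝ → ℝ → ℂ := fun p q => f ⟨⟨p, q, 0⟩, g⟩ * Complex.exp (Q p q)
  have hQq : ∀ p q : ℝ, HasDerivAt (fun q => Q p q)
      (-(2 * Real.pi * Complex.I * m * p + 2 * Real.pi * Complex.I * n)) q := by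
    intro p q
    have h1 : HasDerivAt (fun q : ℝ => (q : ℂ)) 1 q := Complex.ofRealCLM.hasDerivAt
    have h2 := (((h1.const_mul (2 * Real.pi * Complex.I * m * p)).add_const
      (2 * Real.pi * Complex.I * m * g.z * ((p : ℂ) + n / (2 * m)) ^ 2)).add
      (h1.const_mul (2 * Real.pi * Complex.I * n))).neg
    simp only [mul_one] at h2
    exact h2
  have hQp : ∀ p q : ℝ, HasDerivAt (fun p => Q p q)
      (-(2 * Real.pi * Complex.I * m * q +
        2 * Real.pi * Complex.I * m * g.z * (2 * (p + n / (2 * m))))) p := by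
    intro p q
    have h1 : HasDerivAt (fun q : ℝ => (q : ℂ)) 1 p := Complex.ofRealCLM.hasDerivAt
    have h2 := ((((h1.const_mul (2 * Real.pi * Complex.I * m)).mul_const (q : ℂ)).add
      (((h1.add_const ((n : ℂ) / (2 * m))).pow 2).const_mul
          (2 * Real.pi * Complex.I * m * g.z))).add_const
      (2 * Real.pi * Complex.I * n * q)).neg
    refine h2.congr_deriv ?_
    push_cast
    ring
  have hsm : ContDiff ℝ 1 fun v : ℝ × ℝ => H v.1 v.2 := by
    refine ((hf.contDiff_heis g).of_le (by exact_mod_cast le_top)).mul (ContDiff.cexp ?_)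
    have h1 : ContDiff ℝ 1 fun v : ℝ × ℝ => (v.1 : ℂ) := Complex.ofRealCLM.contDiff.comp
        contDiff_fst
    have h2 : ContDiff ℝ 1 fun v : ℝ × ℝ => (v.2 : ℂ) := Complex.ofRealCLM.contDiff.comp
        contDiff_snd
    simp only [Q]
    fun_prop
  have hper : ∀ p, H p 1 = H p 0 := by
    intro p
    have h1 := hf.apply_q_add_one p 0 g
    rw [zero_add] at h1
    simp only [H, h1]
    rw [mul_right_comm, ← Complex.exp_add, mul_comm]
    congr 1
    refine exp_eq_of_int (-n) ?_
    simp only [Q]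
    push_cast
    ring
  have hconst := integral_period_const (D := fun p q => (A p q - (2 * Real.pi * Complex.I * m * p +
      2 * Real.pi * Complex.I * n) * f ⟨⟨p, q, 0⟩, g⟩) * Complex.exp (Q p q)) (τ := g.z) hsm ?_ ?_
          hper
      p (-((n : ℝ) / (2 * m)))
  -- At p = -n/2m the Gaussian is 1 and the two phases in q combine to the kernel of `ext`.
  · have e1 : ext m n f g = ∫ q in (0 : ℝ)..1, H (-((n : ℝ) / (2 * m))) q := by
      refine intervalIntegral.integral_congr fun q _ => ?_
      simp only [H, Q]
      congr 2
      push_cast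
      field_simp
      ring
    rw [e1, ← hconst, ← intervalIntegral.integral_const_mul]
    refine intervalIntegral.integral_congr fun q _ => ?_
    simp only [H, Q]
    rw [mul_assoc, ← Complex.exp_add, mul_left_comm, ← Complex.exp_add]
    congr 2
    ring
  · intro p q
    refine ((hA p q).2.mul (hQp p q).cexp).congr_deriv ?_
    field_simp
    ring
  · intro p q
    refine ((hA p q).1.mul (hQq p q).cexp).congr_deriv ?_
    ring

/-- Periodicity in n modulo 2m leaves finitely many values. -/
theorem exists_norm_ext_le (hf : IsJacobiMaass k m s χ f) (hm : 1 ≤ m) (g : TG) :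
    ∃ C, ∀ n : ℤ, ‖ext m n f g‖ ≤ C := by
  refine ⟨∑ i ∈ Finset.range (2 * m), ‖ext m i f g‖, fun n => ?_⟩
  have hper : Function.Periodic (fun n => ext m n f g) (2 * m : ℤ) := fun n => hf.ext_add hm n g
  have h0 : 0 ≤ n % (2 * m : ℤ) := Int.emod_nonneg _ (by omega)
  have h1 : n % (2 * m : ℤ) < 2 * m := Int.emod_lt_of_pos _ (by omega)
  obtain ⟨i, hi⟩ := Int.eq_ofNat_of_zero_le h0
  have h2 : ext m n f g = ext m i f g := by
    have h3 := hper.int_mul (n / (2 * m)) (n % (2 * m))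
    rw [← hi, ← h3]
    congr 1
    have := Int.emod_add_mul_ediv n (2 * m)
    simp only [Int.cast_id]
    linarith
  rw [h2]
  exact Finset.single_le_sum (f := fun i : ℕ => ‖ext m i f g‖) (fun _ _ => norm_nonneg _)
    (Finset.mem_range.2 (by omega))

/-- The theta decomposition. -/
theorem eq_sum_theta (hf : IsJacobiMaass k m s χ f) (hm : 1 ≤ m) (x : TGJ) :
    f x = ∑ j : Fin (2 * m), theta m ((j : ℕ) + 1) x *
        (ext m ((j : ℕ) + 1) f x.right / wt x.right) := by
  have hm0 : (m : ℂ) ≠ 0 := by exact_mod_cast (by omega : m ≠ 0)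
  have hmR : (0 : ℝ) < 2 * m := by have : 0 < m := hm; positivity
  obtain ⟨⟨p, q, r⟩, g⟩ := x
  -- The phase removes the factor that f acquires under q ↦ q + 1.
  let G : ℝ → ℂ := fun q => f ⟨⟨p, q, 0⟩, g⟩ * Complex.exp (-(2 * Real.pi * Complex.I * m * p * q))
  have hGc : Continuous G := by
    have := hf.smooth.continuous_heis p 0 g
    exact this.mul (by fun_prop)
  have hGp : Function.Periodic G 1 := by
    intro q
    simp only [G]
    rw [hf.apply_q_add_one, mul_right_comm, ← Complex.exp_add, mul_comm]
    congr 2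
    push_cast
    ring
  have hcoeff : ∀ n : ℤ, ∫ q in (0 : ℝ)..1, G q * Complex.exp (-(2 * Real.pi * Complex.I * n * q)) =
      Complex.exp (2 * Real.pi * Complex.I * m * g.z * (p + n / (2 * m)) ^ 2) * ext m n f g :=
    fun n => hf.fourier_heis hm n p g
  have hsum : Summable fun n : ℤ =>
      Complex.exp (2 * Real.pi * Complex.I * m * g.z * (p + n / (2 * m)) ^ 2) := by
    have h1 : ∀ n : ℤ, Complex.exp (2 * Real.pi * Complex.I * m * g.z * (p + n / (2 * m)) ^ 2) =
        Complex.exp (2 * Real.pi * Complex.I * m * g.z * p ^ 2) *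
          jacobiTheta₂_term n (g.z * p) (g.z / (2 * m)) := by
      intro n
      rw [jacobiTheta₂_term, ← Complex.exp_add]
      congr 1
      field_simp
      ring
    simp only [h1]
    refine Summable.mul_left _ ((summable_jacobiTheta₂_term_iff _ _).2 ?_)
    rw [show (2 * m : ℂ) = ((2 * m : ℝ) : ℂ) by push_cast; rfl, Complex.div_ofReal_im]
    exact div_pos g.z.im_pos hmR
  obtain ⟨C, hC⟩ := hf.exists_norm_ext_le hm g
  -- Gaussian decay times the bounded `ext`: the Fourier series converges absolutely and represents
  -- G pointwise.
  have hsum' : Summable fun n : ℤ => Complex.exp (2 * Real.pi * Complex.I * m * g.z *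
      (p + n / (2 * m)) ^ 2) * ext m n f g := by
    refine Summable.of_norm_bounded (hsum.norm.mul_right C) fun n => ?_
    rw [norm_mul]
    exact mul_le_mul_of_nonneg_left (hC n) (norm_nonneg _)
  have hF := hasSum_fourier_of_periodic hGc hGp (by simpa only [hcoeff] using hsum') q
  simp only [hcoeff] at hF
  have hterm : ∀ n : ℤ, Complex.exp (2 * Real.pi * Complex.I * m * g.z * (p + n / (2 * m)) ^ 2) *
      ext m n f g * Complex.exp (2 * Real.pi * Complex.I * n * q) *
      (Complex.exp (2 * Real.pi * Complex.I * m * r) * Complex.exp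
          (2 * Real.pi * Complex.I * m * p * q)) =
      thT m ((n : ℝ) / (2 * m)) ⟨⟨p, q, r⟩, g⟩ * (ext m n f g / wt g) := by
    intro n
    have e : Complex.exp (2 * Real.pi * Complex.I * m * g.z * (p + n / (2 * m)) ^ 2) *
        Complex.exp (2 * Real.pi * Complex.I * n * q) * Complex.exp
            (2 * Real.pi * Complex.I * m * r) *
        Complex.exp (2 * Real.pi * Complex.I * m * p * q) * wt g =
        thT m ((n : ℝ) / (2 * m)) ⟨⟨p, q, r⟩, g⟩ := by
      rw [wt, thT, mul_left_comm]
      simp only [← Complex.exp_add]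
      congr 2
      push_cast
      field_simp
      ring
    rw [← e]
    have := wt_ne_zero g
    field_simp
  have hF2 := hF.mul_right (Complex.exp (2 * Real.pi * Complex.I * m * r) *
    Complex.exp (2 * Real.pi * Complex.I * m * p * q))
  simp only [hterm] at hF2
  have hval : G q * (Complex.exp (2 * Real.pi * Complex.I * m * r) *
      Complex.exp (2 * Real.pi * Complex.I * m * p * q)) = f ⟨⟨p, q, r⟩, g⟩ := by
    rw [hf.apply_r p q r]
    simp only [G]
    rw [Complex.exp_neg]
    have := Complex.exp_ne_zero (2 * Real.pi * Complex.I * m * p * q)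
    field_simp
  rw [hval] at hF2
  -- With n = j + 1 + 2ml the coefficient depends on j only and leaves the sum over l, which is a
  -- theta function.
  rw [← hF2.tsum_eq, tsum_int_eq_sum hm hF2.summable]
  refine Finset.sum_congr rfl fun j _ => ?_
  rw [theta_eq_tsum, ← tsum_mul_right]
  refine tsum_congr fun l => ?_
  have hper : Function.Periodic (fun n => ext m n f g) (2 * m : ℤ) := fun n => hf.ext_add hm n g
  have h3 := hper.int_mul l ((j : ℕ) + 1)
  simp only [Int.cast_id] at h3
  rw [mul_comm (2 * (m : ℤ)) l, h3]
  congr 2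
  have hmR' : (m : ℝ) ≠ 0 := by exact_mod_cast (by omega : m ≠ 0)
  push_cast
  field_simp

end IsJacobiMaass

/-! ### Extraction and synthesis -/

/-- The vector valued function on the upper half-plane that belongs to `f`. -/
def extract (m : ℕ) (f : TGJ → ℂ) (z : ℍ) (j : Fin (2 * m)) : ℂ :=
  ext m ((j : ℕ) + 1) f ⟨z, 0⟩ / wt ⟨z, 0⟩

theorem extract_synth {m : ℕ} (hm : 1 ≤ m) (k : ℝ) (u : ℍ → Fin (2 * m) → ℂ) :
    extract m (synth m k u) = u := by
  funext z j
  rw [extract, ext_synth hm, mul_div_cancel_left₀ _ (wt_ne_zero _)]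
  simp [Psi]

/-- Division by `wt` lowers the weight from k to k - 1/2, so the values at θ = 0 determine the
quotient everywhere. -/
theorem psi_extract {k : ℝ} {m : ℕ} {s : ℂ} {χ : tGamma →* ℂˣ} {f : TGJ → ℂ}
    (hf : IsJacobiMaass k m s χ f) (g : TG) (j : Fin (2 * m)) :
    Psi (k - 1 / 2) (extract m f) g j = ext m ((j : ℕ) + 1) f g / wt g := by
  obtain ⟨z, θ⟩ := g
  have h1 : ext m ((j : ℕ) + 1) f ⟨z, θ⟩ =
      Complex.exp (Complex.I * k * θ) * ext m ((j : ℕ) + 1) f ⟨z, 0⟩ := by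
    rw [ext, ext, ← intervalIntegral.integral_const_mul]
    refine intervalIntegral.integral_congr fun q _ => ?_
    have h2 := hf.apply_θ ⟨-((((j : ℕ) + 1 : ℤ) : ℝ) / (2 * m)), q, 0⟩ z 0 θ
    rw [zero_add] at h2
    rw [h2, mul_assoc]
  have h3 : wt ⟨z, θ⟩ = Complex.exp (Complex.I * θ / 2) * wt ⟨z, 0⟩ := by
    simp [wt, mul_comm]
  have h4 : Complex.exp (Complex.I * (k - 1 / 2 : ℝ) * θ) * Complex.exp (Complex.I * θ / 2) =
      Complex.exp (Complex.I * k * θ) := by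
    rw [← Complex.exp_add]
    congr 1
    push_cast
    ring
  rw [h1, h3, ← h4, Psi, Pi.smul_apply, smul_eq_mul, extract]
  have := wt_ne_zero ⟨z, 0⟩
  have := Complex.exp_ne_zero (Complex.I * θ / 2)
  simp only
  field_simp

theorem synth_extract {k : ℝ} {m : ℕ} {s : ℂ} {χ : tGamma →* ℂˣ} {f : TGJ → ℂ}
    (hf : IsJacobiMaass k m s χ f) (hm : 1 ≤ m) : synth m (k - 1 / 2) (extract m f) = f := by
  funext x
  rw [synth, hf.eq_sum_theta hm]
  exact Finset.sum_congr rfl fun j _ => by rw [psi_extract hf]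

theorem smoothH_extract {m : ℕ} {f : TGJ → ℂ} (hf : SmoothJ f) : SmoothH (extract m f) := by
  refine contDiffOn_pi.2 fun j => ?_
  set p : ℝ := -((((j : ℕ) + 1 : ℤ) : ℝ) / (2 * m)) with hp
  have hmap : ContDiff ℝ ∞ fun v : ℂ × ℝ => ((p, v.2, 0, v.1, 0) : Coord) := by fun_prop
  have h1 : ContDiffOn ℝ ∞ (fun v : ℂ × ℝ => (f ∘ ofCoord) (p, v.2, 0, v.1, 0) *
      Complex.exp (-(Real.pi * Complex.I * ((j : ℕ) + 1 : ℤ) * (v.2 : ℂ))))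
          (upperSet ×ˢ Set.univ) := by
    refine ContDiffOn.mul (ContDiffOn.comp (g := f ∘ ofCoord) hf hmap.contDiffOn fun v hv => hv.1)
        ?_
    have h2 : ContDiff ℝ ∞ fun v : ℂ × ℝ => (v.2 : ℂ) := Complex.ofRealCLM.contDiff.comp
        contDiff_snd
    exact ((contDiff_const.mul h2).neg.cexp).contDiffOn
  have h3 := contDiffOn_top_parametric_integral isOpen_upperSet 0 1 h1
  have h4 : ContDiffOn ℝ ∞ (fun w : ℂ => ((w.im ^ (1 / 4 : ℝ) : ℝ) : ℂ)) upperSet :=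
    (contDiffOn_coord_im_rpow (1 / 4)).comp (f := fun w : ℂ => ((0, 0, 0, w, 0) : Coord))
      (by fun_prop) fun w hw => hw
  have h5 : ∀ w ∈ upperSet, ((w.im ^ (1 / 4 : ℝ) : ℝ) : ℂ) ≠ 0 := fun w hw => by
    exact_mod_cast (Real.rpow_pos_of_pos hw _).ne'
  refine (h3.mul (h4.inv h5)).congr fun w hw => ?_
  have hw' : 0 < w.im := hw
  simp only [Function.comp_apply, extract, ext, div_eq_mul_inv]
  congr 2
  simp [wt, ofComplex_apply_of_im_pos hw']

/-! ### Equivariance -/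

/-- Conjugation of the law for `thVec` and removal of the eta factor, where |c| = 1, give the law of
the theta functions themselves. In the sum the conjugated matrix passes to the coefficients as its
adjoint. -/
theorem sum_theta_mul {κ m : ℕ} {γ : tGamma} {M : Matrix (Fin (2 * m)) (Fin (2 * m)) ℂ} {c : ℂ}
    (hc : c * starRingEnd ℂ c = 1) (hη : ∀ g, etaLift ((κ : ℝ) + 1 / 2) (γ * g) = c * etaLift
        ((κ : ℝ) + 1 / 2) g)
    (hM : ∀ x, thVec κ m (gJ γ * x) = M *ᵥ thVec κ m x) (w : Fin (2 * m) → ℂ) (x : TGJ) :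
    ∑ j : Fin (2 * m), theta m ((j : ℕ) + 1) (gJ γ * x) * w j =
      ∑ j : Fin (2 * m), theta m ((j : ℕ) + 1) x * (c * (Mᴴ *ᵥ w) j) := by
  have hE := etaLift_ne_zero ((κ : ℝ) + 1 / 2) x.right
  have h1 : ∀ j : Fin (2 * m), theta m ((j : ℕ) + 1) (gJ γ * x) =
      ∑ j' : Fin (2 * m), c * starRingEnd ℂ (M j j') * theta m ((j' : ℕ) + 1) x := by
    intro j
    have h2 := congrFun (hM x) j
    simp only [thVec, Matrix.mulVec, dotProduct] at h2
    rw [show (gJ γ * x).right = γ * x.right from rfl, hη] at h2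
    have h3 : c * starRingEnd ℂ (theta m ((j : ℕ) + 1) (gJ γ * x)) =
        ∑ j' : Fin (2 * m), M j j' * starRingEnd ℂ (theta m ((j' : ℕ) + 1) x) := by
      refine mul_left_cancel₀ hE ?_
      rw [Finset.mul_sum]
      calc _ = _ := by ring
        _ = _ := h2
        _ = _ := Finset.sum_congr rfl fun j' _ => by ring
    have h4 := congrArg (starRingEnd ℂ) h3
    simp only [map_mul, map_sum, Complex.conj_conj] at h4
    simp only [mul_assoc]
    rw [← Finset.mul_sum, ← h4, ← mul_assoc, hc, one_mul]
  simp only [h1, Finset.sum_mul, Matrix.mulVec, dotProduct, Finset.mul_sum]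
  rw [Finset.sum_comm]
  refine Finset.sum_congr rfl fun j' _ => Finset.sum_congr rfl fun j _ => ?_
  rw [Matrix.conjTranspose_apply, Complex.star_def]
  ring

/-- For a lift `γ` of a matrix, `f (γ x) = d f(x)` is equivalent to a transformation law of the
coefficients of `f`. -/
theorem synth_mul_iff {κ m : ℕ} (hm : 1 ≤ m) {k : ℝ} {γ : tGamma}
    {M : Matrix.unitaryGroup (Fin (2 * m)) ℂ} {c d e : ℂ}
    (hc : c * starRingEnd ℂ c = 1) (hη : ∀ g, etaLift ((κ : ℝ) + 1 / 2) (γ * g) = c * etaLift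
        ((κ : ℝ) + 1 / 2) g)
    (hM : ∀ x, thVec κ m (gJ γ * x) = (M : Matrix (Fin (2 * m)) (Fin (2 * m)) ℂ) *ᵥ thVec κ m x)
        (hd : d = c * e)
    (u : ℍ → Fin (2 * m) → ℂ) :
    (∀ x, synth m k u (gJ γ * x) = d * synth m k u x) ↔
      ∀ g, Psi k u (γ * g) = e • ((M : Matrix (Fin (2 * m)) (Fin (2 * m)) ℂ) *ᵥ Psi k u g) := by
  have hc0 : c ≠ 0 := by
    rintro rfl
    simp at hc
  have hMM : ∀ w : Fin (2 * m) → ℂ, (M : Matrix (Fin (2 * m)) (Fin (2 * m)) ℂ)ᴴ *ᵥ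
      ((M : Matrix (Fin (2 * m)) (Fin (2 * m)) ℂ) *ᵥ w) = w := fun w => by
    rw [Matrix.mulVec_mulVec, ← Matrix.star_eq_conjTranspose, Matrix.UnitaryGroup.star_mul_self,
      Matrix.one_mulVec]
  have hMM' : ∀ w : Fin (2 * m) → ℂ, (M : Matrix (Fin (2 * m)) (Fin (2 * m)) ℂ) *ᵥ
      ((M : Matrix (Fin (2 * m)) (Fin (2 * m)) ℂ)ᴴ *ᵥ w) = w := fun w => by
    rw [Matrix.mulVec_mulVec, ← Matrix.star_eq_conjTranspose, Matrix.mem_unitaryGroup_iff.1 M.2,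
      Matrix.one_mulVec]
  have h1 : ∀ x, synth m k u (gJ γ * x) = ∑ j : Fin (2 * m), theta m ((j : ℕ) + 1) x *
      (c * ((M : Matrix (Fin (2 * m)) (Fin (2 * m)) ℂ)ᴴ *ᵥ Psi k u (γ * x.right)) j) := fun x =>
    sum_theta_mul hc hη hM _ x
  have h2 : ∀ x, d * synth m k u x = ∑ j : Fin (2 * m), theta m ((j : ℕ) + 1) x *
      (d * Psi k u x.right j) := fun x => by
    rw [synth, Finset.mul_sum]
    exact Finset.sum_congr rfl fun j _ => by ring
  simp only [h1, h2]
  constructor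
  · intro h g
    -- Coefficients over a fixed point of `TG` may be compared, the Heisenberg variable being free.
    have h3 := eq_of_sum_theta_eq hm g
      (c := fun j => c * ((M : Matrix (Fin (2 * m)) (Fin (2 * m)) ℂ)ᴴ *ᵥ Psi k u (γ * g)) j)
      (d := fun j => d * Psi k u g j) fun y => h ⟨y, g⟩
    have h4 : (M : Matrix (Fin (2 * m)) (Fin (2 * m)) ℂ)ᴴ *ᵥ Psi k u (γ * g) = e • Psi k u g := by
      funext j
      have h5 := congrFun h3 j
      rw [hd, mul_assoc] at h5
      exact mul_left_cancel₀ hc0 h5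
    rw [← hMM' (Psi k u (γ * g)), h4, Matrix.mulVec_smul]
  · intro h x
    refine Finset.sum_congr rfl fun j _ => ?_
    rw [h, Matrix.mulVec_smul, hMM, Pi.smul_apply, smul_eq_mul, hd, mul_assoc]

theorem exp_mul_conj {x : ℂ} (t : ℝ) (h : x = Real.pi * Complex.I * t) :
    Complex.exp x * starRingEnd ℂ (Complex.exp x) = 1 := by
  rw [h, conj_exp_pi, ← Complex.exp_add, add_neg_cancel, Complex.exp_zero]

section Equivariance

variable {k : ℝ} {m : ℕ} {a : ZMod 12} {χ φ χ' : tGamma →* ℂˣ}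
  {ρ : SL(2, ℤ) →* Matrix.unitaryGroup (Fin (2 * m)) ℂ}

/-- The characters match because a + k = (a + 1/2) + (k - 1/2): the first summand belongs to the eta
factor in `thVec`, the second to u. -/
theorem synth_tEl_iff (hm : 1 ≤ m) (hχ : IsChi k χ) (hφ : IsPhi a φ) (hρ : IsRho a m ρ)
    (hχ' : IsChi (k - 1 / 2) χ') (u : ℍ → Fin (2 * m) → ℂ) :
    (∀ x, synth m (k - 1 / 2) u (gJ tEl * x) = ((φ * χ) tEl : ℂ) * synth m (k - 1 / 2) u x) ↔
      ∀ g, Psi (k - 1 / 2) u (tEl * g) =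
        (χ' tEl : ℂ) • ((ρ ModularGroup.T : Matrix _ _ ℂ) *ᵥ Psi (k - 1 / 2) u g) := by
  refine synth_mul_iff (κ := a.val) hm
    (c := Complex.exp (Real.pi * Complex.I * ((a.val : ℝ) + 1 / 2 : ℝ) / 6)) ?_
    (etaLift_tEl _) (fun x => ?_) ?_ u
  · exact exp_mul_conj (((a.val : ℝ) + 1 / 2) / 6) (by push_cast; ring)
  · rw [thVec_tEl _ hm]
    congr 1
    ext i j
    rw [hρ.1]
    rfl
  · rw [MonoidHom.mul_apply, Units.val_mul, hφ.1, hχ.1, hχ'.1, ← Complex.exp_add, ← Complex.exp_add]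
    congr 1
    push_cast
    ring

theorem synth_sEl_iff (hm : 1 ≤ m) (hχ : IsChi k χ) (hφ : IsPhi a φ) (hρ : IsRho a m ρ)
    (hχ' : IsChi (k - 1 / 2) χ') (u : ℍ → Fin (2 * m) → ℂ) :
    (∀ x, synth m (k - 1 / 2) u (gJ sEl * x) = ((φ * χ) sEl : ℂ) * synth m (k - 1 / 2) u x) ↔
      ∀ g, Psi (k - 1 / 2) u (sEl * g) =
        (χ' sEl : ℂ) • ((ρ ModularGroup.S : Matrix _ _ ℂ) *ᵥ Psi (k - 1 / 2) u g) := by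
  refine synth_mul_iff (κ := a.val) hm
    (c := Complex.exp (-(Real.pi * Complex.I * ((a.val : ℝ) + 1 / 2 : ℝ) / 2))) ?_
    (etaLift_sEl _) (fun x => ?_) ?_ u
  · exact exp_mul_conj (-(((a.val : ℝ) + 1 / 2) / 2)) (by push_cast; ring)
  · rw [thVec_sEl _ hm]
    congr 1
    ext i j
    rw [hρ.2]
    rfl
  · rw [MonoidHom.mul_apply, Units.val_mul, hφ.2, hχ.2, hχ'.2, ← Complex.exp_add, ← Complex.exp_add]
    congr 1
    push_cast
    ring

/-- The lattice equivariance of the sum of theta functions amounts to the invariance of the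
coefficients. -/
theorem synth_equivariant_iff (hm : 1 ≤ m) (hχ : IsChi k χ) (hφ : IsPhi a φ) (hρ : IsRho a m ρ)
    (u : ℍ → Fin (2 * m) → ℂ) :
    (∀ (γ : tGamma) x, synth m (k - 1 / 2) u (gJ γ * x) =
      ((φ * χ) γ : ℂ) * synth m (k - 1 / 2) u x) ↔ ∀ γ, slash (k - 1 / 2) ρ γ u = u := by
  obtain ⟨χ', hχ', -⟩ := exists_isChi (k - 1 / 2)
  constructor
  · intro h
    exact psi_equivariant hχ' ρ u ((synth_tEl_iff hm hχ hφ hρ hχ' u).1 (h tEl))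
      ((synth_sEl_iff hm hχ hφ hρ hχ' u).1 (h sEl))
  · intro h
    have ht := (slash_eq_iff hχ' ρ u ModularGroup.T).1 (h _)
    have hs := (slash_eq_iff hχ' ρ u ModularGroup.S).1 (h _)
    have et : secG ModularGroup.T = tEl := Subtype.ext sec_T
    have es : secG ModularGroup.S = sEl := Subtype.ext sec_S
    rw [sec_T, et] at ht
    rw [sec_S, es] at hs
    -- Elements under which the synthesized function has the right character form a subgroup, so the
    -- laws at t and s are enough.
    let P : Subgroup tGamma :=
      { carrier := {γ | ∀ x, synth m (k - 1 / 2) u (gJ γ * x) =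
          ((φ * χ) γ : ℂ) * synth m (k - 1 / 2) u x}
        mul_mem' := by
          intro γ δ h1 h2 x
          rw [Subgroup.coe_mul, ← gJ_mul_gJ, mul_assoc, h1, h2, map_mul, Units.val_mul, mul_assoc]
        one_mem' := by
          intro x
          rw [Subgroup.coe_one, show gJ 1 = 1 from map_one _, one_mul, map_one, Units.val_one,
              one_mul]
        inv_mem' := by
          intro γ h1 x
          have h2 := h1 (gJ ((γ⁻¹ : tGamma) : TG) * x)
          rw [← mul_assoc, gJ_mul_gJ, ← Subgroup.coe_mul, mul_inv_cancel, Subgroup.coe_one,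
            show gJ 1 = 1 from map_one _, one_mul] at h2
          rw [h2, map_inv, ← mul_assoc, Units.inv_mul, one_mul] }
    exact fun γ => tGamma_induction P ((synth_tEl_iff hm hχ hφ hρ hχ' u).2 ht)
      ((synth_sEl_iff hm hχ hφ hρ hχ' u).2 hs) γ

end Equivariance

theorem theta_add_r (m : ℕ) (j : ℤ) (p q r t : ℝ) (g : TG) :
    theta m j ⟨⟨p, q, r + t⟩, g⟩ =
      Complex.exp (2 * Real.pi * Complex.I * m * t) * theta m j ⟨⟨p, q, r⟩, g⟩ := by
  rw [theta_eq_tsum, theta_eq_tsum, ← tsum_mul_left]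
  refine tsum_congr fun n => ?_
  rw [thT, thT, mul_left_comm, ← Complex.exp_add]
  congr 2
  push_cast
  ring

theorem synth_weight (m : ℕ) (k : ℝ) (u : ℍ → Fin (2 * m) → ℂ) (r θ : ℝ) (g : TGJ) :
    synth m (k - 1 / 2) u (hJ 0 0 r * g * gJ (kT θ)) =
      Complex.exp (2 * Real.pi * Complex.I * m * r + Complex.I * k * θ) *
        synth m (k - 1 / 2) u g := by
  obtain ⟨⟨p, q, r'⟩, ⟨z, t⟩⟩ := g
  have e : hJ 0 0 r * (⟨⟨p, q, r'⟩, ⟨z, t⟩⟩ : TGJ) * gJ (kT θ) = ⟨⟨p, q, r' + r⟩, ⟨z, t + θ⟩⟩ := by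
    rw [hJ_mul]
    apply SemidirectProduct.ext
    · change _ * Heis.conj (TG.prHom _) 1 = _
      rw [map_one, mul_one]
      ext <;> simp [add_comm]
    · exact TG.mul_kT _ _
  rw [e, synth, synth, Finset.mul_sum]
  refine Finset.sum_congr rfl fun j _ => ?_
  rw [theta_add_r, theta_kT]
  have h : Complex.exp (2 * Real.pi * Complex.I * m * r + Complex.I * k * θ) *
      Complex.exp (Complex.I * (k - 1 / 2 : ℝ) * t) =
      Complex.exp (2 * Real.pi * Complex.I * m * r) * Complex.exp (Complex.I * θ / 2) *
        Complex.exp (Complex.I * (k - 1 / 2 : ℝ) * (t + θ : ℝ)) := by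
    simp only [← Complex.exp_add]
    congr 1
    push_cast
    ring
  simp only [Psi, Pi.smul_apply, smul_eq_mul]
  linear_combination (-(theta m ((j : ℕ) + 1) ⟨⟨p, q, r'⟩, ⟨z, t⟩⟩ * u z j)) * h

theorem synth_heis {m : ℕ} (hm : 1 ≤ m) (k : ℝ) (u : ℍ → Fin (2 * m) → ℂ) (l μ κ : ℤ) (g : TGJ) :
    synth m k u (hJ l μ κ * g) = synth m k u g := by
  rw [synth, synth]
  refine Finset.sum_congr rfl fun j _ => ?_
  rw [theta_heis hm, hJ_mul]

/-! ### Eigenvalues -/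

/-- Injectivity of `synth` reduces this to coefficients. With k' = k - 1/2 one has (k'/2)(k'/2 + 1)
= (2k + 1)²/16 - 1/4, while s'(1 - s') = (1 - s²)/4 for s' = (s + 1)/2. -/
theorem synth_eigen₁_iff {m : ℕ} (hm : 1 ≤ m) (k : ℝ) (s : ℂ) {u : ℍ → Fin (2 * m) → ℂ}
    (hu : SmoothH u) : Dm m (Dp m (synth m (k - 1 / 2) u)) =
      ((4 * s ^ 2 - (2 * k + 1) ^ 2) / 16) • synth m (k - 1 / 2) u ↔
      lapl (k - 1 / 2) u = ((s + 1) / 2 * (1 - (s + 1) / 2)) • u := by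
  rw [Dm_Dp_synth hm _ hu, ← synth_smul, (synth_injective hm _).eq_iff]
  constructor
  · intro h
    funext z j
    have h1 := congrFun (congrFun h z) j
    simp only [Pi.sub_apply, Pi.neg_apply, Pi.smul_apply, smul_eq_mul] at h1 ⊢
    push_cast at h1
    linear_combination -h1
  · intro h
    rw [h]
    funext z j
    simp only [Pi.sub_apply, Pi.neg_apply, Pi.smul_apply, smul_eq_mul]
    push_cast
    ring

/-- The same Laplace equation governs the other order of the operators, because (k'/2)(k'/2 - 1) =
(2k - 3)²/16 - 1/4. -/
theorem synth_eigen₂ {m : ℕ} (hm : 1 ≤ m) (k : ℝ) (s : ℂ) {u : ℍ → Fin (2 * m) → ℂ}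
    (hu : SmoothH u) (h : lapl (k - 1 / 2) u = ((s + 1) / 2 * (1 - (s + 1) / 2)) • u) :
    Dp m (Dm m (synth m (k - 1 / 2) u)) =
      ((4 * s ^ 2 - (2 * k - 3) ^ 2) / 16) • synth m (k - 1 / 2) u := by
  rw [Dp_Dm_synth hm _ hu, ← synth_smul, h]
  congr 1
  funext z j
  simp only [Pi.sub_apply, Pi.neg_apply, Pi.smul_apply, smul_eq_mul]
  push_cast
  ring

/-! ### Growth -/

/-- The estimate `O(y^b)`, uniformly for `x` in compact sets. -/
def PolyBound {n : ℕ} (u : ℍ → Fin n → ℂ) (b : ℝ) : Prop :=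
  ∀ K : Set ℝ, IsCompact K → ∃ C : ℝ, ∀ᶠ y : ℝ in atTop, ∀ x ∈ K,
    ‖u (ofComplex (x + y * Complex.I))‖ ≤ C * y ^ b

/-- The estimate `f(h ã(t) g) = O(t^b)`, uniformly for `h` and `g` in compact sets. -/
def PolyBoundJ (f : TGJ → ℂ) (b : ℝ) : Prop :=
  ∀ L : Set Heis, IsCompact L → ∀ K : Set TGJ, IsCompact K →
    ∃ C : ℝ, ∀ᶠ t : ℝ in atTop, ∀ h ∈ L, ∀ g ∈ K,
      ‖f (SemidirectProduct.inl h * gJ (aT t) * g)‖ ≤ C * t ^ b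

theorem aT_pr {t : ℝ} (ht : 0 < t) :
    ((aT t).pr : Matrix (Fin 2) (Fin 2) ℝ) = !![√t, 0; 0, 1 / √t] := by
  have h1 : (aT t).z.im = t := by
    rw [aT, ofComplex_apply_of_im_pos (by simpa using ht)]
    simp [← UpperHalfPlane.coe_im]
  have h2 : (aT t).z.re = 0 := by
    rw [aT, ofComplex_apply_of_im_pos (by simpa using ht)]
    simp [← UpperHalfPlane.coe_re]
  have h3 : (aT t).θ = 0 := rfl
  rw [TG.coe_pr, h1, h2, h3]
  simp

theorem aT_mul {t : ℝ} (ht : 0 < t) (g : TG) : aT t * g = ⟨ofComplex (t * g.z), g.θ⟩ := by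
  have him : 0 < ((t : ℂ) * g.z).im := by
    rw [Complex.im_ofReal_mul]
    exact mul_pos ht g.z.im_pos
  have hs : (√t : ℂ) * √t = t := by exact_mod_cast Real.mul_self_sqrt ht.le
  have hs0 : (√t : ℂ) ≠ 0 := by exact_mod_cast (Real.sqrt_pos.2 ht).ne'
  apply TG.ext
  · apply UpperHalfPlane.ext
    rw [TG.mul_z, TG.coe_smul, TG.jf, aT_pr ht, ofComplex_apply_of_im_pos him]
    simp
    linear_combination (g.z : ℂ) * hs
  · have h3 : (aT t).θ = 0 := rfl
    rw [TG.mul_θ, TG.ratio, h3]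
    simp

/-- The coordinates q and r enter theta functions only through phases, so they stay unspecified. The
coordinate p remains bounded because conjugation by ã(t) divides by √t. -/
theorem inl_mul_aT_mul {t : ℝ} (ht : 0 < t) (h : Heis) (g : TGJ) :
    ∃ q r : ℝ, SemidirectProduct.inl h * gJ (aT t) * g =
      ⟨⟨h.x + g.left.x / √t, q, r⟩, ⟨ofComplex (t * g.right.z), g.right.θ⟩⟩ := by
  have h1 : (Heis.act (aT t).pr⁻¹ g.left).x = g.left.x / √t := by
    simp [Heis.act, Matrix.SpecialLinearGroup.coe_inv, Matrix.adjugate_fin_two, aT_pr ht,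
      div_eq_mul_inv]
  have h2 : SemidirectProduct.inl h * gJ (aT t) * g =
      ⟨h * Heis.act (aT t).pr⁻¹ g.left, aT t * g.right⟩ := by
    rw [mul_assoc, gJ_mul]
    apply SemidirectProduct.ext
    · change h * Heis.act (TG.pr 1)⁻¹ _ = _
      rw [TG.pr_one, inv_one, Heis.act_one]
    · change 1 * _ = _
      rw [one_mul]
  rw [h2, aT_mul ht, ← h1, Heis.mul_def]
  exact ⟨_, _, rfl⟩

theorem norm_wt (g : TG) : ‖wt g‖ = g.z.im ^ (1 / 4 : ℝ) := by
  rw [wt, norm_mul, Complex.norm_real, Real.norm_eq_abs,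
    abs_of_nonneg (Real.rpow_nonneg g.z.im_pos.le _),
    show Complex.I * g.θ / 2 = ((g.θ / 2 : ℝ) : ℂ) * Complex.I by push_cast; ring,
    Complex.norm_exp_ofReal_mul_I, mul_one]

/-- The coefficient at x + iy is an average of values f(h ã(y) g) with h in a fixed compact set and
g = p̃(x/y + i). The division by `wt`, of modulus y^{1/4} ≥ 1, can only help. -/
theorem PolyBoundJ.extract {m : ℕ} {f : TGJ → ℂ} {b : ℝ} (hf : PolyBoundJ f b) :
    PolyBound (extract m f) b := by
  intro S hS
  obtain ⟨R, hR⟩ := hS.isBounded.exists_norm_le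
  -- The base points p = -(j + 1)/2m lie in [-1, 0], and q runs over [0, 1].
  let L : Set Heis := (fun v : ℝ × ℝ => (⟨v.1, v.2, 0⟩ : Heis)) '' (Set.Icc (-1) 0 ×ˢ Set.Icc 0 1)
  have hL : IsCompact L := by
    refine (isCompact_Icc.prod isCompact_Icc).image (continuous_induced_rng.2 ?_)
    exact continuous_fst.prodMk (continuous_snd.prodMk continuous_const)
  let K : Set TGJ := (fun x : ℝ => (⟨1, ⟨ofComplex (x + Complex.I), 0⟩⟩ : TGJ)) '' Set.Icc (-R) R
  have hK : IsCompact K := by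
    refine isCompact_Icc.image (continuous_induced_rng.2 ?_)
    refine continuous_const.prodMk (continuous_induced_rng.2 ?_)
    refine Continuous.prodMk ?_ continuous_const
    refine UpperHalfPlane.isEmbedding_coe.continuous_iff.2 ?_
    have : (UpperHalfPlane.coe ∘ fun x : ℝ => ofComplex (x + Complex.I)) =
        fun x : ℝ => (x : ℂ) + Complex.I := by
      funext x
      rw [Function.comp_apply, ofComplex_apply_of_im_pos (by simp)]
    change Continuous (UpperHalfPlane.coe ∘ fun x : ℝ => ofComplex (x + Complex.I))
    rw [this]
    fun_prop
  obtain ⟨C, hC⟩ := hf L hL K hK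
  refine ⟨C, ?_⟩
  filter_upwards [hC, eventually_ge_atTop 1] with y hy hy1 x hx
  have hy0 : 0 < y := by linarith
  have hb : 0 ≤ C * y ^ b :=
    (norm_nonneg _).trans (hy ⟨0, 0, 0⟩ ⟨(0, 0), by simp, rfl⟩ _ ⟨0, by
      have := (norm_nonneg x).trans (hR x hx)
      simp [this], rfl⟩)
  set z : ℍ := ofComplex (x + y * Complex.I) with hz
  have hzim : z.im = y := by
    rw [hz, ofComplex_apply_of_im_pos (by simpa using hy0)]
    simp [← UpperHalfPlane.coe_im]
  refine (pi_norm_le_iff_of_nonneg hb).2 fun j => ?_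
  have hw : 1 ≤ ‖wt ⟨z, 0⟩‖ := by
    rw [norm_wt, hzim]
    exact Real.one_le_rpow hy1 (by norm_num)
  have he : ‖ext m ((j : ℕ) + 1) f ⟨z, 0⟩‖ ≤ C * y ^ b := by
    have h1 : ∀ q ∈ Set.uIoc (0 : ℝ) 1, ‖f ⟨⟨-((((j : ℕ) + 1 : ℤ) : ℝ) / (2 * m)), q, 0⟩, ⟨z, 0⟩⟩ *
        Complex.exp (-(Real.pi * Complex.I * ((j : ℕ) + 1 : ℤ) * q))‖ ≤ C * y ^ b := by
      intro q hq
      rw [Set.uIoc_of_le zero_le_one] at hq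
      have e1 : ‖Complex.exp (-(Real.pi * Complex.I * ((j : ℕ) + 1 : ℤ) * q))‖ = 1 := by
        rw [show -(Real.pi * Complex.I * ((j : ℕ) + 1 : ℤ) * q : ℂ) =
          ((-(Real.pi * ((j : ℕ) + 1 : ℤ) * q) : ℝ) : ℂ) * Complex.I by push_cast; ring,
          Complex.norm_exp_ofReal_mul_I]
      rw [norm_mul, e1, mul_one]
      have hj : (((j : ℕ) + 1 : ℕ) : ℝ) ≤ 2 * m := by exact_mod_cast j.2
      have hm : (0 : ℝ) < 2 * m := lt_of_lt_of_le (by positivity) hj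
      have hp1 : (((j : ℕ) + 1 : ℤ) : ℝ) / (2 * m) ≤ 1 := by
        rw [div_le_one hm]
        push_cast at hj ⊢
        exact hj
      have hp0 : 0 ≤ (((j : ℕ) + 1 : ℤ) : ℝ) / (2 * m) := by positivity
      have hxy : x / y ∈ Set.Icc (-R) R := by
        have h2 : |x| ≤ R := hR x hx
        have h3 : |x / y| ≤ R := by
          rw [abs_div, abs_of_pos hy0]
          exact (div_le_self (abs_nonneg _) hy1).trans h2
        exact abs_le.1 h3
      have h4 := hy ⟨-((((j : ℕ) + 1 : ℤ) : ℝ) / (2 * m)), q, 0⟩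
        ⟨(-((((j : ℕ) + 1 : ℤ) : ℝ) / (2 * m)), q), ⟨⟨by linarith, by linarith⟩, hq.1.le, hq.2⟩,
            rfl⟩
        _ ⟨x / y, hxy, rfl⟩
      have h5 : (SemidirectProduct.inl ⟨-((((j : ℕ) + 1 : ℤ) : ℝ) / (2 * m)), q, 0⟩ * gJ (aT y) *
          (⟨1, ⟨ofComplex ((x / y : ℝ) + Complex.I), 0⟩⟩ : TGJ)) =
          ⟨⟨-((((j : ℕ) + 1 : ℤ) : ℝ) / (2 * m)), q, 0⟩, ⟨z, 0⟩⟩ := by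
        have h6 : (⟨1, ⟨ofComplex ((x / y : ℝ) + Complex.I), 0⟩⟩ : TGJ) =
            gJ ⟨ofComplex ((x / y : ℝ) + Complex.I), 0⟩ := rfl
        rw [h6, mul_assoc, gJ_mul_gJ, aT_mul hy0]
        have h7 : ofComplex ((y : ℂ) * (ofComplex ((x / y : ℝ) + Complex.I) : ℍ)) = z := by
          rw [hz, ofComplex_apply_of_im_pos (z := (x / y : ℝ) + Complex.I) (by simp)]
          congr 1
          have : (y : ℂ) ≠ 0 := by exact_mod_cast hy0.ne'
          push_cast
          field_simp
        rw [h7]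
        exact hJ_mul_gJ _ _ _ _
      rw [h5] at h4
      exact h4
    have h2 := intervalIntegral.norm_integral_le_of_norm_le_const h1
    rwa [sub_zero, abs_one, mul_one] at h2
  rw [JMF.extract, norm_div]
  exact (div_le_self (norm_nonneg _) hw).trans he

/-- The theta functions are `O(y^{1/4})`. -/
theorem exists_norm_theta_le {m : ℕ} (hm : 1 ≤ m) (P : ℝ) :
    ∃ C, 0 ≤ C ∧ ∀ (j : Fin (2 * m)) (g : TGJ), |g.left.x| ≤ P → 1 ≤ g.right.z.im →
      ‖theta m ((j : ℕ) + 1) g‖ ≤ C * g.right.z.im ^ (1 / 4 : ℝ) := by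
  have hsum : Summable fun n : ℤ => Real.exp (-(Real.pi * n ^ 2)) := by
    have h1 := ((summable_jacobiTheta₂_term_iff 0 Complex.I).2 (by simp)).norm
    refine h1.congr fun n => ?_
    rw [norm_jacobiTheta₂_term]
    simp
  have hW : ∀ (j : Fin (2 * m)) (p : ℝ), |p| ≤ P → |p + (((j : ℕ) + 1 : ℤ) : ℝ) / (2 * m)| ≤ P +
      1 := by
    intro j p hp
    have hj : (((j : ℕ) + 1 : ℕ) : ℝ) ≤ 2 * m := by exact_mod_cast j.2
    have hm : (0 : ℝ) < 2 * m := lt_of_lt_of_le (by positivity) hj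
    have hp1 : (((j : ℕ) + 1 : ℤ) : ℝ) / (2 * m) ≤ 1 := by
      rw [div_le_one hm]
      push_cast at hj ⊢
      exact hj
    have hp0 : 0 ≤ (((j : ℕ) + 1 : ℤ) : ℝ) / (2 * m) := by positivity
    refine (abs_add_le _ _).trans (add_le_add hp ?_)
    rwa [abs_of_nonneg hp0]
  refine ⟨Real.exp (2 * Real.pi * m * (P + 1) ^ 2) * ∑' n : ℤ, Real.exp (-(Real.pi * n ^ 2)),
    mul_nonneg (Real.exp_pos _).le (tsum_nonneg fun n => (Real.exp_pos _).le), ?_⟩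
  intro j g hp hy
  have hm1 : (1 : ℝ) ≤ m := by exact_mod_cast hm
  set β : ℝ := (((j : ℕ) + 1 : ℤ) : ℝ) / (2 * m) with hβ
  have hbound : ∀ n : ℤ, ‖thT m (β + n) g‖ ≤ g.right.z.im ^ (1 / 4 : ℝ) *
      (Real.exp (2 * Real.pi * m * (P + 1) ^ 2) * Real.exp (-(Real.pi * n ^ 2))) := by
    intro n
    rw [norm_thT, ← Real.exp_add]
    refine mul_le_mul_of_nonneg_left (Real.exp_le_exp.2 ?_) (Real.rpow_nonneg g.right.z.im_pos.le _)
    have h1 : (g.left.x + β) ^ 2 ≤ (P + 1) ^ 2 := by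
      rw [← sq_abs]
      exact pow_le_pow_left₀ (abs_nonneg _) (hW j _ hp) 2
    -- From (2A + n)² ≥ 0 with A = p + β; the shift by A costs only a constant factor in the sum
    -- over n.
    have h2 : (n : ℝ) ^ 2 / 2 - (P + 1) ^ 2 ≤ (g.left.x + (β + n)) ^ 2 := by
      nlinarith [sq_nonneg (2 * (g.left.x + β) + n)]
    have h3 : (g.left.x + (β + n)) ^ 2 ≤ g.right.z.im * (g.left.x + (β + n)) ^ 2 :=
      le_mul_of_one_le_left (sq_nonneg _) hy
    have h4 : 2 * Real.pi * m * ((n : ℝ) ^ 2 / 2 - (P + 1) ^ 2) ≤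
        2 * Real.pi * m * (g.right.z.im * (g.left.x + (β + n)) ^ 2) :=
      mul_le_mul_of_nonneg_left (h2.trans h3) (by positivity)
    have h5 : Real.pi * (n : ℝ) ^ 2 ≤ m * (Real.pi * (n : ℝ) ^ 2) :=
      le_mul_of_one_le_left (by positivity) hm1
    linarith
  rw [theta_eq_tsum]
  refine (tsum_of_norm_bounded ((hsum.mul_left _).mul_left _).hasSum hbound).trans (le_of_eq ?_)
  rw [tsum_mul_left, tsum_mul_left]
  ring

/-- Each component picks up a constant phase under `z ↦ z + 1`. -/
theorem exists_apply_T {k : ℝ} {m : ℕ} {a : ZMod 12}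
    {ρ : SL(2, ℤ) →* Matrix.unitaryGroup (Fin (2 * m)) ℂ} (hρ : IsRho a m ρ)
    {u : ℍ → Fin (2 * m) → ℂ} (hu : slash k ρ ModularGroup.T u = u) (j : Fin (2 * m)) :
    ∃ κ : ℝ, ∀ z, u (ModularGroup.T • z) j = Complex.exp (2 * Real.pi * Complex.I * κ) * u z j := by
  obtain ⟨χ, hχ, -⟩ := exists_isChi k
  refine ⟨k / 12 + ((a.val : ℝ) / 6 + 1 / 12 - ((j : ℕ) + 1 : ℝ) ^ 2 / (2 * m)) / 2, fun z => ?_⟩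
  have h1 := congrFun ((slash_eq_iff hχ ρ u ModularGroup.T).1 hu ⟨z, 0⟩) j
  have et : secG ModularGroup.T = tEl := Subtype.ext sec_T
  obtain ⟨e1, e2⟩ := tEl_mul ⟨z, 0⟩
  have hd : (ρ ModularGroup.T : Matrix (Fin (2 * m)) (Fin (2 * m)) ℂ) =
      Matrix.diagonal fun j : Fin (2 * m) => Complex.exp (((Real.pi *
        ((a.val : ℝ) / 6 + 1 / 12 - ((j : ℕ) + 1 : ℝ) ^ 2 / (2 * m)) : ℝ) : ℂ) * Complex.I) := by
    ext i j
    rw [hρ.1, Matrix.diagonal_apply]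
    congr 2
    push_cast
    ring
  rw [sec_T, et, hχ.1, hd, Pi.smul_apply, Matrix.mulVec_diagonal, Psi, Psi, e1, e2] at h1
  simp only [Pi.smul_apply, smul_eq_mul] at h1
  simp only [Complex.ofReal_zero, mul_zero, Complex.exp_zero, one_mul] at h1
  rw [h1, ← mul_assoc, ← Complex.exp_add]
  congr 2
  push_cast
  ring

theorem ofComplex_add_one (x : ℝ) {y : ℝ} (hy : 0 < y) :
    ofComplex (((x + 1 : ℝ) : ℂ) + y * Complex.I) =
      ModularGroup.T • ofComplex (x + y * Complex.I) := by
  apply UpperHalfPlane.ext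
  rw [UpperHalfPlane.modular_T_smul, UpperHalfPlane.coe_vadd,
    ofComplex_apply_of_im_pos (by simpa using hy), ofComplex_apply_of_im_pos (by simpa using hy)]
  push_cast
  ring

/-- T acts diagonally by phases, so the modulus of each component has period 1 in x and a bound on
[0, 1] holds for all real x. This matters because the real part of t·τ is unbounded as t grows. -/
theorem norm_apply_add_int {k : ℝ} {m : ℕ} {a : ZMod 12}
    {ρ : SL(2, ℤ) →* Matrix.unitaryGroup (Fin (2 * m)) ℂ} (hρ : IsRho a m ρ)
    {u : ℍ → Fin (2 * m) → ℂ} (hu : slash k ρ ModularGroup.T u = u) (x : ℝ) {y : ℝ} (hy : 0 < y)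
    (j : Fin (2 * m)) (n : ℤ) :
    ‖u (ofComplex ((x + n : ℝ) + y * Complex.I)) j‖ = ‖u (ofComplex (x + y * Complex.I)) j‖ := by
  have hper : Function.Periodic (fun x : ℝ => ‖u (ofComplex (x + y * Complex.I)) j‖) 1 := by
    intro x
    change ‖u (ofComplex (((x + 1 : ℝ) : ℂ) + y * Complex.I)) j‖ = _
    obtain ⟨κ, hκ⟩ := exists_apply_T hρ hu j
    rw [ofComplex_add_one x hy, hκ, norm_mul, show 2 * Real.pi * Complex.I * (κ : ℂ) =
      ((2 * Real.pi * κ : ℝ) : ℂ) * Complex.I by push_cast; ring, Complex.norm_exp_ofReal_mul_I,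
      one_mul]
  have h := hper.int_mul n x
  simpa using h

/-- At ã(t) g the height is t v, with v in a compact subset of the positive reals. The theta
functions cost (tv)^{1/4} and the components of u cost (tv)^b. -/
theorem PolyBound.synth {k : ℝ} {m : ℕ} (hm : 1 ≤ m) {a : ZMod 12}
    {ρ : SL(2, ℤ) →* Matrix.unitaryGroup (Fin (2 * m)) ℂ} (hρ : IsRho a m ρ)
    {u : ℍ → Fin (2 * m) → ℂ} (hu : slash k ρ ModularGroup.T u = u) {b : ℝ} (hb : PolyBound u b) :
    PolyBoundJ (synth m k u) (b + 1 / 4) := by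
  intro L hL K hK
  have hcx : Continuous fun h : Heis => h.x := by
    have h2 : Continuous fun h : Heis => (h.x, h.y, h.r) := continuous_induced_dom
    exact h2.fst
  have hct := continuous_toCoord
  obtain ⟨P₁, hP₁⟩ := hL.exists_bound_of_continuousOn hcx.continuousOn
  obtain ⟨P₂, hP₂⟩ := hK.exists_bound_of_continuousOn (f := fun g : TGJ => g.left.x)
    (continuous_fst.comp hct).continuousOn
  have hcim : Continuous fun g : TGJ => g.right.z.im := Complex.continuous_im.comp
      hct.snd.snd.snd.fst
  obtain ⟨M₁, hM₁⟩ := hK.exists_bound_of_continuousOn (f := fun g : TGJ => (g.right.z.im)⁻¹)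
    (hcim.inv₀ fun g => g.right.z.im_pos.ne').continuousOn
  obtain ⟨M₂, hM₂⟩ := hK.exists_bound_of_continuousOn
    (f := fun g : TGJ => g.right.z.im ^ (b + 1 / 4))
    (hcim.rpow_const fun g => Or.inl g.right.z.im_pos.ne').continuousOn
  obtain ⟨Cθ, hCθ0, hCθ⟩ := exists_norm_theta_le hm (P₁ + P₂)
  obtain ⟨C, hC⟩ := hb (Set.Icc 0 1) isCompact_Icc
  obtain ⟨Y, hY⟩ := eventually_atTop.1 hC
  refine ⟨2 * m * (Cθ * |C| * M₂), ?_⟩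
  -- As v⁻¹ ≤ M₁ on K, the bounds on t give tv ≥ 1 and tv ≥ Y, where the estimates for theta and for
  -- u apply.
  filter_upwards [eventually_ge_atTop 1, eventually_ge_atTop M₁, eventually_ge_atTop (Y * M₁),
    eventually_ge_atTop (-Y * M₁)] with t ht1 ht2 ht3 ht4 h hh g hg
  have ht0 : 0 < t := by linarith
  obtain ⟨q, r, e⟩ := inl_mul_aT_mul ht0 h g
  rw [e]
  set v := g.right.z.im with hv
  have hv0 : 0 < v := g.right.z.im_pos
  have hM₁' : v⁻¹ ≤ M₁ := (le_abs_self _).trans (hM₁ g hg)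
  have hM0 : 0 < M₁ := lt_of_lt_of_le (by positivity) hM₁'
  have hvM : 1 ≤ v * M₁ := by
    rw [← mul_inv_cancel₀ hv0.ne']
    exact mul_le_mul_of_nonneg_left hM₁' hv0.le
  have htv1 : 1 ≤ t * v := by nlinarith
  have htvY : Y ≤ t * v := by
    rcases le_or_gt Y 0 with h0 | h0
    · linarith
    · have : Y * 1 ≤ Y * (v * M₁) := mul_le_mul_of_nonneg_left hvM h0.le
      nlinarith
  have htv0 : 0 < t * v := by linarith
  have hre : (t : ℂ) * g.right.z = ((t * g.right.z.re : ℝ) : ℂ) + ((t * v : ℝ) : ℂ) *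
      Complex.I := by
    apply Complex.ext <;> simp [hv]
  have hzim : (ofComplex ((t : ℂ) * g.right.z)).im = t * v := by
    rw [hre, ofComplex_apply_of_im_pos (by simpa using htv0)]
    simp [← UpperHalfPlane.coe_im]
  have hp : |h.x + g.left.x / √t| ≤ P₁ + P₂ := by
    refine (abs_add_le _ _).trans (add_le_add (hP₁ h hh) ?_)
    rw [abs_div, abs_of_nonneg (Real.sqrt_nonneg t)]
    exact (div_le_self (abs_nonneg _) (Real.one_le_sqrt.2 ht1)).trans (hP₂ g hg)
  have hub : ∀ j, ‖u (ofComplex ((t : ℂ) * g.right.z)) j‖ ≤ |C| * (t * v) ^ b := by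
    intro j
    rw [hre]
    have h1 := norm_apply_add_int hρ hu (Int.fract (t * g.right.z.re)) htv0 j ⌊t * g.right.z.re⌋
    rw [Int.fract_add_floor] at h1
    rw [h1]
    refine (norm_le_pi_norm _ j).trans ((hY (t * v) htvY _
      ⟨Int.fract_nonneg _, (Int.fract_lt_one _).le⟩).trans ?_)
    exact mul_le_mul_of_nonneg_right (le_abs_self C) (Real.rpow_nonneg htv0.le _)
  have hterm : ∀ j : Fin (2 * m), ‖theta m ((j : ℕ) + 1)
      ⟨⟨h.x + g.left.x / √t, q, r⟩, ⟨ofComplex (t * g.right.z), g.right.θ⟩⟩ *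
        Psi k u ⟨ofComplex (t * g.right.z), g.right.θ⟩ j‖ ≤ Cθ * |C| * M₂ * t ^ (b + 1 / 4) := by
    intro j
    have h1 := hCθ j ⟨⟨h.x + g.left.x / √t, q, r⟩, ⟨ofComplex (t * g.right.z), g.right.θ⟩⟩ hp
      (by rw [hzim]; exact htv1)
    rw [hzim] at h1
    have h2 : ‖Psi k u ⟨ofComplex (t * g.right.z), g.right.θ⟩ j‖ ≤ |C| * (t * v) ^ b := by
      rw [Psi, Pi.smul_apply, norm_smul, show Complex.I * k * g.right.θ =
        ((k * g.right.θ : ℝ) : ℂ) * Complex.I by push_cast; ring, Complex.norm_exp_ofReal_mul_I,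
        one_mul]
      exact hub j
    rw [norm_mul]
    have h3 : (t * v) ^ (1 / 4 : ℝ) * (t * v) ^ b = t ^ (b + 1 / 4) * v ^ (b + 1 / 4) := by
      rw [← Real.rpow_add htv0, add_comm, Real.mul_rpow ht0.le hv0.le]
    have h4 : v ^ (b + 1 / 4) ≤ M₂ := (le_abs_self _).trans (hM₂ g hg)
    calc _ ≤ (Cθ * (t * v) ^ (1 / 4 : ℝ)) * (|C| * (t * v) ^ b) :=
          mul_le_mul h1 h2 (norm_nonneg _) (mul_nonneg hCθ0 (Real.rpow_nonneg htv0.le _))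
      _ = Cθ * |C| * t ^ (b + 1 / 4) * v ^ (b + 1 / 4) := by linear_combination (Cθ * |C|) * h3
      _ ≤ Cθ * |C| * t ^ (b + 1 / 4) * M₂ := by
          refine mul_le_mul_of_nonneg_left h4 ?_
          have := Real.rpow_nonneg ht0.le (b + 1 / 4)
          positivity
      _ = _ := by ring
  refine (norm_sum_le _ _).trans ((Finset.sum_le_sum fun j _ => hterm j).trans (le_of_eq ?_))
  rw [Finset.sum_const, Finset.card_univ, Fintype.card_fin, nsmul_eq_mul]
  push_cast
  ring

theorem PolyBoundJ.mono {f : TGJ → ℂ} {b c : ℝ} (hbc : b ≤ c) (hf : PolyBoundJ f b) :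
    PolyBoundJ f c := by
  intro L hL K hK
  obtain ⟨C, hC⟩ := hf L hL K hK
  refine ⟨|C|, ?_⟩
  filter_upwards [hC, eventually_ge_atTop 1] with t h1 ht h hh g hg
  have h2 : t ^ b ≤ t ^ c := Real.rpow_le_rpow_of_exponent_le ht hbc
  have h3 : 0 ≤ t ^ b := Real.rpow_nonneg (by linarith) _
  exact (h1 h hh g hg).trans (mul_le_mul (le_abs_self _) h2 h3 (abs_nonneg _))

theorem ExpDecay.polyBound {n : ℕ} {u : ℍ → Fin n → ℂ} (hu : ExpDecay u) (b : ℝ) :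
    PolyBound u b := by
  obtain ⟨a, ha, h⟩ := hu
  intro K hK
  obtain ⟨C, hC⟩ := h K hK
  refine ⟨|C|, ?_⟩
  have h1 := (isLittleO_exp_neg_mul_rpow_atTop ha b).bound one_pos
  filter_upwards [hC, h1, eventually_ge_atTop 0] with y h2 h3 h4 x hx
  rw [Real.norm_eq_abs, Real.norm_eq_abs, abs_of_pos (Real.exp_pos _), one_mul,
    abs_of_nonneg (Real.rpow_nonneg h4 _), neg_mul] at h3
  exact (h2 x hx).trans (mul_le_mul (le_abs_self _) h3 (Real.exp_pos _).le (abs_nonneg _))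

/-! ### Decay of solutions of second order equations -/

/-- The function (F' + μF) e^{-μy} is increasing. If F' + μF were positive somewhere, F would grow
exponentially, against its bound. Hence F' + μF ≤ 0 and F e^{μy} decreases. -/
theorem decay_of_second_deriv {F F' F'' : ℝ → ℝ} {y₀ μ B : ℝ} (hμ : 0 < μ)
    (h1 : ∀ y, y₀ ≤ y → HasDerivAt F (F' y) y) (h2 : ∀ y, y₀ ≤ y → HasDerivAt F' (F'' y) y)
    (h3 : ∀ y, y₀ ≤ y → μ ^ 2 * F y ≤ F'' y) (h0 : ∀ y, y₀ ≤ y → 0 ≤ F y)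
    (hB : ∀ y, y₀ ≤ y → F y ≤ B) {y : ℝ} (hy : y₀ ≤ y) :
    F y ≤ F y₀ * Real.exp (-(μ * (y - y₀))) := by
  have hexp : ∀ c y : ℝ, HasDerivAt (fun y => Real.exp (c * y)) (Real.exp (c * y) * c) y :=
      fun c y => by
    simpa using ((hasDerivAt_id y).const_mul c).exp
  have hΦ : ∀ y, y₀ ≤ y → HasDerivAt (fun y => F y * Real.exp (μ * y))
      ((F' y + μ * F y) * Real.exp (μ * y)) y := fun y hy =>
    ((h1 y hy).mul (hexp μ y)).congr_deriv (by ring)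
  have hΨ : ∀ y, y₀ ≤ y → HasDerivAt (fun y => (F' y + μ * F y) * Real.exp (-μ * y))
      ((F'' y - μ ^ 2 * F y) * Real.exp (-μ * y)) y := fun y hy =>
    (((h2 y hy).add ((h1 y hy).const_mul μ)).mul (hexp (-μ) y)).congr_deriv (by
      simp only [Pi.add_apply]; ring)
  have hmono : MonotoneOn (fun y => (F' y + μ * F y) * Real.exp (-μ * y)) (Set.Ici y₀) := by
    refine monotoneOn_of_deriv_nonneg (convex_Ici _)
      (fun y hy => (hΨ y hy).continuousAt.continuousWithinAt)
      (fun y hy => (hΨ y (interior_subset hy)).differentiableAt.differentiableWithinAt) fun y hy =>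
          ?_
    rw [(hΨ y (interior_subset hy)).deriv]
    exact mul_nonneg (sub_nonneg.2 (h3 y (interior_subset hy))) (Real.exp_pos _).le
  have hH : ∀ y, y₀ ≤ y → F' y + μ * F y ≤ 0 := by
    intro y₁ hy₁
    by_contra hpos
    push Not at hpos
    set h := (F' y₁ + μ * F y₁) * Real.exp (-μ * y₁) with hh
    have hh0 : 0 < h := mul_pos hpos (Real.exp_pos _)
    have hlow : ∀ y, y₁ ≤ y → h * Real.exp (μ * y) ≤ F' y + μ * F y := by
      intro y hy
      have h4 := hmono (Set.mem_Ici.2 hy₁) (Set.mem_Ici.2 (hy₁.trans hy)) hy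
      have h5 := mul_le_mul_of_nonneg_right h4 (Real.exp_pos (μ * y)).le
      simp only [mul_assoc, ← Real.exp_add] at h5
      rw [show -μ * y + μ * y = 0 by ring, Real.exp_zero, mul_one] at h5
      rw [hh, mul_assoc, ← Real.exp_add]
      exact h5
    -- The subtracted term is an antiderivative of the lower bound h e^{2μy} for the derivative of F
    -- e^{μy}.
    have hmono2 : MonotoneOn (fun y => F y * Real.exp (μ * y) - h / (2 * μ) * Real.exp (2 * μ * y))
        (Set.Ici y₁) := by
      have hd : ∀ y, y₁ ≤ y → HasDerivAt
          (fun y => F y * Real.exp (μ * y) - h / (2 * μ) * Real.exp (2 * μ * y))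
          ((F' y + μ * F y - h * Real.exp (μ * y)) * Real.exp (μ * y)) y := fun y hy =>
        ((hΦ y (hy₁.trans hy)).sub ((hexp (2 * μ) y).const_mul (h / (2 * μ)))).congr_deriv (by
          rw [show 2 * μ * y = μ * y + μ * y by ring, Real.exp_add]
          field_simp)
      refine monotoneOn_of_deriv_nonneg (convex_Ici _)
        (fun y hy => (hd y hy).continuousAt.continuousWithinAt)
        (fun y hy => (hd y (interior_subset hy)).differentiableAt.differentiableWithinAt)
        fun y hy => ?_
      rw [(hd y (interior_subset hy)).deriv]
      exact mul_nonneg (sub_nonneg.2 (hlow y (interior_subset hy))) (Real.exp_pos _).le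
    have hbig : ∀ y, y₁ ≤ y → h / (2 * μ) * Real.exp (μ * y) ≤
        B + h / (2 * μ) * Real.exp (2 * μ * y₁) * Real.exp (-(μ * y)) := by
      intro y hy
      have h4 := hmono2 (Set.mem_Ici.2 le_rfl) (Set.mem_Ici.2 hy) hy
      simp only at h4
      have h5 : 0 ≤ F y₁ * Real.exp (μ * y₁) := mul_nonneg (h0 _ hy₁) (Real.exp_pos _).le
      have h6 : F y * Real.exp (μ * y) ≤ B * Real.exp (μ * y) :=
        mul_le_mul_of_nonneg_right (hB y (hy₁.trans hy)) (Real.exp_pos _).le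
      have h7 : h / (2 * μ) * Real.exp (2 * μ * y) ≤
          B * Real.exp (μ * y) + h / (2 * μ) * Real.exp (2 * μ * y₁) := by linarith
      have h8 := mul_le_mul_of_nonneg_right h7 (Real.exp_pos (-(μ * y))).le
      rw [add_mul, mul_assoc, mul_assoc B, ← Real.exp_add, ← Real.exp_add,
        show 2 * μ * y + -(μ * y) = μ * y by ring, show μ * y + -(μ * y) = 0 by ring,
        Real.exp_zero, mul_one] at h8
      exact h8
    have ht1 : Tendsto (fun y : ℝ => h / (2 * μ) * Real.exp (μ * y)) atTop atTop :=
      (Real.tendsto_exp_atTop.comp (tendsto_id.const_mul_atTop hμ)).const_mul_atTop (by positivity)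
    obtain ⟨y, hy⟩ := ((ht1.eventually_gt_atTop (B + h / (2 * μ) * Real.exp (2 * μ * y₁))).and
      ((eventually_ge_atTop y₁).and (eventually_ge_atTop 0))).exists
    have h9 := hbig y hy.2.1
    have h10 : Real.exp (-(μ * y)) ≤ 1 := Real.exp_le_one_iff.2 (by
      have := mul_nonneg hμ.le hy.2.2
      linarith)
    have h11 : h / (2 * μ) * Real.exp (2 * μ * y₁) * Real.exp (-(μ * y)) ≤
        h / (2 * μ) * Real.exp (2 * μ * y₁) * 1 := mul_le_mul_of_nonneg_left h10 (by positivity)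
    linarith [hy.1]
  have hanti : AntitoneOn (fun y => F y * Real.exp (μ * y)) (Set.Ici y₀) := by
    refine antitoneOn_of_deriv_nonpos (convex_Ici _)
      (fun y hy => (hΦ y hy).continuousAt.continuousWithinAt)
      (fun y hy => (hΦ y (interior_subset hy)).differentiableAt.differentiableWithinAt) fun y hy =>
          ?_
    rw [(hΦ y (interior_subset hy)).deriv]
    exact mul_nonpos_of_nonpos_of_nonneg (hH y (interior_subset hy)) (Real.exp_pos _).le
  have h4 := hanti (Set.mem_Ici.2 le_rfl) (Set.mem_Ici.2 hy) hy
  have h5 := mul_le_mul_of_nonneg_right h4 (Real.exp_pos (-(μ * y))).le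
  simp only [mul_assoc, ← Real.exp_add] at h5
  rw [show μ * y + -(μ * y) = 0 by ring, Real.exp_zero, mul_one] at h5
  rwa [show -(μ * (y - y₀)) = μ * y₀ + -(μ * y) by ring]

theorem norm_sq_eq_re_im (z : ℂ) : ‖z‖ ^ 2 = z.re ^ 2 + z.im ^ 2 := by
  rw [← Complex.normSq_eq_norm_sq, Complex.normSq_apply]
  ring

theorem hasDerivAt_re {c : ℝ → ℂ} {c' : ℂ} {y : ℝ} (h : HasDerivAt c c' y) :
    HasDerivAt (fun y => (c y).re) c'.re y := Complex.reCLM.hasFDerivAt.comp_hasDerivAt y h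

theorem hasDerivAt_im {c : ℝ → ℂ} {c' : ℂ} {y : ℝ} (h : HasDerivAt c c' y) :
    HasDerivAt (fun y => (c y).im) c'.im y := Complex.imCLM.hasFDerivAt.comp_hasDerivAt y h

/-- A bounded solution of `c'' = q c` decays exponentially if the real part of `q` is large. -/
theorem norm_le_of_second_deriv {c c' q : ℝ → ℂ} {y₀ μ B : ℝ} (hμ : 0 < μ)
    (h1 : ∀ y, y₀ ≤ y → HasDerivAt c (c' y) y) (h2 : ∀ y, y₀ ≤ y → HasDerivAt c' (q y * c y) y)
    (hq : ∀ y, y₀ ≤ y → μ ^ 2 ≤ 2 * (q y).re) (hB : ∀ y, y₀ ≤ y → ‖c y‖ ≤ B) {y : ℝ} (hy : y₀ ≤ y) :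
    ‖c y‖ ≤ B * Real.exp (-(μ * (y - y₀) / 2)) := by
  have hB0 : 0 ≤ B := (norm_nonneg _).trans (hB y hy)
  -- Applied to F = |c|², with F'' = 2|c'|² + 2 Re(q)|c|² ≥ μ²F. The square root afterwards halves
  -- the rate.
  have h := decay_of_second_deriv (F := fun y => (c y).re ^ 2 + (c y).im ^ 2)
    (F' := fun y => 2 * ((c y).re * (c' y).re + (c y).im * (c' y).im))
    (F'' := fun y => 2 * ((c' y).re ^ 2 + (c' y).im ^ 2 + (q y).re * ((c y).re ^ 2 + (c y).im ^ 2)))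
    (B := B ^ 2) hμ
    (fun y hy => (((hasDerivAt_re (h1 y hy)).pow 2).add
        ((hasDerivAt_im (h1 y hy)).pow 2)).congr_deriv
      (by push_cast; ring))
    (fun y hy => ((((hasDerivAt_re (h1 y hy)).mul (hasDerivAt_re (h2 y hy))).add
      ((hasDerivAt_im (h1 y hy)).mul (hasDerivAt_im (h2 y hy)))).const_mul 2).congr_deriv
      (by rw [Complex.mul_re, Complex.mul_im]; ring))
    (fun y hy => by
      have h3 := mul_le_mul_of_nonneg_right (hq y hy)
        (add_nonneg (sq_nonneg (c y).re) (sq_nonneg (c y).im))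
      nlinarith [sq_nonneg (c' y).re, sq_nonneg (c' y).im])
    (fun y _ => add_nonneg (sq_nonneg _) (sq_nonneg _))
    (fun y hy => by
      rw [← norm_sq_eq_re_im]
      exact pow_le_pow_left₀ (norm_nonneg _) (hB y hy) 2) hy
  simp only [← norm_sq_eq_re_im] at h
  have h3 : ‖c y‖ ^ 2 ≤ (B * Real.exp (-(μ * (y - y₀) / 2))) ^ 2 := by
    rw [mul_pow, ← Real.exp_nat_mul]
    refine h.trans (mul_le_mul (pow_le_pow_left₀ (norm_nonneg _) (hB _ le_rfl) 2)
      (le_of_eq ?_) (Real.exp_pos _).le (sq_nonneg _))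
    congr 1
    push_cast
    ring
  exact (pow_le_pow_iff_left₀ (norm_nonneg _) (by positivity) two_ne_zero).1 h3

/-- A solution of `c'' = -λ y⁻² c` that decays faster than each power of `y` vanishes. -/
theorem eq_zero_of_quick_decay {c c' : ℝ → ℂ} {l : ℂ} {y₀ : ℝ} (hy₀ : 0 < y₀)
    (h1 : ∀ y, y₀ ≤ y → HasDerivAt c (c' y) y)
    (h2 : ∀ y, y₀ ≤ y → HasDerivAt c' (-l / (y : ℂ) ^ 2 * c y) y)
    (hc : ∀ b : ℝ, ∃ C, ∀ᶠ y in atTop, ‖c y‖ ≤ C * y ^ b) {y : ℝ} (hy : y₀ ≤ y) : c y = 0 := by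
  -- The equation gives yE' ≥ -(1 + ‖l‖)E for the energy E = |c|² + y²|c'|², so E y^M is
  -- nondecreasing with this exponent.
  set M : ℝ := 1 + ‖l‖ with hM
  let E : ℝ → ℝ := fun y => (c y).re ^ 2 + (c y).im ^ 2 + y ^ 2 * ((c' y).re ^ 2 + (c' y).im ^ 2)
  have hE : ∀ y, E y = ‖c y‖ ^ 2 + y ^ 2 * ‖c' y‖ ^ 2 := fun y => by
    rw [norm_sq_eq_re_im, norm_sq_eq_re_im]
  -- The derivative is c(y + 1) - c(y) up to an error controlled by the second derivative on [y, y +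
  -- 1], so it inherits the decay of c.
  have hc' : ∀ b : ℝ, b ≤ 0 → ∃ C, ∀ᶠ y in atTop, ‖c' y‖ ≤ C * y ^ b := by
    intro b hb
    obtain ⟨C, hC⟩ := hc b
    obtain ⟨Y, hY⟩ := eventually_atTop.1 hC
    refine ⟨|C| + |C| + ‖l‖ * |C|, ?_⟩
    filter_upwards [eventually_ge_atTop Y, eventually_ge_atTop y₀, eventually_ge_atTop 1]
      with y h3 h4 h5
    have hyb : ∀ t, y ≤ t → ‖c t‖ ≤ |C| * y ^ b := fun t ht => by
      refine (hY t (h3.trans ht)).trans (mul_le_mul (le_abs_self C) ?_ ?_ (abs_nonneg _))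
      · exact Real.rpow_le_rpow_of_nonpos (by linarith) ht hb
      · exact Real.rpow_nonneg (by linarith) _
    have hsec : ∀ t, y ≤ t → ‖-l / (t : ℂ) ^ 2 * c t‖ ≤ ‖l‖ * |C| * y ^ b := fun t ht => by
      have ht1 : 1 ≤ t := h5.trans ht
      rw [norm_mul, norm_div, norm_neg, norm_pow, Complex.norm_real, Real.norm_eq_abs,
        abs_of_pos (by linarith), mul_assoc]
      exact mul_le_mul (div_le_self (norm_nonneg _) (one_le_pow₀ ht1)) (hyb t ht) (norm_nonneg _)
        (norm_nonneg _)
    have hdiff : ∀ t ∈ Set.Icc y (y + 1), ‖c' t - c' y‖ ≤ ‖l‖ * |C| * y ^ b := by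
      intro t ht
      have h6 := norm_image_sub_le_of_norm_deriv_le_segment' (f := c')
        (f' := fun t => -l / (t : ℂ) ^ 2 * c t) (a := y) (b := y + 1) (C := ‖l‖ * |C| * y ^ b)
        (fun t ht => (h2 t (h4.trans ht.1)).hasDerivWithinAt) (fun t ht => hsec t ht.1) t ht
      refine h6.trans (mul_le_of_le_one_right ?_ (by linarith [ht.2]))
      have := Real.rpow_nonneg (by linarith : (0 : ℝ) ≤ y) b
      positivity
    have h7 := norm_image_sub_le_of_norm_deriv_le_segment' (f := fun t : ℝ => c t - t * c' y)
      (f' := fun t => c' t - c' y) (a := y) (b := y + 1) (C := ‖l‖ * |C| * y ^ b)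
      (fun t ht => by
        have h8 : HasDerivAt (fun t : ℝ => (t : ℂ) * c' y) (c' y) t := by
          simpa using (Complex.ofRealCLM.hasDerivAt (x := t)).mul_const (c' y)
        exact ((h1 t (h4.trans ht.1)).sub h8).hasDerivWithinAt)
      (fun t ht => hdiff t ⟨ht.1, ht.2.le⟩) (y + 1) ⟨by linarith, le_rfl⟩
    have h9 : c' y = c (y + 1) - c y -
        ((c (y + 1) - ((y + 1 : ℝ) : ℂ) * c' y) - (c y - (y : ℂ) * c' y)) := by
      push_cast
      ring
    rw [h9]
    refine (norm_sub_le _ _).trans ?_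
    have h10 := (norm_sub_le (c (y + 1)) (c y)).trans
      (add_le_add (hyb (y + 1) (by linarith)) (hyb y le_rfl))
    rw [add_sub_cancel_left, mul_one] at h7
    calc _ ≤ |C| * y ^ b + |C| * y ^ b + ‖l‖ * |C| * y ^ b := add_le_add h10 h7
      _ = _ := by ring
  have hEd : ∀ y, y₀ ≤ y → HasDerivAt E (2 * ((c y).re * (c' y).re + (c y).im * (c' y).im) +
      2 * y * ((c' y).re ^ 2 + (c' y).im ^ 2) + y ^ 2 *
          (2 * ((c' y).re * (-l / (y : ℂ) ^ 2 * c y).re +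
        (c' y).im * (-l / (y : ℂ) ^ 2 * c y).im))) y := by
    intro y hy
    have h3 := (((hasDerivAt_re (h1 y hy)).pow 2).add ((hasDerivAt_im (h1 y hy)).pow 2)).add
      (((hasDerivAt_id y).pow 2).mul
        (((hasDerivAt_re (h2 y hy)).pow 2).add ((hasDerivAt_im (h2 y hy)).pow 2)))
    refine h3.congr_deriv ?_
    simp only [Pi.add_apply, Pi.pow_apply, id]
    push_cast
    ring
  have hmono : MonotoneOn (fun y => E y * y ^ M) (Set.Ici y₀) := by
    have hd : ∀ y, y₀ ≤ y → HasDerivAt (fun y => E y * y ^ M) _ y := fun y hy =>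
      (hEd y hy).mul (Real.hasDerivAt_rpow_const (Or.inl (hy₀.trans_le hy).ne'))
    refine monotoneOn_of_deriv_nonneg (convex_Ici _)
      (fun y hy => (hd y hy).continuousAt.continuousWithinAt)
      (fun y hy => (hd y (interior_subset hy)).differentiableAt.differentiableWithinAt) fun y hy =>
          ?_
    have hy' : y₀ ≤ y := interior_subset hy
    have hy0 : 0 < y := hy₀.trans_le hy'
    rw [(hd y hy').deriv, Real.rpow_sub_one hy0.ne']
    have hP := Real.rpow_pos_of_pos hy0 M
    have e1 : ∀ v : ℂ, y ^ 2 * (-l / (y : ℂ) ^ 2 * v).re = -(l * v).re := fun v => by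
      have : (-l / (y : ℂ) ^ 2 * v) = ((-(y ^ 2)⁻¹ : ℝ) : ℂ) * (l * v) := by
        push_cast
        field_simp
      rw [this, Complex.re_ofReal_mul]
      field_simp
    have e2 : ∀ v : ℂ, y ^ 2 * (-l / (y : ℂ) ^ 2 * v).im = -(l * v).im := fun v => by
      have : (-l / (y : ℂ) ^ 2 * v) = ((-(y ^ 2)⁻¹ : ℝ) : ℂ) * (l * v) := by
        push_cast
        field_simp
      rw [this, Complex.im_ofReal_mul]
      field_simp
    have key : 0 ≤ y * (2 * ((c y).re * (c' y).re + (c y).im * (c' y).im) +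
        2 * y * ((c' y).re ^ 2 + (c' y).im ^ 2) + y ^ 2 *
            (2 * ((c' y).re * (-l / (y : ℂ) ^ 2 * c y).re +
        (c' y).im * (-l / (y : ℂ) ^ 2 * c y).im))) + M * E y := by
      have e3 : y ^ 2 * (2 * ((c' y).re * (-l / (y : ℂ) ^ 2 * c y).re +
          (c' y).im * (-l / (y : ℂ) ^ 2 * c y).im)) =
          -(2 * ((c' y).re * (l * c y).re + (c' y).im * (l * c y).im)) := by
        linear_combination (2 * (c' y).re) * e1 (c y) + (2 * (c' y).im) * e2 (c y)
      rw [e3]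
      have hin : ∀ v w : ℂ, |v.re * w.re + v.im * w.im| ≤ ‖v‖ * ‖w‖ := fun v w => by
        have h4 : v.re * w.re + v.im * w.im = (v * starRingEnd ℂ w).re := by simp
        rw [h4]
        refine (Complex.abs_re_le_norm _).trans ?_
        rw [norm_mul, RCLike.norm_conj]
      have h5 := (abs_le.1 (hin (c y) (c' y))).1
      have h6 := (abs_le.1 (hin (c' y) (l * c y))).2
      rw [norm_mul] at h6
      have h7 : 2 * (‖c y‖ * (y * ‖c' y‖)) ≤ E y := by
        rw [hE]
        nlinarith [sq_nonneg (‖c y‖ - y * ‖c' y‖)]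
      have h8 : 0 ≤ 2 * y * ((c' y).re ^ 2 + (c' y).im ^ 2) := by positivity
      have h9 : ‖l‖ * (2 * (‖c y‖ * (y * ‖c' y‖))) ≤ ‖l‖ * E y :=
        mul_le_mul_of_nonneg_left h7 (norm_nonneg l)
      have h10 := mul_le_mul_of_nonneg_left h5 hy0.le
      have h11 := mul_le_mul_of_nonneg_left h6 hy0.le
      have h12 := mul_nonneg hy0.le h8
      rw [hM]
      nlinarith
    have e4 : ∀ D : ℝ, D * y ^ M + E y * (M * (y ^ M / y)) = (y * D + M * E y) * (y ^ M / y) := by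
      intro D
      field_simp
    rw [e4]
    exact mul_nonneg key (div_nonneg hP.le hy0.le)
  have hlim : ∀ ε > 0, ∀ᶠ y in atTop, E y * y ^ M ≤ ε := by
    intro ε hε
    -- With this exponent E y^M is O(y^{-2}), including the factor y² in front of |c'|².
    obtain ⟨C₁, hC₁⟩ := hc (-(M / 2) - 2)
    obtain ⟨C₂, hC₂⟩ := hc' (-(M / 2) - 2) (by
      have := norm_nonneg l
      linarith)
    have ht : Tendsto (fun y : ℝ => (C₁ ^ 2 + C₂ ^ 2) * y ^ (-(1 : ℝ))) atTop
        (𝓝 ((C₁ ^ 2 + C₂ ^ 2) * 0)) :=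
      (tendsto_rpow_neg_atTop one_pos).const_mul _
    rw [mul_zero] at ht
    filter_upwards [hC₁, hC₂, eventually_ge_atTop 1, ht.eventually_le_const hε] with y h3 h4 h5 h6
    have hy0 : 0 < y := by linarith
    refine le_trans ?_ h6
    set X := y ^ (-(M / 2) - 2) with hX
    have hX2 : X ^ 2 * y ^ 2 * y ^ M = y ^ (-(2 : ℝ)) := by
      rw [hX, ← Real.rpow_natCast, ← Real.rpow_natCast, ← Real.rpow_mul hy0.le,
        ← Real.rpow_add hy0, ← Real.rpow_add hy0]
      congr 1
      push_cast
      ring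
    have h7 : ‖c y‖ ^ 2 ≤ C₁ ^ 2 * X ^ 2 := by
      rw [← mul_pow]
      exact pow_le_pow_left₀ (norm_nonneg _) h3 2
    have h8 : ‖c' y‖ ^ 2 ≤ C₂ ^ 2 * X ^ 2 := by
      rw [← mul_pow]
      exact pow_le_pow_left₀ (norm_nonneg _) h4 2
    have hyM := Real.rpow_pos_of_pos hy0 M
    have h9 : E y ≤ (C₁ ^ 2 + C₂ ^ 2) * (X ^ 2 * y ^ 2) := by
      rw [hE]
      have h10 : C₁ ^ 2 * X ^ 2 ≤ C₁ ^ 2 * X ^ 2 * y ^ 2 :=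
        le_mul_of_one_le_right (by positivity) (one_le_pow₀ h5)
      have h11 := mul_le_mul_of_nonneg_left h8 (sq_nonneg y)
      nlinarith
    calc E y * y ^ M ≤ (C₁ ^ 2 + C₂ ^ 2) * (X ^ 2 * y ^ 2) * y ^ M :=
          mul_le_mul_of_nonneg_right h9 hyM.le
      _ = (C₁ ^ 2 + C₂ ^ 2) * y ^ (-(2 : ℝ)) := by rw [mul_assoc, hX2]
      _ ≤ (C₁ ^ 2 + C₂ ^ 2) * y ^ (-(1 : ℝ)) :=
          mul_le_mul_of_nonneg_left (Real.rpow_le_rpow_of_exponent_le h5 (by norm_num))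
              (by positivity)
  have hy0 : 0 < y := hy₀.trans_le hy
  -- A nondecreasing function that is eventually below every ε > 0 is nowhere positive.
  have hE0 : E y * y ^ M ≤ 0 := by
    refine le_of_forall_pos_le_add fun ε hε => ?_
    obtain ⟨t, ht1, ht2⟩ := ((hlim ε hε).and (eventually_ge_atTop y)).exists
    rw [zero_add]
    exact (hmono (Set.mem_Ici.2 hy) (Set.mem_Ici.2 (hy.trans ht2)) ht2).trans ht1
  have hE1 : E y ≤ 0 := by
    by_contra hcon
    push Not at hcon
    exact absurd (mul_pos hcon (Real.rpow_pos_of_pos hy0 M)) (not_lt.2 hE0)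
  rw [hE] at hE1
  have h3 : ‖c y‖ ^ 2 ≤ 0 := by nlinarith [mul_nonneg (sq_nonneg y) (sq_nonneg ‖c' y‖)]
  exact norm_eq_zero.1 (pow_eq_zero_iff two_ne_zero |>.1 (le_antisymm h3 (sq_nonneg _)))

/-! ### Fourier coefficients of functions on the upper half-plane -/

theorem hasDerivAt_line {w : ℍ → ℂ} (hw : SmoothH w) (z v : ℂ) (hz : 0 < z.im) {γ : ℝ → ℂ} {t : ℝ}
    (hγ : HasDerivAt γ v t) (hγt : γ t = z) :
    HasDerivAt (fun t => w (ofComplex (γ t))) (pdH v w (ofComplex z)) t := by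
  have hd := hw.differentiableAt (ofComplex z)
  have hz' : ((ofComplex z : ℍ) : ℂ) = z := by rw [ofComplex_apply_of_im_pos hz]
  rw [pdH, pd, hd.lineDeriv_eq_fderiv]
  have h := hd.hasFDerivAt
  rw [hz'] at h ⊢
  subst hγt
  exact HasFDerivAt.comp_hasDerivAt (l := w ∘ fun z : ℂ => ofComplex z) t h hγ

theorem hasDerivAt_horizontal {w : ℍ → ℂ} (hw : SmoothH w) (x : ℝ) {y : ℝ} (hy : 0 < y) :
    HasDerivAt (fun x : ℝ => w (ofComplex (x + y * Complex.I)))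
      (pdH 1 w (ofComplex (x + y * Complex.I))) x :=
  hasDerivAt_line hw _ 1 (by simpa using hy)
    ((Complex.ofRealCLM.hasDerivAt (x := x)).add_const (y * Complex.I)) rfl

theorem hasDerivAt_vertical {w : ℍ → ℂ} (hw : SmoothH w) (x : ℝ) {y : ℝ} (hy : 0 < y) :
    HasDerivAt (fun y : ℝ => w (ofComplex (x + y * Complex.I)))
      (pdH Complex.I w (ofComplex (x + y * Complex.I))) y := by
  refine hasDerivAt_line hw _ Complex.I (by simpa using hy)
      (γ := fun y : ℝ => (x : ℂ) + y * Complex.I) ?_ rfl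
  simpa using ((Complex.ofRealCLM.hasDerivAt (x := y)).mul_const Complex.I).const_add (x : ℂ)

/-- The Fourier coefficient of frequency `ν` on the horizontal line at height `y`. -/
def coef (w : ℍ → ℂ) (ν y : ℝ) : ℂ :=
  ∫ x in (0 : ℝ)..1, w (ofComplex (x + y * Complex.I)) * Complex.exp
      (-(2 * Real.pi * Complex.I * ν * x))

theorem hasDerivAt_exp_neg (ν x : ℝ) :
    HasDerivAt (fun x : ℝ => Complex.exp (-(2 * Real.pi * Complex.I * ν * x)))
      (-(2 * Real.pi * Complex.I * ν) * Complex.exp (-(2 * Real.pi * Complex.I * ν * x))) x := by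
  have h := (((Complex.ofRealCLM.hasDerivAt (x := x)).const_mul
      (2 * Real.pi * Complex.I * ν)).neg).cexp
  refine h.congr_deriv ?_
  simp [mul_comm]

theorem continuous_horizontal {w : ℍ → ℂ} (hw : SmoothH w) {y : ℝ} (hy : 0 < y) :
    Continuous fun x : ℝ => w (ofComplex (x + y * Complex.I)) :=
  continuous_iff_continuousAt.2 fun x => (hasDerivAt_horizontal hw x hy).continuousAt

/-- Differentiation under the integral over a period; the kernel does not involve y. -/
theorem hasDerivAt_coef {w : ℍ → ℂ} (hw : SmoothH w) (ν : ℝ) {y : ℝ} (hy : 0 < y) :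
    HasDerivAt (coef w ν) (coef (pdH Complex.I w) ν y) y := by
  let f : ℝ × ℝ → ℂ := fun v => w (ofComplex (v.2 + v.1 * Complex.I)) *
    Complex.exp (-(2 * Real.pi * Complex.I * ν * v.2))
  have h1 : ContDiff ℝ 1 fun v : ℝ × ℝ => (v.1 : ℂ) := Complex.ofRealCLM.contDiff.comp contDiff_fst
  have h2 : ContDiff ℝ 1 fun v : ℝ × ℝ => (v.2 : ℂ) := Complex.ofRealCLM.contDiff.comp contDiff_snd
  have hf : ContDiffOn ℝ 1 f (Set.Ioi 0 ×ˢ Set.univ) := by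
    refine ContDiffOn.mul ?_ ((contDiff_const.mul h2).neg.cexp).contDiffOn
    refine ContDiffOn.comp (g := w ∘ fun z : ℂ => ofComplex z) (t := upperSet)
      (ContDiffOn.of_le hw (by exact_mod_cast le_top)) ?_ ?_
    · exact (h2.add (h1.mul contDiff_const)).contDiffOn
    · intro v hv
      have : 0 < v.1 := hv.1
      simpa [upperSet] using this
  have hopen : IsOpen (Set.Ioi (0 : ℝ) ×ˢ (Set.univ : Set ℝ)) := isOpen_Ioi.prod isOpen_univ
  have h3 := (hasFDerivAt_parametric_integral isOpen_Ioi hf (Set.mem_Ioi.2 hy) 0 1).hasDerivAt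
  have hint : IntervalIntegrable (fun q : ℝ => (fderiv ℝ f (y, q)).comp
      (ContinuousLinearMap.inl ℝ ℝ ℝ)) MeasureTheory.volume 0 1 := by
    refine Continuous.intervalIntegrable ?_ _ _
    exact (continuous_of_continuousOn_prod (hf.continuousOn_fderiv_of_isOpen hopen le_rfl)
      (Set.mem_Ioi.2 hy)).clm_comp continuous_const
  rw [ContinuousLinearMap.intervalIntegral_apply hint] at h3
  have h4 : ∀ q : ℝ, ((fderiv ℝ f (y, q)).comp (ContinuousLinearMap.inl ℝ ℝ ℝ)) 1 =
      pdH Complex.I w (ofComplex (q + y * Complex.I)) *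
        Complex.exp (-(2 * Real.pi * Complex.I * ν * q)) := by
    intro q
    have h5 : HasFDerivAt f (fderiv ℝ f (y, q)) (y, q) :=
      ((hf.contDiffAt (hopen.mem_nhds
          (show ((y, q) : ℝ × ℝ) ∈ _ from ⟨hy, Set.mem_univ _⟩))).differentiableAt
              one_ne_zero).hasFDerivAt
    have h0 : HasDerivAt (fun y : ℝ => (y, q)) ((1 : ℝ), (0 : ℝ)) y :=
      (hasDerivAt_id y).prodMk (hasDerivAt_const y q)
    have h6 : HasDerivAt (fun y : ℝ => f (y, q)) (fderiv ℝ f (y, q) (1, 0)) y :=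
      HasFDerivAt.comp_hasDerivAt (l := f) y h5 h0
    have h7 : HasDerivAt (fun y : ℝ => f (y, q)) (pdH Complex.I w (ofComplex (q + y * Complex.I)) *
        Complex.exp (-(2 * Real.pi * Complex.I * ν * q))) y :=
      (hasDerivAt_vertical hw q hy).mul_const (Complex.exp (-(2 * Real.pi * Complex.I * ν * q)))
    exact h6.unique h7
  simp only [h4] at h3
  exact h3

/-- The function picks up the factor `e^{2πiκ}` under `z ↦ z + 1`. -/
def QuasiPeriodic (w : ℍ → ℂ) (κ : ℝ) : Prop :=
  ∀ x y : ℝ, 0 < y → w (ofComplex ((x + 1 : ℝ) + y * Complex.I)) =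
    Complex.exp (2 * Real.pi * Complex.I * κ) * w (ofComplex (x + y * Complex.I))

theorem QuasiPeriodic.pdH_one {w : ℍ → ℂ} {κ : ℝ} (h : QuasiPeriodic w κ) (hw : SmoothH w) :
    QuasiPeriodic (pdH 1 w) κ := by
  intro x y hy
  have h1 : HasDerivAt (fun x : ℝ => w (ofComplex ((x + 1 : ℝ) + y * Complex.I)))
      (pdH 1 w (ofComplex ((x + 1 : ℝ) + y * Complex.I))) x :=
    (hasDerivAt_horizontal hw (x + 1) hy).comp_add_const x 1
  have h2 := (hasDerivAt_horizontal hw x hy).const_mul (Complex.exp (2 * Real.pi * Complex.I * κ))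
  refine h1.unique (h2.congr_of_eventuallyEq (Eventually.of_forall fun x => h x y hy))

/-- Only the class of κ modulo ℤ matters, so results for frequency κ apply to every frequency n + κ.
-/
theorem QuasiPeriodic.add_int {w : ℍ → ℂ} {κ : ℝ} (h : QuasiPeriodic w κ) (n : ℤ) :
    QuasiPeriodic w (n + κ) := by
  intro x y hy
  rw [h x y hy]
  congr 1
  refine (exp_eq_of_int n ?_).symm
  push_cast
  ring

/-- Integration by parts: the integrand has period 1 because the frequency equals the quasi-period,
so the boundary terms cancel. -/
theorem QuasiPeriodic.coef_pdH_one {w : ℍ → ℂ} {ν : ℝ} (h : QuasiPeriodic w ν) (hw : SmoothH w)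
    {y : ℝ} (hy : 0 < y) : coef (pdH 1 w) ν y = 2 * Real.pi * Complex.I * ν * coef w ν y := by
  have hd : ∀ x : ℝ, HasDerivAt (fun x : ℝ => w (ofComplex (x + y * Complex.I)) *
      Complex.exp (-(2 * Real.pi * Complex.I * ν * x))) _ x := fun x =>
    (hasDerivAt_horizontal hw x hy).mul (hasDerivAt_exp_neg ν x)
  have hc1 := continuous_horizontal hw hy
  have hc2 := continuous_horizontal (hw.pdH 1) hy
  have he : Continuous fun x : ℝ => Complex.exp (-(2 * Real.pi * Complex.I * ν * x)) := by fun_prop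
  have hc3 : Continuous fun x : ℝ => pdH 1 w (ofComplex (x + y * Complex.I)) *
      Complex.exp (-(2 * Real.pi * Complex.I * ν * x)) := hc2.mul he
  have hc4 : Continuous fun x : ℝ => w (ofComplex (x + y * Complex.I)) *
      (-(2 * Real.pi * Complex.I * ν) * Complex.exp (-(2 * Real.pi * Complex.I * ν * x))) :=
    hc1.mul (continuous_const.mul he)
  have hint := intervalIntegral.integral_eq_sub_of_hasDerivAt (a := 0) (b := 1) (fun x _ => hd x)
    ((hc3.add hc4).intervalIntegrable _ _)
  have h1 := h 0 y hy
  rw [zero_add] at h1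
  rw [h1, intervalIntegral.integral_add (hc3.intervalIntegrable _ _)
    (hc4.intervalIntegrable _ _)] at hint
  have h2 : (∫ x in (0 : ℝ)..1, w (ofComplex (x + y * Complex.I)) *
      (-(2 * Real.pi * Complex.I * ν) * Complex.exp (-(2 * Real.pi * Complex.I * ν * x)))) =
      -(2 * Real.pi * Complex.I * ν) * coef w ν y := by
    rw [coef, ← intervalIntegral.integral_const_mul]
    exact intervalIntegral.integral_congr fun x _ => by ring
  have h3 : Complex.exp (2 * Real.pi * Complex.I * ν) * w (ofComplex ((0 : ℝ) + y * Complex.I)) *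
      Complex.exp (-(2 * Real.pi * Complex.I * ν * (1 : ℝ))) -
      w (ofComplex ((0 : ℝ) + y * Complex.I)) * Complex.exp
          (-(2 * Real.pi * Complex.I * ν * (0 : ℝ))) = 0 := by
    rw [mul_right_comm, ← Complex.exp_add]
    simp
  rw [h2, h3] at hint
  change coef (pdH 1 w) ν y + _ = 0 at hint
  linear_combination hint

/-- The eigenvalue equation is solved for ∂_y², and ∂_x acts on coefficients as multiplication by
2πiν. -/
theorem coef_pdH_I_pdH_I {w : ℍ → ℂ} {ν : ℝ} (h : QuasiPeriodic w ν) (hw : SmoothH w) {k : ℝ}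
    {l : ℂ}
    (hl : ∀ z, lap1 k w z = l * w z) {y : ℝ} (hy : 0 < y) :
    coef (pdH Complex.I (pdH Complex.I w)) ν y =
      (4 * Real.pi ^ 2 * ν ^ 2 - 2 * Real.pi * k * ν / y - l / (y : ℂ) ^ 2) * coef w ν y := by
  have hy' : (y : ℂ) ≠ 0 := by exact_mod_cast hy.ne'
  have h1 := h.coef_pdH_one hw hy
  have h2 := (h.pdH_one hw).coef_pdH_one (hw.pdH 1) hy
  rw [h1] at h2
  have hc0 := continuous_horizontal hw hy
  have hc1 := continuous_horizontal (hw.pdH 1) hy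
  have hc2 := continuous_horizontal ((hw.pdH 1).pdH 1) hy
  have he : Continuous fun x : ℝ => Complex.exp (-(2 * Real.pi * Complex.I * ν * x)) := by fun_prop
  have hi0 : Continuous fun x : ℝ => (-l / (y : ℂ) ^ 2) * (w (ofComplex (x + y * Complex.I)) *
      Complex.exp (-(2 * Real.pi * Complex.I * ν * x))) := (hc0.mul he).const_mul _
  have hi1 : Continuous fun x : ℝ => Complex.I * k / y *
      (pdH 1 w (ofComplex (x + y * Complex.I)) *
        Complex.exp (-(2 * Real.pi * Complex.I * ν * x))) := (hc1.mul he).const_mul _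
  have hi2 : Continuous fun x : ℝ => -(pdH 1 (pdH 1 w) (ofComplex (x + y * Complex.I)) *
      Complex.exp (-(2 * Real.pi * Complex.I * ν * x))) := (hc2.mul he).neg
  have hi10 : Continuous fun x : ℝ => Complex.I * k / y *
      (pdH 1 w (ofComplex (x + y * Complex.I)) * Complex.exp (-(2 * Real.pi * Complex.I * ν * x))) +
        (-l / (y : ℂ) ^ 2) * (w (ofComplex (x + y * Complex.I)) *
          Complex.exp (-(2 * Real.pi * Complex.I * ν * x))) := hi1.add hi0
  have hpt : ∀ x : ℝ, pdH Complex.I (pdH Complex.I w) (ofComplex (x + y * Complex.I)) *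
      Complex.exp (-(2 * Real.pi * Complex.I * ν * x)) =
      -(pdH 1 (pdH 1 w) (ofComplex (x + y * Complex.I)) *
        Complex.exp (-(2 * Real.pi * Complex.I * ν * x))) +
      (Complex.I * k / y * (pdH 1 w (ofComplex (x + y * Complex.I)) *
        Complex.exp (-(2 * Real.pi * Complex.I * ν * x))) +
      (-l / (y : ℂ) ^ 2) * (w (ofComplex (x + y * Complex.I)) *
        Complex.exp (-(2 * Real.pi * Complex.I * ν * x)))) := by
    intro x
    have h3 := hl (ofComplex (x + y * Complex.I))
    have hzim : (ofComplex ((x : ℂ) + y * Complex.I)).im = y := by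
      rw [ofComplex_apply_of_im_pos (by simpa using hy)]
      simp [← UpperHalfPlane.coe_im]
    rw [lap1, hzim] at h3
    field_simp
    linear_combination (-1) * h3
  rw [coef]
  simp only [hpt]
  rw [intervalIntegral.integral_add (hi2.intervalIntegrable _ _)
    (hi10.intervalIntegrable _ _),
    intervalIntegral.integral_add (hi1.intervalIntegrable _ _) (hi0.intervalIntegrable _ _),
        intervalIntegral.integral_neg,
    intervalIntegral.integral_const_mul, intervalIntegral.integral_const_mul]
  change -coef (pdH 1 (pdH 1 w)) ν y + (_ * coef (pdH 1 w) ν y + _ * coef w ν y) = _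
  rw [h2, h1]
  field_simp
  linear_combination (-(4 * y ^ 2 * Real.pi ^ 2 * ν ^ 2 * coef w ν y) +
    2 * Real.pi * k * ν * y * coef w ν y) * Complex.I_sq

theorem norm_coef_le {w : ℍ → ℂ} (ν : ℝ) {y B : ℝ}
    (hB : ∀ x ∈ Set.Icc (0 : ℝ) 1, ‖w (ofComplex (x + y * Complex.I))‖ ≤ B) : ‖coef w ν y‖ ≤ B := by
  have h := intervalIntegral.norm_integral_le_of_norm_le_const (a := 0) (b := 1) (C := B)
    (f := fun x : ℝ => w (ofComplex (x + y * Complex.I)) *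
      Complex.exp (-(2 * Real.pi * Complex.I * ν * x))) fun x hx => by
    rw [Set.uIoc_of_le zero_le_one] at hx
    rw [norm_mul, show -(2 * Real.pi * Complex.I * ν * x : ℂ) =
      ((-(2 * Real.pi * ν * x) : ℝ) : ℂ) * Complex.I by push_cast; ring,
      Complex.norm_exp_ofReal_mul_I, mul_one]
    exact hB x ⟨hx.1.le, hx.2⟩
  rwa [sub_zero, abs_one, mul_one] at h

/-- After the twist by e^{-2πiκx} this is an ordinary Fourier series with coefficients at the
frequencies n + κ. -/
theorem QuasiPeriodic.hasSum {w : ℍ → ℂ} {κ : ℝ} (h : QuasiPeriodic w κ) (hw : SmoothH w)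
    {y : ℝ} (hy : 0 < y) (hs : Summable fun n : ℤ => coef w (n + κ) y) (x : ℝ) :
    HasSum (fun n : ℤ => coef w (n + κ) y * Complex.exp (2 * Real.pi * Complex.I * n * x))
      (w (ofComplex (x + y * Complex.I)) * Complex.exp (-(2 * Real.pi * Complex.I * κ * x))) := by
  let G : ℝ → ℂ := fun x => w (ofComplex (x + y * Complex.I)) *
    Complex.exp (-(2 * Real.pi * Complex.I * κ * x))
  have hG : Continuous G := (continuous_horizontal hw hy).mul (by fun_prop)
  have hper : Function.Periodic G 1 := by
    intro x
    simp only [G]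
    rw [h x y hy, mul_right_comm, ← Complex.exp_add, mul_comm]
    congr 2
    push_cast
    ring
  have hco : ∀ n : ℤ, ∫ q in (0 : ℝ)..1, G q * Complex.exp (-(2 * Real.pi * Complex.I * n * q)) =
      coef w (n + κ) y := by
    intro n
    refine intervalIntegral.integral_congr fun x _ => ?_
    simp only [G]
    rw [mul_assoc, ← Complex.exp_add]
    congr 2
    push_cast
    ring
  have h1 := hasSum_fourier_of_periodic hG hper (by simpa only [hco] using hs) x
  simpa only [hco] using h1

/-- The nonzero frequencies stay away from 0. This makes the rate of decay uniform in n. -/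
theorem exists_gap (κ : ℝ) : ∃ δ > 0, ∀ n : ℤ, (n : ℝ) + κ = 0 ∨ δ ≤ |(n : ℝ) + κ| := by
  set r := Int.fract κ with hr
  have hr0 : 0 ≤ r := Int.fract_nonneg κ
  have hr1 : r < 1 := Int.fract_lt_one κ
  have hκ : κ = ⌊κ⌋ + r := (Int.floor_add_fract κ).symm
  rcases hr0.eq_or_lt with h0 | h0
  · refine ⟨1, one_pos, fun n => ?_⟩
    rw [hκ, ← h0, add_zero, ← Int.cast_add]
    rcases eq_or_ne (n + ⌊κ⌋) 0 with h | h
    · left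
      rw [h, Int.cast_zero]
    · right
      rw [← Int.cast_abs]
      exact_mod_cast Int.one_le_abs h
  · refine ⟨min r (1 - r), lt_min h0 (by linarith), fun n => Or.inr ?_⟩
    rw [hκ, ← add_assoc, ← Int.cast_add]
    rcases le_or_gt 0 (n + ⌊κ⌋) with h | h
    · have h' : (0 : ℝ) ≤ ((n + ⌊κ⌋ : ℤ) : ℝ) := by exact_mod_cast h
      rw [abs_of_nonneg (by linarith)]
      exact (min_le_left _ _).trans (by linarith)
    · have h' : ((n + ⌊κ⌋ : ℤ) : ℝ) ≤ -1 := by exact_mod_cast (by omega : n + ⌊κ⌋ ≤ -1)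
      rw [abs_of_nonpos (by linarith)]
      exact (min_le_right _ _).trans (by linarith)

theorem summable_exp_neg_abs {c : ℝ} (hc : 0 < c) (κ : ℝ) :
    Summable fun n : ℤ => Real.exp (-(c * |(n : ℝ) + κ|)) := by
  have h0 : Summable fun n : ℕ => Real.exp (-(c * n)) := by
    have := Real.summable_exp_nat_mul_iff.2 (neg_neg_of_pos hc)
    refine this.congr fun n => ?_
    congr 1
    ring
  have h1 : Summable fun n : ℤ => Real.exp (-(c * |(n : ℝ)|)) := by
    refine Summable.of_nat_of_neg ?_ ?_
    · simpa using h0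
    · simpa using h0
  refine Summable.of_nonneg_of_le (fun _ => (Real.exp_pos _).le) (fun n => ?_)
    (h1.mul_left (Real.exp (c * |κ|)))
  rw [← Real.exp_add]
  refine Real.exp_le_exp.2 ?_
  have h2 : |(n : ℝ)| ≤ |(n : ℝ) + κ| + |κ| := by
    have := abs_sub_abs_le_abs_sub ((n : ℝ)) (-κ)
    rw [abs_neg, sub_neg_eq_add] at this
    linarith
  nlinarith

/-- A quickly decreasing eigenfunction decays exponentially. -/
theorem QuasiPeriodic.exp_decay {w : ℍ → ℂ} {κ : ℝ} (h : QuasiPeriodic w κ) (hw : SmoothH w)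
    {k : ℝ} {l : ℂ} (hl : ∀ z, lap1 k w z = l * w z)
    (hdec : ∀ b : ℝ, ∃ C, ∀ᶠ y : ℝ in atTop, ∀ x ∈ Set.Icc (0 : ℝ) 1,
      ‖w (ofComplex (x + y * Complex.I))‖ ≤ C * y ^ b) :
    ∃ a > 0, ∃ C, ∀ᶠ y : ℝ in atTop, ∀ x : ℝ,
      ‖w (ofComplex (x + y * Complex.I))‖ ≤ C * Real.exp (-(a * y)) := by
  have hpi := Real.pi_pos
  obtain ⟨δ, hδ, hgap⟩ := exists_gap κ
  obtain ⟨B, hB⟩ := hdec 0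
  obtain ⟨Y, hY⟩ := eventually_atTop.1 hB
  simp only [Real.rpow_zero, mul_one] at hY
  -- For t ≥ y₀ and every nonzero frequency ν this gives |k| ≤ t|ν| and ‖l‖ ≤ tν², so the leading
  -- term 4π²ν² of the equation dominates.
  set y₀ : ℝ := max 1 (max Y ((|k| + ‖l‖) / (δ * min 1 δ))) with hy₀
  have hy₀1 : 1 ≤ y₀ := le_max_left _ _
  have hy₀Y : Y ≤ y₀ := (le_max_left _ _).trans (le_max_right _ _)
  have hy₀k : (|k| + ‖l‖) / (δ * min 1 δ) ≤ y₀ := (le_max_right _ _).trans (le_max_right _ _)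
  have hderiv : ∀ n : ℤ, ∀ y, y₀ ≤ y →
      HasDerivAt (coef w (n + κ)) (coef (pdH Complex.I w) (n + κ) y) y := fun n y hy =>
    hasDerivAt_coef hw _ (by linarith)
  have hderiv2 : ∀ n : ℤ, ∀ y, y₀ ≤ y →
      HasDerivAt (coef (pdH Complex.I w) (n + κ)) ((4 * Real.pi ^ 2 * ((n + κ : ℝ) : ℂ) ^ 2 -
        2 * Real.pi * k * ((n + κ : ℝ) : ℂ) / y - l / (y : ℂ) ^ 2) * coef w (n + κ) y) y := by
    intro n y hy
    rw [← coef_pdH_I_pdH_I (h.add_int n) hw hl (by linarith)]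
    exact hasDerivAt_coef (hw.pdH _) _ (by linarith)
  have hbd : ∀ n : ℤ, ∀ y, y₀ ≤ y → ‖coef w (n + κ) y‖ ≤ B := fun n y hy =>
    norm_coef_le _ fun x hx => hY y (hy₀Y.trans hy) x hx
  have hB0 : 0 ≤ B := (norm_nonneg _).trans (hbd 0 y₀ le_rfl)
  have hcoef : ∀ n : ℤ, ∀ y, y₀ + 1 ≤ y → ‖coef w (n + κ) y‖ ≤
      B * (Real.exp (-(Real.pi * δ / 4 * (y - y₀))) * Real.exp
          (-(Real.pi / 4 * |(n : ℝ) + κ|))) := by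
    intro n y hy
    rcases hgap n with h0 | h0
    -- At frequency zero the equation is c'' = -l y⁻² c. Its solutions need not decay exponentially,
    -- but quick decay forces them to vanish.
    · have hz : coef w (n + κ) y = 0 := by
        refine eq_zero_of_quick_decay (l := l) (y₀ := y₀) (by linarith) (hderiv n) (fun y hy => ?_)
          (fun b => ?_) (by linarith)
        · refine (hderiv2 n y hy).congr_deriv ?_
          rw [h0]
          push_cast
          ring
        · obtain ⟨C, hC⟩ := hdec b
          refine ⟨C, ?_⟩
          filter_upwards [hC] with y hy
          exact norm_coef_le _ hy
      rw [hz, norm_zero]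
      positivity
    · set ν : ℝ := (n : ℝ) + κ with hν
      have hν0 : 0 < |ν| := hδ.trans_le h0
      -- The rate is admissible because 2 Re q ≥ (8π² - 4π - 2)ν² ≥ π²ν². Half of the exponent so
      -- obtained serves the decay in y, through |ν| ≥ δ; the other half serves summability in n,
      -- through y - y₀ ≥ 1.
      have h1 := norm_le_of_second_deriv (μ := Real.pi * |ν|) (B := B) (by positivity) (hderiv n)
        (hderiv2 n) (fun t ht => ?_) (hbd n) (by linarith : y₀ ≤ y)
      · refine h1.trans (mul_le_mul_of_nonneg_left ?_ hB0)
        rw [← Real.exp_add]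
        refine Real.exp_le_exp.2 ?_
        have h2 : Real.pi * δ / 4 * (y - y₀) ≤ Real.pi * |ν| / 4 * (y - y₀) := by
          refine mul_le_mul_of_nonneg_right ?_ (by linarith)
          have := mul_le_mul_of_nonneg_left h0 hpi.le
          linarith
        have h3 : Real.pi * |ν| / 4 * 1 ≤ Real.pi * |ν| / 4 * (y - y₀) :=
          mul_le_mul_of_nonneg_left (by linarith) (by positivity)
        linarith
      · have ht0 : 0 < t := by linarith
        have ht1 : 1 ≤ t := by linarith
        have hre : (4 * Real.pi ^ 2 * (ν : ℂ) ^ 2 - 2 * Real.pi * k * (ν : ℂ) / t - l / (t : ℂ) ^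
            2).re =
            4 * Real.pi ^ 2 * ν ^ 2 - 2 * Real.pi * k * ν / t - l.re / t ^ 2 := by
          have : (4 * Real.pi ^ 2 * (ν : ℂ) ^ 2 - 2 * Real.pi * k * (ν : ℂ) / t - l / (t : ℂ) ^ 2) =
              ((4 * Real.pi ^ 2 * ν ^ 2 - 2 * Real.pi * k * ν / t : ℝ) : ℂ) -
                ((1 / t ^ 2 : ℝ) : ℂ) * l := by
            push_cast
            ring
          rw [this, Complex.sub_re, Complex.ofReal_re, Complex.re_ofReal_mul]
          ring
        rw [hre]
        have hkl : |k| + ‖l‖ ≤ t * (δ * min 1 δ) :=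
          (div_le_iff₀ (by positivity)).1 (hy₀k.trans ht)
        have hm1 : δ * min 1 δ ≤ δ := mul_le_of_le_one_right hδ.le (min_le_left _ _)
        have hm2 : δ * min 1 δ ≤ δ ^ 2 := by
          rw [sq]
          exact mul_le_mul_of_nonneg_left (min_le_right _ _) hδ.le
        have hk : |k| ≤ t * |ν| := by
          have h4 := norm_nonneg l
          have h5 : t * (δ * min 1 δ) ≤ t * |ν| := mul_le_mul_of_nonneg_left (hm1.trans h0) ht0.le
          linarith
        have hl' : ‖l‖ ≤ t * ν ^ 2 := by
          have h4 := abs_nonneg k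
          have h6 : δ ^ 2 ≤ ν ^ 2 := by
            rw [← sq_abs ν]
            exact pow_le_pow_left₀ hδ.le h0 2
          have h5 : t * (δ * min 1 δ) ≤ t * ν ^ 2 := mul_le_mul_of_nonneg_left (hm2.trans h6) ht0.le
          linarith
        have h7 : k * ν / t ≤ ν ^ 2 := by
          rw [div_le_iff₀ ht0]
          calc k * ν ≤ |k| * |ν| := by rw [← abs_mul]; exact le_abs_self _
            _ ≤ t * |ν| * |ν| := mul_le_mul_of_nonneg_right hk (abs_nonneg _)
            _ = ν ^ 2 * t := by rw [mul_assoc, ← sq, sq_abs]; ring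
        have h8 : l.re / t ^ 2 ≤ ν ^ 2 := by
          rw [div_le_iff₀ (by positivity)]
          have h9 := Complex.re_le_norm l
          have h10 : t * ν ^ 2 ≤ t ^ 2 * ν ^ 2 := by
            refine mul_le_mul_of_nonneg_right ?_ (sq_nonneg _)
            nlinarith
          linarith
        have h11 : 2 * Real.pi * k * ν / t ≤ 2 * Real.pi * ν ^ 2 := by
          have := mul_le_mul_of_nonneg_left h7 (by positivity : 0 ≤ 2 * Real.pi)
          calc _ = 2 * Real.pi * (k * ν / t) := by ring
            _ ≤ _ := this
        have h12 : Real.pi * 3 ≤ Real.pi ^ 2 := by nlinarith [Real.pi_gt_three]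
        rw [mul_pow, sq_abs]
        nlinarith [mul_le_mul_of_nonneg_right h12 (sq_nonneg ν), Real.pi_gt_three, sq_nonneg ν]
  have hS := summable_exp_neg_abs (c := Real.pi / 4) (by positivity) κ
  set A := ∑' n : ℤ, Real.exp (-(Real.pi / 4 * |(n : ℝ) + κ|)) with hA
  refine ⟨Real.pi * δ / 4, by positivity, B * Real.exp (Real.pi * δ / 4 * y₀) * A, ?_⟩
  filter_upwards [eventually_ge_atTop (y₀ + 1)] with y hy x
  have hy0 : 0 < y := by linarith
  have hs : Summable fun n : ℤ => coef w (n + κ) y :=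
    Summable.of_norm_bounded ((hS.mul_left _).mul_left _) fun n => hcoef n y hy
  have h1 := h.hasSum hw hy0 hs x
  have h2 : ∀ t : ℝ, ‖Complex.exp (-(2 * Real.pi * Complex.I * κ * t))‖ = 1 := fun t => by
    rw [show -(2 * Real.pi * Complex.I * κ * t : ℂ) =
      ((-(2 * Real.pi * κ * t) : ℝ) : ℂ) * Complex.I by push_cast; ring,
          Complex.norm_exp_ofReal_mul_I]
  have h3 : ‖w (ofComplex (x + y * Complex.I)) * Complex.exp (-(2 * Real.pi * Complex.I * κ * x))‖ ≤
      B * (Real.exp (-(Real.pi * δ / 4 * (y - y₀))) * A) := by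
    rw [← h1.tsum_eq]
    refine tsum_of_norm_bounded ((hS.hasSum.mul_left _).mul_left _) fun n => ?_
    have h4 : ‖Complex.exp (2 * Real.pi * Complex.I * n * x)‖ = 1 := by
      rw [show (2 * Real.pi * Complex.I * n * x : ℂ) =
        ((2 * Real.pi * n * x : ℝ) : ℂ) * Complex.I by push_cast; ring,
            Complex.norm_exp_ofReal_mul_I]
    rw [norm_mul, h4, mul_one]
    exact hcoef n y hy
  rw [norm_mul, h2, mul_one] at h3
  refine h3.trans (le_of_eq ?_)
  rw [show -(Real.pi * δ / 4 * (y - y₀)) = Real.pi * δ / 4 * y₀ + -(Real.pi * δ / 4 * y) by ring,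
    Real.exp_add]
  ring

/-! ### Cusp forms -/

theorem quasiPeriodic_apply {k : ℝ} {m : ℕ} {a : ZMod 12}
    {ρ : SL(2, ℤ) →* Matrix.unitaryGroup (Fin (2 * m)) ℂ} (hρ : IsRho a m ρ)
    {u : ℍ → Fin (2 * m) → ℂ} (hu : slash k ρ ModularGroup.T u = u) (j : Fin (2 * m)) :
    ∃ κ, QuasiPeriodic (fun z => u z j) κ := by
  obtain ⟨κ, hκ⟩ := exists_apply_T hρ hu j
  refine ⟨κ, fun x y hy => ?_⟩
  rw [ofComplex_add_one x hy]
  exact hκ _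

theorem expDecay_of_forall_apply {n : ℕ} {u : ℍ → Fin n → ℂ}
    (h : ∀ j, ∃ a > 0, ∃ C, ∀ᶠ y : ℝ in atTop, ∀ x : ℝ,
      ‖u (ofComplex (x + y * Complex.I)) j‖ ≤ C * Real.exp (-(a * y))) : ExpDecay u := by
  choose a ha C hC using h
  obtain ⟨b, hb, hba⟩ : ∃ b > 0, ∀ j, b ≤ a j := by
    rcases isEmpty_or_nonempty (Fin n) with hn | hn
    · exact ⟨1, one_pos, fun j => hn.elim j⟩
    · obtain ⟨j, hj⟩ := Finite.exists_min a
      exact ⟨a j, ha j, hj⟩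
  refine ⟨b, hb, fun K _ => ⟨∑ j, |C j|, ?_⟩⟩
  filter_upwards [eventually_all.2 hC, eventually_ge_atTop 0] with y hy hy0 x _
  refine (pi_norm_le_iff_of_nonneg (mul_nonneg (Finset.sum_nonneg fun j _ => abs_nonneg _)
    (Real.exp_pos _).le)).2 fun j => (hy j x).trans ?_
  refine mul_le_mul ((le_abs_self _).trans
    (Finset.single_le_sum (f := fun j => |C j|) (fun j _ => abs_nonneg _) (Finset.mem_univ j)))
    (Real.exp_le_exp.2 (neg_le_neg (mul_le_mul_of_nonneg_right (hba j) hy0))) (Real.exp_pos _).le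
    (Finset.sum_nonneg fun j _ => abs_nonneg _)

/-- Since ρ(T) is diagonal, each component is a quasi-periodic scalar eigenfunction of the
Laplacian, so the scalar result applies. -/
theorem IsMaass.expDecay {k : ℝ} {m : ℕ} {a : ZMod 12} {s : ℂ}
    {ρ : SL(2, ℤ) →* Matrix.unitaryGroup (Fin (2 * m)) ℂ} (hρ : IsRho a m ρ)
    {u : ℍ → Fin (2 * m) → ℂ} (hu : IsMaass k s ρ u) (hb : ∀ b, PolyBound u b) : ExpDecay u := by
  refine expDecay_of_forall_apply fun j => ?_
  obtain ⟨κ, hκ⟩ := quasiPeriodic_apply hρ (hu.invariant _) j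
  refine hκ.exp_decay (hu.smooth.apply j) (k := k) (l := s * (1 - s)) (fun z => ?_) fun b => ?_
  · rw [← lapl_apply k hu.smooth, hu.eigen]
    rfl
  · obtain ⟨C, hC⟩ := hb b _ isCompact_Icc
    refine ⟨C, ?_⟩
    filter_upwards [hC] with y hy x hx
    exact (norm_le_pi_norm _ j).trans (hy x hx)

theorem PolyBound.mono {n : ℕ} {u : ℍ → Fin n → ℂ} {b c : ℝ} (hbc : b ≤ c) (hu : PolyBound u b) :
    PolyBound u c := by
  intro K hK
  obtain ⟨C, hC⟩ := hu K hK
  refine ⟨|C|, ?_⟩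
  filter_upwards [hC, eventually_ge_atTop 1] with y h1 hy x hx
  have h2 : y ^ b ≤ y ^ c := Real.rpow_le_rpow_of_exponent_le hy hbc
  have h3 : 0 ≤ y ^ b := Real.rpow_nonneg (by linarith) _
  exact (h1 x hx).trans (mul_le_mul (le_abs_self _) h2 h3 (abs_nonneg _))

/-! ### The correspondence -/

section Correspondence

variable {k : ℝ} {m : ℕ} {a : ZMod 12} {s : ℂ} {χ φ : tGamma →* ℂˣ}
  {ρ : SL(2, ℤ) →* Matrix.unitaryGroup (Fin (2 * m)) ℂ}

theorem IsJacobiMaass.isMaass_extract (hm : 1 ≤ m) (hχ : IsChi k χ) (hφ : IsPhi a φ)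
    (hρ : IsRho a m ρ) {f : TGJ → ℂ} (hf : IsJacobiMaass k m s (φ * χ) f) :
    IsMaass (k - 1 / 2) ((s + 1) / 2) ρ (extract m f) where
  smooth := smoothH_extract hf.smooth
  invariant := by
    refine (synth_equivariant_iff hm hχ hφ hρ _).1 fun γ x => ?_
    have h1 : hJ 0 0 0 = 1 := rfl
    have h2 := hf.equivariant 0 0 0 γ x
    rw [Int.cast_zero, h1, one_mul] at h2
    rw [synth_extract hf hm, h2]
  eigen := by
    refine (synth_eigen₁_iff hm k s (smoothH_extract hf.smooth)).1 ?_
    rw [synth_extract hf hm]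
    exact hf.eigen₁
  growth := by
    obtain ⟨b, -, hb⟩ := hf.growth
    exact ⟨b, PolyBoundJ.extract hb⟩

theorem IsMaass.isJacobiMaass_synth (hm : 1 ≤ m) (hχ : IsChi k χ) (hφ : IsPhi a φ)
    (hρ : IsRho a m ρ) {u : ℍ → Fin (2 * m) → ℂ} (hu : IsMaass (k - 1 / 2) ((s + 1) / 2) ρ u) :
    IsJacobiMaass k m s (φ * χ) (synth m (k - 1 / 2) u) where
  smooth := smoothJ_synth hm _ hu.smooth
  weight := synth_weight m k u
  equivariant l μ κ γ g := by
    rw [mul_assoc, synth_heis hm]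
    exact (synth_equivariant_iff hm hχ hφ hρ u).2 hu.invariant γ g
  eigen₁ := (synth_eigen₁_iff hm k s hu.smooth).2 hu.eigen
  eigen₂ := synth_eigen₂ hm k s hu.smooth hu.eigen
  holo := Ym_synth hm _ hu.smooth
  growth := by
    obtain ⟨b, hb⟩ := hu.growth
    exact ⟨max (b + 1 / 4) 1, lt_max_of_lt_right one_pos,
      PolyBoundJ.mono (le_max_left _ _) (PolyBound.synth hm hρ (hu.invariant _) hb)⟩

/-- The theta decomposition as a linear equivalence. -/
def thetaEquiv (hm : 1 ≤ m) (hχ : IsChi k χ) (hφ : IsPhi a φ) (hρ : IsRho a m ρ) :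
    JacobiMaass k m s (φ * χ) ≃ₗ[ℂ] Maass (k - 1 / 2) ((s + 1) / 2) ρ :=
  LinearEquiv.symm
    { toFun := fun u => ⟨synth m (k - 1 / 2) u, IsMaass.isJacobiMaass_synth hm hχ hφ hρ u.2⟩
      map_add' := fun u v => Subtype.ext (synth_add m _ u v)
      map_smul' := fun c u => Subtype.ext (synth_smul m _ c u)
      invFun := fun f => ⟨extract m f, IsJacobiMaass.isMaass_extract hm hχ hφ hρ f.2⟩
      left_inv := fun u => Subtype.ext (extract_synth hm _ u)
      right_inv := fun f => Subtype.ext (synth_extract f.2 hm) }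

theorem thetaEquiv_apply (hm : 1 ≤ m) (hχ : IsChi k χ) (hφ : IsPhi a φ) (hρ : IsRho a m ρ)
    (f : JacobiMaass k m s (φ * χ)) :
    (thetaEquiv hm hχ hφ hρ f : ℍ → Fin (2 * m) → ℂ) = extract m f := rfl

/-- Forward, extraction preserves all the bounds, and the eigenvalue equation improves quick decay
to exponential decay. Backward, exponential decay beats every power. -/
theorem quickDecay_iff_expDecay (hm : 1 ≤ m) (hχ : IsChi k χ) (hφ : IsPhi a φ)
    (hρ : IsRho a m ρ) {f : TGJ → ℂ} (hf : IsJacobiMaass k m s (φ * χ) f) :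
    QuickDecay f ↔ ExpDecay (extract m f) := by
  have hu := hf.isMaass_extract hm hχ hφ hρ
  constructor
  · intro h
    refine hu.expDecay hρ fun b => ?_
    -- Quick decay is stated for negative exponents only, and -(|b| + 1) is one that lies below b.
    have h1 : PolyBound (extract m f) (-(|b| + 1)) := PolyBoundJ.extract (h _ (by positivity))
    exact h1.mono (by linarith [neg_abs_le b])
  · intro h α _
    -- The additional -1/4 compensates the growth y^{1/4} of the theta functions.
    have h1 := PolyBound.synth hm hρ (hu.invariant _) (h.polyBound (-α - 1 / 4))
    rw [synth_extract hf hm, sub_add_cancel] at h1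
    exact h1

end Correspondence

end JMF

end

/-! ### Conclusion -/

theorem theoremB (m : ℕ) (hm : 1 ≤ m) (k : ℝ) (a : ZMod 12) (s : ℂ) (hs : 0 ≤ s.re) :
    (∃! χ : tGamma →* ℂˣ, IsChi k χ) ∧
    (∃! φ : tGamma →* ℂˣ, IsPhi a φ) ∧
    (∃! ρ : SL(2, ℤ) →* Matrix.unitaryGroup (Fin (2 * m)) ℂ, IsRho a m ρ) ∧
    ∀ (χ φ : tGamma →* ℂˣ) (ρ : SL(2, ℤ) →* Matrix.unitaryGroup (Fin (2 * m)) ℂ),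
      IsChi k χ → IsPhi a φ → IsRho a m ρ →
      ∃ V : JacobiMaass k m s (φ * χ) ≃ₗ[ℂ] Maass (k - 1 / 2) ((s + 1) / 2) ρ,
        (∀ f : JacobiMaass k m s (φ * χ), IsThetaDecomposition m k f (V f)) ∧
        ((JacobiMaassCusp k m s (φ * χ)).submoduleOf (JacobiMaass k m s (φ * χ))).map
            V.toLinearMap =
          (MaassCusp (k - 1 / 2) ((s + 1) / 2) ρ).submoduleOf
            (Maass (k - 1 / 2) ((s + 1) / 2) ρ) := by
  refine ⟨existsUnique_isChi k, ?_, existsUnique_isRho a hm, fun χ φ ρ hχ hφ hρ =>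
    ⟨thetaEquiv hm hχ hφ hρ, fun f g => ?_, ?_⟩⟩
  · simpa only [isPhi_iff] using existsUnique_isChi (a.val : ℝ)
  · rw [thetaEquiv_apply]
    exact (congrFun (synth_extract f.2 hm) g).symm
  -- Every u is the image of some f. Both being forms already, membership in the cuspidal subspaces
  -- is a matter of decay alone.
  · ext u
    obtain ⟨f, rfl⟩ := (thetaEquiv hm hχ hφ hρ).surjective u
    refine (Submodule.mem_map_equiv (e := thetaEquiv hm hχ hφ hρ) _).trans ?_
    rw [LinearEquiv.symm_apply_apply]
    exact and_congr (iff_of_true f.2 (thetaEquiv hm hχ hφ hρ f).2)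
      (quickDecay_iff_expDecay hm hχ hφ hρ f.2)
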